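/- Let $P$ be an orthogonal polygon, i.e. the closed region enclosed by a simple closed polygonal curve whose sides are alternately horizontal and vertical, and let its $b$ horizontal sides be enumerated $1,\dots,b$ counterclockwise along $\partial P$. Let $U_u$ be the $y$-coordinate of the side $u$ and let $I_u$ be its signed length: its length taken with the sign $+$ if $P$ locally lies below the side, and with the sign $-$ if $P$ locally lies above it. Assume that $P$ is generic, i.e. that $U_1,\dots,U_b$ are pairwise distinct. By the ratio of a (nondegenerate, axis-parallel) rectangle we mean the length of its horizontal side divided by the length of its vertical side. An electrical network with $b$ boundary vertices is a finite graph without loops, possibly with multiple edges and not necessarily connected, with vertices $1,\dots,n$, of which $1,\dots,b$ are called boundary vertices, such that each connected component contains a boundary vertex, together with a nonnegative conductance for each edge. It is planar if the graph can be drawn in the closed unit disc so that the boundary vertices lie on the unit circle, enumerated counterclockwise, the rest of the drawing lies in the open disc, and the edges are simple polygonal arcs having no common points with each other or with the vertices except at their endpoints. A circuit is a network with prescribed incoming voltages $U_1,\dots,U_b$ at the boundary vertices. Its voltages $U_k$, $1\le k\le n$, and the currents through its edges are determined by the following laws: the current from $k$ to $l$ through an edge of conductance $c$ with endpoints $k,l$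 is $c\,(U_k-U_l)$, and for each nonboundary vertex the sum of the currents flowing from it into its edges is zero. The incoming current at a boundary vertex is the sum of the currents flowing from it into its edges. An edge is essential if the current through it is nonzero. Then for all real $c_1,\dots,c_m$ the following two conditions are equivalent: (1) $P$ can be tiled by $m$ rectangles of ratios $c_1,\dots,c_m$, i.e. $P$ is the union of $m$ such rectangles with pairwise disjoint interiors; (2) there is a planar electrical circuit with $b$ boundary vertices, having exactly $m$ edges, all of them essential, of conductances $c_1,\dots,c_m>0$, with incoming voltages $U_1,\dots,U_b$ and incoming currents $I_1,\dots,I_b$. -/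

import Mathlib

open Set Filter Topology

noncomputable section

/-! ### Orthogonal polygons -/

/-- The points enclosed by a closed polygonal curve in the plane: the curve itself together with
the bounded components of its complement. -/
def Polygon.region {n : ℕ} (P : Polygon (ℝ × ℝ) n) : Set (ℝ × ℝ) :=
  P.boundary ℝ ∪
    {p | p ∉ P.boundary ℝ ∧ Bornology.IsBounded (connectedComponentIn (P.boundary ℝ)ᶜ p)}

/-- The boundary is a simple closed curve: the sides are nondegenerate, and two distinct sides
have no common points, except that consecutive sides share their common vertex. -/
def Polygon.IsSimple {n : ℕ} (P : Polygon (ℝ × ℝ) n) : Prop :=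
  P.HasNondegenerateEdges ∧
    ∀ i j : Fin n, i ≠ j → ∀ p : ℝ × ℝ, p ∈ P.edgeSet ℝ i → p ∈ P.edgeSet ℝ j →
      (j = finRotate n i ∧ p = P j) ∨ (i = finRotate n j ∧ p = P i)

/-- The vertices are listed counterclockwise: the enclosed region lies (locally) to the left of
each side, as the side is traversed from its first to its second endpoint. -/
def Polygon.IsCounterclockwise {n : ℕ} (P : Polygon (ℝ × ℝ) n) : Prop :=
  ∀ i : Fin n, ∀ t ∈ Ioo (0 : ℝ) 1, ∀ᶠ ε : ℝ in 𝓝[>] 0,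
    P.edgePath ℝ i t +
      ε • (-((P (finRotate n i)).2 - (P i).2), (P (finRotate n i)).1 - (P i).1) ∈ P.region

/-- The index of the `u`-th horizontal side of an orthogonal polygon with `2 * b` sides. -/
def hIndex {b : ℕ} (u : Fin b) : Fin (2 * b) := ⟨2 * u.1, by omega⟩

/-- The index of the `u`-th vertical side of an orthogonal polygon with `2 * b` sides. -/
def vIndex {b : ℕ} (u : Fin b) : Fin (2 * b) := ⟨2 * u.1 + 1, by omega⟩

/-- A polygon with sides parallel to the coordinate axes. The horizontal sides `0, …, b - 1`
(sides with even index) alternate with the vertical ones (sides with odd index). -/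
def Polygon.IsOrthogonal {b : ℕ} (P : Polygon (ℝ × ℝ) (2 * b)) : Prop :=
  ∀ u : Fin b,
    (P (hIndex u)).2 = (P (finRotate _ (hIndex u))).2 ∧
    (P (vIndex u)).1 = (P (finRotate _ (vIndex u))).1

/-- The `y`-coordinate of the `u`-th horizontal side. -/
def Polygon.height {b : ℕ} (P : Polygon (ℝ × ℝ) (2 * b)) (u : Fin b) : ℝ :=
  (P (hIndex u)).2

/-- The enclosed region locally lies below the `u`-th horizontal side. -/
def Polygon.LiesBelow {b : ℕ} (P : Polygon (ℝ × ℝ) (2 * b)) (u : Fin b) : Prop :=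
  ∀ t ∈ Ioo (0 : ℝ) 1, ∀ᶠ ε : ℝ in 𝓝[>] 0, P.edgePath ℝ (hIndex u) t - (0, ε) ∈ P.region

open Classical in
/-- The signed length of the `u`-th horizontal side: the sign is `+` if the region locally lies
below the side, and `-` otherwise. -/
def Polygon.signedLength {b : ℕ} (P : Polygon (ℝ × ℝ) (2 * b)) (u : Fin b) : ℝ :=
  if P.LiesBelow u then |(P (finRotate _ (hIndex u))).1 - (P (hIndex u)).1|
  else -|(P (finRotate _ (hIndex u))).1 - (P (hIndex u)).1|

/-- A polygon is generic if its horizontal sides have pairwise distinct `y`-coordinates. -/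
def Polygon.IsGeneric {b : ℕ} (P : Polygon (ℝ × ℝ) (2 * b)) : Prop :=
  Function.Injective P.height

/-! ### Tilings -/

/-- A nondegenerate rectangle with sides parallel to the coordinate axes. -/
structure Rect where
  left : ℝ
  right : ℝ
  bottom : ℝ
  top : ℝ
  left_lt_right : left < right
  bottom_lt_top : bottom < top

/-- The closed rectangle as a set of points. -/
def Rect.toSet (R : Rect) : Set (ℝ × ℝ) := Icc R.left R.right ×ˢ Icc R.bottom R.top

/-- The ratio of a rectangle: the horizontal side divided by the vertical side. -/
def Rect.ratio (R : Rect) : ℝ := (R.right - R.left) / (R.top - R.bottom)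

/-- The set `S` can be tiled by `m` rectangles of ratios `c 0, …, c (m - 1)`. -/
def CanBeTiled {m : ℕ} (S : Set (ℝ × ℝ)) (c : Fin m → ℝ) : Prop :=
  ∃ R : Fin m → Rect,
    (∀ e, (R e).ratio = c e) ∧
    (⋃ e, (R e).toSet) = S ∧
    ∀ e f, e ≠ f → Disjoint (interior (R e).toSet) (interior (R f).toSet)

/-! ### Electrical networks and circuits -/

/-- An electrical network with `b` boundary vertices and `m` edges: a finite graph without loops
(multiple edges are allowed) with a nonnegative conductance on each edge, such that each connected
component contains a boundary vertex. The boundary vertices are `Sum.inl u`, the nonboundary ones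
are `Sum.inr k`. The two endpoints `src e`, `tgt e` of an edge are listed in an arbitrary order. -/
structure ElectricalNetwork (b m : ℕ) where
  /-- the number of nonboundary vertices -/
  inner : ℕ
  src : Fin m → Fin b ⊕ Fin inner
  tgt : Fin m → Fin b ⊕ Fin inner
  cond : Fin m → ℝ
  src_ne_tgt : ∀ e, src e ≠ tgt e
  cond_nonneg : ∀ e, 0 ≤ cond e
  component_boundary : ∀ v, ∃ u : Fin b,
    Relation.EqvGen (fun v w => ∃ e, src e = v ∧ tgt e = w) v (Sum.inl u)

namespace ElectricalNetwork

variable {b m : ℕ}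

/-- The vertices of the network. -/
abbrev Vertex (N : ElectricalNetwork b m) : Type := Fin b ⊕ Fin N.inner

/-- The Ohm law: the current through the edge `e`, from `src e` to `tgt e`, for given voltages. -/
def current (N : ElectricalNetwork b m) (V : N.Vertex → ℝ) (e : Fin m) : ℝ :=
  N.cond e * (V (N.src e) - V (N.tgt e))

/-- The sum of the currents flowing from the vertex `v` into the edges incident to it. -/
def outflow (N : ElectricalNetwork b m) (V : N.Vertex → ℝ) (v : N.Vertex) : ℝ :=
  ∑ e, ((if N.src e = v then N.current V e else 0) - (if N.tgt e = v then N.current V e else 0))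

/-- `V` are the voltages at the vertices of the circuit obtained from the network `N` by applying
the incoming voltages `U` to the boundary vertices: the Kirchhoff current law holds at each
nonboundary vertex. -/
def IsVoltage (N : ElectricalNetwork b m) (U : Fin b → ℝ) (V : N.Vertex → ℝ) : Prop :=
  (∀ u, V (Sum.inl u) = U u) ∧ ∀ k, N.outflow V (Sum.inr k) = 0

/-- `γ` is piecewise linear on `[0, 1]`: for some finite set of breakpoints it is affine on each
subinterval without breakpoints inside. -/
def _root_.IsPiecewiseLinear (γ : ℝ → ℂ) : Prop :=
  ∃ s : Finset ℝ, ∀ a c : ℝ, 0 ≤ a → a ≤ c → c ≤ 1 → (∀ t ∈ s, t ∉ Ioo a c) →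
    ∀ θ ∈ Icc (0 : ℝ) 1, γ (AffineMap.lineMap a c θ) = AffineMap.lineMap (γ a) (γ c) θ

/-- The network is planar: its graph is drawn in the closed unit disc so that the boundary vertices
lie on the unit circle and are enumerated counterclockwise along it, and the rest of the drawing
lies in the open disc. As usual for plane graphs, vertices are distinct points, each edge is a
simple polygonal arc joining its endpoints, and no edge meets a vertex or another edge except at
its endpoints. -/
def IsPlanar (N : ElectricalNetwork b m) : Prop :=
  ∃ (pos : N.Vertex → ℂ) (γ : Fin m → ℝ → ℂ),
    Function.Injective pos ∧
    (∃ θ : Fin b → ℝ, StrictMono θ ∧ (∀ u v, θ v < θ u + 2 * Real.pi) ∧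
      ∀ u, pos (Sum.inl u) = Complex.exp (θ u * Complex.I)) ∧
    (∀ k, ‖pos (Sum.inr k)‖ < 1) ∧
    (∀ e, IsPiecewiseLinear (γ e) ∧ InjOn (γ e) (Icc 0 1) ∧
      γ e 0 = pos (N.src e) ∧ γ e 1 = pos (N.tgt e)) ∧
    (∀ e, ∀ t ∈ Ioo (0 : ℝ) 1, ‖γ e t‖ < 1 ∧ ∀ v, γ e t ≠ pos v) ∧
    (∀ e f, e ≠ f → ∀ s ∈ Ioo (0 : ℝ) 1, ∀ t ∈ Ioo (0 : ℝ) 1, γ e s ≠ γ f t)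

end ElectricalNetwork

end

/-! ### Locally constant functions on the plane -/

/-! The dictionary: rectangles are edges, maximal horizontal segments composed of their sides are
vertices, ordinates are voltages, widths are currents, ratios are conductances. Ohm's law reads
width = ratio × height. Kirchhoff's law says that the rectangles below a segment and those above it
have equal total widths; if the segment contains a side of P, these widths differ by the signed
length of the side. By genericity a segment contains at most one side.

From a circuit to a tiling. Join the boundary vertices of a drawing in the unit disc to the circle
of radius 2 by radial segments carrying the incoming currents. The winding number weighted by the
currents (`pot`), corrected for the sources on the outer circle, is a locally constant flow
function, which jumps by the current across each edge. An edge with the values A, B of this function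
on its two sides and the voltages V, V' at its ends yields the rectangle with abscissas A, B (up to
a common translation) and ordinates V, V'. The composition of any g with the flow function is again
locally constant, so its jumps around any vertex add up to zero (`NonCrossing.flux_eq_zero`), and
summation by parts shows that the sum of (g(A) - g(B))(φ(V) - φ(V')) over the edges depends only on
the boundary data, for all g and φ (`PolyDrawing.exists_flow`). Take g and φ to be the indicators of
the half-lines s > x and s > y. As A - B and V - V' have the same sign, the sum counts the
rectangles containing (x, y); the boundary expression is the winding number of ∂P about (x, y)
(`OrthoLoop.wnd_eq_sum`), which is 1 inside P and 0 outside. So generic points are covered exactly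
as often as they should be, and this is a tiling (`OrthoLoop.tiling_of_count`).

From a tiling to a circuit. Kirchhoff's law follows by counting the rectangles met just below and
just above a horizontal line (`IsTiling.jump`) and integrating along a segment
(`IsTiling.flux_eq_integral`). For planarity the circuit is drawn in P itself. Each vertex is a hub
on its segment, moved slightly into P if the segment contains a side. Each edge goes from the hub to
a bend near the top of its rectangle, down the middle of the rectangle to a bend near its bottom,
and on to the other hub. To bring the boundary vertices to the circle, each horizontal side is
replaced by the two other sides of a thin triangle, a notch, whose apex is the hub. The notched
polygon is mapped to a regular polygon inscribed in the unit circle, affinely on each triangle of a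
triangulation without new vertices (`PosLoop.exists_disc_map`). The boundary hubs, being vertices,
go to the circle; points other than vertices go to the open disc, by strict convexity. The rest of
the drawing avoids the notches, hence the vertices.

Both directions rest on the topology of polygons, developed here from sums of angles: a locally
constant function off a simple closed polygonal curve has one value along each side of it, which
yields the Jordan curve theorem; an extremal vertex yields an inner diagonal, and cutting along
diagonals yields a triangulation. -/

theorem IsPreconnected.eq_of_eventually_eq {α β : Type*} [TopologicalSpace α] {S : Set α}
    (hS : IsPreconnected S) {f : α → β} (h : ∀ x ∈ S, ∀ᶠ y in 𝓝[S] x, f y = f x)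
    {x y : α} (hx : x ∈ S) (hy : y ∈ S) : f x = f y := by
  let _ : TopologicalSpace β := ⊥
  have : DiscreteTopology β := ⟨rfl⟩
  refine hS.constant_of_mapsTo (T := univ) (isDiscrete_univ_iff.2 inferInstance) ?_ (mapsTo_univ _ _) hx hy
  intro z hz
  exact tendsto_nhds_of_eventually_eq (h z hz)

/-- `f` is locally constant on the open set `U`. -/
def LocConstOn {β : Type*} (f : ℂ → β) (U : Set ℂ) : Prop :=
  ∀ z ∈ U, ∀ᶠ y in 𝓝 z, f y = f z

theorem LocConstOn.eq {β : Type*} {f : ℂ → β} {U S : Set ℂ} (h : LocConstOn f U)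
    (hS : IsPreconnected S) (hSU : S ⊆ U) {x y : ℂ} (hx : x ∈ S) (hy : y ∈ S) : f x = f y :=
  hS.eq_of_eventually_eq (fun z hz => (h z (hSU hz)).filter_mono nhdsWithin_le_nhds) hx hy

theorem LocConstOn.mono {β : Type*} {f : ℂ → β} {U U' : Set ℂ} (h : LocConstOn f U)
    (hU : U' ⊆ U) : LocConstOn f U' := fun z hz => h z (hU hz)

/-! ### Orientation -/

/-- Twice the signed area of the triangle `a b z`: it is positive if and only if `z` lies to the
left of the line from `a` to `b`. -/
def cr (a b z : ℂ) : ℝ := (b.re - a.re) * (z.im - a.im) - (b.im - a.im) * (z.re - a.re)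

theorem cr_rotate (a b c : ℂ) : cr a b c = cr b c a := by unfold cr; ring

theorem cr_swap (a b c : ℂ) : cr b a c = -cr a b c := by unfold cr; ring

theorem cr_self_left (a b : ℂ) : cr a b a = 0 := by unfold cr; ring

theorem cr_self_right (a b : ℂ) : cr a b b = 0 := by unfold cr; ring

theorem continuous_cr (a b : ℂ) : Continuous (cr a b) := by
  unfold cr
  fun_prop

theorem lineMap_re (a b : ℂ) (t : ℝ) :
    (AffineMap.lineMap a b t : ℂ).re = a.re + t * (b.re - a.re) := by
  simp [AffineMap.lineMap_apply]; ring

theorem lineMap_im (a b : ℂ) (t : ℝ) :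
    (AffineMap.lineMap a b t : ℂ).im = a.im + t * (b.im - a.im) := by
  simp [AffineMap.lineMap_apply]; ring

theorem cr_lineMap (a b c d : ℂ) (t : ℝ) :
    cr a b (AffineMap.lineMap c d t) = (1 - t) * cr a b c + t * cr a b d := by
  unfold cr; rw [lineMap_re, lineMap_im]; ring

theorem mem_segment_iff_lineMap {a b z : ℂ} :
    z ∈ segment ℝ a b ↔ ∃ t ∈ Icc (0 : ℝ) 1, AffineMap.lineMap a b t = z := by
  rw [segment_eq_image_lineMap]; rfl

theorem mem_openSegment_iff_lineMap {a b z : ℂ} :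
    z ∈ openSegment ℝ a b ↔ ∃ t ∈ Ioo (0 : ℝ) 1, AffineMap.lineMap a b t = z := by
  rw [openSegment_eq_image_lineMap]; rfl

theorem cr_eq_zero_of_mem_segment {a b z : ℂ} (h : z ∈ segment ℝ a b) : cr a b z = 0 := by
  obtain ⟨t, -, rfl⟩ := mem_segment_iff_lineMap.1 h
  rw [cr_lineMap, cr_self_left, cr_self_right]; ring

theorem convex_cr_pos (a b : ℂ) (σ : ℝ) : Convex ℝ {z | 0 < σ * cr a b z} := by
  intro x hx y hy s t hs ht hst
  simp only [mem_ofPred_eq, cr] at *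
  simp only [Complex.add_re, Complex.add_im, Complex.real_smul, Complex.mul_re, Complex.mul_im,
    Complex.ofReal_re, Complex.ofReal_im, zero_mul, sub_zero, add_zero]
  obtain rfl : s = 1 - t := by linarith
  rcases eq_or_lt_of_le ht with rfl | ht'
  · simpa using hx
  · nlinarith [mul_nonneg hs hx.le, mul_pos ht' hy]

theorem isOpen_cr_pos (a b : ℂ) (σ : ℝ) : IsOpen {z | 0 < σ * cr a b z} :=
  isOpen_lt continuous_const (continuous_const.mul (continuous_cr a b))

/-- A point on the line through `a` and `b` has an affine coordinate. -/
theorem exists_lineMap_of_cr_eq_zero {a b z : ℂ} (hab : a ≠ b) (h : cr a b z = 0) :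
    ∃ t : ℝ, AffineMap.lineMap a b t = z := by
  have hne : (b.re - a.re) ^ 2 + (b.im - a.im) ^ 2 ≠ 0 := by
    intro h0
    apply hab
    apply Complex.ext <;> nlinarith [sq_nonneg (b.re - a.re), sq_nonneg (b.im - a.im)]
  refine ⟨((b.re - a.re) * (z.re - a.re) + (b.im - a.im) * (z.im - a.im)) /
    ((b.re - a.re) ^ 2 + (b.im - a.im) ^ 2), ?_⟩
  unfold cr at h
  apply Complex.ext
  · rw [lineMap_re, div_mul_eq_mul_div, ← eq_sub_iff_add_eq', div_eq_iff hne]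
    linear_combination (b.im - a.im) * h
  · rw [lineMap_im, div_mul_eq_mul_div, ← eq_sub_iff_add_eq', div_eq_iff hne]
    linear_combination (-(b.re - a.re)) * h

/-! ### Angles subtended by segments -/

/-- The angle under which the segment from `a` to `b` is seen from `z`. -/
noncomputable def ang (a b z : ℂ) : ℝ := Complex.arg ((b - z) / (a - z))

/-- The quotient leaves the slit plane only if it is a real q ≤ 0; then b - z = q (a - z) puts z on
the segment, at the parameter 1 / (1 - q). Hence the principal logarithm of the quotient is
holomorphic off the segment. -/
theorem div_mem_slitPlane_of_notMem_segment {a b z : ℂ} (h : z ∉ segment ℝ a b) :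
    (b - z) / (a - z) ∈ Complex.slitPlane := by
  have ha : a - z ≠ 0 := by
    intro h0; exact h (by rw [sub_eq_zero.1 h0]; exact left_mem_segment ℝ _ _)
  rw [Complex.mem_slitPlane_iff]
  by_contra! hc
  obtain ⟨hre, him⟩ := hc
  set q := (b - z) / (a - z) with hq
  have hqr : q = ((q.re : ℝ) : ℂ) := by apply Complex.ext <;> simp [him]
  have hb : b - z = q.re * (a - z) := by
    rw [← hqr, hq, div_mul_cancel₀ _ ha]
  apply h
  rw [mem_segment_iff_lineMap]
  have hpos : 0 < 1 - q.re := by linarith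
  have hpos' : (1 - (q.re : ℂ)) ≠ 0 := by exact_mod_cast hpos.ne'
  refine ⟨1 / (1 - q.re), ⟨by positivity, by rw [div_le_one hpos]; linarith⟩, ?_⟩
  rw [AffineMap.lineMap_apply]
  simp only [vsub_eq_sub, vadd_eq_add, Complex.real_smul]
  push_cast
  field_simp
  linear_combination hb

theorem im_div_eq (a b z : ℂ) :
    ((b - z) / (a - z)).im = cr a b z / Complex.normSq (a - z) := by
  rw [Complex.div_im]; unfold cr; simp only [Complex.sub_re, Complex.sub_im]; ring

/-- The derivative is a difference of values of one function at the two endpoints; this makes sums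
over closed chains telescope. -/
theorem hasDerivAt_log_div {a b z : ℂ} (h : z ∉ segment ℝ a b) :
    HasDerivAt (fun z => Complex.log ((b - z) / (a - z))) (1 / (a - z) - 1 / (b - z)) z := by
  have ha : a - z ≠ 0 := by
    intro h0; exact h (by rw [sub_eq_zero.1 h0]; exact left_mem_segment ℝ _ _)
  have hb : b - z ≠ 0 := by
    intro h0; exact h (by rw [sub_eq_zero.1 h0]; exact right_mem_segment ℝ _ _)
  have h1 : HasDerivAt (fun z => (b - z) / (a - z))
      (((-1) * (a - z) - (b - z) * (-1)) / (a - z) ^ 2) z :=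
    HasDerivAt.div ((hasDerivAt_id z).const_sub b) ((hasDerivAt_id z).const_sub a) ha
  convert h1.clog (div_mem_slitPlane_of_notMem_segment h) using 1
  field_simp
  ring

theorem continuousAt_ang {a b z : ℂ} (h : z ∉ segment ℝ a b) : ContinuousAt (ang a b) z := by
  have := (hasDerivAt_log_div h).continuousAt
  have h2 := Complex.continuous_im.continuousAt.comp this
  refine h2.congr (Eventually.of_forall fun w => ?_)
  simp [ang, Complex.log_im]

theorem re_div_neg {a b p : ℂ} (hab : a ≠ b) (hp : p ∈ openSegment ℝ a b) :
    ((b - p) / (a - p)).re < 0 ∧ ((b - p) / (a - p)).im = 0 ∧ a - p ≠ 0 := by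
  obtain ⟨t, ⟨ht0, ht1⟩, rfl⟩ := mem_openSegment_iff_lineMap.1 hp
  have hba : b - a ≠ 0 := sub_ne_zero.2 hab.symm
  have e1 : b - AffineMap.lineMap a b t = ((1 - t : ℝ) : ℂ) * (b - a) := by
    rw [AffineMap.lineMap_apply]; simp; ring
  have e2 : a - AffineMap.lineMap a b t = ((-t : ℝ) : ℂ) * (b - a) := by
    rw [AffineMap.lineMap_apply]; simp
  have e3 : (b - AffineMap.lineMap a b t) / (a - AffineMap.lineMap a b t)
      = (((1 - t) / (-t) : ℝ) : ℂ) := by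
    rw [e1, e2, mul_div_mul_right _ _ hba]; push_cast; ring
  refine ⟨?_, ?_, ?_⟩
  · rw [e3, Complex.ofReal_re]
    exact div_neg_of_pos_of_neg (by linarith) (by linarith)
  · rw [e3, Complex.ofReal_im]
  · rw [e2]
    exact mul_ne_zero (by exact_mod_cast (by linarith : (-t : ℝ) ≠ 0)) hba

/-- The quotient tends to a negative real number through the closed upper half-plane, where the
argument tends to π. From the other side of the segment the limit is -π, so the angle jumps by 2π
across the segment. -/
theorem tendsto_ang_left {a b p : ℂ} (hab : a ≠ b) (hp : p ∈ openSegment ℝ a b) :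
    Tendsto (ang a b) (𝓝[{z | 0 < cr a b z}] p) (𝓝 Real.pi) := by
  obtain ⟨h1, h2, h3⟩ := re_div_neg hab hp
  refine (Complex.tendsto_arg_nhdsWithin_im_nonneg_of_re_neg_of_im_zero h1 h2).comp ?_
  rw [tendsto_nhdsWithin_iff]
  constructor
  · have : ContinuousAt (fun z => (b - z) / (a - z)) p := by
      apply ContinuousAt.div _ _ h3 <;> fun_prop
    exact this.tendsto.mono_left nhdsWithin_le_nhds
  · filter_upwards [self_mem_nhdsWithin] with z hz
    have hz : 0 < cr a b z := hz
    change 0 ≤ ((b - z) / (a - z)).im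
    rw [im_div_eq]
    exact div_nonneg hz.le (Complex.normSq_nonneg _)

theorem tendsto_ang_right {a b p : ℂ} (hab : a ≠ b) (hp : p ∈ openSegment ℝ a b) :
    Tendsto (ang a b) (𝓝[{z | cr a b z < 0}] p) (𝓝 (-Real.pi)) := by
  obtain ⟨h1, h2, h3⟩ := re_div_neg hab hp
  refine (Complex.tendsto_arg_nhdsWithin_im_neg_of_re_neg_of_im_zero h1 h2).comp ?_
  have hc : ContinuousAt (fun z => (b - z) / (a - z)) p := by
    apply ContinuousAt.div _ _ h3 <;> fun_prop
  rw [tendsto_nhdsWithin_iff]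
  refine ⟨hc.tendsto.mono_left nhdsWithin_le_nhds, ?_⟩
  have h4 : ∀ᶠ z in 𝓝 p, a - z ≠ 0 :=
    ContinuousAt.eventually_ne (by fun_prop) h3
  filter_upwards [self_mem_nhdsWithin, nhdsWithin_le_nhds h4] with z hz hz'
  have hz : cr a b z < 0 := hz
  change ((b - z) / (a - z)).im < 0
  rw [im_div_eq]
  exact div_neg_of_neg_of_pos hz (Complex.normSq_pos.2 hz')

/-! ### Potentials of closed chains of segments -/

section Potential

variable {E : Type*} [Fintype E]

/-- The weighted winding number of the chain of segments `a e ⟶ b e` with weights `I e`, with a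
correction term `H`. -/
noncomputable def pot (a b : E → ℂ) (I : E → ℝ) (H : ℂ → ℂ) (z : ℂ) : ℝ :=
  (∑ e, I e * ang (a e) (b e) z + (H z).im) / (2 * Real.pi)

variable {a b : E → ℂ} {I : E → ℝ} {H : ℂ → ℂ} {U : Set ℂ}

theorem isClosed_segment (a b : ℂ) : IsClosed (segment ℝ a b) := by
  rw [segment_eq_image_lineMap]
  exact (isCompact_Icc.image (AffineMap.lineMap_continuous)).isClosed

theorem isClosed_iUnion_segment (a b : E → ℂ) : IsClosed (⋃ e, segment ℝ (a e) (b e)) :=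
  isClosed_iUnion_of_finite fun _ => isClosed_segment _ _

/-- The chain is closed up to the sources of `H`. -/
def ClosedChain (a b : E → ℂ) (I : E → ℝ) (H : ℂ → ℂ) (U : Set ℂ) : Prop :=
  IsOpen U ∧ ∀ z ∈ U, z ∉ ⋃ e, segment ℝ (a e) (b e) →
    HasDerivAt H (-∑ e, (I e : ℂ) * (1 / (a e - z) - 1 / (b e - z))) z

theorem ClosedChain.locConstOn (h : ClosedChain a b I H U) :
    LocConstOn (pot a b I H) (U \ ⋃ e, segment ℝ (a e) (b e)) := by
  intro z hz
  have hopen : IsOpen (U \ ⋃ e, segment ℝ (a e) (b e)) := h.1.sdiff (isClosed_iUnion_segment a b)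
  obtain ⟨r, hr, hball⟩ := Metric.isOpen_iff.1 hopen z hz
  -- `pot` is the imaginary part of G divided by 2π, and `ClosedChain` says precisely that G has
  -- zero derivative off the segments.
  set G : ℂ → ℂ := fun z => ∑ e, (I e : ℂ) * Complex.log ((b e - z) / (a e - z)) + H z with hG
  have hd : ∀ w ∈ Metric.ball z r, HasDerivAt G 0 w := by
    intro w hw
    have hw' := hball hw
    have h1 : ∀ e ∈ Finset.univ, HasDerivAt
        (fun z => (I e : ℂ) * Complex.log ((b e - z) / (a e - z)))
        ((I e : ℂ) * (1 / (a e - w) - 1 / (b e - w))) w := fun e _ =>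
      (hasDerivAt_log_div fun hs => hw'.2 (mem_iUnion.2 ⟨e, hs⟩)).const_mul _
    have h2 := (HasDerivAt.fun_sum h1).add (h.2 w hw'.1 hw'.2)
    rw [add_neg_cancel] at h2
    exact h2
  have hG' : ∀ w, pot a b I H w = (G w).im / (2 * Real.pi) := by
    intro w
    simp [pot, hG, ang, Complex.log_im]
  filter_upwards [Metric.ball_mem_nhds z hr] with w hw
  rw [hG', hG']
  congr 2
  exact Metric.isOpen_ball.is_const_of_deriv_eq_zero (convex_ball z r).isPreconnected
    (fun w hw => (hd w hw).differentiableAt.differentiableWithinAt)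
    (fun w hw => (hd w hw).deriv) hw (Metric.mem_ball_self hr)

/-- A point of an edge that is not on the other ones has a neighbourhood free of the other ones. -/
theorem exists_ball_avoiding (a b : E → ℂ) (S : Set E) {p : ℂ} (hU : IsOpen U) (hp : p ∈ U)
    (h : ∀ f ∉ S, p ∉ segment ℝ (a f) (b f)) :
    ∃ r > 0, Metric.ball p r ⊆ U ∧
      ∀ z ∈ Metric.ball p r, ∀ f, z ∈ segment ℝ (a f) (b f) → f ∈ S := by
  have hcl : IsClosed (⋃ f : {f // f ∉ S}, segment ℝ (a f) (b f)) :=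
    isClosed_iUnion_of_finite fun _ => isClosed_segment _ _
  have ho := hU.sdiff hcl
  obtain ⟨r, hr, hball⟩ := Metric.isOpen_iff.1 ho p ⟨hp, by
    rw [mem_iUnion]; rintro ⟨⟨f, hf⟩, hs⟩; exact h f hf hs⟩
  refine ⟨r, hr, fun z hz => (hball hz).1, fun z hz f hf => ?_⟩
  by_contra hfe
  exact (hball hz).2 (mem_iUnion.2 ⟨⟨f, hfe⟩, hf⟩)

theorem frequently_cr_pos {a b p : ℂ} (hab : a ≠ b) (hp : p ∈ openSegment ℝ a b) {σ : ℝ}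
    (hσ : σ ≠ 0) :
    ∃ᶠ z in 𝓝 p, 0 < σ * cr a b z := by
  have hne : 0 < (b.re - a.re) ^ 2 + (b.im - a.im) ^ 2 := by
    by_contra h0
    apply hab
    apply Complex.ext <;> nlinarith [sq_nonneg (b.re - a.re), sq_nonneg (b.im - a.im)]
  have ht : Tendsto (fun ε : ℝ => p + (ε : ℂ) * (σ * (Complex.I * (b - a)))) (𝓝[>] 0) (𝓝 p) := by
    have : Continuous (fun ε : ℝ => p + (ε : ℂ) * (σ * (Complex.I * (b - a)))) := by fun_prop
    have h2 := this.tendsto 0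
    simp only [Complex.ofReal_zero, zero_mul, add_zero] at h2
    exact h2.mono_left nhdsWithin_le_nhds
  refine ht.frequently (Eventually.frequently ?_)
  filter_upwards [self_mem_nhdsWithin] with ε hε
  have h0 := cr_eq_zero_of_mem_segment (openSegment_subset_segment ℝ _ _ hp)
  have : σ * cr a b (p + (ε : ℂ) * (σ * (Complex.I * (b - a))))
      = σ * cr a b p + σ ^ 2 * ε * ((b.re - a.re) ^ 2 + (b.im - a.im) ^ 2) := by
    unfold cr; simp; ring
  rw [this, h0]
  have hε' : 0 < ε := hε
  have : 0 < σ ^ 2 := by positivity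
  simp only [mul_zero, zero_add]; positivity

/-- On each side of an open edge a locally constant function has a value. -/
theorem exists_side_value {β : Type*} {f : ℂ → β} {e : E}
    (hU : IsOpen U) (hf : LocConstOn f (U \ ⋃ e, segment ℝ (a e) (b e)))
    (hab : a e ≠ b e) (hsub : openSegment ℝ (a e) (b e) ⊆ U)
    (hdisj : ∀ p ∈ openSegment ℝ (a e) (b e), ∀ g ≠ e, p ∉ segment ℝ (a g) (b g))
    {σ : ℝ} (hσ : σ ≠ 0) :
    ∃ x : β, ∀ p ∈ openSegment ℝ (a e) (b e), ∀ᶠ z in 𝓝 p,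
      0 < σ * cr (a e) (b e) z → f z = x := by
  have key : ∀ p ∈ openSegment ℝ (a e) (b e), ∃ x : β, ∃ r > 0, ∀ z ∈ Metric.ball p r,
      0 < σ * cr (a e) (b e) z → f z = x := by
    intro p hp
    obtain ⟨r, hr, hrU, hr2⟩ := exists_ball_avoiding a b {e} hU (hsub hp)
      (fun g hg => hdisj p hp g hg)
    have hfr := frequently_cr_pos hab hp hσ
    obtain ⟨z0, hz0, hz0'⟩ := (hfr.and_eventually (Metric.ball_mem_nhds p hr)).exists
    refine ⟨f z0, r, hr, fun z hz hz' => ?_⟩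
    refine hf.eq (S := Metric.ball p r ∩ {z | 0 < σ * cr (a e) (b e) z})
      ((convex_ball p r).inter (convex_cr_pos _ _ σ)).isPreconnected ?_ ⟨hz, hz'⟩ ⟨hz0', hz0⟩
    rintro w ⟨hw1, hw2⟩
    refine ⟨hrU hw1, ?_⟩
    rw [mem_iUnion]
    rintro ⟨g, hg⟩
    have : g = e := hr2 w hw1 g hg
    subst this
    simp [cr_eq_zero_of_mem_segment hg] at hw2
  have : Nonempty β := ⟨f 0⟩
  choose! x r hr hx using key
  have hconst : ∀ p ∈ openSegment ℝ (a e) (b e), ∀ q ∈ openSegment ℝ (a e) (b e), x p = x q := by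
    intro p hp q hq
    refine (convex_openSegment (𝕜 := ℝ) (a e) (b e)).isPreconnected.eq_of_eventually_eq
      (f := x) ?_ hp hq
    intro p hp
    filter_upwards [self_mem_nhdsWithin, nhdsWithin_le_nhds (Metric.ball_mem_nhds p (hr p hp))]
      with q hq hqb
    have hfr := frequently_cr_pos hab hq hσ
    obtain ⟨z, hz, hz1, hz2⟩ := (hfr.and_eventually (Filter.inter_mem
      (Metric.isOpen_ball.mem_nhds hqb) (Metric.ball_mem_nhds q (hr q hq)))).exists
    rw [← hx p hp z hz1 hz, ← hx q hq z hz2 hz]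
  refine ⟨x (AffineMap.lineMap (a e) (b e) (1 / 2 : ℝ)), fun p hp => ?_⟩
  filter_upwards [Metric.ball_mem_nhds p (hr p hp)] with z hz hz'
  rw [hx p hp z hz hz']
  exact hconst p hp _ (mem_openSegment_iff_lineMap.2 ⟨1 / 2, by norm_num, rfl⟩)

/-- All the terms except the angle of e are continuous at p, and this angle tends to π from the left
and to -π from the right. Dividing by 2π leaves the weight of e. -/
theorem ContinuousAt.exists_pot_jump {e : E} {p : ℂ} (hH : ContinuousAt H p) (hab : a e ≠ b e)
    (hp : p ∈ openSegment ℝ (a e) (b e)) (hdisj : ∀ g ≠ e, p ∉ segment ℝ (a g) (b g))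
    {x y : ℝ} (hx : ∀ᶠ z in 𝓝 p, 0 < cr (a e) (b e) z → pot a b I H z = x)
    (hy : ∀ᶠ z in 𝓝 p, cr (a e) (b e) z < 0 → pot a b I H z = y) :
    x - y = I e := by
  classical
  set R : ℂ → ℝ := fun z => ∑ g ∈ Finset.univ.erase e, I g * ang (a g) (b g) z + (H z).im
  have hR : ContinuousAt R p := by
    apply ContinuousAt.add
    · apply tendsto_finsetSum
      intro g hg
      exact (continuousAt_ang (hdisj g (Finset.ne_of_mem_erase hg))).const_mul _
    · exact Complex.continuous_im.continuousAt.comp hH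
  have hpot : ∀ z, pot a b I H z = (I e * ang (a e) (b e) z + R z) / (2 * Real.pi) := by
    intro z
    simp only [pot, R]
    rw [← Finset.add_sum_erase _ _ (Finset.mem_univ e)]; ring
  have lim : ∀ (S : Set ℂ) (A w : ℝ), (∃ᶠ z in 𝓝 p, z ∈ S) →
      Tendsto (ang (a e) (b e)) (𝓝[S] p) (𝓝 A) →
      (∀ᶠ z in 𝓝 p, z ∈ S → pot a b I H z = w) → w = (I e * A + R p) / (2 * Real.pi) := by
    intro S A w hS hA hw
    have h1 : Tendsto (pot a b I H) (𝓝[S] p) (𝓝 ((I e * A + R p) / (2 * Real.pi))) := by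
      have := ((hA.const_mul (I e)).add (hR.tendsto.mono_left nhdsWithin_le_nhds)).div_const
        (2 * Real.pi)
      exact this.congr fun z => (hpot z).symm
    have h2 : Tendsto (pot a b I H) (𝓝[S] p) (𝓝 w) := by
      apply tendsto_nhds_of_eventually_eq
      rw [eventually_nhdsWithin_iff]; exact hw
    have : (𝓝[S] p).NeBot := by
      rw [← mem_closure_iff_nhdsWithin_neBot, mem_closure_iff_frequently]; exact hS
    exact tendsto_nhds_unique h2 h1
  have h1 := lim {z | 0 < cr (a e) (b e) z} _ x
    (by simpa using frequently_cr_pos hab hp one_ne_zero) (tendsto_ang_left hab hp) hx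
  have h2 := lim {z | cr (a e) (b e) z < 0} _ y
    (by simpa using frequently_cr_pos hab hp (neg_ne_zero.2 one_ne_zero))
    (tendsto_ang_right hab hp) hy
  rw [h1, h2]
  field_simp
  ring

end Potential

/-! ### Simple closed polygonal curves -/

theorem cr_eq_of_sub_eq {a q b : ℂ} {k : ℝ} (h : b - q = k * (q - a)) (z : ℂ) :
    cr q b z = k * cr a q z := by
  have h1 := congrArg Complex.re h
  have h2 := congrArg Complex.im h
  simp at h1 h2
  unfold cr
  rw [h1, h2]; ring

theorem lineMap_sub_right (a q : ℂ) (t : ℝ) :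
    AffineMap.lineMap a q t - q = ((1 - t : ℝ) : ℂ) * (a - q) := by
  rw [AffineMap.lineMap_apply]; simp; ring

theorem lineMap_sub_left (a q : ℂ) (t : ℝ) :
    AffineMap.lineMap a q t - a = ((t : ℝ) : ℂ) * (q - a) := by
  rw [AffineMap.lineMap_apply]; simp

theorem mem_segment_of_ball_right {a q : ℂ} {t r : ℝ} (haq : a ≠ q) (hr : r ≤ ‖a - q‖)
    (hz : AffineMap.lineMap a q t ∈ Metric.ball q r) (ht : t ≤ 1) :
    AffineMap.lineMap a q t ∈ segment ℝ a q := by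
  rw [Metric.mem_ball, dist_eq_norm, lineMap_sub_right, norm_mul, Complex.norm_real,
    Real.norm_eq_abs, abs_of_nonneg (by linarith)] at hz
  have h0 : 0 < ‖a - q‖ := norm_pos_iff.2 (sub_ne_zero.2 haq)
  refine mem_segment_iff_lineMap.2 ⟨t, ⟨?_, ht⟩, rfl⟩
  by_contra! hc
  nlinarith

theorem mem_segment_of_ball_left {a q : ℂ} {t r : ℝ} (haq : a ≠ q) (hr : r ≤ ‖a - q‖)
    (hz : AffineMap.lineMap a q t ∈ Metric.ball a r) (ht : 0 ≤ t) :
    AffineMap.lineMap a q t ∈ segment ℝ a q := by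
  rw [Metric.mem_ball, dist_eq_norm, lineMap_sub_left, norm_mul, Complex.norm_real,
    Real.norm_eq_abs, abs_of_nonneg ht, norm_sub_rev] at hz
  have h0 : 0 < ‖a - q‖ := norm_pos_iff.2 (sub_ne_zero.2 haq)
  refine mem_segment_iff_lineMap.2 ⟨t, ⟨ht, ?_⟩, rfl⟩
  by_contra! hc
  nlinarith

theorem exists_openSegment_mem_ball_right (a q : ℂ) {r : ℝ} (hr : 0 < r) :
    ∃ p ∈ openSegment ℝ a q, p ∈ Metric.ball q r := by
  have h : Tendsto (AffineMap.lineMap a q : ℝ → ℂ) (𝓝[<] 1) (𝓝 q) := by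
    have := (AffineMap.lineMap_continuous (R := ℝ) (p := a) (q := q)).tendsto 1
    rw [AffineMap.lineMap_apply_one] at this
    exact this.mono_left nhdsWithin_le_nhds
  have h2 : ∀ᶠ t : ℝ in 𝓝[<] 1, t ∈ Ioo (0 : ℝ) 1 := Ioo_mem_nhdsLT one_pos
  obtain ⟨t, h3, h4⟩ := (h2.and (h (Metric.ball_mem_nhds q hr))).exists
  exact ⟨_, mem_openSegment_iff_lineMap.2 ⟨t, h3, rfl⟩, h4⟩

theorem exists_openSegment_mem_ball_left (a q : ℂ) {r : ℝ} (hr : 0 < r) :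
    ∃ p ∈ openSegment ℝ a q, p ∈ Metric.ball a r := by
  rw [openSegment_symm]
  exact exists_openSegment_mem_ball_right q a hr

/-- The values of a locally constant function on the two sides of two consecutive edges. -/
theorem LocConstOn.corner {β : Type*} {f : ℂ → β} {Γ : Set ℂ} (hf : LocConstOn f Γᶜ)
    {a q b : ℂ} {r : ℝ} (hr : 0 < r)
    (hball : ∀ z ∈ Metric.ball q r, z ∈ Γ → z ∈ segment ℝ a q ∨ z ∈ segment ℝ q b)
    (ha : segment ℝ a q ⊆ Γ) (hb : segment ℝ q b ⊆ Γ) (haq : a ≠ q) (hqb : q ≠ b)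
    (hra : r ≤ ‖a - q‖) (hrb : r ≤ ‖q - b‖)
    (hst : cr a q b = 0 → ∃ k : ℝ, 0 < k ∧ b - q = k * (q - a))
    {σ : ℝ} (hσ : σ = 1 ∨ σ = -1) (hturn : 0 ≤ σ * cr a q b) {x y x' y' : β}
    (hx : ∀ p ∈ openSegment ℝ a q, ∀ᶠ z in 𝓝 p, 0 < σ * cr a q z → f z = x)
    (hx' : ∀ p ∈ openSegment ℝ a q, ∀ᶠ z in 𝓝 p, 0 < (-σ) * cr a q z → f z = x')
    (hy : ∀ p ∈ openSegment ℝ q b, ∀ᶠ z in 𝓝 p, 0 < σ * cr q b z → f z = y)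
    (hy' : ∀ p ∈ openSegment ℝ q b, ∀ᶠ z in 𝓝 p, 0 < (-σ) * cr q b z → f z = y') :
    x = y ∧ x' = y' ∧ ∀ᶠ z in 𝓝 q, z ∉ Γ → f z = x ∨ f z = x' := by
  have hσ0 : σ ≠ 0 := by rcases hσ with rfl | rfl <;> norm_num
  have hσ2 : σ * σ = 1 := by rcases hσ with rfl | rfl <;> norm_num
  have hsa : ∀ z ∈ segment ℝ a q, 0 ≤ σ * cr q b z := by
    intro z hz
    obtain ⟨t, ht, rfl⟩ := mem_segment_iff_lineMap.1 hz
    rw [cr_lineMap, cr_self_left, ← cr_rotate]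
    nlinarith [ht.2]
  have hsb : ∀ z ∈ segment ℝ q b, 0 ≤ σ * cr a q z := by
    intro z hz
    obtain ⟨t, ht, rfl⟩ := mem_segment_iff_lineMap.1 hz
    rw [cr_lineMap, cr_self_right]
    nlinarith [ht.1]
  -- As σ is the sign of the turn, S is the convex sector between the two edges, while T1 ∪ T2 is
  -- the complementary sector, a union of two overlapping half-discs. Both are connected and miss Γ.
  set S : Set ℂ := Metric.ball q r ∩ ({z | 0 < σ * cr a q z} ∩ {z | 0 < σ * cr q b z}) with hS
  set T1 : Set ℂ := Metric.ball q r ∩ {z | 0 < (-σ) * cr a q z} with hT1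
  set T2 : Set ℂ := Metric.ball q r ∩ {z | 0 < (-σ) * cr q b z} with hT2
  have hSc : IsPreconnected S := ((convex_ball q r).inter
    ((convex_cr_pos _ _ σ).inter (convex_cr_pos _ _ σ))).isPreconnected
  have hSΓ : S ⊆ Γᶜ := by
    rintro z ⟨h1, h2, h3⟩ hz
    simp only [mem_ofPred_eq] at h2 h3
    rcases hball z h1 hz with h | h
    · rw [cr_eq_zero_of_mem_segment h] at h2; simp at h2
    · rw [cr_eq_zero_of_mem_segment h] at h3; simp at h3
  have hT1Γ : T1 ⊆ Γᶜ := by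
    rintro z ⟨h1, h2⟩ hz
    simp only [mem_ofPred_eq] at h2
    rcases hball z h1 hz with h | h
    · rw [cr_eq_zero_of_mem_segment h] at h2; simp at h2
    · linarith [hsb z h]
  have hT2Γ : T2 ⊆ Γᶜ := by
    rintro z ⟨h1, h2⟩ hz
    simp only [mem_ofPred_eq] at h2
    rcases hball z h1 hz with h | h
    · linarith [hsa z h]
    · rw [cr_eq_zero_of_mem_segment h] at h2; simp at h2
  have hTne : (T1 ∩ T2).Nonempty := by
    have main : ∀ w : ℂ, σ * ((q.re - a.re) * w.im - (q.im - a.im) * w.re) < 0 →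
        σ * ((b.re - q.re) * w.im - (b.im - q.im) * w.re) < 0 → (T1 ∩ T2).Nonempty := by
      intro w h1 h2
      have ht : Tendsto (fun δ : ℝ => q + (δ : ℂ) * w) (𝓝[>] 0) (𝓝 q) := by
        have : Continuous (fun δ : ℝ => q + (δ : ℂ) * w) := by fun_prop
        have h2 := this.tendsto 0
        simp only [Complex.ofReal_zero, zero_mul, add_zero] at h2
        exact h2.mono_left nhdsWithin_le_nhds
      obtain ⟨δ, hδ, hδ'⟩ := ((ht.eventually (Metric.ball_mem_nhds q hr)).and
        (self_mem_nhdsWithin (s := Ioi (0 : ℝ)))).exists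
      have hδ0 : 0 < δ := hδ'
      refine ⟨q + δ * w, ⟨hδ, ?_⟩, ⟨hδ, ?_⟩⟩
      · have : (-σ) * cr a q (q + δ * w)
            = δ * (-(σ * ((q.re - a.re) * w.im - (q.im - a.im) * w.re))) := by
          unfold cr; simp; ring
        rw [mem_ofPred_eq, this]
        exact mul_pos hδ0 (by linarith)
      · have : (-σ) * cr q b (q + δ * w)
            = δ * (-(σ * ((b.re - q.re) * w.im - (b.im - q.im) * w.re))) := by
          unfold cr; simp; ring
        rw [mem_ofPred_eq, this]
        exact mul_pos hδ0 (by linarith)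
    by_cases h0 : cr a q b = 0
    · obtain ⟨k, hk, hkb⟩ := hst h0
      have hne : 0 < (q.re - a.re) ^ 2 + (q.im - a.im) ^ 2 := by
        by_contra h0
        apply haq
        apply Complex.ext <;> nlinarith [sq_nonneg (q.re - a.re), sq_nonneg (q.im - a.im)]
      have h1 := congrArg Complex.re hkb
      have h2 := congrArg Complex.im hkb
      simp at h1 h2
      refine main (-(σ * (Complex.I * (q - a)))) ?_ ?_
      · simp only [Complex.neg_im, Complex.neg_re, Complex.mul_im, Complex.mul_re,
          Complex.ofReal_re, Complex.ofReal_im, Complex.I_re, Complex.I_im, Complex.sub_re,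
          Complex.sub_im]
        calc _ = -(σ * σ) * ((q.re - a.re) ^ 2 + (q.im - a.im) ^ 2) := by ring
          _ < 0 := by rw [hσ2]; linarith
      · simp only [Complex.neg_im, Complex.neg_re, Complex.mul_im, Complex.mul_re,
          Complex.ofReal_re, Complex.ofReal_im, Complex.I_re, Complex.I_im, Complex.sub_re,
          Complex.sub_im]
        rw [h1, h2]
        have := mul_pos hk hne
        calc _ = -(σ * σ) * (k * ((q.re - a.re) ^ 2 + (q.im - a.im) ^ 2)) := by ring
          _ < 0 := by rw [hσ2]; linarith
    -- At a genuine turn the half-discs overlap in the direction opposite to (a - q) + (b - q); when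
    -- there is no turn, they overlap along the normal to the edges.
    · have hpos : 0 < σ * cr a q b := lt_of_le_of_ne hturn (mul_ne_zero hσ0 h0).symm
      refine main (-(a + b - 2 * q)) ?_ ?_ <;>
      · unfold cr at hpos
        simp only [Complex.neg_im, Complex.neg_re, Complex.mul_im, Complex.mul_re,
          Complex.add_re, Complex.add_im, Complex.sub_re, Complex.sub_im, Complex.re_ofNat,
          Complex.im_ofNat]
        linear_combination hpos
  have hTc : IsPreconnected (T1 ∪ T2) := by
    obtain ⟨w, hw1, hw2⟩ := hTne
    exact IsPreconnected.union w hw1 hw2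
      ((convex_ball q r).inter (convex_cr_pos _ _ _)).isPreconnected
      ((convex_ball q r).inter (convex_cr_pos _ _ _)).isPreconnected
  -- A point of neither sector lies on one of the two lines. It is then on an edge, or on the
  -- extension of an edge beyond q; the signs allow the latter only without a turn, when the
  -- extension runs along the other edge.
  have hcover : ∀ z ∈ Metric.ball q r, z ∉ Γ → z ∈ S ∨ z ∈ T1 ∪ T2 := by
    intro z hz hzΓ
    by_contra! hc
    obtain ⟨hzS, hzT⟩ := hc
    have h1 : 0 ≤ σ * cr a q z := by
      by_contra! h; exact hzT (Or.inl ⟨hz, by rw [mem_ofPred_eq]; linarith⟩)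
    have h2 : 0 ≤ σ * cr q b z := by
      by_contra! h; exact hzT (Or.inr ⟨hz, by rw [mem_ofPred_eq]; linarith⟩)
    have case1 : cr a q z ≠ 0 := by
      intro h0
      obtain ⟨t, rfl⟩ := exists_lineMap_of_cr_eq_zero haq h0
      rcases le_or_gt t 1 with ht | ht
      · exact hzΓ (ha (mem_segment_of_ball_right haq hra hz ht))
      · rw [cr_lineMap, cr_self_left, ← cr_rotate] at h2
        have h3 : σ * cr a q b = 0 := by nlinarith
        obtain ⟨k, hk, hkb⟩ := hst ((mul_eq_zero.1 h3).resolve_left hσ0)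
        have : (AffineMap.lineMap a q t : ℂ) = AffineMap.lineMap q b ((t - 1) / k) := by
          rw [← sub_left_inj (a := q), lineMap_sub_right, lineMap_sub_left, hkb]
          have : (k : ℂ) ≠ 0 := by exact_mod_cast hk.ne'
          push_cast
          field_simp
          ring
        rw [this] at hz hzΓ
        exact hzΓ (hb (mem_segment_of_ball_left hqb hrb hz (div_nonneg (by linarith) hk.le)))
    have case2 : cr q b z ≠ 0 := by
      intro h0
      obtain ⟨t, rfl⟩ := exists_lineMap_of_cr_eq_zero hqb h0
      rcases le_or_gt 0 t with ht | ht
      · exact hzΓ (hb (mem_segment_of_ball_left hqb hrb hz ht))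
      · rw [cr_lineMap, cr_self_right] at h1 case1
        have h3 : σ * cr a q b = 0 := by nlinarith
        have := (mul_eq_zero.1 h3).resolve_left hσ0
        rw [this] at case1
        simp at case1
    exact hzS ⟨hz, lt_of_le_of_ne h1 (mul_ne_zero hσ0 case1).symm,
      lt_of_le_of_ne h2 (mul_ne_zero hσ0 case2).symm⟩
  obtain ⟨p, hp, hpr⟩ := exists_openSegment_mem_ball_right a q hr
  obtain ⟨p', hp', hpr'⟩ := exists_openSegment_mem_ball_left q b hr
  have hT : T1 ∪ T2 ⊆ Γᶜ := union_subset hT1Γ hT2Γ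
  -- representatives of the four sides
  have rx : ∃ z ∈ S, f z = x := by
    obtain ⟨z, hz, hz1, hz2, hz3⟩ := ((frequently_cr_pos haq hp hσ0).and_eventually
      ((hx p hp).and ((show ∀ᶠ z in 𝓝 p, z ∈ Metric.ball q r from Metric.isOpen_ball.mem_nhds hpr).and
      (show ∀ᶠ z in 𝓝 p, 0 < σ * cr a q b → 0 < σ * cr q b z from by
        by_cases hs : 0 < σ * cr a q b
        · have : 0 < σ * cr q b p := by
            obtain ⟨t, ht, rfl⟩ := mem_openSegment_iff_lineMap.1 hp
            rw [cr_lineMap, cr_self_left, ← cr_rotate]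
            nlinarith [ht.2]
          filter_upwards [(isOpen_cr_pos q b σ).mem_nhds this] with z hz _ using hz
        · exact Eventually.of_forall fun z h => absurd h hs)))).exists
    refine ⟨z, ⟨hz2, hz, ?_⟩, hz1 hz⟩
    rcases eq_or_ne (cr a q b) 0 with h0 | h0
    · obtain ⟨k, hk, hkb⟩ := hst h0
      have := cr_eq_of_sub_eq hkb z
      rw [mem_ofPred_eq, this]; nlinarith [mul_pos hk hz]
    · exact hz3 (lt_of_le_of_ne hturn (mul_ne_zero hσ0 h0).symm)
  have ry : ∃ z ∈ S, f z = y := by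
    obtain ⟨z, hz, hz1, hz2, hz3⟩ := ((frequently_cr_pos hqb hp' hσ0).and_eventually
      ((hy p' hp').and ((show ∀ᶠ z in 𝓝 p', z ∈ Metric.ball q r from
        Metric.isOpen_ball.mem_nhds hpr').and
      (show ∀ᶠ z in 𝓝 p', 0 < σ * cr a q b → 0 < σ * cr a q z from by
        by_cases hs : 0 < σ * cr a q b
        · have : 0 < σ * cr a q p' := by
            obtain ⟨t, ht, rfl⟩ := mem_openSegment_iff_lineMap.1 hp'
            rw [cr_lineMap, cr_self_right]
            nlinarith [ht.1]
          filter_upwards [(isOpen_cr_pos a q σ).mem_nhds this] with z hz _ using hz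
        · exact Eventually.of_forall fun z h => absurd h hs)))).exists
    refine ⟨z, ⟨hz2, ?_, hz⟩, hz1 hz⟩
    rcases eq_or_ne (cr a q b) 0 with h0 | h0
    · obtain ⟨k, hk, hkb⟩ := hst h0
      have := cr_eq_of_sub_eq hkb z
      rw [this] at hz
      rw [mem_ofPred_eq]
      by_contra! hc
      nlinarith
    · exact hz3 (lt_of_le_of_ne hturn (mul_ne_zero hσ0 h0).symm)
  have rx' : ∃ z ∈ T1 ∪ T2, f z = x' := by
    obtain ⟨z, hz, hz1, hz2⟩ := ((frequently_cr_pos haq hp (neg_ne_zero.2 hσ0)).and_eventually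
      ((hx' p hp).and
      (show ∀ᶠ z in 𝓝 p, z ∈ Metric.ball q r from Metric.isOpen_ball.mem_nhds hpr))).exists
    exact ⟨z, Or.inl ⟨hz2, hz⟩, hz1 hz⟩
  have ry' : ∃ z ∈ T1 ∪ T2, f z = y' := by
    obtain ⟨z, hz, hz1, hz2⟩ := ((frequently_cr_pos hqb hp' (neg_ne_zero.2 hσ0)).and_eventually
      ((hy' p' hp').and
      (show ∀ᶠ z in 𝓝 p', z ∈ Metric.ball q r from
        Metric.isOpen_ball.mem_nhds hpr'))).exists
    exact ⟨z, Or.inr ⟨hz2, hz⟩, hz1 hz⟩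
  obtain ⟨z1, hz1, rfl⟩ := rx
  obtain ⟨z2, hz2, rfl⟩ := ry
  obtain ⟨z3, hz3, rfl⟩ := rx'
  obtain ⟨z4, hz4, rfl⟩ := ry'
  refine ⟨hf.eq hSc hSΓ hz1 hz2, hf.eq hTc hT hz3 hz4, ?_⟩
  filter_upwards [Metric.ball_mem_nhds q hr] with z hz hzΓ
  rcases hcover z hz hzΓ with h | h
  · exact Or.inl (hf.eq hSc hSΓ h hz1)
  · exact Or.inr (hf.eq hTc hT h hz3)

/-- `v 0, v 1, …, v n = v 0` are the consecutive vertices of a simple closed polygonal curve. -/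
structure SimpleLoop (v : ℕ → ℂ) (n : ℕ) : Prop where
  three_le : 3 ≤ n
  periodic : ∀ i, v (i + n) = v i
  simple : ∀ i < n, ∀ j < n, ∀ s ∈ Ico (0 : ℝ) 1, ∀ t ∈ Ico (0 : ℝ) 1,
    (AffineMap.lineMap (v i) (v (i + 1)) s : ℂ) = AffineMap.lineMap (v j) (v (j + 1)) t →
    i = j ∧ s = t

/-- The points of a closed polygonal curve. -/
def loopTrace (v : ℕ → ℂ) (n : ℕ) : Set ℂ := ⋃ i : Fin n, segment ℝ (v i) (v (i + 1))

namespace SimpleLoop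

variable {v : ℕ → ℂ} {n : ℕ}

theorem pos (h : SimpleLoop v n) : 0 < n := by have := h.three_le; omega

theorem mod (h : SimpleLoop v n) (i : ℕ) : v (i % n) = v i :=
  (Function.Periodic.map_mod_nat (f := v) (a := n) h.periodic i)

theorem mod_succ (h : SimpleLoop v n) (i : ℕ) : v (i % n + 1) = v (i + 1) := by
  rw [← h.mod (i % n + 1), ← h.mod (i + 1), Nat.mod_add_mod]

theorem simple' (h : SimpleLoop v n) {i j : ℕ} {s t : ℝ} (hs : s ∈ Ico (0 : ℝ) 1)
    (ht : t ∈ Ico (0 : ℝ) 1)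
    (heq : (AffineMap.lineMap (v i) (v (i + 1)) s : ℂ) = AffineMap.lineMap (v j) (v (j + 1)) t) :
    i % n = j % n ∧ s = t := by
  rw [← h.mod i, ← h.mod j, ← h.mod_succ i, ← h.mod_succ j] at heq
  exact h.simple _ (Nat.mod_lt _ h.pos) _ (Nat.mod_lt _ h.pos) s hs t ht heq

theorem eq_iff (h : SimpleLoop v n) {i j : ℕ} : v i = v j ↔ i % n = j % n := by
  constructor
  · intro hv
    exact (h.simple' (i := i) (j := j) (s := 0) (t := 0) (by simp) (by simp) (by simpa using hv)).1
  · intro hm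
    rw [← h.mod i, ← h.mod j, hm]

theorem ne_succ (h : SimpleLoop v n) (i : ℕ) : v i ≠ v (i + 1) := by
  intro hv
  have h1 : (0 : ℝ) = 1 / 2 := (h.simple' (i := i) (j := i) (s := 0) (t := 1 / 2) (by simp)
    (by norm_num) (by simp [hv])).2
  norm_num at h1

theorem mem_segment (h : SimpleLoop v n) {i j : ℕ} {s : ℝ} (hs : s ∈ Ico (0 : ℝ) 1)
    (hmem : (AffineMap.lineMap (v i) (v (i + 1)) s : ℂ) ∈ segment ℝ (v j) (v (j + 1))) :
    i % n = j % n ∨ (i % n = (j + 1) % n ∧ s = 0) := by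
  obtain ⟨t, ht, heq⟩ := mem_segment_iff_lineMap.1 hmem
  rcases ht.2.lt_or_eq with h1 | rfl
  · exact Or.inl (h.simple' hs ⟨ht.1, h1⟩ heq.symm).1
  · right
    exact h.simple' (j := j + 1) (t := 0) hs (by simp) (by simpa using heq.symm)

theorem rotate (h : SimpleLoop v n) (k : ℕ) : SimpleLoop (fun i => v (i + k)) n where
  three_le := h.three_le
  periodic i := by rw [show i + n + k = i + k + n by ring]; exact h.periodic _
  simple i hi j hj s hs t ht heq := by
    simp only [show ∀ i, i + 1 + k = i + k + 1 from fun i => by ring] at heq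
    have := h.simple' hs ht heq
    refine ⟨?_, this.2⟩
    have h2 := Nat.ModEq.add_right_cancel' k this.1
    rwa [Nat.ModEq, Nat.mod_eq_of_lt hi, Nat.mod_eq_of_lt hj] at h2

/-- The `i`-th edge. -/
def idx (h : SimpleLoop v n) (i : ℕ) : Fin n := ⟨i % n, Nat.mod_lt _ h.pos⟩

theorem segment_subset (h : SimpleLoop v n) (i : ℕ) :
    segment ℝ (v i) (v (i + 1)) ⊆ loopTrace v n := by
  intro z hz
  refine mem_iUnion.2 ⟨h.idx i, ?_⟩
  simpa [idx, h.mod, h.mod_succ] using hz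

theorem mem_trace_iff (_ : SimpleLoop v n) {z : ℂ} :
    z ∈ loopTrace v n ↔ ∃ i < n, z ∈ segment ℝ (v i) (v (i + 1)) := by
  constructor
  · intro hz
    obtain ⟨i, hi⟩ := mem_iUnion.1 hz
    exact ⟨i, i.2, hi⟩
  · rintro ⟨i, hi, hz⟩
    exact mem_iUnion.2 ⟨⟨i, hi⟩, hz⟩

theorem exists_lineMap_of_mem (h : SimpleLoop v n) {z : ℂ} (hz : z ∈ loopTrace v n) :
    ∃ i < n, ∃ s ∈ Ico (0 : ℝ) 1, AffineMap.lineMap (v i) (v (i + 1)) s = z := by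
  obtain ⟨i, hi, hz⟩ := h.mem_trace_iff.1 hz
  obtain ⟨s, hs, rfl⟩ := mem_segment_iff_lineMap.1 hz
  rcases hs.2.lt_or_eq with h1 | rfl
  · exact ⟨i, hi, s, ⟨hs.1, h1⟩, rfl⟩
  · refine ⟨(i + 1) % n, Nat.mod_lt _ h.pos, 0, by simp, ?_⟩
    simp [h.mod]

theorem isClosed_trace (v : ℕ → ℂ) (n : ℕ) : IsClosed (loopTrace v n) :=
  isClosed_iUnion_segment (fun i : Fin n => v i) (fun i : Fin n => v (i + 1))

theorem notMem_of_openSegment (h : SimpleLoop v n) (e : Fin n) :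
    ∀ p ∈ openSegment ℝ (v e) (v (e + 1)), ∀ g ≠ e, p ∉ segment ℝ (v g) (v (g + 1)) := by
  intro p hp g hg hmem
  obtain ⟨s, hs, rfl⟩ := mem_openSegment_iff_lineMap.1 hp
  rcases h.mem_segment ⟨hs.1.le, hs.2⟩ hmem with h1 | h1
  · rw [Nat.mod_eq_of_lt e.2, Nat.mod_eq_of_lt g.2] at h1
    exact hg (Fin.ext h1.symm)
  · exact hs.1.ne' h1.2

/-- Collinear consecutive edges cannot fold back. Let t be the parameter of `v (i + 2)` on the line
through `v i` and `v (i + 1)`. For 0 ≤ t < 1 the point `v (i + 2)` is on the edge i, for t < 0 the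
point `v i` is on the edge i + 1, and t = 1 makes that edge degenerate; so k = t - 1 is positive. -/
theorem straight (h : SimpleLoop v n) (i : ℕ) (h0 : cr (v i) (v (i + 1)) (v (i + 2)) = 0) :
    ∃ k : ℝ, 0 < k ∧ v (i + 2) - v (i + 1) = k * (v (i + 1) - v i) := by
  have h3 := h.three_le
  obtain ⟨t, ht⟩ := exists_lineMap_of_cr_eq_zero (h.ne_succ i) h0
  refine ⟨t - 1, ?_, ?_⟩
  · by_contra! hle
    rcases hle.lt_or_eq with hlt | heq
    · rcases le_or_gt 0 t with ht0 | ht0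
      · have := (h.simple' (i := i) (j := i + 2) (s := t) (t := 0) ⟨ht0, by linarith⟩ (by simp)
          (by simpa using ht)).1
        have h2 : (0 : ℕ) ≡ 2 [MOD n] := Nat.ModEq.add_left_cancel' i this
        have := (Nat.modEq_zero_iff_dvd.1 h2.symm)
        exact absurd (Nat.le_of_dvd (by norm_num) this) (by omega)
      · have := (h.simple' (i := i) (j := i + 1) (s := 0) (t := 1 / (1 - t)) (by simp)
          ⟨by apply div_nonneg <;> linarith, by rw [div_lt_one] <;> linarith⟩ ?_).1
        · have h2 : (0 : ℕ) ≡ 1 [MOD n] := Nat.ModEq.add_left_cancel' i this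
          have := (Nat.modEq_zero_iff_dvd.1 h2.symm)
          exact absurd (Nat.le_of_dvd (by norm_num) this) (by omega)
        · rw [show i + 1 + 1 = i + 2 from rfl, ← ht]
          have h1t : (1 - (t : ℂ)) ≠ 0 := by
            exact_mod_cast (by linarith : (1 - t) ≠ 0)
          simp only [AffineMap.lineMap_apply, vsub_eq_sub, vadd_eq_add, Complex.real_smul]
          push_cast
          field_simp
          ring
    · have : t = 1 := by linarith
      rw [this, AffineMap.lineMap_apply_one] at ht
      exact h.ne_succ (i + 1) ht
  · rw [← ht, lineMap_sub_right]; push_cast; ring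

/-- A locally constant function off a simple closed polygonal curve has at most two values, one on
the left and one on the right side of the curve. -/
theorem exists_side_values (h : SimpleLoop v n) {β : Type*} {f : ℂ → β}
    (hf : LocConstOn f (loopTrace v n)ᶜ) :
    ∃ x y : β, (∀ z ∉ loopTrace v n, f z = x ∨ f z = y) ∧
      ∀ i, ∀ p ∈ openSegment ℝ (v i) (v (i + 1)), ∀ᶠ z in 𝓝 p,
        (0 < cr (v i) (v (i + 1)) z → f z = x) ∧ (cr (v i) (v (i + 1)) z < 0 → f z = y) := by
  have hside : ∀ σ : ℝ, σ ≠ 0 → ∀ i : ℕ, ∃ x : β, ∀ p ∈ openSegment ℝ (v i) (v (i + 1)),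
      ∀ᶠ z in 𝓝 p, 0 < σ * cr (v i) (v (i + 1)) z → f z = x := by
    intro σ hσ i
    have := exists_side_value (a := fun i : Fin n => v i) (b := fun i : Fin n => v (i + 1))
      (e := h.idx i) isOpen_univ (hf.mono (fun z hz => hz.2)) (h.ne_succ _) (subset_univ _)
      (h.notMem_of_openSegment _) hσ
    simpa [idx, h.mod, h.mod_succ] using this
  have hcorner : ∀ i : ℕ, ∀ x y x' y' : β,
      (∀ p ∈ openSegment ℝ (v i) (v (i + 1)), ∀ᶠ z in 𝓝 p,
        0 < cr (v i) (v (i + 1)) z → f z = x) →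
      (∀ p ∈ openSegment ℝ (v i) (v (i + 1)), ∀ᶠ z in 𝓝 p,
        0 < (-1) * cr (v i) (v (i + 1)) z → f z = x') →
      (∀ p ∈ openSegment ℝ (v (i + 1)) (v (i + 2)), ∀ᶠ z in 𝓝 p,
        0 < cr (v (i + 1)) (v (i + 2)) z → f z = y) →
      (∀ p ∈ openSegment ℝ (v (i + 1)) (v (i + 2)), ∀ᶠ z in 𝓝 p,
        0 < (-1) * cr (v (i + 1)) (v (i + 2)) z → f z = y') →
      x = y ∧ x' = y' ∧ ∀ᶠ z in 𝓝 (v (i + 1)), z ∉ loopTrace v n → f z = x ∨ f z = x' := by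
    intro i x y x' y' hx hx' hy hy'
    obtain ⟨r, hr, -, hball⟩ := exists_ball_avoiding (fun i : Fin n => v i)
      (fun i : Fin n => v (i + 1)) {h.idx i, h.idx (i + 1)} (p := v (i + 1)) isOpen_univ
      (mem_univ _) (by
        intro g hg hmem
        apply hg
        have : (AffineMap.lineMap (v (i + 1)) (v (i + 1 + 1)) (0 : ℝ) : ℂ)
            ∈ segment ℝ (v g) (v (g + 1)) := by simpa using hmem
        rcases h.mem_segment (by simp) this with h1 | h1
        · right
          rw [mem_singleton_iff]
          apply Fin.ext
          simp [idx, h1, Nat.mod_eq_of_lt g.2]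
        · left
          have h2 := Nat.ModEq.add_right_cancel' 1 h1.1
          apply Fin.ext
          simpa [idx, Nat.ModEq, Nat.mod_eq_of_lt g.2] using h2.symm)
    set r' := min r (min ‖v i - v (i + 1)‖ ‖v (i + 1) - v (i + 2)‖) with hr'
    have hr'0 : 0 < r' := lt_min hr (lt_min (norm_pos_iff.2 (sub_ne_zero.2 (h.ne_succ i)))
      (norm_pos_iff.2 (sub_ne_zero.2 (h.ne_succ (i + 1)))))
    have hb' : ∀ z ∈ Metric.ball (v (i + 1)) r', z ∈ loopTrace v n →
        z ∈ segment ℝ (v i) (v (i + 1)) ∨ z ∈ segment ℝ (v (i + 1)) (v (i + 2)) := by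
      intro z hz hzΓ
      obtain ⟨g, hg⟩ := mem_iUnion.1 hzΓ
      have := hball z (Metric.ball_subset_ball (min_le_left _ _) hz) g hg
      rcases this with rfl | hg'
      · left; simpa [idx, h.mod, h.mod_succ] using hg
      · right
        rw [mem_singleton_iff] at hg'
        subst hg'
        simpa [idx, h.mod, h.mod_succ] using hg
    rcases le_total 0 (cr (v i) (v (i + 1)) (v (i + 2))) with hc | hc
    · exact hf.corner hr'0 hb' (h.segment_subset i) (h.segment_subset (i + 1)) (h.ne_succ i)
        (h.ne_succ (i + 1)) ((min_le_right _ _).trans (min_le_left _ _))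
        ((min_le_right _ _).trans (min_le_right _ _)) (h.straight i) (σ := 1) (Or.inl rfl)
        (by simpa using hc) (by simpa using hx) hx' (by simpa using hy) hy'
    -- A right turn is the case σ = -1, in which the two sides exchange their roles.
    · have := hf.corner hr'0 hb' (h.segment_subset i) (h.segment_subset (i + 1)) (h.ne_succ i)
        (h.ne_succ (i + 1)) ((min_le_right _ _).trans (min_le_left _ _))
        ((min_le_right _ _).trans (min_le_right _ _)) (h.straight i) (σ := -1) (Or.inr rfl)
        (by linarith) hx' (by simpa using hx) hy' (by simpa using hy)
      refine ⟨this.2.1, this.1, this.2.2.mono fun z hz hzΓ => (hz hzΓ).symm⟩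
  choose L hL using hside 1 one_ne_zero
  choose R hR using hside (-1) (by norm_num)
  simp only [one_mul] at hL
  have hstep := fun i => hcorner i _ _ _ _ (hL i) (hR i) (hL (i + 1)) (hR (i + 1))
  -- The values on the two sides pass unchanged through every corner, so they are the same along the
  -- whole curve.
  have hL0 : ∀ i, L i = L 0 := by
    intro i; induction i with
    | zero => rfl
    | succ k ih => rw [← ih]; exact ((hstep k).1).symm
  have hR0 : ∀ i, R i = R 0 := by
    intro i; induction i with
    | zero => rfl
    | succ k ih => rw [← ih]; exact ((hstep k).2.1).symm
  have hedge : ∀ i, ∀ p ∈ openSegment ℝ (v i) (v (i + 1)), ∀ᶠ z in 𝓝 p,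
        (0 < cr (v i) (v (i + 1)) z → f z = L 0) ∧ (cr (v i) (v (i + 1)) z < 0 → f z = R 0) := by
    intro i p hp
    filter_upwards [hL i p hp, hR i p hp] with z h1 h2
    exact ⟨fun hz => (h1 hz).trans (hL0 i), fun hz => (h2 (by linarith)).trans (hR0 i)⟩
  have hnear : ∀ q ∈ loopTrace v n, ∀ᶠ z in 𝓝 q, z ∉ loopTrace v n → f z = L 0 ∨ f z = R 0 := by
    intro q hq
    obtain ⟨i, hi, s, hs, rfl⟩ := h.exists_lineMap_of_mem hq
    rcases hs.1.eq_or_lt with rfl | hs0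
    -- The corner at `v i` follows the edge i - 1, written as i + n - 1 to stay in ℕ.
    · have := (hstep (i + n - 1)).2.2
      rw [show i + n - 1 + 1 = i + n by omega, h.periodic, hL0, hR0] at this
      simpa using this
    · have hp : (AffineMap.lineMap (v i) (v (i + 1)) s : ℂ) ∈ openSegment ℝ (v i) (v (i + 1)) :=
        mem_openSegment_iff_lineMap.2 ⟨s, ⟨hs0, hs.2⟩, rfl⟩
      obtain ⟨r, hr, -, hball⟩ := exists_ball_avoiding (fun i : Fin n => v i)
        (fun i : Fin n => v (i + 1)) {⟨i, hi⟩} isOpen_univ (mem_univ _)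
        (fun g hg => h.notMem_of_openSegment ⟨i, hi⟩ _ hp g hg)
      have hop : IsOpen (Metric.ball (AffineMap.lineMap (v i) (v (i + 1)) s : ℂ) r) :=
        Metric.isOpen_ball
      have hline : ∀ᶠ z in 𝓝 (AffineMap.lineMap (v i) (v (i + 1)) s : ℂ),
          cr (v i) (v (i + 1)) z = 0 → z ∈ loopTrace v n := by
        have hpos : 0 < min s (1 - s) * ‖v (i + 1) - v i‖ :=
          mul_pos (lt_min hs0 (by linarith [hs.2]))
            (norm_pos_iff.2 (sub_ne_zero.2 (h.ne_succ i).symm))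
        filter_upwards [Metric.ball_mem_nhds _ hpos] with z hz h0
        obtain ⟨t, rfl⟩ := exists_lineMap_of_cr_eq_zero (h.ne_succ i) h0
        rw [Metric.mem_ball, dist_lineMap_lineMap, dist_comm (v i), dist_eq_norm,
          dist_eq_norm] at hz
        have := lt_of_mul_lt_mul_right hz (norm_nonneg _)
        rw [Real.norm_eq_abs, lt_min_iff, abs_lt, abs_lt] at this
        exact h.segment_subset i (mem_segment_iff_lineMap.2 ⟨t, ⟨by linarith [this.1.1],
          by linarith [this.2.2]⟩, rfl⟩)
      filter_upwards [hedge i _ hp, hline] with z hz hz' hzΓ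
      rcases lt_trichotomy (cr (v i) (v (i + 1)) z) 0 with h0 | h0 | h0
      · exact Or.inr (hz.2 h0)
      · exact absurd (hz' h0) hzΓ
      · exact Or.inl (hz.1 h0)
  refine ⟨L 0, R 0, fun z hz => ?_, hedge⟩
  -- the first point of the curve on the way from `z` to a point of the curve
  set ℓ : ℝ → ℂ := fun t => AffineMap.lineMap z (v 0) t with hℓ
  have hℓc : Continuous ℓ := AffineMap.lineMap_continuous
  set A : Set ℝ := {t | t ∈ Icc (0 : ℝ) 1 ∧ ℓ t ∈ loopTrace v n} with hA
  have hAcl : IsClosed A := isClosed_Icc.inter ((isClosed_trace v n).preimage hℓc)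
  have hAne : A.Nonempty := ⟨1, by simp, by
    simp only [hℓ, AffineMap.lineMap_apply_one]
    exact h.segment_subset 0 (left_mem_segment ℝ _ _)⟩
  have hAb : BddBelow A := ⟨0, fun t ht => ht.1.1⟩
  have ht0 : sInf A ∈ A := hAcl.csInf_mem hAne hAb
  set t0 := sInf A with ht0'
  have ht0pos : 0 < t0 := by
    rcases ht0.1.1.eq_or_lt with h0 | h0
    · exfalso; have := ht0.2; rw [← h0] at this; simp [hℓ] at this; exact hz this
    · exact h0
  have hbefore : ∀ t ∈ Ico 0 t0, ℓ t ∉ loopTrace v n := by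
    intro t ht hmem
    have : t0 ≤ t := csInf_le hAb ⟨⟨ht.1, by linarith [ht.2, ht0.1.2]⟩, hmem⟩
    linarith [ht.2]
  have h1 : ∀ᶠ t in 𝓝[<] t0, ℓ t ∉ loopTrace v n → f (ℓ t) = L 0 ∨ f (ℓ t) = R 0 :=
    ((hℓc.tendsto t0).mono_left nhdsWithin_le_nhds).eventually (hnear _ ht0.2)
  have h2 : ∀ᶠ t in 𝓝[<] t0, t ∈ Ico 0 t0 := by
    filter_upwards [Ioo_mem_nhdsLT ht0pos] with t ht using ⟨ht.1.le, ht.2⟩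
  obtain ⟨t, ht1, ht2⟩ := (h1.and h2).exists
  have h3 : f (ℓ 0) = f (ℓ t) := by
    refine hf.eq (S := ℓ '' Ico 0 t0) (isPreconnected_Ico.image _ hℓc.continuousOn) ?_
      ⟨0, ⟨le_rfl, ht0pos⟩, rfl⟩ ⟨t, ht2, rfl⟩
    rintro _ ⟨s, hs, rfl⟩
    exact hbefore s hs
  have h4 : ℓ 0 = z := by simp [hℓ]
  rw [← h4, h3]
  exact ht1 (hbefore t ht2)

end SimpleLoop

/-! ### Winding numbers -/

/-- The winding number of a closed polygonal curve about `z`. -/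
noncomputable def wnd (v : ℕ → ℂ) (n : ℕ) : ℂ → ℝ :=
  pot (fun i : Fin n => v i) (fun i : Fin n => v (i + 1)) (fun _ => 1) (fun _ => 0)

theorem wnd_eq (v : ℕ → ℂ) (n : ℕ) (z : ℂ) :
    wnd v n z = (∑ i ∈ Finset.range n, ang (v i) (v (i + 1)) z) / (2 * Real.pi) := by
  simp [wnd, pot, Fin.sum_univ_eq_sum_range (fun i => ang (v i) (v (i + 1)) z)]

theorem closedChain_loop {v : ℕ → ℂ} {n : ℕ} (hn : v n = v 0) :
    ClosedChain (fun i : Fin n => v i) (fun i : Fin n => v (i + 1)) (fun _ => 1) (fun _ => 0)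
      univ := by
  refine ⟨isOpen_univ, fun z _ _ => ?_⟩
  have : ∑ i : Fin n, ((1 : ℝ) : ℂ) * (1 / (v i - z) - 1 / (v (i + 1) - z)) = 0 := by
    simp only [Complex.ofReal_one, one_mul]
    rw [Fin.sum_univ_eq_sum_range (fun i => 1 / (v i - z) - 1 / (v (i + 1) - z)),
      Finset.sum_range_sub', hn, sub_self]
  rw [this, neg_zero]
  exact hasDerivAt_const z 0

theorem wnd_locConst {v : ℕ → ℂ} {n : ℕ} (hn : v n = v 0) :
    LocConstOn (wnd v n) (loopTrace v n)ᶜ :=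
  (closedChain_loop hn).locConstOn.mono fun _ hz => ⟨mem_univ _, hz⟩

/-- Seen from z, both ends lie in one open half-plane. After multiplication by u their arguments are
less than π / 2 in absolute value, so the argument of the quotient is the difference without a
correction by 2π. Summing this along a closed curve in the half-plane gives winding number zero. -/
theorem ang_eq_sub {a b z u : ℂ} (ha : 0 < (u * (a - z)).re) (hb : 0 < (u * (b - z)).re) :
    ang a b z = Complex.arg (u * (b - z)) - Complex.arg (u * (a - z)) := by
  have hu : u ≠ 0 := by rintro rfl; simp at ha
  have ha0 : u * (a - z) ≠ 0 := by intro h; rw [h] at ha; simp at ha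
  have hb0 : u * (b - z) ≠ 0 := by intro h; rw [h] at hb; simp at hb
  have h1 := abs_lt.1 (Complex.abs_arg_lt_pi_div_two_iff.2 (Or.inl ha))
  have h2 := abs_lt.1 (Complex.abs_arg_lt_pi_div_two_iff.2 (Or.inl hb))
  have hpi := Real.pi_pos
  have : (b - z) / (a - z) = (u * (b - z)) * (u * (a - z))⁻¹ := by
    rw [← div_eq_mul_inv, mul_div_mul_left _ _ hu]
  rw [ang, this]
  have hinv : ((u * (a - z))⁻¹).arg = -(u * (a - z)).arg := by
    rw [Complex.arg_inv, if_neg (by linarith)]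
  rw [(Complex.arg_mul_eq_add_arg_iff hb0 (inv_ne_zero ha0)).2, hinv]
  · ring
  · rw [hinv]; constructor <;> linarith

theorem wnd_eq_zero_of_halfplane {v : ℕ → ℂ} {n : ℕ} (hn : v n = v 0) {u z : ℂ}
    (h : ∀ i ≤ n, 0 < (u * (v i - z)).re) : wnd v n z = 0 := by
  rw [wnd_eq, Finset.sum_congr rfl fun i hi => ang_eq_sub (h i (Finset.mem_range.1 hi).le)
    (h (i + 1) (Finset.mem_range.1 hi)),
    Finset.sum_range_sub (fun i => Complex.arg (u * (v i - z))), hn]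
  simp

theorem notMem_segment_of_halfplane {a b u z : ℂ} (ha : 0 < (u * (a - z)).re)
    (hb : 0 < (u * (b - z)).re) : z ∉ segment ℝ a b := by
  intro hz
  obtain ⟨t, ht, h⟩ := mem_segment_iff_lineMap.1 hz
  have h1 := congrArg Complex.re h
  have h2 := congrArg Complex.im h
  rw [lineMap_re] at h1
  rw [lineMap_im] at h2
  simp only [Complex.mul_re, Complex.sub_re, Complex.sub_im] at ha hb
  rcases ht.1.eq_or_lt with rfl | h0
  · simp at h1 h2; simp [h1, h2] at ha
  · have h3 : (1 - t) * (u.re * (a.re - z.re) - u.im * (a.im - z.im)) +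
        t * (u.re * (b.re - z.re) - u.im * (b.im - z.im)) = 0 := by rw [← h1, ← h2]; ring
    linarith [mul_pos h0 hb, mul_nonneg (sub_nonneg.2 ht.2) ha.le]

theorem notMem_loopTrace_of_halfplane {v : ℕ → ℂ} {n : ℕ} {u z : ℂ}
    (h : ∀ i ≤ n, 0 < (u * (v i - z)).re) : z ∉ loopTrace v n := by
  rw [loopTrace, mem_iUnion]
  rintro ⟨i, hi⟩
  exact notMem_segment_of_halfplane (h i i.2.le) (h (i + 1) i.2) hi

theorem halfplane_of_norm_lt {v : ℂ} {z : ℂ} (h : ‖v‖ < ‖z‖) :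
    0 < (-(starRingEnd ℂ) z * (v - z)).re := by
  have h1 : ((starRingEnd ℂ) z * v).re ≤ ‖z‖ * ‖v‖ := by
    refine (Complex.re_le_norm _).trans ?_
    rw [norm_mul, Complex.norm_conj]
  have h2 : ((starRingEnd ℂ) z * z).re = ‖z‖ * ‖z‖ := by
    rw [mul_comm, Complex.mul_conj, Complex.ofReal_re, Complex.normSq_eq_norm_sq, sq]
  have h3 : (-(starRingEnd ℂ) z * (v - z)).re
      = ((starRingEnd ℂ) z * z).re - ((starRingEnd ℂ) z * v).re := by
    rw [← Complex.sub_re]; congr 1; ring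
  rw [h3, h2]
  nlinarith [norm_nonneg v]

/-! ### The Jordan curve theorem for polygonal curves. -/

namespace SimpleLoop

variable {v : ℕ → ℂ} {n : ℕ}

theorem apply_n (h : SimpleLoop v n) : v n = v 0 := by simpa using h.periodic 0

theorem exists_norm_bound (v : ℕ → ℂ) (n : ℕ) : ∃ M : ℝ, ∀ z, M < ‖z‖ →
    z ∉ loopTrace v n ∧ (v n = v 0 → wnd v n z = 0) := by
  obtain ⟨M, hM⟩ := ((Finset.range (n + 1)).image fun i => ‖v i‖).bddAbove
  refine ⟨M, fun z hz => ?_⟩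
  have : ∀ i ≤ n, 0 < (-(starRingEnd ℂ) z * (v i - z)).re := fun i hi =>
    halfplane_of_norm_lt ((hM (by
      simp only [Finset.coe_image, Finset.coe_range, mem_image, mem_Iio]
      exact ⟨i, by omega, rfl⟩)).trans_lt hz)
  exact ⟨notMem_loopTrace_of_halfplane this, fun hn => wnd_eq_zero_of_halfplane hn this⟩

theorem exists_far (M : ℝ) : ∃ z : ℂ, M < ‖z‖ := by
  refine ⟨((|M| + 1 : ℝ) : ℂ), ?_⟩
  rw [Complex.norm_real, Real.norm_eq_abs, abs_of_pos (by positivity)]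
  linarith [le_abs_self M]

theorem locConst_component {K : Set ℂ} (hK : IsClosed K) :
    LocConstOn (fun z => connectedComponentIn Kᶜ z) Kᶜ := by
  intro z hz
  obtain ⟨r, hr, hball⟩ := Metric.isOpen_iff.1 hK.isOpen_compl z hz
  filter_upwards [Metric.ball_mem_nhds z hr] with w hw
  exact (connectedComponentIn_eq ((convex_ball z r).isPreconnected.subset_connectedComponentIn
    (Metric.mem_ball_self hr) hball hw)).symm

/-- The Jordan curve theorem for simple closed polygonal curves. -/
theorem jordan (h : SimpleLoop v n) :
    ∃ x : ℝ, (x = 0 ∨ x = 1) ∧ (∀ z ∉ loopTrace v n, wnd v n z = x ∨ wnd v n z = x - 1) ∧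
      (∀ i, ∀ p ∈ openSegment ℝ (v i) (v (i + 1)), ∀ᶠ z in 𝓝 p,
        (0 < cr (v i) (v (i + 1)) z → wnd v n z = x) ∧
        (cr (v i) (v (i + 1)) z < 0 → wnd v n z = x - 1)) ∧
      ∀ z ∉ loopTrace v n, ∀ w ∉ loopTrace v n, wnd v n z = wnd v n w →
        connectedComponentIn (loopTrace v n)ᶜ z = connectedComponentIn (loopTrace v n)ᶜ w := by
  -- The pair of the winding number and the connected component is locally constant, so it has at
  -- most two values. Their first entries differ by the jump 1 across an edge; thus the winding
  -- number determines the component.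
  have hf : LocConstOn (fun z => (wnd v n z, connectedComponentIn (loopTrace v n)ᶜ z))
      (loopTrace v n)ᶜ := by
    intro z hz
    filter_upwards [wnd_locConst h.apply_n z hz, locConst_component (isClosed_trace v n) z hz]
      with w h1 h2
    rw [h1, h2]
  obtain ⟨⟨x, X⟩, ⟨y, Y⟩, h1, h2⟩ := h.exists_side_values hf
  simp only [Prod.mk.injEq] at h1 h2
  have hxy : x - y = 1 := by
    set e : Fin n := ⟨0, h.pos⟩
    have hp : (AffineMap.lineMap (v 0) (v (0 + 1)) (1 / 2 : ℝ) : ℂ) ∈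
        openSegment ℝ (v 0) (v (0 + 1)) := mem_openSegment_iff_lineMap.2 ⟨1 / 2, by norm_num, rfl⟩
    exact ContinuousAt.exists_pot_jump (a := fun i : Fin n => v i)
      (b := fun i : Fin n => v (i + 1)) (I := fun _ => 1) (H := fun _ => 0) (e := e)
      continuousAt_const (h.ne_succ 0) hp (h.notMem_of_openSegment e _ hp)
      ((h2 0 _ hp).mono fun z hz hz' => (hz.1 hz').1)
      ((h2 0 _ hp).mono fun z hz hz' => (hz.2 hz').1)
  have hy : y = x - 1 := by linarith
  subst hy
  refine ⟨x, ?_, fun z hz => (h1 z hz).imp And.left And.left, fun i p hp =>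
    (h2 i p hp).mono fun z hz => ⟨fun h => (hz.1 h).1, fun h => (hz.2 h).1⟩, ?_⟩
  -- Far away the winding number vanishes, so one of x and x - 1 is 0.
  · obtain ⟨M, hM⟩ := exists_norm_bound v n
    obtain ⟨z, hz⟩ := exists_far M
    have := h1 z (hM z hz).1
    rw [(hM z hz).2 h.apply_n] at this
    rcases this with h3 | h3
    · exact Or.inl h3.1.symm
    · exact Or.inr (by linarith [h3.1])
  · intro z hz w hw hzw
    rcases h1 z hz with h3 | h3 <;> rcases h1 w hw with h4 | h4
    · rw [h3.2, h4.2]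
    · exact absurd (h3.1.symm.trans (hzw.trans h4.1)) (by linarith)
    · exact absurd (h3.1.symm.trans (hzw.trans h4.1)) (by linarith)
    · rw [h3.2, h4.2]

/-- The winding number vanishes far away, and points with the same winding number are in one
component. So the points with winding number 0 form the unbounded component. -/
theorem isBounded_component_iff (h : SimpleLoop v n) {z : ℂ} (hz : z ∉ loopTrace v n) :
    Bornology.IsBounded (connectedComponentIn (loopTrace v n)ᶜ z) ↔ wnd v n z ≠ 0 := by
  obtain ⟨x, -, -, -, hcomp⟩ := h.jordan
  obtain ⟨M, hM⟩ := exists_norm_bound v n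
  constructor
  · intro hb h0
    obtain ⟨C, hC⟩ := hb.exists_norm_le
    obtain ⟨w, hw⟩ := exists_far (max M C)
    have hwM := hM w ((le_max_left _ _).trans_lt hw)
    have := hcomp z hz w hwM.1 (by rw [h0, hwM.2 h.apply_n])
    have hmem : w ∈ connectedComponentIn (loopTrace v n)ᶜ z := by
      rw [this]; exact mem_connectedComponentIn hwM.1
    linarith [hC w hmem, le_max_right M C]
  · intro h0
    refine (Metric.isBounded_closedBall (x := (0 : ℂ)) (r := M)).subset fun w hw => ?_
    rw [mem_closedBall_zero_iff]
    by_contra! hc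
    apply h0
    rw [← (hM w hc).2 h.apply_n]
    exact (wnd_locConst h.apply_n).eq isPreconnected_connectedComponentIn
      (connectedComponentIn_subset _ _) (mem_connectedComponentIn hz) hw

end SimpleLoop

/-- A simple closed polygonal curve traversed counterclockwise. -/
structure PosLoop (v : ℕ → ℂ) (n : ℕ) : Prop extends SimpleLoop v n where
  side : ∀ i, ∀ p ∈ openSegment ℝ (v i) (v (i + 1)), ∀ᶠ z in 𝓝 p,
    (0 < cr (v i) (v (i + 1)) z → wnd v n z = 1) ∧ (cr (v i) (v (i + 1)) z < 0 → wnd v n z = 0)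

theorem SimpleLoop.posLoop_or {v : ℕ → ℂ} {n : ℕ} (h : SimpleLoop v n) :
    PosLoop v n ∨ ∀ i, ∀ p ∈ openSegment ℝ (v i) (v (i + 1)), ∀ᶠ z in 𝓝 p,
      (0 < cr (v i) (v (i + 1)) z → wnd v n z = 0) ∧
      (cr (v i) (v (i + 1)) z < 0 → wnd v n z = -1) := by
  obtain ⟨x, rfl | rfl, -, h2, -⟩ := h.jordan
  · right; simpa using h2
  · left; exact ⟨h, by simpa using h2⟩

/-! ### Counterclockwise curves and the regions they enclose. -/

namespace PosLoop

variable {v : ℕ → ℂ} {n : ℕ}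

theorem wnd_eq_or (h : PosLoop v n) {z : ℂ} (hz : z ∉ loopTrace v n) :
    wnd v n z = 1 ∨ wnd v n z = 0 := by
  obtain ⟨x, hx, h1, h2, -⟩ := h.toSimpleLoop.jordan
  have hp : (AffineMap.lineMap (v 0) (v (0 + 1)) (1 / 2 : ℝ) : ℂ) ∈
      openSegment ℝ (v 0) (v (0 + 1)) := mem_openSegment_iff_lineMap.2 ⟨1 / 2, by norm_num, rfl⟩
  obtain ⟨w, hw, hw1, hw2⟩ := ((frequently_cr_pos (h.ne_succ 0) hp one_ne_zero).and_eventually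
    ((h.side 0 _ hp).and (h2 0 _ hp))).exists
  rw [one_mul] at hw
  have : x = 1 := by rw [← hw2.1 hw, hw1.1 hw]
  subst this
  simpa using h1 z hz

/-- The closed region enclosed by the curve. -/
def _root_.loopRegion (v : ℕ → ℂ) (n : ℕ) : Set ℂ :=
  loopTrace v n ∪ {z | z ∉ loopTrace v n ∧ wnd v n z = 1}

theorem isOpen_inside (h : PosLoop v n) : IsOpen {z | z ∉ loopTrace v n ∧ wnd v n z = 1} := by
  rw [isOpen_iff_mem_nhds]
  rintro z ⟨hz, hz1⟩
  filter_upwards [(SimpleLoop.isClosed_trace v n).isOpen_compl.mem_nhds hz,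
    wnd_locConst h.apply_n z hz] with w h1 h2
  exact ⟨h1, h2.trans hz1⟩

theorem compl_region (h : PosLoop v n) :
    (loopRegion v n)ᶜ = {z | z ∉ loopTrace v n ∧ wnd v n z = 0} := by
  ext z
  simp only [loopRegion, mem_compl_iff, mem_union, mem_ofPred_eq, not_or, not_and]
  constructor
  · rintro ⟨h1, h2⟩
    exact ⟨h1, (h.wnd_eq_or h1).resolve_left (h2 h1)⟩
  · rintro ⟨h1, h2⟩
    exact ⟨h1, fun _ => by rw [h2]; exact zero_ne_one⟩

theorem isClosed_region (h : PosLoop v n) : IsClosed (loopRegion v n) := by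
  rw [← isOpen_compl_iff, h.compl_region, isOpen_iff_mem_nhds]
  rintro z ⟨hz, hz1⟩
  filter_upwards [(SimpleLoop.isClosed_trace v n).isOpen_compl.mem_nhds hz,
    wnd_locConst h.apply_n z hz] with w h1 h2
  exact ⟨h1, h2.trans hz1⟩

/-- Every point of the closed region is a limit of inner points. -/
theorem region_subset_closure (h : PosLoop v n) :
    loopRegion v n ⊆ closure {z | z ∉ loopTrace v n ∧ wnd v n z = 1} := by
  rintro z (hz | hz)
  · obtain ⟨i, hi, hz⟩ := h.mem_trace_iff.1 hz
    have h1 : openSegment ℝ (v i) (v (i + 1)) ⊆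
        closure {z | z ∉ loopTrace v n ∧ wnd v n z = 1} := by
      intro p hp
      rw [mem_closure_iff_frequently]
      obtain ⟨r, hr, -, hball⟩ := exists_ball_avoiding (fun i : Fin n => v i)
        (fun i : Fin n => v (i + 1)) {⟨i, hi⟩} isOpen_univ (mem_univ _)
        (fun g hg => h.notMem_of_openSegment ⟨i, hi⟩ _ hp g hg)
      refine ((frequently_cr_pos (h.ne_succ i) hp one_ne_zero).and_eventually
        ((h.side i p hp).and (Metric.ball_mem_nhds p hr))).mono ?_
      rintro w ⟨h1, h2, h3⟩
      rw [one_mul] at h1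
      refine ⟨fun hw => ?_, h2.1 h1⟩
      obtain ⟨g, hg⟩ := mem_iUnion.1 hw
      have := hball w h3 g hg
      rw [mem_singleton_iff] at this
      subst this
      rw [cr_eq_zero_of_mem_segment hg] at h1
      exact lt_irrefl _ h1
    have h2 := closure_mono h1
    rw [closure_closure, closure_openSegment] at h2
    exact h2 hz
  · exact subset_closure hz

end PosLoop

/-! ### Diagonals of simple closed polygonal curves -/

theorem cr_add_cr_add_cr (a b c z : ℂ) : cr a b z + cr b c z + cr c a z = cr a b c := by
  unfold cr; ring

theorem mem_segment_of_cr {a b c z : ℂ} (hD : 0 < cr a b c) (h0 : cr a b z = 0)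
    (h1 : 0 ≤ cr b c z) (h2 : 0 ≤ cr c a z) : z ∈ segment ℝ a b := by
  have hab : a ≠ b := by rintro rfl; simp [cr] at hD
  obtain ⟨t, rfl⟩ := exists_lineMap_of_cr_eq_zero hab h0
  rw [cr_lineMap, ← cr_rotate, cr_self_left] at h1
  rw [cr_lineMap, cr_self_right, cr_rotate] at h2
  refine mem_segment_iff_lineMap.2 ⟨t, ⟨?_, ?_⟩, rfl⟩
  · by_contra! hc; nlinarith
  · by_contra! hc; nlinarith

theorem re_conj_mul_lt {a w : ℂ} (h : ‖a‖ ≤ ‖w‖) (hne : a ≠ w) :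
    w.re * a.re + w.im * a.im < w.re * w.re + w.im * w.im := by
  have h1 : a.re * a.re + a.im * a.im ≤ w.re * w.re + w.im * w.im := by
    have := mul_self_le_mul_self (norm_nonneg a) h
    rwa [← sq, ← sq, ← Complex.normSq_eq_norm_sq, ← Complex.normSq_eq_norm_sq,
      Complex.normSq_apply, Complex.normSq_apply] at this
  by_contra! hc
  apply hne
  apply Complex.ext <;> nlinarith [sq_nonneg (a.re - w.re), sq_nonneg (a.im - w.im)]

/-- Two affine functions on [0, 1] are positive at 0, with values A', B' at 1 that are not both
nonnegative. At the first zero of either of them the other one is still nonnegative. This locates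
the point where a moving point leaves an angle. -/
theorem exists_first_zero {A B A' B' : ℝ} (hA : 0 < A) (hB : 0 < B) (h : A' < 0 ∨ B' < 0) :
    ∃ s ∈ Ioc (0 : ℝ) 1, ((1 - s) * A + s * A' = 0 ∧ 0 ≤ (1 - s) * B + s * B') ∨
      ((1 - s) * B + s * B' = 0 ∧ 0 ≤ (1 - s) * A + s * A') := by
  have key : ∀ A A' : ℝ, 0 < A → A' < 0 → A / (A - A') ∈ Ioc (0 : ℝ) 1 ∧
      (1 - A / (A - A')) * A + A / (A - A') * A' = 0 ∧
      ∀ s, s ≤ A / (A - A') → 0 ≤ (1 - s) * A + s * A' := by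
    intro A A' hA hA'
    have h1 : 0 < A - A' := by linarith
    refine ⟨⟨by positivity, by rw [div_le_one h1]; linarith⟩, by field_simp; ring, fun s hs => ?_⟩
    rw [le_div_iff₀ h1] at hs
    linarith
  by_cases hA' : A' < 0 <;> by_cases hB' : B' < 0
  · obtain ⟨a1, a2, a3⟩ := key A A' hA hA'
    obtain ⟨b1, b2, b3⟩ := key B B' hB hB'
    rcases le_total (A / (A - A')) (B / (B - B')) with hle | hle
    · exact ⟨_, a1, Or.inl ⟨a2, b3 _ hle⟩⟩
    · exact ⟨_, b1, Or.inr ⟨b2, a3 _ hle⟩⟩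
  · obtain ⟨a1, a2, a3⟩ := key A A' hA hA'
    refine ⟨_, a1, Or.inl ⟨a2, ?_⟩⟩
    have := mul_nonneg (sub_nonneg.2 a1.2) hB.le
    have := mul_nonneg a1.1.le (not_lt.1 hB')
    linarith
  · obtain ⟨a1, a2, a3⟩ := key B B' hB hB'
    refine ⟨_, a1, Or.inr ⟨a2, ?_⟩⟩
    have := mul_nonneg (sub_nonneg.2 a1.2) hA.le
    have := mul_nonneg a1.1.le (not_lt.1 hA')
    linarith
  · tauto

theorem convex_cr_nonneg (a b : ℂ) (m : ℝ) : Convex ℝ {z | m ≤ cr a b z} := by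
  intro x hx y hy s t hs ht hst
  have : cr a b (s • x + t • y) = s * cr a b x + t * cr a b y := by
    obtain rfl : s = 1 - t := by linarith
    simp [cr]; ring
  rw [mem_ofPred_eq] at *
  rw [this]
  calc m = s * m + t * m := by rw [← add_mul, hst, one_mul]
    _ ≤ _ := add_le_add (mul_le_mul_of_nonneg_left hx hs) (mul_le_mul_of_nonneg_left hy ht)

theorem convex_cr_lt (a b : ℂ) (m : ℝ) : Convex ℝ {z | m < cr a b z} := by
  intro x hx y hy s t hs ht hst
  have : cr a b (s • x + t • y) = s * cr a b x + t * cr a b y := by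
    obtain rfl : s = 1 - t := by linarith
    simp [cr]; ring
  rw [mem_ofPred_eq] at *
  rw [this]
  rcases hs.eq_or_lt with rfl | hs
  · simp only [zero_add] at hst; subst hst; simpa using hy
  · calc m = s * m + t * m := by rw [← add_mul, hst, one_mul]
      _ < _ := add_lt_add_of_lt_of_le (mul_lt_mul_of_pos_left hx hs)
        (mul_le_mul_of_nonneg_left hy.le ht)

/-- A point beyond a line that has the curve on its other side is outside the curve. -/
theorem wnd_eq_zero_of_cr {v : ℕ → ℂ} {n : ℕ} (hn : v n = v 0) {a b z : ℂ}
    (h : ∀ i ≤ n, cr a b z < cr a b (v i)) : z ∉ loopTrace v n ∧ wnd v n z = 0 := by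
  have : ∀ i ≤ n, 0 < ((-Complex.I * (starRingEnd ℂ) (b - a)) * (v i - z)).re := by
    intro i hi
    have h1 := h i hi
    unfold cr at h1
    simp
    nlinarith
  exact ⟨notMem_loopTrace_of_halfplane this, wnd_eq_zero_of_halfplane hn this⟩

theorem wnd_rotate {v : ℕ → ℂ} {n : ℕ} (h : ∀ i, v (i + n) = v i) (k : ℕ) :
    wnd (fun i => v (i + k)) n = wnd v n := by
  funext z
  induction k with
  | zero => rfl
  | succ k ih =>
    rw [← ih, wnd_eq, wnd_eq]
    congr 1
    have h1 := Finset.sum_range_succ (fun i => ang (v (i + k)) (v (i + 1 + k)) z) n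
    have h2 := Finset.sum_range_succ' (fun i => ang (v (i + k)) (v (i + 1 + k)) z) n
    rw [h1] at h2
    have h3 : v (n + k) = v (0 + k) := by rw [add_comm n k, h, zero_add]
    have h4 : v (n + 1 + k) = v (0 + 1 + k) := by
      rw [show n + 1 + k = 1 + k + n by ring, h, zero_add]
    rw [h3, h4, add_left_inj] at h2
    rw [h2]
    refine Finset.sum_congr rfl fun i _ => ?_
    rw [show i + (k + 1) = i + 1 + k by ring, show i + 1 + (k + 1) = i + 1 + 1 + k by ring]

theorem SimpleLoop.loopTrace_rotate {v : ℕ → ℂ} {n : ℕ} (h : SimpleLoop v n) (k : ℕ) :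
    loopTrace (fun i => v (i + k)) n = loopTrace v n := by
  apply Subset.antisymm
  · intro z hz
    obtain ⟨i, hi, hz⟩ := (h.rotate k).mem_trace_iff.1 hz
    refine h.segment_subset (i + k) ?_
    rwa [show i + k + 1 = i + 1 + k by ring]
  · intro z hz
    obtain ⟨i, hi, hz⟩ := h.mem_trace_iff.1 hz
    have := (h.rotate k).segment_subset (i + (n - 1) * k)
    have e : ∀ m, v (m + (n - 1) * k + k) = v m := by
      intro m
      rw [← h.mod, show m + (n - 1) * k + k = m + n * k by
        obtain ⟨n', hn'⟩ : ∃ n', n = n' + 1 := ⟨n - 1, by have := h.pos; omega⟩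
        subst hn'; simp; ring, Nat.add_mul_mod_self_left, h.mod]
    apply this
    rwa [e, show i + (n - 1) * k + 1 = (i + 1) + (n - 1) * k by ring, e]

theorem PosLoop.rotate {v : ℕ → ℂ} {n : ℕ} (h : PosLoop v n) (k : ℕ) :
    PosLoop (fun i => v (i + k)) n where
  toSimpleLoop := h.toSimpleLoop.rotate k
  side i p hp := by
    rw [wnd_rotate h.periodic]
    have := h.side (i + k) p
    rw [show i + k + 1 = i + 1 + k by ring] at this
    exact this hp

theorem PosLoop.loopRegion_rotate {v : ℕ → ℂ} {n : ℕ} (h : PosLoop v n) (k : ℕ) :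
    loopRegion (fun i => v (i + k)) n = loopRegion v n := by
  rw [loopRegion, loopRegion, h.loopTrace_rotate, wnd_rotate h.periodic]

namespace PosLoop

variable {v : ℕ → ℂ} {n : ℕ}

/-- At a vertex of maximal norm a counterclockwise curve turns left. -/
theorem cr_pos_of_norm_le (h : PosLoop v n) (hmax : ∀ i, ‖v i‖ ≤ ‖v 0‖) :
    0 < cr (v 0) (v 1) (v (n - 1)) := by
  have h3 := h.three_le
  have hlast : v (n - 1 + 1) = v 0 := by rw [show n - 1 + 1 = n by omega, h.apply_n]
  -- Both neighbours lie strictly on the origin's side of the line through `v 0` perpendicular to `v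
  -- 0`. In particular the curve cannot go straight on there, since the inner product with `v 0`
  -- increases along the last edge and decreases along the first one.
  have ha := re_conj_mul_lt (hmax 1) (h.ne_succ 0).symm
  have hb := re_conj_mul_lt (hmax (n - 1)) (by rw [← hlast]; exact h.ne_succ (n - 1))
  by_contra! hle
  rcases hle.eq_or_lt with h0 | hneg
  · have hst := h.straight (n - 1) (by
      rw [hlast, show n - 1 + 2 = 1 + n by omega, h.periodic, ← h0]
      exact (cr_rotate _ _ _))
    obtain ⟨k, hk, hkb⟩ := hst
    rw [hlast, show n - 1 + 2 = 1 + n by omega, h.periodic] at hkb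
    have h1 := congrArg Complex.re hkb
    have h2 := congrArg Complex.im hkb
    simp at h1 h2
    have h4 : (v 0).re * ((v 1).re - (v 0).re) + (v 0).im * ((v 1).im - (v 0).im) =
      k * ((v 0).re * ((v 0).re - (v (n - 1)).re) + (v 0).im * ((v 0).im - (v (n - 1)).im)) := by
      rw [h1, h2]; ring
    have h5 : 0 < k * ((v 0).re * ((v 0).re - (v (n - 1)).re) +
      (v 0).im * ((v 0).im - (v (n - 1)).im)) := mul_pos hk (by linarith)
    linarith
  · obtain ⟨r, hr, -, hball⟩ := exists_ball_avoiding (fun i : Fin n => v i)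
      (fun i : Fin n => v (i + 1)) {h.idx (n - 1), h.idx 0} (p := v 0) isOpen_univ
      (mem_univ _) (by
        intro g hg hmem
        apply hg
        have : (AffineMap.lineMap (v 0) (v (0 + 1)) (0 : ℝ) : ℂ)
            ∈ segment ℝ (v g) (v (g + 1)) := by simpa using hmem
        have hg2 := g.2
        rcases h.mem_segment (by simp) this with h1 | h1
        · right
          rw [mem_singleton_iff]
          apply Fin.ext
          simp [SimpleLoop.idx, h1, Nat.mod_eq_of_lt g.2]
        · left
          apply Fin.ext
          have h2 : n ∣ g + 1 := Nat.dvd_of_mod_eq_zero (by simpa using h1.1.symm)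
          have h4 := Nat.le_of_dvd (by omega) h2
          simp only [SimpleLoop.idx]
          rw [Nat.mod_eq_of_lt (by omega)]
          omega)
    have hin : ∀ z ∈ Metric.ball (v 0) r, z ∈ loopTrace v n →
        z ∈ segment ℝ (v (n - 1)) (v 0) ∨ z ∈ segment ℝ (v 0) (v 1) := by
      intro z hz hzΓ
      obtain ⟨g, hg⟩ := mem_iUnion.1 hzΓ
      rcases hball z hz g hg with rfl | hg'
      · left
        have e : (n - 1) % n = n - 1 := Nat.mod_eq_of_lt (by omega)
        simpa [SimpleLoop.idx, e, hlast] using hg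
      · right
        rw [mem_singleton_iff] at hg'
        subst hg'
        simpa [SimpleLoop.idx] using hg
    -- a point outside the curve near the vertex
    have hv0 : v 0 ≠ 0 := by
      intro h0
      have h1 := hmax 1
      rw [h0, norm_zero, norm_le_zero_iff] at h1
      exact h.ne_succ 0 (h0.trans h1.symm)
    have ht : Tendsto (fun δ : ℝ => v 0 + (δ : ℂ) * v 0) (𝓝[>] 0) (𝓝 (v 0)) := by
      have : Continuous (fun δ : ℝ => v 0 + (δ : ℂ) * v 0) := by fun_prop
      have h2 := this.tendsto 0
      simp only [Complex.ofReal_zero, zero_mul, add_zero] at h2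
      exact h2.mono_left nhdsWithin_le_nhds
    obtain ⟨δ, hδ, hδ'⟩ := ((ht.eventually (Metric.ball_mem_nhds (v 0) hr)).and
        (self_mem_nhdsWithin (s := Ioi (0 : ℝ)))).exists
    have hδ0 : 0 < δ := hδ'
    have hout : wnd v n (v 0 + δ * v 0) = 0 := by
      refine wnd_eq_zero_of_halfplane h.apply_n
        (u := -(starRingEnd ℂ) (v 0 + δ * v 0)) fun i _ => halfplane_of_norm_lt ?_
      rw [show v 0 + δ * v 0 = ((1 + δ : ℝ) : ℂ) * v 0 by push_cast; ring, norm_mul,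
        Complex.norm_real, Real.norm_eq_abs, abs_of_pos (by linarith)]
      nlinarith [hmax i, norm_pos_iff.2 hv0]
    -- the half discs to the left of the two edges at the vertex
    have half : ∀ a b : ℂ, ∀ i : ℕ, v i = a → v (i + 1) = b → (v 0 = a ∨ v 0 = b) →
        (∀ z ∈ segment ℝ (v (n - 1)) (v 0), cr a b z ≤ 0) →
        (∀ z ∈ segment ℝ (v 0) (v 1), cr a b z ≤ 0) → ¬ 0 < cr a b (v 0 + δ * v 0) := by
      intro a b i hia hib hv h1 h2 hc
      have hside := h.side i
      rw [hia, hib] at hside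
      have hab : a ≠ b := by rw [← hia, ← hib]; exact h.ne_succ i
      obtain ⟨p, hp, hpr⟩ : ∃ p ∈ openSegment ℝ a b, p ∈ Metric.ball (v 0) r := by
        rcases hv with hv | hv
        · rw [hv]; exact exists_openSegment_mem_ball_left a b hr
        · rw [hv]; exact exists_openSegment_mem_ball_right a b hr
      obtain ⟨z, hz, hz1, hz2⟩ := ((frequently_cr_pos hab hp one_ne_zero).and_eventually
        ((hside p hp).and (show ∀ᶠ z in 𝓝 p, z ∈ Metric.ball (v 0) r from
          Metric.isOpen_ball.mem_nhds hpr))).exists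
      rw [one_mul] at hz
      have : wnd v n z = wnd v n (v 0 + δ * v 0) := by
        refine (wnd_locConst h.apply_n).eq (S := Metric.ball (v 0) r ∩ {z | 0 < 1 * cr a b z})
          ((convex_ball _ _).inter (convex_cr_pos a b 1)).isPreconnected ?_ ⟨hz2, by simpa using hz⟩
          ⟨hδ, by simpa using hc⟩
        rintro w ⟨hw1, hw2⟩ hwΓ
        rw [mem_ofPred_eq, one_mul] at hw2
        rcases hin w hw1 hwΓ with hw | hw
        · linarith [h1 w hw]
        · linarith [h2 w hw]
      rw [hout, hz1.1 hz] at this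
      exact one_ne_zero this
    -- At a right turn both open half-discs on the left of the two edges miss the curve and have
    -- winding number 1, so the outer point is on the left of neither edge.
    have c1 := half (v 0) (v 1) 0 rfl rfl (Or.inl rfl) (by
      intro z hz
      obtain ⟨t, ht, rfl⟩ := mem_segment_iff_lineMap.1 hz
      rw [cr_lineMap, cr_self_left]
      nlinarith [ht.2]) (fun z hz => (cr_eq_zero_of_mem_segment hz).le)
    have c2 := half (v (n - 1)) (v 0) (n - 1) rfl hlast (Or.inr rfl)
      (fun z hz => (cr_eq_zero_of_mem_segment hz).le) (by
      intro z hz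
      obtain ⟨t, ht, rfl⟩ := mem_segment_iff_lineMap.1 hz
      rw [cr_lineMap, cr_self_right, cr_rotate]
      nlinarith [ht.1])
    have e1 : cr (v 0) (v 1) (v 0 + δ * v 0) =
        δ * (((v 1).re - (v 0).re) * (v 0).im - ((v 1).im - (v 0).im) * (v 0).re) := by
      unfold cr; simp; ring
    have e2 : cr (v (n - 1)) (v 0) (v 0 + δ * v 0) = δ * (((v 0).re - (v (n - 1)).re) * (v 0).im -
        ((v 0).im - (v (n - 1)).im) * (v 0).re) := by
      unfold cr; simp; ring
    rw [e1] at c1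
    rw [e2] at c2
    have c1' := le_of_not_gt fun hh => c1 (mul_pos hδ0 hh)
    have c2' := le_of_not_gt fun hh => c2 (mul_pos hδ0 hh)
    have hn0 : 0 < (v 0).re * (v 0).re + (v 0).im * (v 0).im := by
      have := Complex.normSq_pos.2 hv0
      rwa [Complex.normSq_apply] at this
    unfold cr at hneg
    -- For the edge vectors p = v 1 - v 0 and q = v 0 - v (n - 1) and for w = v 0 there is the
    -- identity (p × w)(q · w) - (q × w)(p · w) = (p × q)|w|². The left side is nonpositive, while p
    -- × q > 0 at a right turn.
    have h6 := mul_nonneg_of_nonpos_of_nonpos c1'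
      (show -((v 0).re * ((v 0).re - (v (n - 1)).re) +
        (v 0).im * ((v 0).im - (v (n - 1)).im)) ≤ 0 by linarith)
    have h7 := mul_nonneg_of_nonpos_of_nonpos c2'
      (show ((v 0).re * ((v 1).re - (v 0).re) +
        (v 0).im * ((v 1).im - (v 0).im)) ≤ 0 by linarith)
    have h8 := mul_pos_of_neg_of_neg hneg (neg_lt_zero.2 hn0)
    nlinarith

/-- An edge cannot enter the triangle cut off by two consecutive edges beyond its vertices. -/
theorem notMem_of_corner (h : PosLoop v n) (hn : 4 ≤ n)
    (hD : 0 < cr (v 0) (v 1) (v (n - 1))) {z : ℂ} (hα : 0 ≤ cr (v 1) (v (n - 1)) z)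
    (ha : 0 < cr (v (n - 1)) (v 0) z) (hb : 0 < cr (v 0) (v 1) z)
    (hW : ∀ k, 2 ≤ k → k ≤ n - 2 → 0 ≤ cr (v 1) (v (n - 1)) (v k) →
      0 ≤ cr (v (n - 1)) (v 0) (v k) → 0 ≤ cr (v 0) (v 1) (v k) →
      cr (v 1) (v (n - 1)) (v k) < cr (v 1) (v (n - 1)) z) : z ∉ loopTrace v n := by
  intro hz
  have hlast : v (n - 1 + 1) = v 0 := by rw [show n - 1 + 1 = n by omega, h.apply_n]
  obtain ⟨i, hi, hz⟩ := h.mem_trace_iff.1 hz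
  have hi0 : i ≠ 0 := by
    rintro rfl
    rw [cr_eq_zero_of_mem_segment hz] at hb
    exact lt_irrefl _ hb
  have hin : i ≠ n - 1 := by
    rintro rfl
    rw [hlast] at hz
    rw [cr_eq_zero_of_mem_segment hz] at ha
    exact lt_irrefl _ ha
  obtain ⟨t, ht, hzt⟩ := mem_segment_iff_lineMap.1 hz
  -- no exit through the endpoint `v m`
  have exit : ∀ (m : ℕ) (u : ℝ → ℝ), 2 ≤ m → m ≤ n - 2 → (∀ s ∈ Ioc (0 : ℝ) 1,
      (u s ∈ Ico (0 : ℝ) 1 ∨ s = 1) ∧ (u s = 0 → i = 1 → s = 1) ∧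
      (AffineMap.lineMap z (v m) s : ℂ) = AffineMap.lineMap (v i) (v (i + 1)) (u s)) →
      cr (v 1) (v (n - 1)) z ≤ cr (v 1) (v (n - 1)) (v m) → False := by
    intro m u hm2 hmn hu hge
    -- The end `v m` is at least as far beyond the line through `v 1` and `v (n - 1)` as z is, so by
    -- `hW` it is outside the triangle. On the way to it the edge must cross one of the two sides at
    -- `v 0`, against simplicity.
    have hneg : cr (v (n - 1)) (v 0) (v m) < 0 ∨ cr (v 0) (v 1) (v m) < 0 := by
      by_contra! hc
      linarith [hW m hm2 hmn (by linarith) hc.1 hc.2]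
    obtain ⟨s, hs, hs'⟩ := exists_first_zero ha hb hneg
    rw [← cr_lineMap, ← cr_lineMap] at hs'
    have hα' : 0 ≤ cr (v 1) (v (n - 1)) (AffineMap.lineMap z (v m) s) := by
      rw [cr_lineMap]; nlinarith [hs.1, hs.2]
    have hD1 : 0 < cr (v (n - 1)) (v 0) (v 1) := by rw [cr_rotate]; exact hD
    have hmem : AffineMap.lineMap z (v m) s ∈ segment ℝ (v (n - 1)) (v 0) ∨
        AffineMap.lineMap z (v m) s ∈ segment ℝ (v 0) (v 1) := by
      rcases hs' with ⟨h1, h2⟩ | ⟨h1, h2⟩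
      · exact Or.inl (mem_segment_of_cr hD1 h1 h2 hα')
      · exact Or.inr (mem_segment_of_cr hD h1 hα' h2)
    obtain ⟨hus, hu1, hueq⟩ := hu s hs
    have hs1 : s = 1 → False := by
      rintro rfl
      rw [AffineMap.lineMap_apply_one] at hmem
      have e : v m = (AffineMap.lineMap (v m) (v (m + 1)) (0 : ℝ) : ℂ) := by simp
      rw [e] at hmem
      rw [← hlast] at hmem
      rcases hmem with hmem | hmem
      · rcases h.mem_segment (by simp) hmem with h1 | h1
        · rw [Nat.mod_eq_of_lt (by omega), Nat.mod_eq_of_lt (by omega)] at h1; omega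
        · rw [Nat.mod_eq_of_lt (by omega), show n - 1 + 1 = n by omega, Nat.mod_self] at h1; omega
      · rw [hlast] at hmem
        rcases h.mem_segment (j := 0) (by simp) hmem with h1 | h1
        · rw [Nat.mod_eq_of_lt (by omega), Nat.zero_mod] at h1; omega
        · rw [Nat.mod_eq_of_lt (by omega), Nat.mod_eq_of_lt (by omega)] at h1; omega
    rcases hus with hus | hus
    · rw [hueq, ← hlast] at hmem
      rcases hmem with hmem | hmem
      · rcases h.mem_segment hus hmem with h1 | h1
        · rw [Nat.mod_eq_of_lt (by omega), Nat.mod_eq_of_lt (by omega)] at h1; omega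
        · rw [Nat.mod_eq_of_lt (by omega), show n - 1 + 1 = n by omega, Nat.mod_self] at h1; omega
      · rw [hlast] at hmem
        rcases h.mem_segment (j := 0) hus hmem with h1 | h1
        · rw [Nat.mod_eq_of_lt (by omega), Nat.zero_mod] at h1; omega
        · rw [Nat.mod_eq_of_lt (by omega), Nat.mod_eq_of_lt (by omega)] at h1
          exact hs1 (hu1 h1.2 (by omega))
    · exact hs1 hus
  -- The distance to the line through `v 1` and `v (n - 1)` is affine along the edge, so it does not
  -- decrease from z towards one of the two ends. The map s ↦ t + s (1 - t) is the parameter on the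
  -- edge of the point that moves from z to `v (i + 1)`.
  have right : cr (v 1) (v (n - 1)) z ≤ cr (v 1) (v (n - 1)) (v (i + 1)) → i + 1 ≠ n - 1 →
      False := by
    intro hge hne
    refine exit (i + 1) (fun s => t + s * (1 - t)) (by omega) (by omega) ?_ hge
    intro s hs
    refine ⟨?_, ?_, ?_⟩
    · rcases hs.2.lt_or_eq with h1 | h1
      · rcases ht.2.lt_or_eq with h2 | h2
        · exact Or.inl ⟨by nlinarith [hs.1, ht.1], by nlinarith⟩
        · exfalso
          rw [h2, AffineMap.lineMap_apply_one] at hzt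
          rw [← hzt] at hα ha hb hW
          exact lt_irrefl _ (hW (i + 1) (by omega) (by omega) hα ha.le hb.le)
      · exact Or.inr h1
    · intro h0 _
      nlinarith [hs.1, hs.2, ht.1, ht.2]
    · rw [← hzt]
      apply Complex.ext <;> simp only [lineMap_re, lineMap_im] <;> ring
  have left : cr (v 1) (v (n - 1)) z ≤ cr (v 1) (v (n - 1)) (v i) → i ≠ 1 → False := by
    intro hge hne
    refine exit i (fun s => (1 - s) * t) (by omega) (by omega) ?_ hge
    intro s hs
    refine ⟨Or.inl ⟨by nlinarith [hs.1, hs.2, ht.1], by nlinarith [hs.1, hs.2, ht.1, ht.2]⟩,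
      fun _ h1 => absurd h1 hne, ?_⟩
    rw [← hzt]
    apply Complex.ext <;> simp only [lineMap_re, lineMap_im] <;> ring
  have hval : cr (v 1) (v (n - 1)) z =
      (1 - t) * cr (v 1) (v (n - 1)) (v i) + t * cr (v 1) (v (n - 1)) (v (i + 1)) := by
    rw [← hzt, cr_lineMap]
  by_cases h1 : i = 1
  · subst h1
    rw [cr_self_left] at hval
    have ht0 : 0 < t := by
      rcases ht.1.eq_or_lt with h0 | h0
      · exfalso
        rw [← h0, AffineMap.lineMap_apply_zero] at hzt
        rw [← hzt, cr_self_right] at hb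
        exact lt_irrefl _ hb
      · exact h0
    refine right ?_ (by omega)
    rw [hval]
    have : 0 ≤ cr (v 1) (v (n - 1)) (v (1 + 1)) := by
      by_contra! hc; nlinarith
    nlinarith [ht.2]
  · by_cases h2 : i + 1 = n - 1
    · rw [h2, cr_self_right] at hval
      have ht1 : t < 1 := by
        rcases ht.2.lt_or_eq with h0 | h0
        · exact h0
        · exfalso
          rw [h0, AffineMap.lineMap_apply_one, h2] at hzt
          rw [← hzt, cr_self_left] at ha
          exact lt_irrefl _ ha
      refine left ?_ h1
      rw [hval]
      have : 0 ≤ cr (v 1) (v (n - 1)) (v i) := by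
        by_contra! hc; nlinarith
      nlinarith [ht.1]
    · rcases le_total (cr (v 1) (v (n - 1)) (v i)) (cr (v 1) (v (n - 1)) (v (i + 1))) with hc | hc
      · refine right ?_ h2
        rw [hval]; nlinarith [ht.1, ht.2]
      · refine left ?_ h1
        rw [hval]; nlinarith [ht.1, ht.2]

/-- Every simple closed polygonal curve with at least four vertices has an inner diagonal. -/
theorem exists_diagonal (h : PosLoop v n) (hn : 4 ≤ n) :
    ∃ s j, 2 ≤ j ∧ j ≤ n - 2 ∧ ∀ z ∈ openSegment ℝ (v s) (v (j + s)),
      z ∉ loopTrace v n ∧ wnd v n z = 1 := by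
  -- A vertex farthest from the origin is a convex corner. It is moved to the index 0.
  obtain ⟨s, hs, hmax⟩ := Finset.exists_max_image (Finset.range n) (fun i => ‖v i‖)
    ⟨0, by have := h.pos; simpa⟩
  have hmax' : ∀ i, ‖v (i + s)‖ ≤ ‖v (0 + s)‖ := by
    intro i
    rw [← h.mod (i + s), zero_add]
    exact hmax _ (Finset.mem_range.2 (Nat.mod_lt _ h.pos))
  suffices H : ∀ w : ℕ → ℂ, PosLoop w n → (∀ i, ‖w i‖ ≤ ‖w 0‖) → ∃ s j, 2 ≤ j ∧ j ≤ n - 2 ∧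
      ∀ z ∈ openSegment ℝ (w s) (w (j + s)), z ∉ loopTrace w n ∧ wnd w n z = 1 by
    obtain ⟨s', j, h1, h2, h3⟩ := H _ (h.rotate s) hmax'
    refine ⟨s' + s, j, h1, h2, ?_⟩
    rw [h.loopTrace_rotate, wnd_rotate h.periodic] at h3
    simpa [add_assoc] using h3
  clear hmax' hmax hs s h
  intro v h hmax
  have hD := h.cr_pos_of_norm_le hmax
  have hlast : v (n - 1 + 1) = v 0 := by rw [show n - 1 + 1 = n by omega, h.apply_n]
  set W : Finset ℕ := (Finset.Icc 2 (n - 2)).filter fun k => 0 ≤ cr (v 1) (v (n - 1)) (v k) ∧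
      0 ≤ cr (v (n - 1)) (v 0) (v k) ∧ 0 ≤ cr (v 0) (v 1) (v k) with hWdef
  have hWmem : ∀ k, k ∈ W ↔ (2 ≤ k ∧ k ≤ n - 2) ∧ 0 ≤ cr (v 1) (v (n - 1)) (v k) ∧
      0 ≤ cr (v (n - 1)) (v 0) (v k) ∧ 0 ≤ cr (v 0) (v 1) (v k) := by
    intro k; rw [hWdef, Finset.mem_filter, Finset.mem_Icc]
  -- K is the part of the triangle at `v 0` strictly farther from the line through `v 1` and `v (n -
  -- 1)` than every vertex in W. It is convex and free of the curve by `notMem_of_corner`.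
  set K : Set ℂ := (({z | 0 ≤ cr (v 1) (v (n - 1)) z} ∩ {z | 0 < cr (v (n - 1)) (v 0) z}) ∩
    {z | 0 < cr (v 0) (v 1) z}) ∩ ⋂ k ∈ W, {z | cr (v 1) (v (n - 1)) (v k) < cr (v 1) (v (n - 1)) z}
    with hK
  have hKconv : Convex ℝ K := by
    refine (((convex_cr_nonneg _ _ 0).inter (convex_cr_lt _ _ 0)).inter
      (convex_cr_lt _ _ 0)).inter (convex_iInter₂ fun k _ => convex_cr_lt _ _ _)
  have hKΓ : K ⊆ (loopTrace v n)ᶜ := by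
    rintro z ⟨⟨⟨h1, h2⟩, h3⟩, h4⟩
    refine h.notMem_of_corner hn hD h1 h2 h3 fun k hk1 hk2 hk3 hk4 hk5 => ?_
    exact mem_iInter₂.1 h4 k ((hWmem k).2 ⟨⟨hk1, hk2⟩, hk3, hk4, hk5⟩)
  have hpoly : ∀ z, cr (v 0) (v 1) z + cr (v 1) (v (n - 1)) z + cr (v (n - 1)) (v 0) z =
    cr (v 0) (v 1) (v (n - 1)) := fun z => cr_add_cr_add_cr _ _ _ _
  have hWpos : ∀ k ∈ W, 0 < cr (v (n - 1)) (v 0) (v k) ∧ 0 < cr (v 0) (v 1) (v k) := by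
    intro k hk
    obtain ⟨⟨h1, h2⟩, h3, h4, h5⟩ := (hWmem k).1 hk
    have e : v k = (AffineMap.lineMap (v k) (v (k + 1)) (0 : ℝ) : ℂ) := by simp
    constructor
    · refine lt_of_le_of_ne h4 fun h0 => ?_
      have hm : v k ∈ segment ℝ (v (n - 1)) (v 0) :=
        mem_segment_of_cr (by rw [cr_rotate]; exact hD) h0.symm h5 h3
      rw [e, ← hlast] at hm
      rcases h.mem_segment (by simp) hm with h1 | h1
      · rw [Nat.mod_eq_of_lt (by omega), Nat.mod_eq_of_lt (by omega)] at h1; omega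
      · rw [Nat.mod_eq_of_lt (by omega), show n - 1 + 1 = n by omega, Nat.mod_self] at h1; omega
    · refine lt_of_le_of_ne h5 fun h0 => ?_
      have hm : v k ∈ segment ℝ (v 0) (v 1) := mem_segment_of_cr hD h0.symm h3 h4
      rw [e] at hm
      rcases h.mem_segment (j := 0) (by simp) hm with h1 | h1
      · rw [Nat.mod_eq_of_lt (by omega), Nat.zero_mod] at h1; omega
      · rw [Nat.mod_eq_of_lt (by omega), Nat.mod_eq_of_lt (by omega)] at h1; omega
  have hα0 : cr (v 1) (v (n - 1)) (v 0) = cr (v 0) (v 1) (v (n - 1)) := (cr_rotate _ _ _).symm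
  -- K contains points just to the left of the edge from `v 0` to `v 1`, near `v 0`. The winding
  -- number is 1 there, hence on all of K.
  have hK1 : ∀ z ∈ K, wnd v n z = 1 := by
    have hlt : ∀ k ∈ W, cr (v 1) (v (n - 1)) (v k) < cr (v 1) (v (n - 1)) (v 0) := by
      intro k hk
      rw [hα0]
      linarith [hWpos k hk, hpoly (v k)]
    have hev : ∀ᶠ s : ℝ in 𝓝[>] 0, ∀ k ∈ W, cr (v 1) (v (n - 1)) (v k) <
        cr (v 1) (v (n - 1)) (AffineMap.lineMap (v 0) (v 1) s) := by
      rw [Filter.eventually_all_finset]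
      intro k hk
      have hc : Continuous fun s : ℝ => cr (v 1) (v (n - 1)) (AffineMap.lineMap (v 0) (v 1) s) :=
        (continuous_cr _ _).comp AffineMap.lineMap_continuous
      have := (hc.tendsto 0).mono_left (nhdsWithin_le_nhds (s := Ioi 0))
      rw [AffineMap.lineMap_apply_zero] at this
      exact this.eventually (lt_mem_nhds (hlt k hk))
    obtain ⟨s, hs1, hs2⟩ := (hev.and (Ioo_mem_nhdsGT (zero_lt_one (α := ℝ)))).exists
    have hp : (AffineMap.lineMap (v 0) (v 1) s : ℂ) ∈ openSegment ℝ (v 0) (v 1) :=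
      mem_openSegment_iff_lineMap.2 ⟨s, hs2, rfl⟩
    set p : ℂ := AffineMap.lineMap (v 0) (v 1) s with hpdef
    have hpa : 0 < cr (v 1) (v (n - 1)) p := by
      rw [hpdef, cr_lineMap, cr_self_left, hα0]; nlinarith [hs2.2]
    have hpb : 0 < cr (v (n - 1)) (v 0) p := by
      rw [hpdef, cr_lineMap, cr_self_right, cr_rotate (v (n - 1))]; nlinarith [hs2.1]
    have ev1 := (continuous_cr (v 1) (v (n - 1))).continuousAt.eventually (lt_mem_nhds hpa)
    have ev2 := (continuous_cr (v (n - 1)) (v 0)).continuousAt.eventually (lt_mem_nhds hpb)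
    have ev3 : ∀ᶠ z in 𝓝 p, ∀ k ∈ W, cr (v 1) (v (n - 1)) (v k) < cr (v 1) (v (n - 1)) z := by
      rw [Filter.eventually_all_finset]
      intro k hk
      exact (continuous_cr (v 1) (v (n - 1))).continuousAt.eventually (lt_mem_nhds (hs1 k hk))
    obtain ⟨z, hz, hz1, hz2, hz3, hz4⟩ := ((frequently_cr_pos (h.ne_succ 0) hp
      one_ne_zero).and_eventually ((h.side 0 p hp).and (ev1.and (ev2.and ev3)))).exists
    rw [one_mul] at hz
    have hzK : z ∈ K := ⟨⟨⟨hz2.le, hz3⟩, hz⟩, mem_iInter₂.2 hz4⟩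
    intro w hw
    rw [← hz1.1 hz]
    exact (wnd_locConst h.apply_n).eq hKconv.isPreconnected hKΓ hw hzK
  -- If other vertices lie in the triangle, the one farthest from the line through `v 1` and `v (n -
  -- 1)` is visible from `v 0`; otherwise `v 1` and `v (n - 1)` see each other.
  by_cases hWne : W.Nonempty
  · obtain ⟨k, hk, hkmax⟩ := Finset.exists_max_image W (fun k => cr (v 1) (v (n - 1)) (v k)) hWne
    obtain ⟨⟨h1, h2⟩, h3, h4, h5⟩ := (hWmem k).1 hk
    refine ⟨0, k, h1, h2, fun z hz => ?_⟩
    have hzK : z ∈ K := by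
      obtain ⟨t, ht, rfl⟩ := mem_openSegment_iff_lineMap.1 hz
      obtain ⟨p1, p2⟩ := hWpos k hk
      have hlt : cr (v 1) (v (n - 1)) (v k) < cr (v 0) (v 1) (v (n - 1)) := by
        linarith [hpoly (v k)]
      have hz' : cr (v 1) (v (n - 1)) (v k) <
          cr (v 1) (v (n - 1)) (AffineMap.lineMap (v 0) (v (k + 0)) t) := by
        rw [add_zero, cr_lineMap, hα0]; nlinarith [ht.1, ht.2]
      refine ⟨⟨⟨(h3.trans hz'.le), ?_⟩, ?_⟩, mem_iInter₂.2 fun k' hk' => ?_⟩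
      · rw [mem_ofPred_eq, add_zero, cr_lineMap, cr_self_right]
        nlinarith [mul_pos ht.1 p1]
      · rw [mem_ofPred_eq, add_zero, cr_lineMap, cr_self_left]
        nlinarith [mul_pos ht.1 p2]
      · exact (hkmax k' hk').trans_lt hz'
    exact ⟨hKΓ hzK, hK1 z hzK⟩
  · rw [Finset.not_nonempty_iff_eq_empty] at hWne
    refine ⟨1, n - 2, by omega, le_rfl, fun z hz => ?_⟩
    rw [show n - 2 + 1 = n - 1 by omega] at hz
    have hzK : z ∈ K := by
      obtain ⟨t, ht, rfl⟩ := mem_openSegment_iff_lineMap.1 hz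
      refine ⟨⟨⟨?_, ?_⟩, ?_⟩, ?_⟩
      · rw [mem_ofPred_eq, cr_lineMap, cr_self_left, cr_self_right]; simp
      · rw [mem_ofPred_eq, cr_lineMap, cr_self_left, cr_rotate]
        nlinarith [ht.2]
      · rw [mem_ofPred_eq, cr_lineMap, cr_self_right]
        nlinarith [ht.1]
      · rw [hWne]; simp
    exact ⟨hKΓ hzK, hK1 z hzK⟩

end PosLoop

/-! ### Cutting a simple closed polygonal curve along a diagonal -/

/-- The closed sequence `c 0, …, c j, c 0, …`. -/
def cutLoop {ι : Type*} (c : ℕ → ι) (j : ℕ) : ℕ → ι := fun i => c (i % (j + 1))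

theorem cutLoop_of_le {ι : Type*} (c : ℕ → ι) {j i : ℕ} (h : i ≤ j) : cutLoop c j i = c i := by
  rw [cutLoop, Nat.mod_eq_of_lt (by omega)]

theorem cutLoop_last {ι : Type*} (c : ℕ → ι) (j : ℕ) : cutLoop c j (j + 1) = c 0 := by
  rw [cutLoop, Nat.mod_self]

theorem cutLoop_periodic {ι : Type*} (c : ℕ → ι) (j i : ℕ) :
    cutLoop c j (i + (j + 1)) = cutLoop c j i := by
  rw [cutLoop, cutLoop, Nat.add_mod_right]

theorem ang_add_ang_swap {a b z : ℂ} (h : z ∉ segment ℝ a b) : ang a b z + ang b a z = 0 := by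
  have h1 := Complex.mem_slitPlane_iff_arg.1 (div_mem_slitPlane_of_notMem_segment h)
  rw [ang, ang, ← inv_div (b - z) (a - z), Complex.arg_inv, if_neg h1.1]; ring

theorem mem_loopTrace_cutLoop {v : ℕ → ℂ} {j : ℕ} {z : ℂ} :
    z ∈ loopTrace (cutLoop v j) (j + 1) ↔
      (∃ i < j, z ∈ segment ℝ (v i) (v (i + 1))) ∨ z ∈ segment ℝ (v j) (v 0) := by
  rw [loopTrace, mem_iUnion]
  constructor
  · rintro ⟨⟨i, hi⟩, hz⟩
    dsimp only at hz
    rcases Nat.lt_succ_iff_lt_or_eq.1 hi with h | rfl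
    · rw [cutLoop_of_le v h.le, cutLoop_of_le v h] at hz
      exact Or.inl ⟨i, h, hz⟩
    · rw [cutLoop_of_le v le_rfl, cutLoop_last] at hz
      exact Or.inr hz
  · rintro (⟨i, hi, hz⟩ | hz)
    · refine ⟨⟨i, by omega⟩, ?_⟩
      dsimp only
      rwa [cutLoop_of_le v hi.le, cutLoop_of_le v hi]
    · refine ⟨⟨j, by omega⟩, ?_⟩
      dsimp only
      rwa [cutLoop_of_le v le_rfl, cutLoop_last]

theorem wnd_cutLoop (v : ℕ → ℂ) (j : ℕ) (z : ℂ) : wnd (cutLoop v j) (j + 1) z =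
    (∑ i ∈ Finset.range j, ang (v i) (v (i + 1)) z + ang (v j) (v 0) z) / (2 * Real.pi) := by
  rw [wnd_eq, Finset.sum_range_succ, cutLoop_of_le v le_rfl, cutLoop_last]
  congr 2
  refine Finset.sum_congr rfl fun i hi => ?_
  have := Finset.mem_range.1 hi
  rw [cutLoop_of_le v (by omega), cutLoop_of_le v (by omega)]

theorem SimpleLoop.cutLoop {v : ℕ → ℂ} {n j : ℕ} (h : SimpleLoop v n) (h2 : 2 ≤ j)
    (hj : j ≤ n - 2) (hdiag : ∀ z ∈ openSegment ℝ (v 0) (v j), z ∉ loopTrace v n) :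
    SimpleLoop (cutLoop v j) (j + 1) where
  three_le := by omega
  periodic := cutLoop_periodic v j
  simple := by
    have key : ∀ i < j, ∀ s ∈ Ico (0 : ℝ) 1, ∀ t ∈ Ico (0 : ℝ) 1,
        (AffineMap.lineMap (v i) (v (i + 1)) s : ℂ) = AffineMap.lineMap (v j) (v 0) t → False := by
      intro i hi s hs t ht heq
      rcases ht.1.eq_or_lt with rfl | h0
      · have := (h.simple' (j := j) (t := 0) hs (by simp) (by simpa using heq)).1
        rw [Nat.mod_eq_of_lt (by omega), Nat.mod_eq_of_lt (by omega)] at this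
        omega
      · refine hdiag (AffineMap.lineMap (v j) (v 0) t) ?_ ?_
        · rw [openSegment_symm]; exact mem_openSegment_iff_lineMap.2 ⟨t, ⟨h0, ht.2⟩, rfl⟩
        · rw [← heq]
          exact h.segment_subset i (mem_segment_iff_lineMap.2 ⟨s, ⟨hs.1, hs.2.le⟩, rfl⟩)
    have hne : v j ≠ v 0 := by
      rw [ne_eq, h.eq_iff, Nat.mod_eq_of_lt (by omega), Nat.zero_mod]; omega
    intro i hi k hk s hs t ht heq
    rcases Nat.lt_succ_iff_lt_or_eq.1 hi with hij | rfl <;>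
    rcases Nat.lt_succ_iff_lt_or_eq.1 hk with hkj | rfl
    · rw [cutLoop_of_le v hij.le, cutLoop_of_le v hij, cutLoop_of_le v hkj.le,
        cutLoop_of_le v hkj] at heq
      exact h.simple i (by omega) k (by omega) s hs t ht heq
    · rw [cutLoop_of_le v hij.le, cutLoop_of_le v hij, cutLoop_of_le v le_rfl,
        cutLoop_last] at heq
      exact (key i hij s hs t ht heq).elim
    · rw [cutLoop_of_le v hkj.le, cutLoop_of_le v hkj, cutLoop_of_le v le_rfl,
        cutLoop_last] at heq
      exact (key k hkj t ht s hs heq.symm).elim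
    · rw [cutLoop_of_le v le_rfl, cutLoop_last] at heq
      exact ⟨rfl, AffineMap.lineMap_injective ℝ hne heq⟩

/-- The two curves into which a diagonal cuts a counterclockwise simple closed curve. -/
structure PosLoop.IsCut {v : ℕ → ℂ} {n : ℕ} (h : PosLoop v n) (j : ℕ) : Prop where
  two_le : 2 ≤ j
  le_sub : j ≤ n - 2
  diag : ∀ z ∈ openSegment ℝ (v 0) (v j), z ∉ loopTrace v n ∧ wnd v n z = 1

namespace PosLoop.IsCut

variable {v : ℕ → ℂ} {n j : ℕ} {h : PosLoop v n}

theorem four_le (hc : h.IsCut j) : 4 ≤ n := by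
  have := hc.two_le; have := hc.le_sub; omega

theorem apply_sub (hc : h.IsCut j) : v (n - j + j) = v 0 := by
  rw [show n - j + j = n by have := hc.le_sub; omega, h.apply_n]

theorem other (hc : h.IsCut j) : (h.rotate j).IsCut (n - j) where
  two_le := by have := hc.le_sub; have := hc.four_le; omega
  le_sub := by have := hc.two_le; omega
  diag := by
    rw [hc.apply_sub, zero_add, h.loopTrace_rotate, wnd_rotate h.periodic, openSegment_symm]
    exact hc.diag

theorem simple₁ (hc : h.IsCut j) : SimpleLoop (cutLoop v j) (j + 1) :=
  h.toSimpleLoop.cutLoop hc.two_le hc.le_sub fun z hz => (hc.diag z hz).1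

/-- The two pieces traverse the diagonal in opposite directions, and off the diagonal the two angles
cancel. -/
theorem wnd_add (hc : h.IsCut j) {z : ℂ} (hz : z ∉ segment ℝ (v 0) (v j)) :
    wnd v n z = wnd (cutLoop v j) (j + 1) z +
      wnd (cutLoop (fun i => v (i + j)) (n - j)) (n - j + 1) z := by
  rw [wnd_cutLoop, wnd_cutLoop, wnd_eq, ← add_div]
  congr 1
  obtain ⟨m, rfl⟩ : ∃ m, n = j + m := ⟨n - j, by have := hc.le_sub; omega⟩
  have h1 := ang_add_ang_swap hz
  rw [Finset.sum_range_add, hc.apply_sub, zero_add]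
  simp only [add_tsub_cancel_left]
  have h2 : ∑ x ∈ Finset.range m, ang (v (j + x)) (v (j + x + 1)) z =
      ∑ x ∈ Finset.range m, ang (v (x + j)) (v (x + 1 + j)) z :=
    Finset.sum_congr rfl fun i _ => by rw [show j + i + 1 = i + 1 + j by ring, add_comm j i]
  linear_combination h2 - h1

theorem trace_union (hc : h.IsCut j) {z : ℂ} :
    z ∈ loopTrace (cutLoop v j) (j + 1) ∨
      z ∈ loopTrace (cutLoop (fun i => v (i + j)) (n - j)) (n - j + 1) ↔
    z ∈ loopTrace v n ∨ z ∈ segment ℝ (v 0) (v j) := by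
  have h1 := hc.le_sub
  have h2 := hc.two_le
  rw [mem_loopTrace_cutLoop, mem_loopTrace_cutLoop, hc.apply_sub, zero_add, h.mem_trace_iff,
    segment_symm ℝ (v j)]
  constructor
  · rintro ((⟨i, hi, hz⟩ | hz) | (⟨i, hi, hz⟩ | hz))
    · exact Or.inl ⟨i, by omega, hz⟩
    · exact Or.inr hz
    · exact Or.inl ⟨i + j, by omega, by rwa [show i + j + 1 = i + 1 + j by ring]⟩
    · exact Or.inr hz
  · rintro (⟨i, hi, hz⟩ | hz)
    · rcases lt_or_ge i j with hij | hij
      · exact Or.inl (Or.inl ⟨i, hij, hz⟩)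
      · refine Or.inr (Or.inl ⟨i - j, by omega, ?_⟩)
        rwa [show i - j + j = i by omega, show i - j + 1 + j = i + 1 by omega]
    · exact Or.inl (Or.inr hz)

/-- Just to the left of the diagonal from `v 0` to `v j` the whole curve winds once. There the first
piece, which runs back along the diagonal, contributes 0 or -1, and the second one 1 or 0. The sum
is 1 only if both pieces are counterclockwise. -/
theorem posLoop_pair (hc : h.IsCut j) : PosLoop (cutLoop v j) (j + 1) ∧
    PosLoop (cutLoop (fun i => v (i + j)) (n - j)) (n - j + 1) := by
  have hne : v 0 ≠ v j := by
    have := hc.two_le; have := hc.le_sub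
    rw [ne_eq, h.eq_iff, Nat.mod_eq_of_lt (a := j) (by omega), Nat.zero_mod]; omega
  set p : ℂ := AffineMap.lineMap (v 0) (v j) (1 / 2 : ℝ) with hp
  have hpm : p ∈ openSegment ℝ (v 0) (v j) :=
    mem_openSegment_iff_lineMap.2 ⟨1 / 2, by norm_num, rfl⟩
  have ev := h.isOpen_inside.mem_nhds (hc.diag p hpm)
  have e1 : cutLoop v j j = v j := cutLoop_of_le v le_rfl
  have e2 : cutLoop v j (j + 1) = v 0 := cutLoop_last v j
  have e3 : cutLoop (fun i => v (i + j)) (n - j) (n - j) = v 0 := by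
    rw [cutLoop_of_le _ le_rfl, hc.apply_sub]
  have e4 : cutLoop (fun i => v (i + j)) (n - j) (n - j + 1) = v j := by
    rw [cutLoop_last, zero_add]
  have get : ∀ (w : ℕ → ℂ) (m i : ℕ) (x y : ℝ) (a b : ℂ), w i = a → w (i + 1) = b →
      (∀ i, ∀ p ∈ openSegment ℝ (w i) (w (i + 1)), ∀ᶠ z in 𝓝 p,
        (0 < cr (w i) (w (i + 1)) z → wnd w m z = x) ∧
        (cr (w i) (w (i + 1)) z < 0 → wnd w m z = y)) →
      p ∈ openSegment ℝ a b → ∀ᶠ z in 𝓝 p,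
        (0 < cr a b z → wnd w m z = x) ∧ (cr a b z < 0 → wnd w m z = y) := by
    rintro w m i x y a b rfl rfl hw hp
    exact hw i p hp
  have main : ∀ x1 y1 x2 y2 : ℝ,
      (∀ᶠ z in 𝓝 p, (0 < cr (v j) (v 0) z → wnd (cutLoop v j) (j + 1) z = x1) ∧
        (cr (v j) (v 0) z < 0 → wnd (cutLoop v j) (j + 1) z = y1)) →
      (∀ᶠ z in 𝓝 p, (0 < cr (v 0) (v j) z →
          wnd (cutLoop (fun i => v (i + j)) (n - j)) (n - j + 1) z = x2) ∧
        (cr (v 0) (v j) z < 0 →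
          wnd (cutLoop (fun i => v (i + j)) (n - j)) (n - j + 1) z = y2)) → 1 = y1 + x2 := by
    intro x1 y1 x2 y2 h1 h2
    obtain ⟨z, hz, hz1, hz2, hz3⟩ := ((frequently_cr_pos hne hpm one_ne_zero).and_eventually
      (h1.and (h2.and ev))).exists
    rw [one_mul] at hz
    have hzd : z ∉ segment ℝ (v 0) (v j) := fun hm => by
      rw [cr_eq_zero_of_mem_segment hm] at hz; exact lt_irrefl _ hz
    rw [← hz1.2 (by rw [cr_swap]; linarith), ← hz2.1 hz, ← hc.wnd_add hzd]
    exact hz3.2.symm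
  rcases hc.simple₁.posLoop_or with hp1 | hp1 <;>
  rcases hc.other.simple₁.posLoop_or with hp2 | hp2
  · exact ⟨hp1, hp2⟩
  · have := main _ _ _ _ (get _ _ j _ _ _ _ e1 e2 hp1.side (by rwa [openSegment_symm]))
      (get _ _ (n - j) _ _ _ _ e3 e4 hp2 hpm)
    norm_num at this
  · have := main _ _ _ _ (get _ _ j _ _ _ _ e1 e2 hp1 (by rwa [openSegment_symm]))
      (get _ _ (n - j) _ _ _ _ e3 e4 hp2.side hpm)
    norm_num at this
  · have := main _ _ _ _ (get _ _ j _ _ _ _ e1 e2 hp1 (by rwa [openSegment_symm]))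
      (get _ _ (n - j) _ _ _ _ e3 e4 hp2 hpm)
    norm_num at this

theorem region_left_subset (hc : h.IsCut j) : loopRegion (cutLoop v j) (j + 1) ⊆ loopRegion v n := by
  intro z hz
  by_cases hzΓ : z ∈ loopTrace v n
  · exact Or.inl hzΓ
  by_cases hzd : z ∈ segment ℝ (v 0) (v j)
  · rw [← insert_endpoints_openSegment] at hzd
    rcases hzd with rfl | rfl | hzd
    · exact absurd (h.segment_subset 0 (left_mem_segment ℝ _ _)) hzΓ
    · exact absurd (h.segment_subset j (left_mem_segment ℝ _ _)) hzΓ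
    · exact Or.inr (hc.diag z hzd)
  have hnot := not_or.1 (mt hc.trace_union.1 (not_or.2 ⟨hzΓ, hzd⟩))
  have h1 : wnd (cutLoop v j) (j + 1) z = 1 := by
    rcases hz with hz | hz
    · exact absurd hz hnot.1
    · exact hz.2
  have h2 := hc.wnd_add hzd
  rcases hc.posLoop_pair.2.wnd_eq_or hnot.2 with h3 | h3
  · rcases h.wnd_eq_or hzΓ with h4 | h4 <;> rw [h4, h1, h3] at h2 <;> norm_num at h2
  · exact Or.inr ⟨hzΓ, by rw [h2, h1, h3, add_zero]⟩

theorem region_subset_union (hc : h.IsCut j) : loopRegion v n ⊆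
    loopRegion (cutLoop v j) (j + 1) ∪
      loopRegion (cutLoop (fun i => v (i + j)) (n - j)) (n - j + 1) := by
  intro z hz
  by_cases ht : z ∈ loopTrace (cutLoop v j) (j + 1) ∨
      z ∈ loopTrace (cutLoop (fun i => v (i + j)) (n - j)) (n - j + 1)
  · exact ht.imp Or.inl Or.inl
  · obtain ⟨h1, h2⟩ := not_or.1 (mt hc.trace_union.2 ht)
    obtain ⟨h3, h4⟩ := not_or.1 ht
    have hw : wnd v n z = 1 := by
      rcases hz with hz | hz
      · exact absurd hz h1
      · exact hz.2
    rw [hc.wnd_add h2] at hw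
    rcases hc.posLoop_pair.1.wnd_eq_or h3 with h5 | h5
    · exact Or.inl (Or.inr ⟨h3, h5⟩)
    · exact Or.inr (Or.inr ⟨h4, by rwa [h5, zero_add] at hw⟩)

theorem mem_diag_of_mem_traces (hc : h.IsCut j) {z : ℂ}
    (h1 : z ∈ loopTrace (cutLoop v j) (j + 1))
    (h2 : z ∈ loopTrace (cutLoop (fun i => v (i + j)) (n - j)) (n - j + 1)) :
    z ∈ segment ℝ (v 0) (v j) := by
  have hj2 := hc.two_le
  have hjn := hc.le_sub
  rw [mem_loopTrace_cutLoop, segment_symm ℝ (v j)] at h1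
  rw [mem_loopTrace_cutLoop, hc.apply_sub, zero_add] at h2
  rcases h1 with ⟨i, hi, h1⟩ | h1
  · rcases h2 with ⟨k, hk, h2⟩ | h2
    · rw [show k + 1 + j = k + j + 1 by ring] at h2
      obtain ⟨s, hs, rfl⟩ := mem_segment_iff_lineMap.1 h1
      rcases hs.2.lt_or_eq with hs1 | rfl
      · rcases h.mem_segment ⟨hs.1, hs1⟩ h2 with h3 | ⟨h3, rfl⟩
        · rw [Nat.mod_eq_of_lt (by omega), Nat.mod_eq_of_lt (by omega)] at h3; omega
        · rw [Nat.mod_eq_of_lt (by omega)] at h3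
          rcases Nat.lt_or_ge (k + j + 1) n with h4 | h4
          · rw [Nat.mod_eq_of_lt h4] at h3; omega
          · rw [show k + j + 1 = n by omega, Nat.mod_self] at h3
            subst h3
            rw [AffineMap.lineMap_apply_zero]; exact left_mem_segment ℝ _ _
      · rw [AffineMap.lineMap_apply_one] at h2 ⊢
        have e : v (i + 1) = (AffineMap.lineMap (v (i + 1)) (v (i + 1 + 1)) (0 : ℝ) : ℂ) := by simp
        rw [e] at h2
        rcases h.mem_segment (by simp) h2 with h3 | ⟨h3, -⟩
        · rw [Nat.mod_eq_of_lt (by omega), Nat.mod_eq_of_lt (by omega)] at h3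
          rw [show i + 1 = j by omega]; exact right_mem_segment ℝ _ _
        · rw [Nat.mod_eq_of_lt (by omega)] at h3
          rcases Nat.lt_or_ge (k + j + 1) n with h4 | h4
          · rw [Nat.mod_eq_of_lt h4] at h3; omega
          · rw [show k + j + 1 = n by omega, Nat.mod_self] at h3; omega
    · exact h2
  · exact h1

/-- Off the diagonal the winding numbers of the pieces add up to 0 or 1, so no point is inside both.
A boundary point of one piece inside the other reduces to this case, being a limit of inner points
of its own piece. -/
theorem mem_diag_of_mem_regions (hc : h.IsCut j) {z : ℂ}
    (h1 : z ∈ loopRegion (cutLoop v j) (j + 1))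
    (h2 : z ∈ loopRegion (cutLoop (fun i => v (i + j)) (n - j)) (n - j + 1)) :
    z ∈ segment ℝ (v 0) (v j) := by
  obtain ⟨hp1, hp2⟩ := hc.posLoop_pair
  by_contra hzd
  have hdc := (isClosed_segment (v 0) (v j)).isOpen_compl.mem_nhds hzd
  have contra : ∀ w, w ∉ segment ℝ (v 0) (v j) →
      (w ∉ loopTrace (cutLoop v j) (j + 1) ∧ wnd (cutLoop v j) (j + 1) w = 1) →
      (w ∉ loopTrace (cutLoop (fun i => v (i + j)) (n - j)) (n - j + 1) ∧
        wnd (cutLoop (fun i => v (i + j)) (n - j)) (n - j + 1) w = 1) → False := by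
    intro w hw hw1 hw2
    have h3 : w ∉ loopTrace v n := fun hm =>
      (not_or.2 ⟨hw1.1, hw2.1⟩) (hc.trace_union.2 (Or.inl hm))
    have h4 := hc.wnd_add hw
    rw [hw1.2, hw2.2] at h4
    rcases h.wnd_eq_or h3 with h5 | h5 <;> rw [h5] at h4 <;> norm_num at h4
  by_cases ht1 : z ∈ loopTrace (cutLoop v j) (j + 1)
  · by_cases ht2 : z ∈ loopTrace (cutLoop (fun i => v (i + j)) (n - j)) (n - j + 1)
    · exact hzd (hc.mem_diag_of_mem_traces ht1 ht2)
    · have hz2 := h2.resolve_left ht2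
      have hfr := mem_closure_iff_frequently.1 (hp1.region_subset_closure h1)
      obtain ⟨w, hw1, hw2, hw3⟩ := (hfr.and_eventually
        (Filter.inter_mem (hp2.isOpen_inside.mem_nhds hz2) hdc)).exists
      exact contra w hw3 hw1 hw2
  · have hz1 := h1.resolve_left ht1
    have hfr := mem_closure_iff_frequently.1 (hp2.region_subset_closure h2)
    obtain ⟨w, hw1, hw2, hw3⟩ := (hfr.and_eventually
      (Filter.inter_mem (hp1.isOpen_inside.mem_nhds hz1) hdc)).exists
    exact contra w hw3 hw2 hw1

theorem region_right_subset (hc : h.IsCut j) :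
    loopRegion (cutLoop (fun i => v (i + j)) (n - j)) (n - j + 1) ⊆ loopRegion v n := by
  rw [← h.loopRegion_rotate j]
  exact hc.other.region_left_subset

end PosLoop.IsCut

/-! ### Triangulations -/

/-- The points `Q (c 0), …, Q (c (n - 1))` are in convex position, listed counterclockwise. -/
def ConvexPos {ι : Type*} (Q : ι → ℂ) (c : ℕ → ι) (n : ℕ) : Prop :=
  ∀ i j k, i < j → j < k → k < n → 0 < cr (Q (c i)) (Q (c j)) (Q (c k))

theorem ConvexPos.rotate {ι : Type*} {Q : ι → ℂ} {c : ℕ → ι} {n : ℕ} (h : ConvexPos Q c n)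
    (hp : ∀ i, c (i + n) = c i) (s : ℕ) : ConvexPos Q (fun i => c (i + s)) n := by
  induction s with
  | zero => exact h
  | succ s ih =>
    intro i j k hij hjk hkn
    simp only [show ∀ i, i + (s + 1) = i + 1 + s from fun i => by ring]
    rcases Nat.lt_or_ge (k + 1) n with hk | hk
    · exact ih (i + 1) (j + 1) (k + 1) (by omega) (by omega) hk
    · have := ih 0 (i + 1) (j + 1) (by omega) (by omega) (by omega)
      rw [show k + 1 + s = (0 + s) + n by omega, hp]
      rw [cr_rotate] at this
      exact this

section Triangulation

variable {ι : Type*} [Fintype ι]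

/-- The point with barycentric weights `l`. -/
def baryPt (V : ι → ℂ) (l : ι → ℝ) : ℂ := ∑ i, (l i : ℂ) * V i

/-- Barycentric weights carried by a triangle of `T`. -/
def IsBary (T : Set (Set ι)) (l : ι → ℝ) : Prop :=
  (∀ i, 0 ≤ l i) ∧ ∑ i, l i = 1 ∧ ∃ S ∈ T, ∀ i, l i ≠ 0 → i ∈ S

theorem baryPt_re (V : ι → ℂ) (l : ι → ℝ) : (baryPt V l).re = ∑ i, l i * (V i).re := by
  simp [baryPt]

theorem baryPt_im (V : ι → ℂ) (l : ι → ℝ) : (baryPt V l).im = ∑ i, l i * (V i).im := by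
  simp [baryPt]

theorem cr_baryPt (a b : ℂ) (V : ι → ℂ) {l : ι → ℝ} (hl : ∑ i, l i = 1) :
    cr a b (baryPt V l) = ∑ i, l i * cr a b (V i) := by
  unfold cr
  rw [baryPt_re, baryPt_im]
  have h1 : a.im = ∑ i, l i * a.im := by rw [← Finset.sum_mul, hl, one_mul]
  have h2 : a.re = ∑ i, l i * a.re := by rw [← Finset.sum_mul, hl, one_mul]
  calc (b.re - a.re) * (∑ i, l i * (V i).im - a.im) - (b.im - a.im) * (∑ i, l i * (V i).re - a.re)
      = (b.re - a.re) * (∑ i, l i * (V i).im - ∑ i, l i * a.im) -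
        (b.im - a.im) * (∑ i, l i * (V i).re - ∑ i, l i * a.re) := by rw [← h1, ← h2]
    _ = _ := by
      rw [← Finset.sum_sub_distrib, ← Finset.sum_sub_distrib, Finset.mul_sum, Finset.mul_sum,
        ← Finset.sum_sub_distrib]
      refine Finset.sum_congr rfl fun i _ => by ring

/-- Both `V` and `Q` realize the set of triangles `T` as a triangulation; `V` realizes it as a
triangulation of the region enclosed by the loop `V ∘ c`. -/
structure IsTriangulation (V Q : ι → ℂ) (c : ℕ → ι) (n : ℕ) (T : Set (Set ι)) : Prop where
  sub_range : ∀ S ∈ T, S ⊆ range c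
  injV : ∀ l m, IsBary T l → IsBary T m → baryPt V l = baryPt V m → l = m
  injQ : ∀ l m, IsBary T l → IsBary T m → baryPt Q l = baryPt Q m → l = m
  edge : ∀ i, ∃ S ∈ T, c i ∈ S ∧ c (i + 1) ∈ S
  mem_region : ∀ l, IsBary T l → baryPt V l ∈ loopRegion (V ∘ c) n
  cover : ∀ z ∈ loopRegion (V ∘ c) n, ∃ l, IsBary T l ∧ baryPt V l = z

end Triangulation

section Triangulation

variable {ι : Type*} [Fintype ι]

theorem eq_of_cr_eq {a b c z w : ℂ} (hD : 0 < cr a b c) (h1 : cr a b z = cr a b w)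
    (h2 : cr b c z = cr b c w) : z = w := by
  unfold cr at *
  have e1 : (b.re - a.re) * (z.im - w.im) - (b.im - a.im) * (z.re - w.re) = 0 := by linarith
  have e2 : (c.re - b.re) * (z.im - w.im) - (c.im - b.im) * (z.re - w.re) = 0 := by linarith
  have h3 : ((b.re - a.re) * (c.im - a.im) - (b.im - a.im) * (c.re - a.re)) * (z.re - w.re) = 0 := by
    linear_combination (c.re - b.re) * e1 - (b.re - a.re) * e2
  have h4 : ((b.re - a.re) * (c.im - a.im) - (b.im - a.im) * (c.re - a.re)) * (z.im - w.im) = 0 := by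
    linear_combination (c.im - b.im) * e1 - (b.im - a.im) * e2
  apply Complex.ext
  · linarith [(mul_eq_zero.1 h3).resolve_left hD.ne']
  · linarith [(mul_eq_zero.1 h4).resolve_left hD.ne']

theorem sum_eq_three {f : ι → ℝ} {a b c : ι} (hab : a ≠ b) (hac : a ≠ c) (hbc : b ≠ c)
    (h : ∀ i, f i ≠ 0 → i ∈ ({a, b, c} : Set ι)) : ∑ i, f i = f a + f b + f c := by
  classical
  rw [← Finset.sum_subset (Finset.subset_univ {a, b, c}) fun i _ hi => by
    by_contra h0; exact hi (by simpa using h i h0)]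
  rw [Finset.sum_insert (by simp [hab, hac]), Finset.sum_pair hbc]; ring

theorem bary_injective {V : ι → ℂ} {a b c : ι} (hD : 0 < cr (V a) (V b) (V c)) {l m : ι → ℝ}
    (hl : ∀ i, l i ≠ 0 → i ∈ ({a, b, c} : Set ι)) (hm : ∀ i, m i ≠ 0 → i ∈ ({a, b, c} : Set ι))
    (hl1 : ∑ i, l i = 1) (hm1 : ∑ i, m i = 1) (h : baryPt V l = baryPt V m) : l = m := by
  have hab : a ≠ b := by rintro rfl; simp [cr] at hD
  have hac : a ≠ c := by rintro rfl; simp [cr] at hD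
  have hbc : b ≠ c := by rintro rfl; unfold cr at hD; linarith
  have sums : ∀ f : ι → ℝ, (∀ i, f i ≠ 0 → i ∈ ({a, b, c} : Set ι)) → ∀ x y : ℂ,
      ∑ i, f i * cr x y (V i) =
        f a * cr x y (V a) + f b * cr x y (V b) + f c * cr x y (V c) := fun f hf x y =>
    sum_eq_three (f := fun i => f i * cr x y (V i)) hab hac hbc fun i hi =>
      hf i (left_ne_zero_of_mul hi)
  have c1 := cr_baryPt (V a) (V b) V hl1
  have c2 := cr_baryPt (V b) (V c) V hl1
  have d1 := cr_baryPt (V a) (V b) V hm1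
  have d2 := cr_baryPt (V b) (V c) V hm1
  rw [sums l hl, cr_self_left, cr_self_right] at c1 c2
  rw [sums m hm, cr_self_left, cr_self_right] at d1 d2
  rw [h] at c1 c2
  rw [← cr_rotate (V a) (V b) (V c)] at c2 d2
  have e1 : l c = m c := by
    have : (l c - m c) * cr (V a) (V b) (V c) = 0 := by linarith
    linarith [(mul_eq_zero.1 this).resolve_right hD.ne']
  have e2 : l a = m a := by
    have : (l a - m a) * cr (V a) (V b) (V c) = 0 := by linarith
    linarith [(mul_eq_zero.1 this).resolve_right hD.ne']
  have e3 : l b = m b := by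
    have h1 := sum_eq_three hab hac hbc hl
    have h2 := sum_eq_three hab hac hbc hm
    linarith
  funext i
  by_cases hi : i ∈ ({a, b, c} : Set ι)
  · rcases hi with rfl | rfl | rfl
    · exact e2
    · exact e3
    · exact e1
  · rw [not_not.1 (mt (hl i) hi), not_not.1 (mt (hm i) hi)]

open Classical in
/-- The barycentric weights of a point of the segment between two vertices. -/
noncomputable def edgeWeight (a b : ι) (t : ℝ) : ι → ℝ :=
  fun i => (if i = a then 1 - t else 0) + (if i = b then t else 0)

theorem isBary_edgeWeight {T : Set (Set ι)} {a b : ι} {t : ℝ} (ht : t ∈ Icc (0 : ℝ) 1)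
    (h : ∃ S ∈ T, a ∈ S ∧ b ∈ S) : IsBary T (edgeWeight a b t) := by
  refine ⟨fun i => ?_, ?_, ?_⟩
  · have h1 := ht.1
    have h2 := sub_nonneg.2 ht.2
    unfold edgeWeight
    split_ifs <;> simp [h1, ht.2]
  · classical
    simp only [edgeWeight, Finset.sum_add_distrib]
    rw [Finset.sum_ite_eq' Finset.univ a, Finset.sum_ite_eq' Finset.univ b]
    simp
  · obtain ⟨S, hS, ha, hb⟩ := h
    refine ⟨S, hS, fun i hi => ?_⟩
    by_contra hc
    apply hi
    unfold edgeWeight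
    rw [if_neg (by rintro rfl; exact hc ha), if_neg (by rintro rfl; exact hc hb), add_zero]

theorem baryPt_edgeWeight (V : ι → ℂ) (a b : ι) (t : ℝ) :
    baryPt V (edgeWeight a b t) = AffineMap.lineMap (V a) (V b) t := by
  classical
  apply Complex.ext
  · rw [baryPt_re, lineMap_re]
    simp only [edgeWeight, add_mul, Finset.sum_add_distrib, ite_mul, zero_mul]
    rw [Finset.sum_ite_eq' Finset.univ a, Finset.sum_ite_eq' Finset.univ b]
    simp only [Finset.mem_univ, if_true]
    ring
  · rw [baryPt_im, lineMap_im]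
    simp only [edgeWeight, add_mul, Finset.sum_add_distrib, ite_mul, zero_mul]
    rw [Finset.sum_ite_eq' Finset.univ a, Finset.sum_ite_eq' Finset.univ b]
    simp only [Finset.mem_univ, if_true]
    ring

/-- If the three vertices were collinear, all the edges would point in the same direction and could
not close up. If the triangle were clockwise, the points to the left of the first edge would be
separated from it by a line and have winding number 0. -/
theorem cr_pos_of_posLoop_three {v : ℕ → ℂ} (h : PosLoop v 3) : 0 < cr (v 0) (v 1) (v 2) := by
  by_contra! hle
  rcases hle.eq_or_lt with h0 | hneg
  · obtain ⟨k, hk, h1⟩ := h.straight 0 h0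
    obtain ⟨k', hk', h2⟩ := h.straight 1 (by
      rw [show v (1 + 2) = v 0 from h.apply_n, ← h0]; exact (cr_rotate _ _ _).symm)
    rw [show v (1 + 2) = v 0 from h.apply_n] at h2
    simp only [zero_add, Nat.reduceAdd] at h1 h2
    have h3 : ((1 + k + k' * k : ℝ) : ℂ) * (v 1 - v 0) = 0 := by
      push_cast
      linear_combination (-(k' : ℂ) - 1) * h1 - h2
    have h4 : ((1 + k + k' * k : ℝ) : ℂ) ≠ 0 := by
      have := mul_pos hk' hk
      exact_mod_cast (by linarith : (1 + k + k' * k) ≠ 0)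
    exact h.ne_succ 0 (sub_eq_zero.1 ((mul_eq_zero.1 h3).resolve_left h4)).symm
  · have hp : (AffineMap.lineMap (v 0) (v (0 + 1)) (1 / 2 : ℝ) : ℂ) ∈
      openSegment ℝ (v 0) (v (0 + 1)) := mem_openSegment_iff_lineMap.2 ⟨1 / 2, by norm_num, rfl⟩
    obtain ⟨z, hz, hz1⟩ := ((frequently_cr_pos (h.ne_succ 0) hp one_ne_zero).and_eventually
      (h.side 0 _ hp)).exists
    rw [one_mul, zero_add] at hz
    have := wnd_eq_zero_of_cr h.apply_n (a := v 1) (b := v 0) (z := z) (fun i hi => by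
      rw [cr_swap (v 0) (v 1) z, cr_swap (v 0) (v 1) (v i)]
      have : i = 0 ∨ i = 1 ∨ i = 2 ∨ i = 3 := by omega
      rcases this with rfl | rfl | rfl | rfl
      · rw [cr_self_left]; linarith
      · rw [cr_self_right]; linarith
      · linarith
      · rw [h.apply_n, cr_self_left]; linarith)
    rw [this.2] at hz1
    exact zero_ne_one (hz1.1 hz)

theorem isTriangulation_three {V Q : ι → ℂ} {c : ℕ → ι} (h : PosLoop (V ∘ c) 3)
    (hp : ∀ i, c (i + 3) = c i) (hQ : ConvexPos Q c 3) :
    IsTriangulation V Q c 3 {({c 0, c 1, c 2} : Set ι)} := by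
  have hD : 0 < cr (V (c 0)) (V (c 1)) (V (c 2)) := cr_pos_of_posLoop_three h
  have hab : c 0 ≠ c 1 := by intro e; rw [e] at hD; simp [cr] at hD
  have hac : c 0 ≠ c 2 := by intro e; rw [e] at hD; simp [cr] at hD
  have hbc : c 1 ≠ c 2 := by intro e; rw [e] at hD; unfold cr at hD; linarith
  have hperm : ∀ z, cr (V (c 0)) (V (c 1)) z + cr (V (c 1)) (V (c 2)) z + cr (V (c 2)) (V (c 0)) z
    = cr (V (c 0)) (V (c 1)) (V (c 2)) := fun z => cr_add_cr_add_cr _ _ _ _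
  have h3 : (V ∘ c) 3 = V (c 0) := h.apply_n
  have hedges : ∀ z, z ∈ loopTrace (V ∘ c) 3 ↔ z ∈ segment ℝ (V (c 0)) (V (c 1)) ∨
      z ∈ segment ℝ (V (c 1)) (V (c 2)) ∨ z ∈ segment ℝ (V (c 2)) (V (c 0)) := by
    intro z
    rw [h.mem_trace_iff]
    constructor
    · rintro ⟨i, hi, hz⟩
      interval_cases i
      · exact Or.inl hz
      · exact Or.inr (Or.inl hz)
      · right; right; rw [← h3]; exact hz
    · rintro (hz | hz | hz)
      · exact ⟨0, by norm_num, hz⟩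
      · exact ⟨1, by norm_num, hz⟩
      · exact ⟨2, by norm_num, by rw [← h3] at hz; exact hz⟩
  refine ⟨?_, ?_, ?_, ?_, ?_, ?_⟩
  · rintro S rfl
    rintro i (rfl | rfl | rfl) <;> exact mem_range_self _
  · rintro l m ⟨-, hl1, S, rfl, hl⟩ ⟨-, hm1, S, rfl, hm⟩ heq
    exact bary_injective hD hl hm hl1 hm1 heq
  · rintro l m ⟨-, hl1, S, rfl, hl⟩ ⟨-, hm1, S, rfl, hm⟩ heq
    exact bary_injective (hQ 0 1 2 (by norm_num) (by norm_num) (by norm_num)) hl hm hl1 hm1 heq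
  · intro i
    refine ⟨_, rfl, ?_⟩
    have h4 : c i = c (i % 3) := (Function.Periodic.map_mod_nat (f := c) (a := 3) hp i).symm
    have h5 : c (i + 1) = c ((i + 1) % 3) :=
      (Function.Periodic.map_mod_nat (f := c) (a := 3) hp (i + 1)).symm
    have h6 : i % 3 = 0 ∨ i % 3 = 1 ∨ i % 3 = 2 := by omega
    rcases h6 with h6 | h6 | h6
    · rw [h4, h5, h6, show (i + 1) % 3 = 1 by omega]; simp
    · rw [h4, h5, h6, show (i + 1) % 3 = 2 by omega]; simp
    · rw [h4, h5, h6, show (i + 1) % 3 = 0 by omega]; simp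
  · rintro l ⟨hl0, hl1, S, rfl, hl⟩
    have sums : ∀ x y : ℂ, cr x y (baryPt V l) =
        l (c 0) * cr x y (V (c 0)) + l (c 1) * cr x y (V (c 1)) + l (c 2) * cr x y (V (c 2)) := by
      intro x y
      rw [cr_baryPt x y V hl1]
      exact sum_eq_three (f := fun i => l i * cr x y (V i)) hab hac hbc fun i hi =>
        hl i (left_ne_zero_of_mul hi)
    have s1 := sums (V (c 0)) (V (c 1))
    have s2 := sums (V (c 1)) (V (c 2))
    have s3 := sums (V (c 2)) (V (c 0))
    simp only [cr_self_left, cr_self_right, mul_zero, add_zero, zero_add] at s1 s2 s3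
    rw [← cr_rotate (V (c 0)) (V (c 1)) (V (c 2))] at s2
    rw [cr_rotate (V (c 2)) (V (c 0)) (V (c 1))] at s3
    set z := baryPt V l
    have n1 : 0 ≤ cr (V (c 0)) (V (c 1)) z := by rw [s1]; exact mul_nonneg (hl0 _) hD.le
    have n2 : 0 ≤ cr (V (c 1)) (V (c 2)) z := by rw [s2]; exact mul_nonneg (hl0 _) hD.le
    have n3 : 0 ≤ cr (V (c 2)) (V (c 0)) z := by rw [s3]; exact mul_nonneg (hl0 _) hD.le
    have hD1 : 0 < cr (V (c 1)) (V (c 2)) (V (c 0)) := by rwa [← cr_rotate]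
    have hD2 : 0 < cr (V (c 2)) (V (c 0)) (V (c 1)) := by rwa [← cr_rotate]
    rcases n1.eq_or_lt with e1 | e1
    · exact Or.inl ((hedges z).2 (Or.inl (mem_segment_of_cr hD e1.symm n2 n3)))
    rcases n2.eq_or_lt with e2 | e2
    · exact Or.inl ((hedges z).2 (Or.inr (Or.inl (mem_segment_of_cr hD1 e2.symm n3 n1))))
    rcases n3.eq_or_lt with e3 | e3
    · exact Or.inl ((hedges z).2 (Or.inr (Or.inr (mem_segment_of_cr hD2 e3.symm n1 n2))))
    -- The open triangle K is convex, misses the curve and contains points just to the left of the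
    -- first edge, where the winding number is 1.
    set K : Set ℂ := ({z | 0 < cr (V (c 0)) (V (c 1)) z} ∩ {z | 0 < cr (V (c 1)) (V (c 2)) z}) ∩
      {z | 0 < cr (V (c 2)) (V (c 0)) z} with hK
    have hKc : Convex ℝ K :=
      ((convex_cr_lt _ _ 0).inter (convex_cr_lt _ _ 0)).inter (convex_cr_lt _ _ 0)
    have hKΓ : K ⊆ (loopTrace (V ∘ c) 3)ᶜ := by
      rintro w ⟨⟨k1, k2⟩, k3⟩ hw
      rw [mem_ofPred_eq] at k1 k2 k3
      rcases (hedges w).1 hw with hw | hw | hw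
      · rw [cr_eq_zero_of_mem_segment hw] at k1; exact lt_irrefl _ k1
      · rw [cr_eq_zero_of_mem_segment hw] at k2; exact lt_irrefl _ k2
      · rw [cr_eq_zero_of_mem_segment hw] at k3; exact lt_irrefl _ k3
    have hzK : z ∈ K := ⟨⟨e1, e2⟩, e3⟩
    refine Or.inr ⟨hKΓ hzK, ?_⟩
    set p : ℂ := AffineMap.lineMap (V (c 0)) (V (c 1)) (1 / 2 : ℝ) with hpdef
    have hpm : p ∈ openSegment ℝ (V (c 0)) (V (c 1)) :=
      mem_openSegment_iff_lineMap.2 ⟨1 / 2, by norm_num, rfl⟩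
    have hp1 : 0 < cr (V (c 1)) (V (c 2)) p := by
      rw [hpdef, cr_lineMap, cr_self_left]; linarith
    have hp2 : 0 < cr (V (c 2)) (V (c 0)) p := by
      rw [hpdef, cr_lineMap, cr_self_right]; linarith
    have hab' : V (c 0) ≠ V (c 1) := h.ne_succ 0
    obtain ⟨w, hw, hw1, hw2, hw3⟩ := ((frequently_cr_pos hab' hpm one_ne_zero).and_eventually
      ((h.side 0 p hpm).and (((continuous_cr _ _).continuousAt.eventually (lt_mem_nhds hp1)).and
      ((continuous_cr _ _).continuousAt.eventually (lt_mem_nhds hp2))))).exists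
    rw [one_mul] at hw
    rw [← hw1.1 hw]
    exact (wnd_locConst h.apply_n).eq hKc.isPreconnected hKΓ hzK ⟨⟨hw, hw2⟩, hw3⟩
  · intro z hz
    have out : ∀ a b : ℂ, (∀ i ≤ 3, 0 ≤ cr a b ((V ∘ c) i)) → 0 ≤ cr a b z := by
      intro a b hi
      by_contra! hc
      have := wnd_eq_zero_of_cr h.apply_n (a := a) (b := b) (z := z) fun i h' =>
        hc.trans_le (hi i h')
      rcases hz with hz | hz
      · exact this.1 hz
      · exact zero_ne_one (this.2.symm.trans hz.2)
    have n1 : 0 ≤ cr (V (c 0)) (V (c 1)) z := out _ _ fun i hi => by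
      have : i = 0 ∨ i = 1 ∨ i = 2 ∨ i = 3 := by omega
      rcases this with rfl | rfl | rfl | rfl
      · exact (cr_self_left _ _).ge
      · exact (cr_self_right _ _).ge
      · exact hD.le
      · rw [h3]; exact (cr_self_left _ _).ge
    have n2 : 0 ≤ cr (V (c 1)) (V (c 2)) z := out _ _ fun i hi => by
      have : i = 0 ∨ i = 1 ∨ i = 2 ∨ i = 3 := by omega
      rcases this with rfl | rfl | rfl | rfl
      · change 0 ≤ cr (V (c 1)) (V (c 2)) (V (c 0)); rw [← cr_rotate]; exact hD.le
      · exact (cr_self_left _ _).ge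
      · exact (cr_self_right _ _).ge
      · rw [h3, ← cr_rotate]; exact hD.le
    have n3 : 0 ≤ cr (V (c 2)) (V (c 0)) z := out _ _ fun i hi => by
      have : i = 0 ∨ i = 1 ∨ i = 2 ∨ i = 3 := by omega
      rcases this with rfl | rfl | rfl | rfl
      · exact (cr_self_right _ _).ge
      · change 0 ≤ cr (V (c 2)) (V (c 0)) (V (c 1)); rw [cr_rotate]; exact hD.le
      · exact (cr_self_left _ _).ge
      · rw [h3]; exact (cr_self_right _ _).ge
    classical
    set D := cr (V (c 0)) (V (c 1)) (V (c 2)) with hDdef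
    -- Barycentric weights as ratios of signed areas.
    set l : ι → ℝ := fun i => if i = c 0 then cr (V (c 1)) (V (c 2)) z / D else
      if i = c 1 then cr (V (c 2)) (V (c 0)) z / D else
      if i = c 2 then cr (V (c 0)) (V (c 1)) z / D else 0 with hl
    have l0 : l (c 0) = cr (V (c 1)) (V (c 2)) z / D := by simp [hl]
    have l1 : l (c 1) = cr (V (c 2)) (V (c 0)) z / D := by simp [hl, hab.symm]
    have l2 : l (c 2) = cr (V (c 0)) (V (c 1)) z / D := by simp [hl, hac.symm, hbc.symm]
    have hsupp : ∀ i, l i ≠ 0 → i ∈ ({c 0, c 1, c 2} : Set ι) := by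
      intro i hi
      by_contra hc
      simp only [mem_insert_iff, mem_singleton_iff, not_or] at hc
      exact hi (by simp [hl, hc])
    have hsum : ∑ i, l i = 1 := by
      rw [sum_eq_three hab hac hbc hsupp, l0, l1, l2, ← add_div, ← add_div, div_eq_one_iff_eq hD.ne']
      linarith [hperm z]
    refine ⟨l, ⟨fun i => ?_, hsum, _, rfl, hsupp⟩, ?_⟩
    · simp only [hl]; split_ifs <;> positivity
    · have sums : ∀ x y : ℂ, cr x y (baryPt V l) =
          l (c 0) * cr x y (V (c 0)) + l (c 1) * cr x y (V (c 1)) +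
            l (c 2) * cr x y (V (c 2)) := by
        intro x y
        rw [cr_baryPt x y V hsum]
        exact sum_eq_three (f := fun i => l i * cr x y (V i)) hab hac hbc fun i hi =>
          hsupp i (left_ne_zero_of_mul hi)
      refine eq_of_cr_eq hD ?_ ?_
      · rw [sums, cr_self_left, cr_self_right, l2, ← hDdef]; field_simp; ring
      · rw [sums, cr_self_left, cr_self_right, ← cr_rotate, l0, ← hDdef]; field_simp; ring

theorem IsTriangulation.of_rotate {V Q : ι → ℂ} {c : ℕ → ι} {n s : ℕ} {T : Set (Set ι)}
    (h : PosLoop (V ∘ c) n) (hp : ∀ i, c (i + n) = c i)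
    (hT : IsTriangulation V Q (fun i => c (i + s)) n T) : IsTriangulation V Q c n T where
  sub_range S hS := (hT.sub_range S hS).trans (by rintro _ ⟨i, rfl⟩; exact mem_range_self _)
  injV := hT.injV
  injQ := hT.injQ
  edge i := by
    have e : ∀ m, c (m + (n - 1) * s + s) = c m := by
      intro m
      have hm : ∀ i, c (i % n) = c i := fun i => Function.Periodic.map_mod_nat (f := c) hp i
      rw [← hm, show m + (n - 1) * s + s = m + n * s by
        obtain ⟨n', hn'⟩ : ∃ n', n = n' + 1 := ⟨n - 1, by have := h.pos; omega⟩
        subst hn'; simp; ring, Nat.add_mul_mod_self_left, hm]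
    obtain ⟨S, hS, h1, h2⟩ := hT.edge (i + (n - 1) * s)
    refine ⟨S, hS, by rwa [e] at h1, ?_⟩
    rwa [show i + (n - 1) * s + 1 + s = (i + 1) + (n - 1) * s + s by ring, e] at h2
  mem_region l hl := by
    have := hT.mem_region l hl
    rwa [show (V ∘ fun i => c (i + s)) = fun i => (V ∘ c) (i + s) from rfl,
      h.loopRegion_rotate] at this
  cover z hz := by
    refine hT.cover z ?_
    rwa [show (V ∘ fun i => c (i + s)) = fun i => (V ∘ c) (i + s) from rfl, h.loopRegion_rotate]

/-- Weights from different pieces that represent the same point must agree. For V the point lies on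
the diagonal, where the two regions meet, and both weights are the `edgeWeight` of the diagonal. For
Q the chord separates the vertices of the pieces; the common point is on the chord, so the second
weight is carried by its ends and belongs to the first triangulation too. -/
theorem IsTriangulation.glue {V Q : ι → ℂ} {c : ℕ → ι} {n j : ℕ} {T1 T2 : Set (Set ι)}
    {h : PosLoop (V ∘ c) n} (hc : h.IsCut j) (hp : ∀ i, c (i + n) = c i)
    (hQ : ConvexPos Q c n) (hT1 : IsTriangulation V Q (cutLoop c j) (j + 1) T1)
    (hT2 : IsTriangulation V Q (cutLoop (fun i => c (i + j)) (n - j)) (n - j + 1) T2) :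
    IsTriangulation V Q c n (T1 ∪ T2) := by
  have hj2 := hc.two_le
  have hjn := hc.le_sub
  have hcn : c (n - j + j) = c 0 := by rw [show n - j + j = 0 + n by omega, hp]
  have hcut1 : V ∘ cutLoop c j = cutLoop (V ∘ c) j := rfl
  have hcut2 : V ∘ cutLoop (fun i => c (i + j)) (n - j) =
    cutLoop (fun i => (V ∘ c) (i + j)) (n - j) := rfl
  have bary_or : ∀ l, IsBary (T1 ∪ T2) l → IsBary T1 l ∨ IsBary T2 l := by
    rintro l ⟨h1, h2, S, hS | hS, h3⟩
    · exact Or.inl ⟨h1, h2, S, hS, h3⟩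
    · exact Or.inr ⟨h1, h2, S, hS, h3⟩
  have ed1 : ∃ S ∈ T1, c 0 ∈ S ∧ c j ∈ S := by
    obtain ⟨S, hS, h1, h2⟩ := hT1.edge j
    rw [cutLoop_of_le c le_rfl] at h1
    rw [cutLoop_last] at h2
    exact ⟨S, hS, h2, h1⟩
  have ed2 : ∃ S ∈ T2, c 0 ∈ S ∧ c j ∈ S := by
    obtain ⟨S, hS, h1, h2⟩ := hT2.edge (n - j)
    rw [cutLoop_of_le _ le_rfl, hcn] at h1
    rw [cutLoop_last, zero_add] at h2
    exact ⟨S, hS, h1, h2⟩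
  have crossV : ∀ l m, IsBary T1 l → IsBary T2 m → baryPt V l = baryPt V m → l = m := by
    intro l m hl hm heq
    have h1 := hT1.mem_region l hl
    have h2 := hT2.mem_region m hm
    rw [hcut1] at h1
    rw [hcut2, ← heq] at h2
    obtain ⟨t, ht, hz⟩ := mem_segment_iff_lineMap.1 (hc.mem_diag_of_mem_regions h1 h2)
    have e1 : l = edgeWeight (c 0) (c j) t := hT1.injV _ _ hl (isBary_edgeWeight ht ed1)
      (by rw [baryPt_edgeWeight]; exact hz.symm)
    have e2 : m = edgeWeight (c 0) (c j) t := hT2.injV _ _ hm (isBary_edgeWeight ht ed2)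
      (by rw [baryPt_edgeWeight, ← heq]; exact hz.symm)
    rw [e1, e2]
  have side1 : ∀ i ∈ range (cutLoop c j), cr (Q (c 0)) (Q (c j)) (Q i) ≤ 0 ∧
      (cr (Q (c 0)) (Q (c j)) (Q i) = 0 → i = c 0 ∨ i = c j) := by
    rintro _ ⟨k, rfl⟩
    have hk : k % (j + 1) < j + 1 := Nat.mod_lt _ (by omega)
    rw [cutLoop]
    rcases Nat.eq_zero_or_pos (k % (j + 1)) with h0 | h0
    · rw [h0, cr_self_left]; exact ⟨le_rfl, fun _ => Or.inl rfl⟩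
    rcases Nat.lt_succ_iff_lt_or_eq.1 hk with h1 | h1
    · have := hQ 0 (k % (j + 1)) j h0 h1 (by omega)
      have h2 : cr (Q (c 0)) (Q (c j)) (Q (c (k % (j + 1)))) < 0 := by
        rw [cr_rotate, cr_swap, ← cr_rotate]
        linarith
      exact ⟨h2.le, fun h3 => absurd h3 h2.ne⟩
    · rw [h1, cr_self_right]; exact ⟨le_rfl, fun _ => Or.inr rfl⟩
  have side2 : ∀ i ∈ range (cutLoop (fun i => c (i + j)) (n - j)),
      0 ≤ cr (Q (c 0)) (Q (c j)) (Q i) ∧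
      (cr (Q (c 0)) (Q (c j)) (Q i) = 0 → i = c 0 ∨ i = c j) := by
    rintro _ ⟨k, rfl⟩
    have hk : k % (n - j + 1) < n - j + 1 := Nat.mod_lt _ (by omega)
    rw [cutLoop]
    rcases Nat.eq_zero_or_pos (k % (n - j + 1)) with h0 | h0
    · rw [h0, zero_add, cr_self_right]; exact ⟨le_rfl, fun _ => Or.inr rfl⟩
    rcases Nat.lt_succ_iff_lt_or_eq.1 hk with h1 | h1
    · have := hQ 0 j (k % (n - j + 1) + j) (by omega) (by omega) (by omega)
      exact ⟨this.le, fun h3 => absurd h3 this.ne'⟩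
    · rw [h1, hcn, cr_self_left]; exact ⟨le_rfl, fun _ => Or.inl rfl⟩
  have crossQ : ∀ l m, IsBary T1 l → IsBary T2 m → baryPt Q l = baryPt Q m → l = m := by
    rintro l m hl hm heq
    obtain ⟨hm0, hm1, S2, hS2, hmS⟩ := hm
    have c1 := cr_baryPt (Q (c 0)) (Q (c j)) Q hl.2.1
    have c2 := cr_baryPt (Q (c 0)) (Q (c j)) Q hm1
    have key2 : ∀ i, 0 ≤ m i * cr (Q (c 0)) (Q (c j)) (Q i) := by
      intro i
      by_cases hi : m i = 0
      · rw [hi, zero_mul]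
      · exact mul_nonneg (hm0 i) (side2 i (hT2.sub_range S2 hS2 (hmS i hi))).1
    have key1 : ∑ i, l i * cr (Q (c 0)) (Q (c j)) (Q i) ≤ 0 := by
      obtain ⟨hl0, hl1, S1, hS1, hlS⟩ := hl
      refine Finset.sum_nonpos fun i _ => ?_
      by_cases hi : l i = 0
      · rw [hi, zero_mul]
      · exact mul_nonpos_of_nonneg_of_nonpos (hl0 i)
          (side1 i (hT1.sub_range S1 hS1 (hlS i hi))).1
    rw [← c1, heq, c2] at key1
    have hz : ∀ i, m i ≠ 0 → i = c 0 ∨ i = c j := by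
      intro i hi
      have h0 := (Finset.sum_eq_zero_iff_of_nonneg (fun i _ => key2 i)).1
        (le_antisymm key1 (Finset.sum_nonneg fun i _ => key2 i)) i (Finset.mem_univ i)
      exact (side2 i (hT2.sub_range S2 hS2 (hmS i hi))).2 ((mul_eq_zero.1 h0).resolve_left hi)
    refine hT1.injQ l m hl ⟨hm0, hm1, ?_⟩ heq
    obtain ⟨S, hS, h1, h2⟩ := ed1
    refine ⟨S, hS, fun i hi => ?_⟩
    rcases hz i hi with rfl | rfl
    · exact h1
    · exact h2
  refine ⟨?_, ?_, ?_, ?_, ?_, ?_⟩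
  · rintro S (hS | hS)
    · refine (hT1.sub_range S hS).trans ?_
      rintro _ ⟨i, rfl⟩; exact mem_range_self _
    · refine (hT2.sub_range S hS).trans ?_
      rintro _ ⟨i, rfl⟩; exact ⟨_, rfl⟩
  · intro l m hl hm heq
    rcases bary_or l hl with hl | hl <;> rcases bary_or m hm with hm | hm
    · exact hT1.injV l m hl hm heq
    · exact crossV l m hl hm heq
    · exact (crossV m l hm hl heq.symm).symm
    · exact hT2.injV l m hl hm heq
  · intro l m hl hm heq
    rcases bary_or l hl with hl | hl <;> rcases bary_or m hm with hm | hm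
    · exact hT1.injQ l m hl hm heq
    · exact crossQ l m hl hm heq
    · exact (crossQ m l hm hl heq.symm).symm
    · exact hT2.injQ l m hl hm heq
  · intro i
    have hm : ∀ i, c (i % n) = c i := fun i => Function.Periodic.map_mod_nat (f := c) hp i
    have hm' : c (i % n + 1) = c (i + 1) := by rw [← hm (i % n + 1), ← hm (i + 1), Nat.mod_add_mod]
    rw [← hm i, ← hm']
    have hlt := Nat.mod_lt i h.pos
    generalize i % n = i at hlt ⊢
    rcases lt_or_ge i j with hij | hij
    · obtain ⟨S, hS, h1, h2⟩ := hT1.edge i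
      rw [cutLoop_of_le c hij.le] at h1
      rw [cutLoop_of_le c hij] at h2
      exact ⟨S, Or.inl hS, h1, h2⟩
    · obtain ⟨S, hS, h1, h2⟩ := hT2.edge (i - j)
      rw [cutLoop_of_le _ (by omega), show i - j + j = i by omega] at h1
      rw [cutLoop_of_le _ (by omega), show i - j + 1 + j = i + 1 by omega] at h2
      exact ⟨S, Or.inr hS, h1, h2⟩
  · intro l hl
    rcases bary_or l hl with hl | hl
    · exact hc.region_left_subset (hT1.mem_region l hl)
    · exact hc.region_right_subset (hT2.mem_region l hl)
  · intro z hz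
    rcases hc.region_subset_union hz with hz | hz
    · obtain ⟨l, ⟨h1, h2, S, hS, h3⟩, h4⟩ := hT1.cover z hz
      exact ⟨l, ⟨h1, h2, S, Or.inl hS, h3⟩, h4⟩
    · obtain ⟨l, ⟨h1, h2, S, hS, h3⟩, h4⟩ := hT2.cover z hz
      exact ⟨l, ⟨h1, h2, S, Or.inr hS, h3⟩, h4⟩

/-- Every counterclockwise simple closed polygonal curve can be triangulated without new vertices,
in the same way as a convex polygon. -/
theorem PosLoop.exists_isTriangulation {V Q : ι → ℂ} (n : ℕ) : ∀ {c : ℕ → ι},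
    PosLoop (V ∘ c) n → (∀ i, c (i + n) = c i) → ConvexPos Q c n →
    ∃ T, IsTriangulation V Q c n T := by
  induction n using Nat.strong_induction_on with
  | _ n ih =>
    intro c h hp hQ
    have h3 := h.three_le
    rcases h3.eq_or_lt with h3 | h4
    · subst h3
      exact ⟨_, isTriangulation_three h hp hQ⟩
    -- Cut along an inner diagonal. The corresponding chord splits the points in convex position
    -- into two such families, so both pieces fall under the induction hypothesis.
    · obtain ⟨s, j, h2j, hjn, hdiag⟩ := h.exists_diagonal h4
      set c' : ℕ → ι := fun i => c (i + s) with hc'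
      have h' : PosLoop (V ∘ c') n := h.rotate s
      have hp' : ∀ i, c' (i + n) = c' i := fun i => by
        simp only [hc']; rw [show i + n + s = i + s + n by ring, hp]
      have hQ' : ConvexPos Q c' n := hQ.rotate hp s
      have hcut : h'.IsCut j := ⟨h2j, hjn, by
        rw [show V ∘ c' = fun i => (V ∘ c) (i + s) from rfl, h.loopTrace_rotate,
          wnd_rotate h.periodic]
        simpa only [zero_add] using hdiag⟩
      obtain ⟨p1, p2⟩ := hcut.posLoop_pair
      have cutQ : ∀ (d : ℕ → ι) (k : ℕ), k < n → ConvexPos Q d n →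
          ConvexPos Q (cutLoop d k) (k + 1) := by
        intro d k hk hd i j' k' h1 h2 h3
        rw [cutLoop_of_le d (by omega), cutLoop_of_le d (by omega), cutLoop_of_le d (by omega)]
        exact hd i j' k' h1 h2 (by omega)
      obtain ⟨T1, hT1⟩ := ih (j + 1) (by omega) (c := cutLoop c' j) p1 (cutLoop_periodic _ _)
        (cutQ _ _ (by omega) hQ')
      obtain ⟨T2, hT2⟩ := ih (n - j + 1) (by omega) (c := cutLoop (fun i => c' (i + j)) (n - j)) p2
        (cutLoop_periodic _ _) (cutQ _ _ (by omega) (hQ'.rotate hp' j))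
      exact ⟨T1 ∪ T2, (IsTriangulation.glue hcut hp' hQ' hT1 hT2).of_rotate h hp⟩

end Triangulation

/-! ### Orthogonal polygons as closed curves -/

theorem PosLoop.side_region {v : ℕ → ℂ} {n : ℕ} (h : PosLoop v n) (i : ℕ) {p : ℂ}
    (hp : p ∈ openSegment ℝ (v i) (v (i + 1))) : ∀ᶠ z in 𝓝 p,
      (0 < cr (v i) (v (i + 1)) z → z ∉ loopTrace v n ∧ wnd v n z = 1) ∧
      (cr (v i) (v (i + 1)) z < 0 → z ∉ loopTrace v n ∧ wnd v n z = 0) := by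
  have hp' : p ∈ openSegment ℝ (v (h.idx i)) (v (h.idx i + 1)) := by
    simpa [SimpleLoop.idx, h.mod, h.mod_succ] using hp
  obtain ⟨r, hr, -, hball⟩ := exists_ball_avoiding (fun i : Fin n => v i)
    (fun i : Fin n => v (i + 1)) {h.idx i} isOpen_univ (mem_univ _)
    (fun g hg => h.notMem_of_openSegment (h.idx i) _ hp' g hg)
  have hnot : ∀ z ∈ Metric.ball p r, cr (v i) (v (i + 1)) z ≠ 0 → z ∉ loopTrace v n := by
    intro z hz hc hm
    obtain ⟨g, hg⟩ := mem_iUnion.1 hm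
    have := hball z hz g hg
    rw [mem_singleton_iff] at this
    subst this
    apply hc
    simpa [SimpleLoop.idx, h.mod, h.mod_succ] using cr_eq_zero_of_mem_segment hg
  filter_upwards [h.side i p hp, Metric.ball_mem_nhds p hr] with z h1 h2
  exact ⟨fun h3 => ⟨hnot z h2 h3.ne', h1.1 h3⟩, fun h3 => ⟨hnot z h2 h3.ne, h1.2 h3⟩⟩

/-- The points of the plane as complex numbers. -/
noncomputable def toC : (ℝ × ℝ) ≃L[ℝ] ℂ := Complex.equivRealProdCLM.symm

@[simp] theorem toC_re (p : ℝ × ℝ) : (toC p).re = p.1 := rfl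

@[simp] theorem toC_im (p : ℝ × ℝ) : (toC p).im = p.2 := rfl

theorem toC_lineMap (p q : ℝ × ℝ) (t : ℝ) :
    toC (AffineMap.lineMap p q t) = AffineMap.lineMap (toC p) (toC q) t := by
  simp [AffineMap.lineMap_apply]

namespace Polygon

variable {n : ℕ}

/-- The vertices of a polygon as a periodic sequence of complex numbers. -/
noncomputable def loop (P : Polygon (ℝ × ℝ) n) (hn : 0 < n) : ℕ → ℂ :=
  fun i => toC (P ⟨i % n, Nat.mod_lt _ hn⟩)

theorem coe_finRotate' (i : Fin n) : (finRotate n i : ℕ) = (i + 1) % n := by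
  obtain ⟨m, rfl⟩ : ∃ m, n = m + 1 := ⟨n - 1, by have := i.2; omega⟩
  rw [finRotate_apply, Fin.val_add, Fin.val_one', Nat.add_mod_mod]

theorem loop_coe (P : Polygon (ℝ × ℝ) n) (hn : 0 < n) (i : Fin n) : P.loop hn i = toC (P i) := by
  unfold loop
  congr 2
  exact Fin.ext (Nat.mod_eq_of_lt i.2)

theorem loop_succ (P : Polygon (ℝ × ℝ) n) (hn : 0 < n) (i : Fin n) :
    P.loop hn (i + 1) = toC (P (finRotate n i)) := by
  unfold loop
  congr 2
  exact Fin.ext (coe_finRotate' i).symm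

theorem mem_edgeSet (P : Polygon (ℝ × ℝ) n) (hn : 0 < n) (i : Fin n) (p : ℝ × ℝ) :
    p ∈ P.edgeSet ℝ i ↔ toC p ∈ segment ℝ (P.loop hn i) (P.loop hn (i + 1)) := by
  rw [loop_coe, loop_succ, mem_segment_iff_lineMap, edgeSet, affineSegment, mem_image]
  simp only [← toC_lineMap, toC.injective.eq_iff]

theorem mem_boundary (P : Polygon (ℝ × ℝ) n) (hn : 0 < n) (p : ℝ × ℝ) :
    p ∈ P.boundary ℝ ↔ toC p ∈ loopTrace (P.loop hn) n := by
  rw [boundary, loopTrace, mem_iUnion, mem_iUnion]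
  exact exists_congr fun i => P.mem_edgeSet hn i p

theorem IsSimple.simpleLoop {P : Polygon (ℝ × ℝ) n} (h : P.IsSimple) (hn : 3 ≤ n) :
    SimpleLoop (P.loop (by omega)) n where
  three_le := hn
  periodic i := by simp [loop]
  simple := by
    have hn0 : 0 < n := by omega
    have hne : ∀ i : Fin n, P.loop hn0 i ≠ P.loop hn0 (i + 1) := by
      intro i
      rw [loop_coe, loop_succ]
      exact fun he => h.1 i (toC.injective he)
    -- Two sides may share only the last endpoint of one of them, and half-open edges omit that
    -- point.
    have hend : ∀ (i : Fin n) (s : ℝ), s < 1 →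
        (AffineMap.lineMap (P.loop hn0 i) (P.loop hn0 (i + 1)) s : ℂ) ≠ P.loop hn0 (i + 1) := by
      intro i s hs he
      have := AffineMap.lineMap_injective ℝ (hne i)
        (he.trans (AffineMap.lineMap_apply_one (k := ℝ) _ _).symm)
      linarith
    intro i hi j hj s hs t ht heq
    by_cases hij : i = j
    · subst hij
      exact ⟨rfl, AffineMap.lineMap_injective ℝ (hne ⟨i, hi⟩) heq⟩
    exfalso
    set z : ℂ := AffineMap.lineMap (P.loop hn0 i) (P.loop hn0 (i + 1)) s with hz
    have h1 : toC.symm z ∈ P.edgeSet ℝ ⟨i, hi⟩ := by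
      rw [P.mem_edgeSet hn0, toC.apply_symm_apply]
      exact mem_segment_iff_lineMap.2 ⟨s, ⟨hs.1, hs.2.le⟩, rfl⟩
    have h2 : toC.symm z ∈ P.edgeSet ℝ ⟨j, hj⟩ := by
      rw [P.mem_edgeSet hn0, toC.apply_symm_apply]
      exact mem_segment_iff_lineMap.2 ⟨t, ⟨ht.1, ht.2.le⟩, heq.symm⟩
    rcases h.2 ⟨i, hi⟩ ⟨j, hj⟩ (by simpa using hij) _ h1 h2 with ⟨h3, h4⟩ | ⟨h3, h4⟩
    · refine hend ⟨i, hi⟩ s hs.2 (hz.symm.trans ?_)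
      rw [loop_succ, ← h3, ← h4, toC.apply_symm_apply]
    · refine hend ⟨j, hj⟩ t ht.2 (heq.symm.trans ?_)
      rw [loop_succ, ← h3, ← h4, toC.apply_symm_apply]

theorem isBounded_toC_image {S : Set (ℝ × ℝ)} :
    Bornology.IsBounded (toC '' S) ↔ Bornology.IsBounded S := by
  constructor
  · intro h
    have := toC.symm.lipschitz.isBounded_image h
    rwa [← image_comp, show (toC.symm ∘ toC : ℝ × ℝ → ℝ × ℝ) = id by
      funext x; exact toC.symm_apply_apply x, image_id] at this
  · intro h
    exact toC.lipschitz.isBounded_image h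

theorem mem_region_iff {P : Polygon (ℝ × ℝ) n} (h : P.IsSimple) (hn : 3 ≤ n) (p : ℝ × ℝ) :
    p ∈ P.region ↔ toC p ∈ loopTrace (P.loop (by omega)) n ∨
      (toC p ∉ loopTrace (P.loop (by omega)) n ∧ wnd (P.loop (by omega)) n (toC p) ≠ 0) := by
  have hn0 : 0 < n := by omega
  have himage : toC '' (P.boundary ℝ)ᶜ = (loopTrace (P.loop hn0) n)ᶜ := by
    ext z
    constructor
    · rintro ⟨p, hp, rfl⟩ hz
      exact hp ((P.mem_boundary hn0 p).2 hz)
    · intro hz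
      refine ⟨toC.symm z, fun hm => hz ?_, toC.apply_symm_apply z⟩
      simpa using (P.mem_boundary hn0 _).1 hm
  unfold region
  rw [mem_union, P.mem_boundary hn0, mem_ofPred_eq, P.mem_boundary hn0]
  refine or_congr Iff.rfl (and_congr_right fun hp => ?_)
  rw [← (h.simpleLoop hn).isBounded_component_iff hp, ← himage, ← isBounded_toC_image]
  have := toC.toHomeomorph.image_connectedComponentIn (s := (P.boundary ℝ)ᶜ) (x := p)
    (fun hm => hp ((P.mem_boundary hn0 p).1 hm))
  rw [show (toC '' connectedComponentIn (P.boundary ℝ)ᶜ p) =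
    connectedComponentIn (toC '' (P.boundary ℝ)ᶜ) (toC p) from this]

theorem tendsto_add_smul (p w : ℝ × ℝ) :
    Tendsto (fun ε : ℝ => toC (p + ε • w)) (𝓝[>] 0) (𝓝 (toC p)) := by
  have : Continuous (fun ε : ℝ => toC (p + ε • w)) := by fun_prop
  have h2 := this.tendsto 0
  simp only [zero_smul, add_zero] at h2
  exact h2.mono_left nhdsWithin_le_nhds

theorem edgePath_mem (P : Polygon (ℝ × ℝ) n) (hn : 0 < n) (i : Fin n) {t : ℝ}
    (ht : t ∈ Ioo (0 : ℝ) 1) :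
    toC (P.edgePath ℝ i t) ∈ openSegment ℝ (P.loop hn i) (P.loop hn (i + 1)) := by
  rw [edgePath, toC_lineMap, loop_coe, loop_succ]
  exact mem_openSegment_iff_lineMap.2 ⟨t, ht, rfl⟩

/-- One point decides the orientation. If the winding number were 0 on the left, points near the
middle of a side on its left would be outside the region. -/
theorem posLoop {P : Polygon (ℝ × ℝ) n} (h : P.IsSimple) (hccw : P.IsCounterclockwise)
    (hn : 3 ≤ n) : PosLoop (P.loop (by omega)) n := by
  have hn0 : 0 < n := by omega
  have hs := h.simpleLoop hn
  rcases hs.posLoop_or with hp | hneg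
  · exact hp
  exfalso
  set i : Fin n := ⟨0, hn0⟩ with hi
  have ht : (1 / 2 : ℝ) ∈ Ioo (0 : ℝ) 1 := by norm_num
  have hmem := P.edgePath_mem hn0 i ht
  set w : ℝ × ℝ := (-((P (finRotate n i)).2 - (P i).2), (P (finRotate n i)).1 - (P i).1) with hw
  set p := P.edgePath ℝ i (1 / 2) with hp
  obtain ⟨r, hr, -, hball⟩ := exists_ball_avoiding (fun i : Fin n => P.loop hn0 i)
    (fun i : Fin n => P.loop hn0 (i + 1)) {i} isOpen_univ (mem_univ _)
    (fun g hg => hs.notMem_of_openSegment i _ hmem g hg)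
  have htd := tendsto_add_smul p w
  obtain ⟨ε, h1, h2, h3, h4⟩ := ((hccw i (1 / 2) ht).and ((htd.eventually (hneg 0 _ hmem)).and
    ((htd.eventually (Metric.ball_mem_nhds _ hr)).and
      (self_mem_nhdsWithin (s := Ioi (0 : ℝ)))))).exists
  have hε : 0 < ε := h4
  have hc : 0 < cr (P.loop hn0 0) (P.loop hn0 (0 + 1)) (toC (p + ε • w)) := by
    have e0 : P.loop hn0 0 = toC (P i) := P.loop_coe hn0 i
    have e1 : P.loop hn0 (0 + 1) = toC (P (finRotate n i)) := P.loop_succ hn0 i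
    have h0 := cr_eq_zero_of_mem_segment (openSegment_subset_segment ℝ _ _ hmem)
    have hne : (0 : ℝ) < ((P (finRotate n i)).1 - (P i).1) ^ 2 +
        ((P (finRotate n i)).2 - (P i).2) ^ 2 := by
      by_contra hc
      apply h.1 i
      apply Prod.ext <;> nlinarith [sq_nonneg ((P (finRotate n i)).1 - (P i).1),
        sq_nonneg ((P (finRotate n i)).2 - (P i).2)]
    have : cr (P.loop hn0 0) (P.loop hn0 (0 + 1)) (toC (p + ε • w)) =
        cr (P.loop hn0 0) (P.loop hn0 (0 + 1)) (toC p) +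
        ε * (((P (finRotate n i)).1 - (P i).1) ^ 2 + ((P (finRotate n i)).2 - (P i).2) ^ 2) := by
      rw [e0, e1]
      simp [cr, hw]
      ring
    rw [this]
    change cr (P.loop hn0 0) (P.loop hn0 (0 + 1)) (toC p) = 0 at h0
    rw [h0, zero_add]
    exact mul_pos hε hne
  rcases (mem_region_iff h hn _).1 h1 with h5 | h5
  · obtain ⟨g, hg⟩ := mem_iUnion.1 h5
    have := hball _ h3 g hg
    rw [mem_singleton_iff] at this
    subst this
    exact hc.ne' (cr_eq_zero_of_mem_segment hg)
  · exact h5.2 (h2.1 hc)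

end Polygon

/-- A counterclockwise simple closed curve with sides alternately horizontal and vertical, the
horizontal ones at different heights. -/
structure OrthoLoop (v : ℕ → ℂ) (b : ℕ) : Prop extends PosLoop v (2 * b) where
  horiz : ∀ u, (v (2 * u + 1)).im = (v (2 * u)).im
  vert : ∀ u, (v (2 * u + 2)).re = (v (2 * u + 1)).re
  generic : ∀ u < b, ∀ w < b, (v (2 * u)).im = (v (2 * w)).im → u = w

namespace Polygon

/-- For b = 1 the two sides are one segment traversed in both directions, and its midpoint is a
forbidden common point. -/
theorem two_le_of_isSimple {b : ℕ} {P : Polygon (ℝ × ℝ) (2 * b)} (h : P.IsSimple) (hb : b ≠ 0) :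
    2 ≤ b := by
  by_contra hc
  obtain rfl : b = 1 := by omega
  have hne := h.1 0
  have hm : P.edgePath ℝ 0 (1 / 2) ∈ P.edgeSet ℝ 0 := ⟨1 / 2, by norm_num, rfl⟩
  have hm' : P.edgePath ℝ 0 (1 / 2) ∈ P.edgeSet ℝ 1 := by
    rw [edgeSet, affineSegment_comm]
    exact ⟨1 / 2, by norm_num, rfl⟩
  have key : ∀ a c : ℝ × ℝ, a ≠ c → AffineMap.lineMap a c (1 / 2 : ℝ) ≠ a ∧
      AffineMap.lineMap a c (1 / 2 : ℝ) ≠ c := by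
    intro a c hac
    constructor
    · intro he
      have := AffineMap.lineMap_injective ℝ hac
        (he.trans (AffineMap.lineMap_apply_zero (k := ℝ) a c).symm)
      norm_num at this
    · intro he
      have := AffineMap.lineMap_injective ℝ hac
        (he.trans (AffineMap.lineMap_apply_one (k := ℝ) a c).symm)
      norm_num at this
  rcases h.2 0 1 (by decide) _ hm hm' with ⟨-, h1⟩ | ⟨-, h1⟩
  · exact (key _ _ hne).2 h1
  · exact (key _ _ hne).1 h1

variable {b : ℕ} {P : Polygon (ℝ × ℝ) (2 * b)}

theorem orthoLoop (h : P.IsSimple) (ho : P.IsOrthogonal) (hccw : P.IsCounterclockwise)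
    (hg : P.IsGeneric) (hb : 2 ≤ b) : OrthoLoop (P.loop (by omega)) b := by
  have hn : 0 < 2 * b := by omega
  have hp := posLoop h hccw (show 3 ≤ 2 * b by omega)
  have red : ∀ u, ∃ w : Fin b, P.loop hn (2 * u) = toC (P (hIndex w)) ∧
      P.loop hn (2 * u + 1) = toC (P (finRotate _ (hIndex w))) ∧
      P.loop hn (2 * u + 1) = toC (P (vIndex w)) ∧
      P.loop hn (2 * u + 2) = toC (P (finRotate _ (vIndex w))) := by
    intro u
    refine ⟨⟨u % b, Nat.mod_lt _ (by omega)⟩, ?_, ?_, ?_, ?_⟩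
    · rw [← P.loop_coe hn, ← hp.mod (2 * u), Nat.mul_mod_mul_left]; rfl
    · rw [← P.loop_succ hn, ← hp.mod_succ (2 * u), Nat.mul_mod_mul_left]; rfl
    · rw [← P.loop_coe hn, ← hp.mod_succ (2 * u), Nat.mul_mod_mul_left]; rfl
    · have e : (2 * u + 1) % (2 * b) = 2 * (u % b) + 1 := by
        rw [Nat.add_mod, Nat.mul_mod_mul_left, Nat.mod_eq_of_lt (a := 1) (by omega),
          Nat.mod_eq_of_lt]
        have := Nat.mod_lt u (show 0 < b by omega)
        omega
      rw [← P.loop_succ hn, ← hp.mod_succ (2 * u + 1), e]; rfl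
  refine ⟨hp, fun u => ?_, fun u => ?_, fun u hu w hw he => ?_⟩
  · obtain ⟨w, h1, h2, -, -⟩ := red u
    rw [h1, h2, toC_im, toC_im, (ho w).1]
  · obtain ⟨w, -, -, h1, h2⟩ := red u
    rw [h1, h2, toC_re, toC_re, (ho w).2]
  · have e : ∀ u, ∀ hu : u < b, P.loop hn (2 * u) = toC (P (hIndex ⟨u, hu⟩)) :=
      fun u hu => P.loop_coe hn (hIndex ⟨u, hu⟩)
    rw [e u hu, e w hw] at he
    have := @hg ⟨u, hu⟩ ⟨w, hw⟩ he
    simpa using this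

theorem height_eq (hb : 0 < 2 * b) (u : Fin b) : P.height u = (P.loop hb (2 * u)).im := by
  rw [height, ← toC_im, ← P.loop_coe hb]; rfl

/-- The region is to the left of each side. So it lies below a horizontal side exactly when the side
is traversed leftwards, that is, when the difference of the abscissas is positive. -/
theorem signedLength_eq (h : P.IsSimple) (ho : P.IsOrthogonal) (hccw : P.IsCounterclockwise)
    (hg : P.IsGeneric) (hb : 2 ≤ b) (u : Fin b) :
    P.signedLength u = (P.loop (by omega) (2 * u)).re - (P.loop (by omega) (2 * u + 1)).re := by
  have hn : 0 < 2 * b := by omega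
  have hp := posLoop h hccw (show 3 ≤ 2 * b by omega)
  have hl := orthoLoop h ho hccw hg hb
  have e0 : P.loop hn (2 * u) = toC (P (hIndex u)) := P.loop_coe hn (hIndex u)
  have e1 : P.loop hn (2 * u + 1) = toC (P (finRotate _ (hIndex u))) := P.loop_succ hn (hIndex u)
  have him := hl.horiz u
  have hne : (P.loop hn (2 * u)).re ≠ (P.loop hn (2 * u + 1)).re := fun he =>
    hp.ne_succ (2 * u) (Complex.ext he him.symm)
  have hcr : ∀ (p : ℝ × ℝ) (ε : ℝ),
      toC p ∈ openSegment ℝ (P.loop hn (2 * u)) (P.loop hn (2 * u + 1)) →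
      cr (P.loop hn (2 * u)) (P.loop hn (2 * u + 1)) (toC (p - (0, ε))) =
        ε * ((P.loop hn (2 * u)).re - (P.loop hn (2 * u + 1)).re) := by
    intro p ε hm
    have h0 := cr_eq_zero_of_mem_segment (openSegment_subset_segment ℝ _ _ hm)
    unfold cr at h0 ⊢
    rw [toC_re, toC_im, him] at h0 ⊢
    simp only [Prod.fst_sub, Prod.snd_sub, sub_zero]
    linear_combination h0
  have htend : ∀ p : ℝ × ℝ, Tendsto (fun ε : ℝ => toC (p - (0, ε))) (𝓝[>] 0) (𝓝 (toC p)) := by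
    intro p
    have := tendsto_add_smul p (0, -1)
    refine this.congr fun ε => ?_
    congr 1
    ext <;> simp [sub_eq_add_neg]
  rcases lt_or_gt_of_ne hne with hlt | hgt
  · have hnot : ¬ P.LiesBelow u := by
      intro hL
      have ht : (1 / 2 : ℝ) ∈ Ioo (0 : ℝ) 1 := by norm_num
      have hm := P.edgePath_mem hn (hIndex u) ht
      obtain ⟨ε, h1, h2, h3⟩ := ((hL _ ht).and (((htend _).eventually
        (hp.side_region (2 * u) hm)).and (self_mem_nhdsWithin (s := Ioi (0 : ℝ))))).exists
      have hε : 0 < ε := h3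
      have h4 := h2.2 (by
        rw [hcr _ _ hm]
        exact mul_neg_of_pos_of_neg hε (by linarith))
      rcases (mem_region_iff h (by omega) _).1 h1 with h5 | h5
      · exact h4.1 h5
      · exact h5.2 h4.2
    rw [signedLength, if_neg hnot, ← toC_re, ← toC_re, ← e0, ← e1, abs_of_pos (by linarith)]
    ring
  · have hL : P.LiesBelow u := by
      intro t ht
      have hm := P.edgePath_mem hn (hIndex u) ht
      filter_upwards [(htend _).eventually (hp.side_region (2 * u) hm),
        self_mem_nhdsWithin (s := Ioi (0 : ℝ))] with ε h2 h3
      have hε : 0 < ε := h3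
      have h4 := h2.1 (by
        rw [hcr _ _ hm]
        exact mul_pos hε (by linarith))
      exact (mem_region_iff h (by omega) _).2 (Or.inr ⟨h4.1, by rw [h4.2]; exact one_ne_zero⟩)
    rw [signedLength, if_pos hL, ← toC_re, ← toC_re, ← e0, ← e1, abs_of_neg (by linarith)]
    ring

theorem mem_region_iff_loopRegion (h : P.IsSimple) (hccw : P.IsCounterclockwise) (hb : 2 ≤ b)
    (p : ℝ × ℝ) : p ∈ P.region ↔ toC p ∈ loopRegion (P.loop (by omega)) (2 * b) := by
  have hp := posLoop h hccw (show 3 ≤ 2 * b by omega)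
  rw [mem_region_iff h (by omega), loopRegion, mem_union, mem_ofPred_eq]
  refine or_congr Iff.rfl (and_congr_right fun hm => ?_)
  rcases hp.wnd_eq_or hm with h1 | h1 <;> simp [h1]

end Polygon

/-! ### Jumps of locally constant functions -/

/-- The total change of a step function is the sum of its jumps. The values of f at the jump points
themselves are arbitrary, so only one-sided conditions are imposed. -/
theorem sub_eq_sum_jump {ι : Type*} [DecidableEq ι] (S : Finset ι) {τ xl xr : ι → ℝ} {α β : ℝ}
    (hαβ : α ≤ β) (hτ : ∀ i ∈ S, τ i ∈ Ioo α β) (hinj : InjOn τ S) {f : ℝ → ℝ}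
    (hf : ∀ x ∈ Icc α β, (∀ i ∈ S, τ i ≠ x) → ∀ᶠ y in 𝓝 x, f y = f x)
    (hl : ∀ i ∈ S, ∀ᶠ y in 𝓝 (τ i), y < τ i → f y = xl i)
    (hr : ∀ i ∈ S, ∀ᶠ y in 𝓝 (τ i), τ i < y → f y = xr i) :
    f β - f α = ∑ i ∈ S, (xr i - xl i) := by
  induction S using Finset.induction_on generalizing f xl xr with
  | empty =>
    rw [Finset.sum_empty, sub_eq_zero]
    exact (isPreconnected_Icc (a := α) (b := β)).eq_of_eventually_eq
      (fun x hx => (hf x hx (by simp)).filter_mono nhdsWithin_le_nhds)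
      (right_mem_Icc.2 hαβ) (left_mem_Icc.2 hαβ)
  | insert i S hi ih =>
    set J := xr i - xl i with hJ
    -- Subtracting the step at τ i and resetting the value there to the left one makes F locally
    -- constant at τ i; the other jumps are unchanged.
    set F : ℝ → ℝ := Function.update (fun x => f x - if τ i < x then J else 0) (τ i) (xl i) with hF
    have hii : i ∈ insert i S := Finset.mem_insert_self i S
    have hne : ∀ x, x ≠ τ i → ∀ᶠ y in 𝓝 x, F y = f y - if τ i < x then J else 0 := by
      intro x hx
      rcases lt_or_gt_of_ne hx with h | h
      · filter_upwards [eventually_lt_nhds h] with y hy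
        rw [hF, Function.update_of_ne hy.ne, if_neg hy.not_gt, if_neg h.not_gt]
      · filter_upwards [eventually_gt_nhds h] with y hy
        rw [hF, Function.update_of_ne (ne_of_gt hy), if_pos hy, if_pos h]
    have hτne : ∀ j ∈ S, τ j ≠ τ i := fun j hj he => hi (by
      rwa [← hinj (Finset.mem_insert_of_mem hj) hii he])
    have := ih (f := F) (xl := fun j => xl j - if τ i < τ j then J else 0)
      (xr := fun j => xr j - if τ i < τ j then J else 0)
      (fun j hj => hτ j (Finset.mem_insert_of_mem hj))
      (hinj.mono (by simp)) ?_ ?_ ?_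
    · have hα : F α = f α := by
        rw [(hne α (hτ i hii).1.ne).self_of_nhds, if_neg (hτ i hii).1.not_gt, sub_zero]
      have hβ : F β = f β - J := by
        rw [(hne β (hτ i hii).2.ne').self_of_nhds, if_pos (hτ i hii).2]
      rw [hα, hβ] at this
      simp only [sub_sub_sub_cancel_right] at this
      rw [Finset.sum_insert hi]
      linarith
    · intro x hx hxS
      by_cases hxi : x = τ i
      · subst hxi
        filter_upwards [hl i hii, hr i hii] with y h1 h2
        have e : F (τ i) = xl i := Function.update_self ..
        rw [e]
        rcases lt_trichotomy y (τ i) with h | h | h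
        · rw [hF, Function.update_of_ne h.ne, if_neg h.not_gt, h1 h, sub_zero]
        · rw [h, e]
        · rw [hF, Function.update_of_ne h.ne', if_pos h, h2 h, hJ]; ring
      · have h1 := hf x hx (fun j hj => by
          rcases Finset.mem_insert.1 hj with rfl | hj
          · exact fun he => hxi he.symm
          · exact hxS j hj)
        filter_upwards [h1, hne x hxi] with y h2 h3
        rw [h3, (hne x hxi).self_of_nhds, h2]
    · intro j hj
      filter_upwards [hl j (Finset.mem_insert_of_mem hj), hne _ (hτne j hj)] with y h1 h2 h3
      rw [h2, h1 h3]
    · intro j hj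
      filter_upwards [hr j (Finset.mem_insert_of_mem hj), hne _ (hτne j hj)] with y h1 h2 h3
      rw [h2, h1 h3]

/-! ### Flux of a locally constant function -/

section Flux

variable {E : Type*}

/-- The segments are nondegenerate, and none of them contains an interior point of another one. -/
structure NonCrossing (a b : E → ℂ) : Prop where
  ne : ∀ e, a e ≠ b e
  disj : ∀ e, ∀ p ∈ openSegment ℝ (a e) (b e), ∀ g ≠ e, p ∉ segment ℝ (a g) (b g)

/-- The values of `f` to the left and to the right of the segments. -/
def SideValues (a b : E → ℂ) (f : ℂ → ℝ) (fL fR : E → ℝ) : Prop :=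
  ∀ e, ∀ p ∈ openSegment ℝ (a e) (b e), ∀ᶠ z in 𝓝 p,
    (0 < cr (a e) (b e) z → f z = fL e) ∧ (cr (a e) (b e) z < 0 → f z = fR e)

theorem SideValues.comp {a b : E → ℂ} {f : ℂ → ℝ} {fL fR : E → ℝ} (h : SideValues a b f fL fR)
    (g : ℝ → ℝ) : SideValues a b (g ∘ f) (g ∘ fL) (g ∘ fR) := by
  intro e p hp
  filter_upwards [h e p hp] with z hz
  exact ⟨fun h1 => congrArg g (hz.1 h1), fun h1 => congrArg g (hz.2 h1)⟩

variable [Fintype E]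

theorem NonCrossing.exists_sideValues {a b : E → ℂ} (h : NonCrossing a b) {f : ℂ → ℝ} {U : Set ℂ}
    (hU : IsOpen U) (hf : LocConstOn f (U \ ⋃ e, segment ℝ (a e) (b e)))
    (hsub : ∀ e, openSegment ℝ (a e) (b e) ⊆ U) : ∃ fL fR, SideValues a b f fL fR := by
  have key : ∀ e, ∀ σ : ℝ, σ ≠ 0 → ∃ x : ℝ, ∀ p ∈ openSegment ℝ (a e) (b e), ∀ᶠ z in 𝓝 p,
      0 < σ * cr (a e) (b e) z → f z = x := fun e σ hσ =>
    exists_side_value hU hf (h.ne e) (hsub e) (h.disj e) hσ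
  choose fL hL using fun e => key e 1 one_ne_zero
  choose fR hR using fun e => key e (-1) (by norm_num)
  refine ⟨fL, fR, fun e p hp => ?_⟩
  filter_upwards [hL e p hp, hR e p hp] with z h1 h2
  exact ⟨fun h3 => h1 (by linarith), fun h3 => h2 (by linarith)⟩

theorem LocConstOn.comp {α β : Type*} {f : ℂ → α} {U : Set ℂ} (h : LocConstOn f U) (g : α → β) :
    LocConstOn (g ∘ f) U := fun z hz => (h z hz).mono fun _ hy => congrArg g hy

theorem exists_norm_eq_one_avoiding (T : Finset ℂ) : ∃ w : ℂ, ‖w‖ = 1 ∧ w ∉ T := by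
  have hinf : (Metric.sphere (0 : ℂ) 1).Infinite :=
    (isPreconnected_sphere (by simp [Complex.rank_real_complex]) 0 1).infinite_of_nontrivial
      ⟨1, by simp, -1, by simp, by norm_num⟩
  obtain ⟨w, hw, hT⟩ := hinf.exists_notMem_finset T
  exact ⟨w, by simpa using hw, hT⟩

theorem cr_add_polar {p ζ w : ℂ} {r t : ℝ} :
    cr p (p + w * ζ) (p + w * (r * Complex.exp (t * Complex.I))) =
      Complex.normSq w * (r * ‖ζ‖ * Real.sin (t - ζ.arg)) := by
  have h : ζ = ‖ζ‖ * Complex.exp (ζ.arg * Complex.I) := (Complex.norm_mul_exp_arg_mul_I ζ).symm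
  have h1 : ζ.re = ‖ζ‖ * Real.cos ζ.arg := (Complex.norm_mul_cos_arg ζ).symm
  have h2 : ζ.im = ‖ζ‖ * Real.sin ζ.arg := (Complex.norm_mul_sin_arg ζ).symm
  rw [Real.sin_sub]
  simp only [cr, Complex.add_re, Complex.add_im, Complex.mul_re, Complex.mul_im, Complex.ofReal_re,
    Complex.ofReal_im, Complex.exp_ofReal_mul_I_re, Complex.exp_ofReal_mul_I_im,
    Complex.normSq_apply]
  rw [h1, h2]
  ring

open Classical in
/-- The flux of a locally constant function is conserved at every point. -/
theorem NonCrossing.flux_eq_zero {a b : E → ℂ} (h : NonCrossing a b) {f : ℂ → ℝ} {U : Set ℂ}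
    (hU : IsOpen U) (hf : LocConstOn f (U \ ⋃ e, segment ℝ (a e) (b e))) {fL fR : E → ℝ}
    (hs : SideValues a b f fL fR) {p : ℂ} (hp : p ∈ U) :
    ∑ e, ((if a e = p then fL e - fR e else 0) - (if b e = p then fL e - fR e else 0)) = 0 := by
  by_cases hopen : ∃ e, p ∈ openSegment ℝ (a e) (b e)
  · obtain ⟨e, he⟩ := hopen
    apply Finset.sum_eq_zero
    intro g _
    have : a g ≠ p ∧ b g ≠ p := by
      by_cases hg : g = e
      · subst hg
        constructor
        · rintro rfl
          exact h.ne g (left_mem_openSegment_iff.1 he)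
        · rintro rfl
          exact h.ne g (right_mem_openSegment_iff.1 he)
      · constructor
        · rintro rfl
          exact h.disj e _ he g hg (left_mem_segment ℝ _ _)
        · rintro rfl
          exact h.disj e _ he g hg (right_mem_segment ℝ _ _)
    rw [if_neg this.1, if_neg this.2, sub_zero]
  push Not at hopen
  -- T consists of the segments that end at p, and q e is the other end of e.
  set T : Finset E := Finset.univ.filter fun e => p ∈ segment ℝ (a e) (b e) with hT
  have hmemT : ∀ e, e ∈ T ↔ p ∈ segment ℝ (a e) (b e) := fun e => by simp [hT]
  have hend : ∀ e ∈ T, a e = p ∨ b e = p := by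
    intro e he
    by_contra hc
    push Not at hc
    exact hopen e (mem_openSegment_of_ne_left_right hc.1 hc.2 ((hmemT e).1 he))
  set q : E → ℂ := fun e => if a e = p then b e else a e with hq
  have hqa : ∀ e, a e = p → q e = b e := fun e he => by simp [hq, he]
  have hqb : ∀ e, b e = p → q e = a e := fun e he => by
    have : a e ≠ p := fun h2 => h.ne e (h2.trans he.symm)
    simp [hq, this]
  have hqp : ∀ e ∈ T, q e ≠ p := by
    intro e he
    rcases hend e he with h1 | h1
    · rw [hqa e h1, ← h1]; exact (h.ne e).symm
    · rw [hqb e h1, ← h1]; exact h.ne e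
  have hseg : ∀ e ∈ T, segment ℝ (a e) (b e) = segment ℝ p (q e) := by
    intro e he
    rcases hend e he with h1 | h1
    · rw [hqa e h1, ← h1]
    · rw [hqb e h1, ← h1, segment_symm]
  have hoseg : ∀ e ∈ T, openSegment ℝ (a e) (b e) = openSegment ℝ p (q e) := by
    intro e he
    rcases hend e he with h1 | h1
    · rw [hqa e h1, ← h1]
    · rw [hqb e h1, ← h1, openSegment_symm]
  obtain ⟨r0, hr0, hrU, hball⟩ := exists_ball_avoiding a b {e | e ∈ T} hU hp (fun e he hm =>
    he ((hmemT e).2 hm))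
  obtain ⟨r, hr, hrr0, hrq⟩ : ∃ r : ℝ, 0 < r ∧ r < r0 ∧ ∀ e ∈ T, r < ‖q e - p‖ := by
    have h1 : ∀ᶠ r in 𝓝[>] (0 : ℝ), ∀ e ∈ T, r < ‖q e - p‖ := by
      rw [Filter.eventually_all_finset]
      intro e he
      exact (eventually_lt_nhds (norm_pos_iff.2 (sub_ne_zero.2 (hqp e he)))).filter_mono
        nhdsWithin_le_nhds
    obtain ⟨r, h2, h3, h4⟩ := (h1.and (((eventually_lt_nhds hr0).filter_mono
      nhdsWithin_le_nhds).and (self_mem_nhdsWithin (s := Ioi (0 : ℝ))))).exists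
    exact ⟨r, h4, h3, h2⟩
  -- The direction -w from p is avoided by all the segments of T. With angles measured from w, the
  -- circle about p can be cut at the angle π without touching a segment.
  obtain ⟨w, hw1, hwT⟩ := exists_norm_eq_one_avoiding (T.image fun e => -(q e - p) / ‖q e - p‖)
  have hw0 : w ≠ 0 := by
    rintro rfl
    simp at hw1
  set ζ : E → ℂ := fun e => (q e - p) / w with hζ
  have hqζ : ∀ e, q e = p + w * ζ e := fun e => by
    simp only [hζ]; field_simp; ring
  have hnζ : ∀ e, ‖ζ e‖ = ‖q e - p‖ := fun e => by simp [hζ, hw1]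
  have hζ0 : ∀ e ∈ T, 0 < ‖ζ e‖ := fun e he => by
    rw [hnζ]; exact hr.trans (hrq e he)
  set τ : E → ℝ := fun e => (ζ e).arg with hτ
  have hτπ : ∀ e ∈ T, (ζ e).arg ≠ Real.pi := by
    intro e he hc
    apply hwT
    refine Finset.mem_image.2 ⟨e, he, ?_⟩
    have h1 := Complex.norm_mul_exp_arg_mul_I (ζ e)
    rw [hc, Complex.exp_pi_mul_I, hnζ] at h1
    have h2 : (‖q e - p‖ : ℂ) ≠ 0 := by
      have := hζ0 e he
      rw [hnζ] at this
      exact_mod_cast this.ne'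
    have h3 : q e - p = w * ζ e := by rw [hqζ e]; ring
    rw [div_eq_iff h2]
    linear_combination -h3 + w * h1
  -- A small circle about p, traversed once. It meets each segment of T once, at the angle τ e, and
  -- no other segments.
  set z : ℝ → ℂ := fun t => p + w * (r * Complex.exp (t * Complex.I)) with hz
  have hzc : Continuous z := by fun_prop
  have hzr : ∀ t, dist (z t) p = r := by
    intro t
    rw [hz, dist_eq_norm]
    simp [hw1, Complex.norm_exp_ofReal_mul_I, abs_of_pos hr]
  have hzball : ∀ t, z t ∈ Metric.ball p r0 := fun t => by rw [Metric.mem_ball, hzr]; exact hrr0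
  have hzτ : ∀ e ∈ T, z (τ e) = AffineMap.lineMap p (q e) (r / ‖ζ e‖) := by
    intro e he
    have h1 := Complex.norm_mul_exp_arg_mul_I (ζ e)
    have h2 : (‖ζ e‖ : ℂ) ≠ 0 := by exact_mod_cast (hζ0 e he).ne'
    rw [AffineMap.lineMap_apply, hqζ]
    simp only [hz, hτ, vsub_eq_sub, vadd_eq_add, Complex.real_smul, Complex.ofReal_div]
    rw [add_sub_cancel_left]
    have h3 : Complex.exp ((ζ e).arg * Complex.I) = ζ e / ‖ζ e‖ := by
      rw [eq_div_iff h2, mul_comm, h1]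
    rw [h3]
    ring
  have hzo : ∀ e ∈ T, z (τ e) ∈ openSegment ℝ (a e) (b e) := by
    intro e he
    rw [hzτ e he, hoseg e he]
    refine mem_openSegment_iff_lineMap.2 ⟨_, ⟨div_pos hr (hζ0 e he), ?_⟩, rfl⟩
    rw [div_lt_one (hζ0 e he), hnζ]
    exact hrq e he
  have hmeet : ∀ t ∈ Icc (-Real.pi) Real.pi, ∀ e, z t ∈ segment ℝ (a e) (b e) →
      e ∈ T ∧ τ e = t := by
    intro t ht e hm
    have he : e ∈ T := hball _ (hzball t) e hm
    refine ⟨he, ?_⟩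
    rw [hseg e he] at hm
    obtain ⟨s, hs, hsz⟩ := mem_segment_iff_lineMap.1 hm
    rw [AffineMap.lineMap_apply, hqζ] at hsz
    simp only [hz, vsub_eq_sub, vadd_eq_add, Complex.real_smul, add_sub_cancel_left] at hsz
    have h1 : (s : ℂ) * ζ e = r * Complex.exp (t * Complex.I) := by
      have : w * (s * ζ e) = w * (r * Complex.exp (t * Complex.I)) := by
        linear_combination hsz
      exact mul_left_cancel₀ hw0 this
    have hs0 : 0 < s := by
      refine lt_of_le_of_ne hs.1 fun h2 => ?_
      rw [← h2] at h1
      simp at h1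
      exact hr.ne' h1
    have h2 : (r * Complex.exp (t * Complex.I)).arg = (ζ e).arg := by
      rw [← h1, Complex.arg_real_mul _ hs0]
    rw [Complex.arg_real_mul _ hr] at h2
    have htπ : t ≠ -Real.pi := by
      rintro rfl
      apply hτπ e he
      rw [← h2]
      simp [Complex.exp_neg]
    rw [hτ]
    simp only
    rw [← h2, Complex.arg_exp_mul_I, toIocMod_eq_self]
    exact ⟨lt_of_le_of_ne ht.1 htπ.symm, by linarith [ht.2]⟩
  have hcr : ∀ e t, cr p (q e) (z t) = r * ‖ζ e‖ * Real.sin (t - τ e) := by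
    intro e t
    rw [hqζ, hz, cr_add_polar, Complex.normSq_eq_norm_sq, hw1]
    simp [hτ]
  have hside : ∀ e ∈ T, ∀ᶠ t in 𝓝 (τ e), (τ e < t → 0 < cr p (q e) (z t)) ∧
      (t < τ e → cr p (q e) (z t) < 0) := by
    intro e he
    filter_upwards [eventually_lt_nhds (show τ e < τ e + Real.pi by linarith [Real.pi_pos]),
      eventually_gt_nhds (show τ e - Real.pi < τ e by linarith [Real.pi_pos])] with t h1 h2
    rw [hcr]
    constructor
    · intro h3
      exact mul_pos (mul_pos hr (hζ0 e he))
        (Real.sin_pos_of_pos_of_lt_pi (by linarith) (by linarith))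
    · intro h3
      exact mul_neg_of_pos_of_neg (mul_pos hr (hζ0 e he))
        (Real.sin_neg_of_neg_of_neg_pi_lt (by linarith) (by linarith))
  have hval : ∀ e ∈ T, ∀ᶠ t in 𝓝 (τ e), (0 < cr (a e) (b e) (z t) → f (z t) = fL e) ∧
      (cr (a e) (b e) (z t) < 0 → f (z t) = fR e) := fun e he =>
    hzc.continuousAt.eventually (hs e _ (hzo e he))
  -- A segment leaving p is crossed from its right to its left, an arriving one from its left to its
  -- right; hence the choice of `xl` and `xr`.
  have hjump := sub_eq_sum_jump T (τ := τ) (f := f ∘ z) (α := -Real.pi) (β := Real.pi)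
    (xl := fun e => if a e = p then fR e else fL e)
    (xr := fun e => if a e = p then fL e else fR e) (by linarith [Real.pi_pos])
    (fun e he => ⟨Complex.neg_pi_lt_arg _, lt_of_le_of_ne (Complex.arg_le_pi _) (hτπ e he)⟩)
    (fun e he g hg hτe => by
      by_contra hne
      refine h.disj e _ (hzo e he) g (Ne.symm hne) ?_
      rw [hτe]
      exact openSegment_subset_segment _ _ _ (hzo g hg))
    (fun t ht htT => by
      have h1 : z t ∈ U \ ⋃ e, segment ℝ (a e) (b e) := by
        refine ⟨hrU (hzball t), fun hm => ?_⟩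
        obtain ⟨e, he⟩ := mem_iUnion.1 hm
        obtain ⟨h2, h3⟩ := hmeet t ht e he
        exact htT e h2 h3
      exact hzc.continuousAt.eventually (hf _ h1))
    (fun e he => by
      filter_upwards [hside e he, hval e he] with t h1 h2 h3
      rcases hend e he with h4 | h4
      · rw [if_pos h4]
        refine h2.2 ?_
        rw [h4, ← hqa e h4]
        exact h1.2 h3
      · rw [if_neg (fun h5 => h.ne e (h5.trans h4.symm))]
        refine h2.1 ?_
        rw [h4, ← hqb e h4, cr_swap]
        linarith [h1.2 h3])
    (fun e he => by
      filter_upwards [hside e he, hval e he] with t h1 h2 h3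
      rcases hend e he with h4 | h4
      · rw [if_pos h4]
        refine h2.1 ?_
        rw [h4, ← hqa e h4]
        exact h1.1 h3
      · rw [if_neg (fun h5 => h.ne e (h5.trans h4.symm))]
        refine h2.2 ?_
        rw [h4, ← hqb e h4, cr_swap]
        linarith [h1.1 h3])
  -- After a full turn f returns to its initial value, so the jumps add up to zero.
  have hper : z Real.pi = z (-Real.pi) := by simp [hz, Complex.exp_neg]
  rw [Function.comp_apply, Function.comp_apply, hper, sub_self] at hjump
  rw [← Finset.sum_subset (Finset.subset_univ T)]
  · refine Eq.trans ?_ hjump.symm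
    refine Finset.sum_congr rfl fun e he => ?_
    rcases hend e he with h4 | h4
    · have : b e ≠ p := fun h5 => h.ne e (h4.trans h5.symm)
      simp [h4, this]
    · have : a e ≠ p := fun h5 => h.ne e (h5.trans h4.symm)
      simp [h4, this]
  · intro e _ he
    have h1 : a e ≠ p := by
      rintro rfl
      exact he ((hmemT e).2 (left_mem_segment ℝ _ _))
    have h2 : b e ≠ p := by
      rintro rfl
      exact he ((hmemT e).2 (right_mem_segment ℝ _ _))
    simp [h1, h2]

end Flux

/-! ### The winding number of an orthogonal closed curve -/

theorem re_mem_uIcc {a b z : ℂ} (h : z ∈ segment ℝ a b) : z.re ∈ uIcc a.re b.re := by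
  obtain ⟨t, ht, rfl⟩ := mem_segment_iff_lineMap.1 h
  rw [← segment_eq_uIcc, segment_eq_image_lineMap]
  exact ⟨t, ht, (by simp [AffineMap.lineMap_apply])⟩

theorem im_mem_uIcc {a b z : ℂ} (h : z ∈ segment ℝ a b) : z.im ∈ uIcc a.im b.im := by
  obtain ⟨t, ht, rfl⟩ := mem_segment_iff_lineMap.1 h
  rw [← segment_eq_uIcc, segment_eq_image_lineMap]
  exact ⟨t, ht, (by simp [AffineMap.lineMap_apply])⟩

theorem mem_openSegment_of_im_eq {a b z : ℂ} (hab : b.im = a.im) (hz : z.im = a.im)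
    (h : (a.re < z.re ∧ z.re < b.re) ∨ (b.re < z.re ∧ z.re < a.re)) :
    z ∈ openSegment ℝ a b := by
  have hne : b.re - a.re ≠ 0 := by
    rcases h with h | h
    · exact (sub_pos.2 (h.1.trans h.2)).ne'
    · exact (sub_neg.2 (h.1.trans h.2)).ne
  refine mem_openSegment_iff_lineMap.2 ⟨(z.re - a.re) / (b.re - a.re), ?_, ?_⟩
  · rcases h with h | h
    · exact ⟨div_pos (by linarith) (by linarith), (div_lt_one (by linarith)).2 (by linarith)⟩
    · refine ⟨div_pos_of_neg_of_neg (by linarith) (by linarith), ?_⟩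
      rw [div_lt_one_of_neg (by linarith)]
      linarith
  · apply Complex.ext
    · rw [lineMap_re]
      field_simp
      ring
    · rw [lineMap_im, hab, hz]
      ring

-- Follow the vertical ray from z upwards. Far up the winding number is 0, and on the way it jumps
-- only at the horizontal sides that cross the ray, by ±1 according to their direction.
open Classical in
theorem OrthoLoop.wnd_eq_sum {v : ℕ → ℂ} {b : ℕ} (h : OrthoLoop v b) {z : ℂ}
    (hx : ∀ i, (v i).re ≠ z.re) (hy : ∀ i, (v i).im ≠ z.im) :
    wnd v (2 * b) z = ∑ u : Fin b, if z.im < (v (2 * u)).im then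
      (if z.re < (v (2 * u)).re then (1 : ℝ) else 0) -
        (if z.re < (v (2 * u + 1)).re then 1 else 0) else 0 := by
  obtain ⟨M0, hM0⟩ : ∃ M : ℝ, ∀ i < 2 * b + 1, (v i).im < M := by
    obtain ⟨M, hM⟩ := ((Finset.range (2 * b + 1)).image fun i => (v i).im).exists_le
    exact ⟨M + 1, fun i hi => (hM _ (Finset.mem_image_of_mem _ (Finset.mem_range.2 hi))).trans_lt
      (lt_add_one M)⟩
  set M := max M0 z.im with hMdef
  have hM : ∀ i < 2 * b + 1, (v i).im < M := fun i hi => (hM0 i hi).trans_le (le_max_left _ _)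
  set d : Fin b → ℝ := fun u => (if z.re < (v (2 * u)).re then (1 : ℝ) else 0) -
    (if z.re < (v (2 * u + 1)).re then 1 else 0) with hd
  set S : Finset (Fin b) := Finset.univ.filter fun u => z.im < (v (2 * u)).im ∧ d u ≠ 0 with hS
  set ℓ : ℝ → ℂ := fun t => ⟨z.re, t⟩ with hℓ
  have hℓc : Continuous ℓ := by
    have : ℓ = fun t : ℝ => (z.re : ℂ) + t * Complex.I := by
      funext t; apply Complex.ext <;> simp [hℓ]
    rw [this]; fun_prop
  have hcase : ∀ u : Fin b, d u ≠ 0 →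
      (d u = 1 ∧ (v (2 * u + 1)).re < z.re ∧ z.re < (v (2 * u)).re) ∨
      (d u = -1 ∧ (v (2 * u)).re < z.re ∧ z.re < (v (2 * u + 1)).re) := by
    intro u hu
    rcases lt_or_gt_of_ne (hx (2 * u)) with h1 | h1 <;>
      rcases lt_or_gt_of_ne (hx (2 * u + 1)) with h2 | h2
    · exact absurd (by simp [hd, h1.not_gt, h2.not_gt]) hu
    · exact Or.inr ⟨by simp [hd, h1.not_gt, h2], h1, h2⟩
    · exact Or.inl ⟨by simp [hd, h1, h2.not_gt], h2, h1⟩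
    · exact absurd (by simp [hd, h1, h2]) hu
  have hopen : ∀ u ∈ S, ℓ (v (2 * u)).im ∈ openSegment ℝ (v (2 * u)) (v (2 * u + 1)) := by
    intro u hu
    refine mem_openSegment_of_im_eq (h.horiz u) rfl ?_
    rcases hcase u (Finset.mem_filter.1 hu).2.2 with h1 | h1
    · exact Or.inr h1.2
    · exact Or.inl h1.2
  have hcr : ∀ (u : Fin b) t, cr (v (2 * u)) (v (2 * u + 1)) (ℓ t) =
      ((v (2 * u + 1)).re - (v (2 * u)).re) * (t - (v (2 * u)).im) := by
    intro u t
    simp only [cr, hℓ, h.horiz u]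
    ring
  have hside : ∀ u ∈ S, ∀ᶠ t in 𝓝 (v (2 * u)).im,
      (0 < cr (v (2 * u)) (v (2 * u + 1)) (ℓ t) → wnd v (2 * b) (ℓ t) = 1) ∧
      (cr (v (2 * u)) (v (2 * u + 1)) (ℓ t) < 0 → wnd v (2 * b) (ℓ t) = 0) := fun u hu =>
    hℓc.continuousAt.eventually (h.side (2 * u) _ (hopen u hu))
  have key := sub_eq_sum_jump S (τ := fun u : Fin b => (v (2 * u)).im) (α := z.im) (β := M)
    (f := fun t => wnd v (2 * b) (ℓ t)) (xl := fun u => if d u = 1 then 1 else 0)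
    (xr := fun u => if d u = 1 then 0 else 1) (le_max_right _ _)
    (fun u hu => ⟨(Finset.mem_filter.1 hu).2.1, hM _ (by omega)⟩)
    (fun u _ w _ he => Fin.ext (h.generic u u.2 w w.2 he))
    (fun t ht htS => by
      refine hℓc.continuousAt.eventually (wnd_locConst (h.periodic 0 ▸ by rw [zero_add]) _ ?_)
      intro hm
      obtain ⟨i, hi, hseg⟩ := h.mem_trace_iff.1 hm
      have hre := re_mem_uIcc hseg
      have him := im_mem_uIcc hseg
      rcases Nat.even_or_odd' i with ⟨u, rfl | rfl⟩
      · have hu : u < b := by omega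
        rw [h.horiz u, uIcc_self, mem_singleton_iff] at him
        simp only [hℓ] at him hre
        refine htS ⟨u, hu⟩ (Finset.mem_filter.2 ⟨Finset.mem_univ _, ?_, ?_⟩) him.symm
        · exact lt_of_le_of_ne (him ▸ ht.1) (hy _).symm
        · intro h0
          rcases mem_uIcc.1 hre with h1 | h1
          · have h2 := lt_of_le_of_ne h1.1 (hx _)
            have h3 := lt_of_le_of_ne h1.2 (hx _).symm
            simp [hd, h2.not_gt, h3] at h0
          · have h2 := lt_of_le_of_ne h1.1 (hx _)
            have h3 := lt_of_le_of_ne h1.2 (hx _).symm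
            simp [hd, h2.not_gt, h3] at h0
      · rw [h.vert u, uIcc_self, mem_singleton_iff] at hre
        exact hx (2 * u + 1) hre.symm)
    (fun u hu => by
      filter_upwards [hside u hu] with t ht hlt
      rcases hcase u (Finset.mem_filter.1 hu).2.2 with h1 | h1
      · rw [if_pos h1.1]
        refine ht.1 ?_
        rw [hcr]
        exact mul_pos_of_neg_of_neg (by linarith) (by linarith)
      · rw [if_neg (by rw [h1.1]; norm_num)]
        refine ht.2 ?_
        rw [hcr]
        exact mul_neg_of_pos_of_neg (by linarith) (by linarith))
    (fun u hu => by
      filter_upwards [hside u hu] with t ht hlt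
      rcases hcase u (Finset.mem_filter.1 hu).2.2 with h1 | h1
      · rw [if_pos h1.1]
        refine ht.2 ?_
        rw [hcr]
        exact mul_neg_of_neg_of_pos (by linarith) (by linarith)
      · rw [if_neg (by rw [h1.1]; norm_num)]
        refine ht.1 ?_
        rw [hcr]
        exact mul_pos (by linarith) (by linarith))
  have htop : wnd v (2 * b) (ℓ M) = 0 := by
    refine wnd_eq_zero_of_halfplane (u := Complex.I) (h.periodic 0 ▸ by rw [zero_add])
      fun i hi => ?_
    simp only [Complex.mul_re, Complex.I_re, Complex.I_im, Complex.sub_im, hℓ]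
    linarith [hM i (by omega)]
  have hz : ℓ z.im = z := rfl
  simp only [htop, hz] at key
  have hsum : ∑ u ∈ S, ((if d u = 1 then (0 : ℝ) else 1) - if d u = 1 then 1 else 0) =
      -∑ u : Fin b, if z.im < (v (2 * u)).im then d u else 0 := by
    rw [← Finset.sum_neg_distrib, ← Finset.sum_subset (Finset.subset_univ S)]
    · refine Finset.sum_congr rfl fun u hu => ?_
      rw [if_pos (Finset.mem_filter.1 hu).2.1]
      rcases hcase u (Finset.mem_filter.1 hu).2.2 with h1 | h1 <;> rw [h1.1] <;> norm_num
    · intro u _ hu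
      rw [neg_eq_zero]
      by_contra hc
      apply hu
      by_cases h1 : z.im < (v (2 * u)).im
      · rw [if_pos h1] at hc
        exact Finset.mem_filter.2 ⟨Finset.mem_univ _, h1, hc⟩
      · rw [if_neg h1] at hc
        exact absurd rfl hc
  rw [hsum] at key
  linarith

/-! ### The flow function of a planar network -/

theorem exists_subdivision (S : Finset ℝ) : ∃ (K : ℕ) (τ : ℕ → ℝ), 0 < K ∧ τ 0 = 0 ∧ τ K = 1 ∧
    (∀ i j, i < j → j ≤ K → τ i < τ j) ∧ ∀ s ∈ S, ∀ j < K, s ∉ Ioo (τ j) (τ (j + 1)) := by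
  set T : Finset ℝ := insert 0 (insert 1 (S.filter fun s => s ∈ Icc (0 : ℝ) 1)) with hT
  have h0 : (0 : ℝ) ∈ T := by simp [hT]
  have h1 : (1 : ℝ) ∈ T := by simp [hT]
  have hmem : ∀ s ∈ T, s ∈ Icc (0 : ℝ) 1 := by
    intro s hs
    simp only [hT, Finset.mem_insert, Finset.mem_filter] at hs
    rcases hs with rfl | rfl | hs
    · simp
    · simp
    · exact hs.2
  have hcard : 1 < T.card := Finset.one_lt_card.2 ⟨0, h0, 1, h1, by norm_num⟩
  set φ := T.orderEmbOfFin rfl with hφ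
  have hφm : ∀ i, φ i ∈ T := fun i => T.orderEmbOfFin_mem rfl i
  have hsurj : ∀ s ∈ T, ∃ i, φ i = s := by
    intro s hs
    have : s ∈ Set.range φ := by rw [Finset.range_orderEmbOfFin]; exact hs
    exact this
  obtain ⟨i0, hi0⟩ := hsurj 0 h0
  obtain ⟨i1, hi1⟩ := hsurj 1 h1
  set τ : ℕ → ℝ := fun j => φ ⟨min j (T.card - 1), by omega⟩ with hτ
  have hτlt : ∀ i j, i < j → j ≤ T.card - 1 → τ i < τ j := by
    intro i j hij hj
    refine φ.strictMono ?_
    rw [Fin.mk_lt_mk]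
    omega
  have hτφ : ∀ i : Fin T.card, τ i = φ i := by
    intro i
    simp only [hτ]
    congr 1
    exact Fin.ext (min_eq_left (by omega))
  refine ⟨T.card - 1, τ, by omega, ?_, ?_, hτlt, ?_⟩
  · refine le_antisymm ?_ (hmem _ (hφm _)).1
    rw [← hi0]
    exact φ.monotone (Fin.mk_le_of_le_val (by simp))
  · refine le_antisymm (hmem _ (hφm _)).2 ?_
    rw [← hi1]
    refine φ.monotone ?_
    rw [Fin.le_def]
    simp only [min_self]
    omega
  · intro s hs j hj hmid
    have hsT : s ∈ T := by
      simp only [hT, Finset.mem_insert, Finset.mem_filter]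
      exact Or.inr (Or.inr ⟨hs, (hmem _ (hφm _)).1.trans hmid.1.le,
        hmid.2.le.trans (hmem _ (hφm _)).2⟩)
    obtain ⟨k, rfl⟩ := hsurj s hsT
    rw [← hτφ k] at hmid
    have h2 : j < k := by
      by_contra hc
      rcases (not_lt.1 hc).lt_or_eq with h | h
      · exact absurd (hτlt _ _ h hj.le) hmid.1.not_gt
      · rw [h] at hmid; exact lt_irrefl _ hmid.1
    have h3 : (k : ℕ) < j + 1 := by
      by_contra hc
      rcases (not_lt.1 hc).lt_or_eq with h | h
      · exact absurd (hτlt _ _ h (by omega)) hmid.2.not_gt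
      · rw [← h] at hmid; exact lt_irrefl _ hmid.2
    omega

namespace ElectricalNetwork

variable {b m : ℕ} (N : ElectricalNetwork b m)

/-- Summation by parts: each edge contributes to the sums at its two ends. -/
theorem sum_mul_sub {R : Type*} [CommRing R] (s : Fin m → R) (ψ : N.Vertex → R) :
    ∑ e, s e * (ψ (N.src e) - ψ (N.tgt e)) = ∑ v, ψ v * ∑ e,
      ((if N.src e = v then s e else 0) - (if N.tgt e = v then s e else 0)) := by
  simp_rw [Finset.mul_sum]
  rw [Finset.sum_comm]
  refine Finset.sum_congr rfl fun e _ => ?_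
  simp_rw [mul_sub, mul_ite, mul_zero]
  rw [Finset.sum_sub_distrib, Finset.sum_ite_eq, Finset.sum_ite_eq, if_pos (Finset.mem_univ _),
    if_pos (Finset.mem_univ _)]
  ring

/-- A drawing of the network in the disc, where the edge `e` is the polygonal arc with the vertices
`Q e 0, …, Q e K`. -/
structure PolyDrawing (pos : N.Vertex → ℂ) (θ : Fin b → ℝ) (K : ℕ) (Q : Fin m → ℕ → ℂ) : Prop where
  K_pos : 0 < K
  pos_inj : Function.Injective pos
  θ_mono : StrictMono θ
  θ_lt : ∀ u v, θ v < θ u + 2 * Real.pi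
  pos_inl : ∀ u, pos (Sum.inl u) = Complex.exp (θ u * Complex.I)
  pos_inr : ∀ k, ‖pos (Sum.inr k)‖ < 1
  zero : ∀ e, Q e 0 = pos (N.src e)
  last : ∀ e, Q e K = pos (N.tgt e)
  ne_pos : ∀ e j, 0 < j → j < K → ∀ v, Q e j ≠ pos v
  norm_lt : ∀ e j, 0 < j → j < K → ‖Q e j‖ < 1
  inj : ∀ e j f i, 0 < j → j < K → i ≤ K → Q e j = Q f i → e = f ∧ j = i
  ne_succ : ∀ e, ∀ j < K, Q e j ≠ Q e (j + 1)
  open_norm_lt : ∀ e, ∀ j < K, ∀ p ∈ openSegment ℝ (Q e j) (Q e (j + 1)), ‖p‖ < 1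
  disj : ∀ e, ∀ j < K, ∀ p ∈ openSegment ℝ (Q e j) (Q e (j + 1)), ∀ f, ∀ i < K,
    p ∈ segment ℝ (Q f i) (Q f (i + 1)) → e = f ∧ j = i

theorem IsPlanar.exists_polyDrawing {N : ElectricalNetwork b m} (h : N.IsPlanar) :
    ∃ pos θ K Q, N.PolyDrawing pos θ K Q := by
  obtain ⟨pos, γ, hinj, ⟨θ, hθ, hθ2, hpos⟩, hinr, hγ, hint, hdisj⟩ := h
  choose S hS using fun e => (hγ e).1
  -- A common subdivision containing the breakpoints of all the edges, so that every arc consists of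
  -- the same number K of segments.
  obtain ⟨K, τ, hK, hτ0, hτK, hτ, hτS⟩ := exists_subdivision (Finset.univ.biUnion S)
  have hτ01 : ∀ j ≤ K, τ j ∈ Icc (0 : ℝ) 1 := by
    intro j hj
    constructor
    · rcases Nat.eq_zero_or_pos j with rfl | h
      · exact hτ0.ge
      · exact hτ0 ▸ (hτ 0 j h hj).le
    · rcases hj.lt_or_eq with h | rfl
      · exact hτK ▸ (hτ j K h le_rfl).le
      · exact hτK.le
  have hτo : ∀ j, 0 < j → j < K → τ j ∈ Ioo (0 : ℝ) 1 := fun j h0 h1 =>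
    ⟨hτ0 ▸ hτ 0 j h0 h1.le, hτK ▸ hτ j K h1 le_rfl⟩
  have hline : ∀ e, ∀ j < K, ∀ s ∈ Icc (0 : ℝ) 1,
      γ e (AffineMap.lineMap (τ j) (τ (j + 1)) s) =
        AffineMap.lineMap (γ e (τ j)) (γ e (τ (j + 1))) s := by
    intro e j hj s hs
    exact hS e _ _ (hτ01 j hj.le).1 (hτ j (j + 1) (by omega) hj).le (hτ01 (j + 1) hj).2
      (fun t ht => hτS t (Finset.mem_biUnion.2 ⟨e, Finset.mem_univ _, ht⟩) j hj) s hs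
  have hop : ∀ e, ∀ j < K, ∀ p ∈ openSegment ℝ (γ e (τ j)) (γ e (τ (j + 1))),
      ∃ t ∈ Ioo (τ j) (τ (j + 1)), γ e t = p := by
    intro e j hj p hp
    obtain ⟨s, hs, rfl⟩ := mem_openSegment_iff_lineMap.1 hp
    refine ⟨AffineMap.lineMap (τ j) (τ (j + 1)) s, ?_, hline e j hj s ⟨hs.1.le, hs.2.le⟩⟩
    rw [← openSegment_eq_Ioo (hτ j (j + 1) (by omega) hj), openSegment_eq_image_lineMap]
    exact ⟨s, hs, rfl⟩
  have hcl : ∀ e, ∀ j < K, ∀ p ∈ segment ℝ (γ e (τ j)) (γ e (τ (j + 1))),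
      ∃ t ∈ Icc (τ j) (τ (j + 1)), γ e t = p := by
    intro e j hj p hp
    obtain ⟨s, hs, rfl⟩ := mem_segment_iff_lineMap.1 hp
    refine ⟨AffineMap.lineMap (τ j) (τ (j + 1)) s, ?_, hline e j hj s hs⟩
    rw [← segment_eq_Icc (hτ j (j + 1) (by omega) hj).le, segment_eq_image_lineMap]
    exact ⟨s, hs, rfl⟩
  have h01 : ∀ j < K, ∀ t ∈ Ioo (τ j) (τ (j + 1)), t ∈ Ioo (0 : ℝ) 1 := fun j hj t ht =>
    ⟨(hτ01 j hj.le).1.trans_lt ht.1, ht.2.trans_le (hτ01 (j + 1) hj).2⟩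
  have hmain : ∀ e, ∀ t ∈ Ioo (0 : ℝ) 1, ∀ f, ∀ s ∈ Icc (0 : ℝ) 1, γ e t = γ f s →
      e = f ∧ t = s := by
    intro e t ht f s hs hes
    have hs' : s ∈ Ioo (0 : ℝ) 1 := by
      refine ⟨lt_of_le_of_ne hs.1 ?_, lt_of_le_of_ne hs.2 ?_⟩
      · rintro rfl
        rw [(hγ f).2.2.1] at hes
        exact (hint e t ht).2 _ hes
      · rintro rfl
        rw [(hγ f).2.2.2] at hes
        exact (hint e t ht).2 _ hes
    by_cases hef : e = f
    · subst hef
      exact ⟨rfl, (hγ e).2.1 ⟨ht.1.le, ht.2.le⟩ hs hes⟩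
    · exact absurd hes (hdisj e f hef t ht s hs')
  have hτinj : ∀ i ≤ K, ∀ j ≤ K, τ i = τ j → i = j := by
    intro i hi j hj he
    rcases lt_trichotomy i j with h | h | h
    · exact absurd he (hτ i j h hj).ne
    · exact h
    · exact absurd he (hτ j i h hi).ne'
  refine ⟨pos, θ, K, fun e j => γ e (τ j), hK, hinj, hθ, hθ2, hpos, hinr, fun e => ?_, fun e => ?_,
    fun e j h0 h1 => (hint e _ (hτo j h0 h1)).2, fun e j h0 h1 => (hint e _ (hτo j h0 h1)).1,
    fun e j f i h0 h1 hi he => ?_, fun e j hj he => ?_, fun e j hj p hp => ?_,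
    fun e j hj p hp f i hi hm => ?_⟩
  · simp only [hτ0, (hγ e).2.2.1]
  · simp only [hτK, (hγ e).2.2.2]
  · obtain ⟨h2, h3⟩ := hmain e _ (hτo j h0 h1) f _ (hτ01 i hi) he
    exact ⟨h2, hτinj j h1.le i hi h3⟩
  · have := hτinj j hj.le (j + 1) hj ((hγ e).2.1 (hτ01 j hj.le) (hτ01 (j + 1) hj) he)
    omega
  · obtain ⟨t, ht, rfl⟩ := hop e j hj p hp
    exact (hint e t (h01 j hj t ht)).1
  · obtain ⟨t, ht, rfl⟩ := hop e j hj p hp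
    obtain ⟨s, hs, he⟩ := hcl f i hi _ hm
    obtain ⟨h2, rfl⟩ := hmain e t (h01 j hj t ht) f s
      ⟨(hτ01 i hi.le).1.trans hs.1, hs.2.trans (hτ01 (i + 1) hi).2⟩ he.symm
    refine ⟨h2, ?_⟩
    by_contra hne
    rcases lt_or_gt_of_ne hne with h | h
    · have h3 : τ (j + 1) ≤ τ i := by
        rcases (Nat.succ_le_of_lt h).lt_or_eq with h | h
        · exact (hτ _ _ h hi.le).le
        · exact (congrArg τ h).le
      linarith [ht.2, hs.1]
    · have h3 : τ (i + 1) ≤ τ j := by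
        rcases (Nat.succ_le_of_lt h).lt_or_eq with h | h
        · exact (hτ _ _ h hj.le).le
        · exact (congrArg τ h).le
      linarith [ht.1, hs.2]

/-- The sources of the segments of a drawing, together with the radial segments that lead from the
boundary vertices out of the disc. -/
def segSrc (pos : N.Vertex → ℂ) (K : ℕ) (Q : Fin m → ℕ → ℂ) : (Fin m × Fin K) ⊕ Fin b → ℂ :=
  Sum.elim (fun x => Q x.1 x.2) fun u => pos (Sum.inl u)

/-- The targets of the segments of a drawing and of the radial segments. -/
def segTgt (pos : N.Vertex → ℂ) (K : ℕ) (Q : Fin m → ℕ → ℂ) : (Fin m × Fin K) ⊕ Fin b → ℂ :=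
  Sum.elim (fun x => Q x.1 (x.2 + 1)) fun u => ((2 : ℝ) : ℂ) * pos (Sum.inl u)

/-- The currents through the segments of a drawing and the radial segments. -/
def segCurrent (V : N.Vertex → ℝ) (K : ℕ) : (Fin m × Fin K) ⊕ Fin b → ℝ :=
  Sum.elim (fun x => N.current V x.1) fun u => -N.outflow V (Sum.inl u)

/-- The potential of the sources outside the disc. -/
noncomputable def sourcePot (pos : N.Vertex → ℂ) (V : N.Vertex → ℝ) (z : ℂ) : ℂ :=
  ∑ u, (N.outflow V (Sum.inl u) : ℂ) * Complex.log (1 - z / (((2 : ℝ) : ℂ) * pos (Sum.inl u)))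

namespace PolyDrawing

variable {N} {pos : N.Vertex → ℂ} {θ : Fin b → ℝ} {K : ℕ} {Q : Fin m → ℕ → ℂ}

theorem norm_inl (h : N.PolyDrawing pos θ K Q) (u : Fin b) : ‖pos (Sum.inl u)‖ = 1 := by
  rw [h.pos_inl, Complex.norm_exp_ofReal_mul_I]

theorem norm_pos_le (h : N.PolyDrawing pos θ K Q) (v : N.Vertex) : ‖pos v‖ ≤ 1 := by
  rcases v with u | k
  · exact (h.norm_inl u).le
  · exact (h.pos_inr k).le

theorem norm_Q_le (h : N.PolyDrawing pos θ K Q) (e : Fin m) {j : ℕ} (hj : j ≤ K) : ‖Q e j‖ ≤ 1 := by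
  rcases Nat.eq_zero_or_pos j with rfl | h0
  · rw [h.zero]; exact h.norm_pos_le _
  rcases hj.lt_or_eq with h1 | rfl
  · exact (h.norm_lt e j h0 h1).le
  · rw [h.last]; exact h.norm_pos_le _

theorem norm_segment_le (h : N.PolyDrawing pos θ K Q) (e : Fin m) {j : ℕ} (hj : j < K) {p : ℂ}
    (hp : p ∈ segment ℝ (Q e j) (Q e (j + 1))) : ‖p‖ ≤ 1 := by
  have := (convex_closedBall (0 : ℂ) 1).segment_subset
    (mem_closedBall_zero_iff.2 (h.norm_Q_le e hj.le)) (mem_closedBall_zero_iff.2 (h.norm_Q_le e hj))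
    hp
  exact mem_closedBall_zero_iff.1 this

theorem mem_spoke {w p : ℂ} (hp : p ∈ segment ℝ w (((2 : ℝ) : ℂ) * w)) :
    ∃ s ∈ Icc (1 : ℝ) 2, p = s * w := by
  obtain ⟨t, ht, rfl⟩ := mem_segment_iff_lineMap.1 hp
  refine ⟨1 + t, ⟨by linarith [ht.1], by linarith [ht.2]⟩, ?_⟩
  rw [AffineMap.lineMap_apply]
  simp
  ring

theorem mem_openSpoke {w p : ℂ} :
    p ∈ openSegment ℝ w (((2 : ℝ) : ℂ) * w) ↔ ∃ s ∈ Ioo (1 : ℝ) 2, p = s * w := by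
  rw [mem_openSegment_iff_lineMap]
  have key : ∀ t : ℝ, AffineMap.lineMap w (((2 : ℝ) : ℂ) * w) t = ((1 + t : ℝ) : ℂ) * w := by
    intro t
    rw [AffineMap.lineMap_apply]
    simp
    ring
  constructor
  · rintro ⟨t, ht, rfl⟩
    exact ⟨1 + t, ⟨by linarith [ht.1], by linarith [ht.2]⟩, key t⟩
  · rintro ⟨s, hs, rfl⟩
    refine ⟨s - 1, ⟨by linarith [hs.1], by linarith [hs.2]⟩, ?_⟩
    rw [key]
    ring_nf

theorem spoke_inj (h : N.PolyDrawing pos θ K Q) {u w : Fin b} {s t : ℝ} (hs : 0 < s) (ht : 0 < t)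
    (he : (s : ℂ) * pos (Sum.inl u) = t * pos (Sum.inl w)) : u = w := by
  have h1 := congrArg norm he
  rw [norm_mul, norm_mul, h.norm_inl, h.norm_inl, Complex.norm_real, Complex.norm_real,
    Real.norm_of_nonneg hs.le, Real.norm_of_nonneg ht.le, mul_one, mul_one] at h1
  subst h1
  have h2 : (s : ℂ) ≠ 0 := by exact_mod_cast hs.ne'
  simpa using h.pos_inj (mul_left_cancel₀ h2 he)

theorem nonCrossing (h : N.PolyDrawing pos θ K Q) :
    NonCrossing (N.segSrc pos K Q) (N.segTgt pos K Q) where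
  ne x := by
    rcases x with ⟨e, j⟩ | u
    · exact h.ne_succ e j j.2
    · intro he
      have h1 := congrArg norm he
      simp only [segSrc, segTgt, Sum.elim_inr, norm_mul, h.norm_inl, Complex.norm_real] at h1
      norm_num at h1
  disj x p hp y hy hm := by
    rcases x with ⟨e, j⟩ | u <;> rcases y with ⟨f, i⟩ | w
    · obtain ⟨rfl, h2⟩ := h.disj e j j.2 p hp f i i.2 hm
      exact hy (by rw [Fin.ext h2])
    · obtain ⟨s, hs, rfl⟩ := mem_spoke (w := pos (Sum.inl w)) hm
      have h1 := h.open_norm_lt e j j.2 _ hp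
      rw [norm_mul, h.norm_inl, Complex.norm_real, Real.norm_of_nonneg (by linarith [hs.1])] at h1
      linarith [hs.1]
    · obtain ⟨s, hs, rfl⟩ := (mem_openSpoke (w := pos (Sum.inl u))).1 hp
      have h1 := h.norm_segment_le f i.2 hm
      rw [norm_mul, h.norm_inl, Complex.norm_real, Real.norm_of_nonneg (by linarith [hs.1])] at h1
      linarith [hs.1]
    · obtain ⟨s, hs, rfl⟩ := (mem_openSpoke (w := pos (Sum.inl u))).1 hp
      obtain ⟨t, ht, he⟩ := mem_spoke (w := pos (Sum.inl w)) hm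
      exact hy (by rw [h.spoke_inj (by linarith [hs.1]) (by linarith [ht.1]) he])

theorem openSegment_subset (h : N.PolyDrawing pos θ K Q) (x : (Fin m × Fin K) ⊕ Fin b) :
    openSegment ℝ (N.segSrc pos K Q x) (N.segTgt pos K Q x) ⊆ Metric.ball 0 2 := by
  intro p hp
  rw [mem_ball_zero_iff]
  rcases x with ⟨e, j⟩ | u
  · exact (h.open_norm_lt e j j.2 _ hp).trans one_lt_two
  · obtain ⟨s, hs, rfl⟩ := (mem_openSpoke (w := pos (Sum.inl u))).1 hp
    rw [norm_mul, h.norm_inl, Complex.norm_real, Real.norm_of_nonneg (by linarith [hs.1])]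
    linarith [hs.2]

theorem hasDerivAt_sourcePot (h : N.PolyDrawing pos θ K Q) (V : N.Vertex → ℝ) {z : ℂ}
    (hz : z ∈ Metric.ball (0 : ℂ) 2) : HasDerivAt (N.sourcePot pos V)
      (-∑ u, (N.outflow V (Sum.inl u) : ℂ) * (1 / (((2 : ℝ) : ℂ) * pos (Sum.inl u) - z))) z := by
  rw [← Finset.sum_neg_distrib]
  unfold sourcePot
  refine HasDerivAt.fun_sum fun u _ => ?_
  set w : ℂ := ((2 : ℝ) : ℂ) * pos (Sum.inl u) with hw
  have hwn : ‖w‖ = 2 := by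
    rw [hw, norm_mul, h.norm_inl, Complex.norm_real]; norm_num
  have hw0 : w ≠ 0 := by
    rintro h0
    rw [h0] at hwn
    simp at hwn
  rw [mem_ball_zero_iff] at hz
  have hwz : w - z ≠ 0 := by
    intro h0
    rw [sub_eq_zero.1 h0] at hwn
    linarith
  -- Since ‖z / w‖ < 1, the real part is positive and the principal logarithm is holomorphic on the
  -- whole disc of radius 2.
  have hslit : 1 - z / w ∈ Complex.slitPlane := by
    left
    have h1 := Complex.re_le_norm (z / w)
    rw [norm_div, hwn] at h1
    rw [Complex.sub_re, Complex.one_re]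
    linarith
  have h1 := (((hasDerivAt_id z).div_const w).const_sub 1).clog hslit
  have h2 := h1.const_mul (N.outflow V (Sum.inl u) : ℂ)
  refine h2.congr_deriv ?_
  have h3 : 1 - z / w = (w - z) / w := by field_simp
  simp only [id]
  rw [h3]
  field_simp

/-- The poles at inner vertices cancel by Kirchhoff's law. At a boundary vertex the radial segment,
with the weight opposite to the outflow, balances the edges; its outer end leaves a pole on the
circle of radius 2, which `sourcePot` compensates. -/
theorem closedChain (h : N.PolyDrawing pos θ K Q) {V : N.Vertex → ℝ}
    (hV : ∀ k, N.outflow V (Sum.inr k) = 0) :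
    ClosedChain (N.segSrc pos K Q) (N.segTgt pos K Q) (N.segCurrent V K) (N.sourcePot pos V)
      (Metric.ball 0 2) := by
  refine ⟨Metric.isOpen_ball, fun z hz _ => ?_⟩
  refine (h.hasDerivAt_sourcePot V hz).congr_deriv ?_
  congr 1
  set ψ : ℂ → ℂ := fun w => 1 / (w - z) with hψ
  have h1 : ∀ e, ∑ j : Fin K, (N.current V e : ℂ) * (ψ (Q e j) - ψ (Q e (j + 1))) =
      N.current V e * (ψ (pos (N.src e)) - ψ (pos (N.tgt e))) := by
    intro e
    rw [← Finset.mul_sum, Fin.sum_univ_eq_sum_range (fun j => ψ (Q e j) - ψ (Q e (j + 1))),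
      Finset.sum_range_sub' (fun j => ψ (Q e j)), h.zero, h.last]
  have h2 := N.sum_mul_sub (fun e => (N.current V e : ℂ)) (fun v => ψ (pos v))
  have h3 : ∀ v, ∑ e, ((if N.src e = v then (N.current V e : ℂ) else 0) -
      (if N.tgt e = v then (N.current V e : ℂ) else 0)) = (N.outflow V v : ℂ) := by
    intro v
    rw [outflow]
    push_cast
    refine Finset.sum_congr rfl fun e _ => ?_
    split_ifs <;> simp
  simp only [h3] at h2
  rw [Fintype.sum_sum_type] at h2
  simp only [hV, Complex.ofReal_zero, mul_zero, Finset.sum_const_zero, add_zero] at h2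
  rw [Fintype.sum_sum_type, Fintype.sum_prod_type]
  simp only [segSrc, segTgt, segCurrent, Sum.elim_inl, Sum.elim_inr]
  change _ = (∑ e, ∑ j : Fin K, (N.current V e : ℂ) * (ψ (Q e j) - ψ (Q e (j + 1)))) +
    ∑ u, ((-N.outflow V (Sum.inl u) : ℝ) : ℂ) *
      (ψ (pos (Sum.inl u)) - ψ (((2 : ℝ) : ℂ) * pos (Sum.inl u)))
  simp only [h1]
  rw [h2, ← Finset.sum_add_distrib]
  refine Finset.sum_congr rfl fun u _ => ?_
  push_cast
  simp only [hψ]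
  ring

/-- The flow function has the same values on both sides of consecutive radial segments. -/
theorem sector (h : N.PolyDrawing pos θ K Q) {f : ℂ → ℝ}
    (hf : LocConstOn f (Metric.ball 0 2 \ ⋃ x, segment ℝ (N.segSrc pos K Q x) (N.segTgt pos K Q x)))
    {fL fR : (Fin m × Fin K) ⊕ Fin b → ℝ}
    (hs : SideValues (N.segSrc pos K Q) (N.segTgt pos K Q) f fL fR) {u w : Fin b}
    (huw : (w : ℕ) = u + 1) : fR (Sum.inr w) = fL (Sum.inr u) := by
  -- An arc of the circle of radius 3/2, which is outside the unit disc with all the edges. Between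
  -- the angles θ u and θ w of consecutive boundary vertices it meets no radial segment either, so
  -- the flow function is constant on it.
  set ℓ : ℝ → ℂ := fun t => ((3 / 2 : ℝ) : ℂ) * Complex.exp (t * Complex.I) with hℓ
  have hℓc : Continuous ℓ := by fun_prop
  have hopen : ∀ x : Fin b, ℓ (θ x) ∈
      openSegment ℝ (pos (Sum.inl x)) (((2 : ℝ) : ℂ) * pos (Sum.inl x)) := fun x =>
    mem_openSpoke.2 ⟨3 / 2, by norm_num, by rw [h.pos_inl]⟩
  have hcr : ∀ (x : Fin b) t, cr (pos (Sum.inl x)) (((2 : ℝ) : ℂ) * pos (Sum.inl x)) (ℓ t) =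
      3 / 2 * Real.sin (t - θ x) := by
    intro x t
    rw [h.pos_inl, Real.sin_sub]
    simp only [cr, hℓ, Complex.re_ofReal_mul, Complex.im_ofReal_mul, Complex.exp_ofReal_mul_I_re,
      Complex.exp_ofReal_mul_I_im]
    ring
  have hlt : θ u < θ w := h.θ_mono (by rw [Fin.lt_def]; omega)
  have hpi := Real.pi_pos
  have hL : ∀ᶠ t in 𝓝[>] (θ u), f (ℓ t) = fL (Sum.inr u) := by
    filter_upwards [(hℓc.continuousAt.eventually (hs (Sum.inr u) _ (hopen u))).filter_mono
      nhdsWithin_le_nhds, self_mem_nhdsWithin (s := Ioi (θ u)),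
      (eventually_lt_nhds (show θ u < θ u + Real.pi by linarith)).filter_mono nhdsWithin_le_nhds]
      with t h1 h2 h3
    refine h1.1 ?_
    change 0 < cr (pos (Sum.inl u)) (((2 : ℝ) : ℂ) * pos (Sum.inl u)) (ℓ t)
    rw [hcr]
    have h2' : θ u < t := h2
    have := Real.sin_pos_of_pos_of_lt_pi (show 0 < t - θ u by linarith) (by linarith)
    linarith
  have hR : ∀ᶠ t in 𝓝[<] (θ w), f (ℓ t) = fR (Sum.inr w) := by
    filter_upwards [(hℓc.continuousAt.eventually (hs (Sum.inr w) _ (hopen w))).filter_mono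
      nhdsWithin_le_nhds, self_mem_nhdsWithin (s := Iio (θ w)),
      (eventually_gt_nhds (show θ w - Real.pi < θ w by linarith)).filter_mono nhdsWithin_le_nhds]
      with t h1 h2 h3
    refine h1.2 ?_
    change cr (pos (Sum.inl w)) (((2 : ℝ) : ℂ) * pos (Sum.inl w)) (ℓ t) < 0
    rw [hcr]
    have h2' : t < θ w := h2
    have := Real.sin_neg_of_neg_of_neg_pi_lt (show t - θ w < 0 by linarith) (by linarith)
    linarith
  obtain ⟨s, hs1, hs2⟩ := (hL.and (Ioo_mem_nhdsGT hlt)).exists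
  obtain ⟨t, ht1, ht2⟩ := (hR.and (Ioo_mem_nhdsLT hlt)).exists
  rw [← hs1, ← ht1]
  refine hf.eq (S := ℓ '' Ioo (θ u) (θ w)) (isPreconnected_Ioo.image _ hℓc.continuousOn) ?_
    (mem_image_of_mem _ ht2) (mem_image_of_mem _ hs2)
  rintro _ ⟨r, hr, rfl⟩
  have hn : ‖ℓ r‖ = 3 / 2 := by
    rw [hℓ, norm_mul, Complex.norm_exp_ofReal_mul_I, Complex.norm_real]
    norm_num
  refine ⟨by rw [mem_ball_zero_iff, hn]; norm_num, fun hm => ?_⟩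
  obtain ⟨⟨e, j⟩ | x, hx⟩ := mem_iUnion.1 hm
  · have := h.norm_segment_le e j.2 hx
    rw [hn] at this
    norm_num at this
  · obtain ⟨s, hs, he⟩ := mem_spoke (w := pos (Sum.inl x)) hx
    have h1 := congrArg norm he
    rw [hn, norm_mul, h.norm_inl, Complex.norm_real, Real.norm_of_nonneg (by linarith [hs.1]),
      mul_one] at h1
    rw [← h1, hℓ, h.pos_inl] at he
    have h2 := mul_left_cancel₀ (by norm_num) he
    rw [Complex.exp_eq_exp_iff_exists_int] at h2
    obtain ⟨k, hk⟩ := h2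
    have h3 : r = θ x + k * (2 * Real.pi) := by
      have h4 : (r : ℂ) * Complex.I = (θ x + k * (2 * Real.pi) : ℝ) * Complex.I := by
        rw [hk]; push_cast; ring
      exact_mod_cast mul_right_cancel₀ Complex.I_ne_zero h4
    rcases lt_trichotomy k 0 with h4 | h4 | h4
    · have h5 : (k : ℝ) ≤ -1 := by exact_mod_cast (by omega : k ≤ -1)
      nlinarith [h.θ_lt u x, hr.1]
    · rw [h4, Int.cast_zero, zero_mul, add_zero] at h3
      rw [h3] at hr
      have h5 := h.θ_mono.lt_iff_lt.1 hr.1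
      have h6 := h.θ_mono.lt_iff_lt.1 hr.2
      rw [Fin.lt_def] at h5 h6
      omega
    · have h5 : (1 : ℝ) ≤ k := by exact_mod_cast h4
      nlinarith [h.θ_lt x w, hr.2]

theorem Q_eq_pos_iff (h : N.PolyDrawing pos θ K Q) (e : Fin m) {j : ℕ} (hj : j < K) (v : N.Vertex) :
    Q e j = pos v ↔ j = 0 ∧ N.src e = v := by
  constructor
  · intro he
    rcases Nat.eq_zero_or_pos j with rfl | h0
    · exact ⟨rfl, h.pos_inj (by rw [← h.zero, he])⟩
    · exact absurd he (h.ne_pos e j h0 hj v)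
  · rintro ⟨rfl, rfl⟩
    exact h.zero e

theorem Q_succ_eq_pos_iff (h : N.PolyDrawing pos θ K Q) (e : Fin m) {j : ℕ} (hj : j < K)
    (v : N.Vertex) : Q e (j + 1) = pos v ↔ j + 1 = K ∧ N.tgt e = v := by
  constructor
  · intro he
    rcases (Nat.succ_le_of_lt hj).lt_or_eq with h1 | h1
    · exact absurd he (h.ne_pos e (j + 1) (by omega) h1 v)
    · have h2 : j + 1 = K := h1
      exact ⟨h2, h.pos_inj (by rw [← h.last, ← h2, he])⟩
  · rintro ⟨h1, rfl⟩
    rw [h1, h.last]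

/-- Exactly two segments of the drawing end at an inner breakpoint of an arc, one arriving and one
leaving, so conservation makes their jumps equal. -/
theorem flux_succ (h : N.PolyDrawing pos θ K Q) {f : ℂ → ℝ}
    (hf : LocConstOn f (Metric.ball 0 2 \ ⋃ x, segment ℝ (N.segSrc pos K Q x) (N.segTgt pos K Q x)))
    {fL fR : (Fin m × Fin K) ⊕ Fin b → ℝ}
    (hs : SideValues (N.segSrc pos K Q) (N.segTgt pos K Q) f fL fR)
    (e : Fin m) {j : ℕ} (hj : j + 1 < K) :
    fL (Sum.inl (e, ⟨j + 1, hj⟩)) - fR (Sum.inl (e, ⟨j + 1, hj⟩)) =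
      fL (Sum.inl (e, ⟨j, by omega⟩)) - fR (Sum.inl (e, ⟨j, by omega⟩)) := by
  classical
  have hn := h.norm_lt e (j + 1) (by omega) hj
  have key := h.nonCrossing.flux_eq_zero Metric.isOpen_ball hf hs (p := Q e (j + 1))
    (by rw [mem_ball_zero_iff]; linarith)
  have h1 : ∀ x : Fin m × Fin K, Q x.1 x.2 = Q e (j + 1) ↔ (e, (⟨j + 1, hj⟩ : Fin K)) = x := by
    rintro ⟨f, i⟩
    constructor
    · intro he
      obtain ⟨rfl, h3⟩ := h.inj e (j + 1) f i (by omega) hj i.2.le he.symm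
      exact Prod.ext rfl (Fin.ext h3)
    · intro he
      cases he
      rfl
  have h2 : ∀ x : Fin m × Fin K,
      Q x.1 (x.2 + 1) = Q e (j + 1) ↔ (e, (⟨j, by omega⟩ : Fin K)) = x := by
    rintro ⟨f, i⟩
    constructor
    · intro he
      obtain ⟨rfl, h3⟩ := h.inj e (j + 1) f (i + 1) (by omega) hj i.2 he.symm
      exact Prod.ext rfl (Fin.ext (by simpa using h3))
    · intro he
      cases he
      rfl
  have h3 : ∀ u, pos (Sum.inl u) ≠ Q e (j + 1) := fun u he => h.ne_pos e _ (by omega) hj _ he.symm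
  have h4 : ∀ u, ((2 : ℝ) : ℂ) * pos (Sum.inl u) ≠ Q e (j + 1) := by
    intro u he
    rw [← he, norm_mul, h.norm_inl, Complex.norm_real] at hn
    norm_num at hn
  rw [Fintype.sum_sum_type] at key
  simp only [segSrc, segTgt, Sum.elim_inl, Sum.elim_inr, h1, h2, h3, h4, if_false, sub_zero,
    Finset.sum_const_zero, add_zero, Finset.sum_sub_distrib, Finset.sum_ite_eq, Finset.mem_univ,
    if_true] at key
  linarith

theorem flux_const (h : N.PolyDrawing pos θ K Q) {f : ℂ → ℝ}
    (hf : LocConstOn f (Metric.ball 0 2 \ ⋃ x, segment ℝ (N.segSrc pos K Q x) (N.segTgt pos K Q x)))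
    {fL fR : (Fin m × Fin K) ⊕ Fin b → ℝ}
    (hs : SideValues (N.segSrc pos K Q) (N.segTgt pos K Q) f fL fR) (e : Fin m) (j : Fin K) :
    fL (Sum.inl (e, j)) - fR (Sum.inl (e, j)) =
      fL (Sum.inl (e, ⟨0, h.K_pos⟩)) - fR (Sum.inl (e, ⟨0, h.K_pos⟩)) := by
  obtain ⟨j, hj⟩ := j
  induction j with
  | zero => rfl
  | succ j ih => rw [h.flux_succ hf hs e hj, ih]

-- At the position of a vertex the only segments that end are the first ones of the edges leaving
-- it, the last ones of the edges entering it and its radial segment. By `flux_const` the jump is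
-- the same on all the pieces of an edge.
open Classical in
theorem flux_pos (h : N.PolyDrawing pos θ K Q) {f : ℂ → ℝ}
    (hf : LocConstOn f (Metric.ball 0 2 \ ⋃ x, segment ℝ (N.segSrc pos K Q x) (N.segTgt pos K Q x)))
    {fL fR : (Fin m × Fin K) ⊕ Fin b → ℝ}
    (hs : SideValues (N.segSrc pos K Q) (N.segTgt pos K Q) f fL fR) {s : Fin m → ℝ}
    (hsdef : ∀ e, s e = fL (Sum.inl (e, ⟨0, h.K_pos⟩)) - fR (Sum.inl (e, ⟨0, h.K_pos⟩)))
    (v : N.Vertex) :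
    ∑ e, ((if N.src e = v then s e else 0) - (if N.tgt e = v then s e else 0)) =
      -∑ u, if Sum.inl u = v then fL (Sum.inr u) - fR (Sum.inr u) else 0 := by
  have key := h.nonCrossing.flux_eq_zero Metric.isOpen_ball hf hs (p := pos v)
    (by rw [mem_ball_zero_iff]; linarith [h.norm_pos_le v])
  have h4 : ∀ u, ((2 : ℝ) : ℂ) * pos (Sum.inl u) ≠ pos v := by
    intro u he
    have hn := h.norm_pos_le v
    rw [← he, norm_mul, h.norm_inl, Complex.norm_real] at hn
    norm_num at hn
  have h1 : ∀ e, ∑ j : Fin K, (if Q e j = pos v then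
      fL (Sum.inl (e, j)) - fR (Sum.inl (e, j)) else 0) = if N.src e = v then s e else 0 := by
    intro e
    rw [Finset.sum_eq_single (⟨0, h.K_pos⟩ : Fin K)]
    · simp only [h.Q_eq_pos_iff e h.K_pos, true_and, hsdef]
    · intro j _ hj
      rw [if_neg]
      rw [h.Q_eq_pos_iff e j.2]
      exact fun h5 => hj (Fin.ext h5.1)
    · simp
  have h2 : ∀ e, ∑ j : Fin K, (if Q e (j + 1) = pos v then
      fL (Sum.inl (e, j)) - fR (Sum.inl (e, j)) else 0) = if N.tgt e = v then s e else 0 := by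
    intro e
    have hK := h.K_pos
    rw [Finset.sum_eq_single (⟨K - 1, by omega⟩ : Fin K)]
    · have h5 : K - 1 + 1 = K := by omega
      have h6 := h.Q_succ_eq_pos_iff e (show K - 1 < K by omega) v
      rw [h5] at h6
      simp only [h5, h6, true_and, hsdef,
        h.flux_const hf hs e ⟨K - 1, by omega⟩]
    · intro j _ hj
      rw [if_neg]
      rw [h.Q_succ_eq_pos_iff e j.2]
      exact fun h5 => hj (Fin.ext (by have := h5.1; simp only; omega))
    · simp
  rw [Fintype.sum_sum_type, Fintype.sum_prod_type] at key
  have key' : ∑ e, ∑ j : Fin K,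
      ((if Q e j = pos v then fL (Sum.inl (e, j)) - fR (Sum.inl (e, j)) else 0) -
        if Q e (j + 1) = pos v then fL (Sum.inl (e, j)) - fR (Sum.inl (e, j)) else 0) +
      ∑ u, ((if pos (Sum.inl u) = pos v then fL (Sum.inr u) - fR (Sum.inr u) else 0) -
        if ((2 : ℝ) : ℂ) * pos (Sum.inl u) = pos v then fL (Sum.inr u) - fR (Sum.inr u) else 0) =
      0 := key
  simp only [h4, if_false, sub_zero, Finset.sum_sub_distrib, h1, h2, h.pos_inj.eq_iff] at key'
  rw [Finset.sum_sub_distrib]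
  linarith

/-- The flow function of a planar network: it differs by the current on the two sides of an edge,
and the flux of every function of it is conserved. -/
theorem exists_flow (h : N.PolyDrawing pos θ K Q) {V : N.Vertex → ℝ}
    (hV : ∀ k, N.outflow V (Sum.inr k) = 0) :
    ∃ (A B : Fin m → ℝ) (XL XR : Fin b → ℝ),
      (∀ e, A e - B e = N.current V e) ∧
      (∀ u, XL u - XR u = -N.outflow V (Sum.inl u)) ∧
      (∀ u w : Fin b, (w : ℕ) = u + 1 → XR w = XL u) ∧
      ∀ g φ : ℝ → ℝ, ∑ e, (g (A e) - g (B e)) * (φ (V (N.src e)) - φ (V (N.tgt e))) =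
        ∑ u, φ (V (Sum.inl u)) * (g (XR u) - g (XL u)) := by
  classical
  have hcl := h.closedChain hV
  have hlc := hcl.locConstOn
  obtain ⟨fL, fR, hs⟩ := h.nonCrossing.exists_sideValues Metric.isOpen_ball hlc h.openSegment_subset
  have hjump : ∀ x, fL x - fR x = N.segCurrent V K x := by
    intro x
    obtain ⟨p, hp, -⟩ := exists_openSegment_mem_ball_left (N.segSrc pos K Q x) (N.segTgt pos K Q x)
      one_pos
    refine ContinuousAt.exists_pot_jump
      (h.hasDerivAt_sourcePot V (h.openSegment_subset x hp)).continuousAt (h.nonCrossing.ne x) hp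
      (h.nonCrossing.disj x p hp) ((hs x p hp).mono fun z hz => hz.1)
      ((hs x p hp).mono fun z hz => hz.2)
  refine ⟨fun e => fL (Sum.inl (e, ⟨0, h.K_pos⟩)), fun e => fR (Sum.inl (e, ⟨0, h.K_pos⟩)),
    fun u => fL (Sum.inr u), fun u => fR (Sum.inr u), fun e => hjump _, fun u => hjump _,
    fun u w huw => h.sector hlc hs huw, fun g φ => ?_⟩
  -- The composition with g keeps the flow function locally constant, so conservation holds for g of
  -- its values as well. This freedom in g is what later permits counting rectangles.
  have h1 := h.flux_pos (hlc.comp g) (hs.comp g) (fun e => rfl)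
  simp only [Function.comp_apply] at h1
  beta_reduce
  rw [N.sum_mul_sub (fun e => g (fL (Sum.inl (e, ⟨0, h.K_pos⟩))) -
    g (fR (Sum.inl (e, ⟨0, h.K_pos⟩)))) (fun v => φ (V v))]
  simp only [h1]
  simp only [mul_neg, Finset.mul_sum, mul_ite, mul_zero]
  rw [Finset.sum_neg_distrib, Finset.sum_comm]
  simp only [Finset.sum_ite_eq, Finset.mem_univ, if_true]
  rw [← Finset.sum_neg_distrib]
  refine Finset.sum_congr rfl fun u _ => ?_
  ring

end PolyDrawing

end ElectricalNetwork

/-! ### From circuits to tilings -/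

theorem OrthoLoop.notMem_trace {v : ℕ → ℂ} {b : ℕ} (h : OrthoLoop v b) {z : ℂ}
    (hx : ∀ i, (v i).re ≠ z.re) (hy : ∀ i, (v i).im ≠ z.im) : z ∉ loopTrace v (2 * b) := by
  intro hm
  obtain ⟨i, -, hseg⟩ := h.mem_trace_iff.1 hm
  have hre := re_mem_uIcc hseg
  have him := im_mem_uIcc hseg
  rcases Nat.even_or_odd' i with ⟨u, rfl | rfl⟩
  · rw [h.horiz u, uIcc_self, mem_singleton_iff] at him
    exact hy _ him.symm
  · rw [h.vert u, uIcc_self, mem_singleton_iff] at hre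
    exact hx _ hre.symm

theorem Rect.interior_toSet (R : Rect) :
    interior R.toSet = Ioo R.left R.right ×ˢ Ioo R.bottom R.top := by
  rw [Rect.toSet, interior_prod_eq, interior_Icc, interior_Icc]

theorem Rect.isClosed_toSet (R : Rect) : IsClosed R.toSet := isClosed_Icc.prod isClosed_Icc

theorem Rect.toSet_eq_closure (R : Rect) : R.toSet = closure (interior R.toSet) := by
  rw [R.interior_toSet, closure_prod_eq, closure_Ioo R.left_lt_right.ne,
    closure_Ioo R.bottom_lt_top.ne, Rect.toSet]

open Classical in
/-- A family of rectangles that covers almost every point as often as the curve winds around it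
is a tiling. -/
theorem OrthoLoop.tiling_of_count {v : ℕ → ℂ} {b m : ℕ} (h : OrthoLoop v b) (R : Fin m → Rect)
    {D : Set (ℝ × ℝ)} (hD : Dense D) (hDx : ∀ p ∈ D, ∀ i, (v i).re ≠ p.1)
    (hDy : ∀ p ∈ D, ∀ i, (v i).im ≠ p.2)
    (hcount : ∀ p ∈ D, ∑ e, (if p ∈ (R e).toSet then (1 : ℝ) else 0) = wnd v (2 * b) (toC p)) :
    (⋃ e, (R e).toSet) = toC ⁻¹' loopRegion v (2 * b) ∧
      ∀ e f, e ≠ f → Disjoint (interior (R e).toSet) (interior (R f).toSet) := by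
  have hnot : ∀ p ∈ D, toC p ∉ loopTrace v (2 * b) := fun p hp =>
    h.notMem_trace (z := toC p) (hDx p hp) (hDy p hp)
  have hnonneg : ∀ (p : ℝ × ℝ) (e : Fin m), (0 : ℝ) ≤ if p ∈ (R e).toSet then 1 else 0 := by
    intro p e
    split_ifs <;> norm_num
  -- All three claims are checked on the dense set D and extended by closures. The winding number is
  -- 0 or 1: a positive count means being inside, winding number 1 forces a positive count, and two
  -- overlapping interiors would give a count of at least 2.
  refine ⟨Subset.antisymm (iUnion_subset fun e => ?_) ?_, fun e f hef => ?_⟩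
  · rw [(R e).toSet_eq_closure]
    refine (closure_mono (hD.open_subset_closure_inter isOpen_interior)).trans ?_
    rw [closure_closure]
    refine closure_minimal ?_ (h.isClosed_region.preimage toC.continuous)
    rintro p ⟨hp, hpD⟩
    right
    refine ⟨hnot p hpD, ?_⟩
    rcases h.wnd_eq_or (hnot p hpD) with h0 | h0
    · exact h0
    · exfalso
      rw [← hcount p hpD, Finset.sum_eq_zero_iff_of_nonneg fun e _ => hnonneg p e] at h0
      have := h0 e (Finset.mem_univ _)
      rw [if_pos (interior_subset hp)] at this
      exact one_ne_zero this
  · have hop : IsOpen (toC ⁻¹' {z | z ∉ loopTrace v (2 * b) ∧ wnd v (2 * b) z = 1}) :=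
      h.isOpen_inside.preimage toC.continuous
    have h1 : toC ⁻¹' loopRegion v (2 * b) ⊆
        closure (toC ⁻¹' {z | z ∉ loopTrace v (2 * b) ∧ wnd v (2 * b) z = 1}) := by
      have := toC.toHomeomorph.preimage_closure
        {z | z ∉ loopTrace v (2 * b) ∧ wnd v (2 * b) z = 1}
      intro p hp
      have h2 : p ∈ toC.toHomeomorph ⁻¹' closure
        {z | z ∉ loopTrace v (2 * b) ∧ wnd v (2 * b) z = 1} := h.region_subset_closure hp
      rw [this] at h2
      exact h2
    refine h1.trans ((closure_mono (hD.open_subset_closure_inter hop)).trans ?_)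
    rw [closure_closure]
    refine closure_minimal ?_ (isClosed_iUnion_of_finite fun e => (R e).isClosed_toSet)
    rintro p ⟨hp, hpD⟩
    by_contra hc
    have h2 := hcount p hpD
    rw [hp.2, Finset.sum_eq_zero] at h2
    · exact zero_ne_one h2
    · intro e _
      rw [if_neg fun he => hc (mem_iUnion.2 ⟨e, he⟩)]
  · by_contra hc
    rw [not_disjoint_iff_nonempty_inter] at hc
    obtain ⟨p, hp, hpD⟩ := hD.inter_open_nonempty _ (isOpen_interior.inter isOpen_interior) hc
    have h1 : ∑ g ∈ ({e, f} : Finset (Fin m)), (if p ∈ (R g).toSet then (1 : ℝ) else 0) ≤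
        ∑ g, if p ∈ (R g).toSet then (1 : ℝ) else 0 :=
      Finset.sum_le_sum_of_subset_of_nonneg (Finset.subset_univ _) fun g _ _ => hnonneg p g
    rw [Finset.sum_pair hef, if_pos (interior_subset hp.1), if_pos (interior_subset hp.2),
      hcount p hpD] at h1
    rcases h.wnd_eq_or (hnot p hpD) with h0 | h0 <;> rw [h0] at h1 <;> norm_num at h1

theorem dense_avoiding (X Y : Finset ℝ) : Dense {p : ℝ × ℝ | p.1 ∉ X ∧ p.2 ∉ Y} := by
  have h1 := (X.finite_toSet.countable.dense_compl ℝ).prod (Y.finite_toSet.countable.dense_compl ℝ)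
  exact h1

/-- The sign of two differences with the same sign. -/
theorem indicator_mul_indicator {A B a c x y : ℝ} (hs : 0 < (A - B) * (a - c))
    (hxA : x ≠ A) (hxB : x ≠ B) (hya : y ≠ a) (hyc : y ≠ c) :
    ((if x < A then (1 : ℝ) else 0) - if x < B then 1 else 0) *
      ((if y < a then 1 else 0) - if y < c then 1 else 0) =
    if (min A B ≤ x ∧ x ≤ max A B) ∧ (min a c ≤ y ∧ y ≤ max a c) then 1 else 0 := by
  have h1 : A < B ∧ a < c ∨ B < A ∧ c < a := by
    rcases mul_pos_iff.1 hs with h | h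
    · exact Or.inr ⟨by linarith, by linarith⟩
    · exact Or.inl ⟨by linarith, by linarith⟩
  have e : ∀ p q r : ℝ, r ≠ p → r ≠ q → p < q →
      ((min p q ≤ r ∧ r ≤ max p q) ↔ (¬ r < p ∧ r < q)) := by
    intro p q r h1 h2 h3
    rw [min_eq_left h3.le, max_eq_right h3.le, not_lt]
    exact and_congr_right fun _ => ⟨fun h => lt_of_le_of_ne h h2, le_of_lt⟩
  rcases h1 with ⟨h1, h2⟩ | ⟨h1, h2⟩
  · simp only [e A B x hxA hxB h1, e a c y hya hyc h2]
    by_cases h3 : x < A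
    · simp [h3, h3.trans h1]
    · by_cases h4 : y < a
      · simp [h4, h4.trans h2]
      · by_cases h5 : x < B <;> by_cases h6 : y < c <;> simp [h3, h4, h5, h6]
  · simp only [min_comm A, max_comm A, min_comm a, max_comm a, e B A x hxB hxA h1,
      e c a y hyc hya h2]
    by_cases h3 : x < B
    · simp [h3, h3.trans h1]
    · by_cases h4 : y < c
      · simp [h4, h4.trans h2]
      · by_cases h5 : x < A <;> by_cases h6 : y < a <;> simp [h3, h4, h5, h6]

/-- The rectangle of an edge is bounded horizontally by the values of the flow function on its two
sides and vertically by the voltages at its ends. Ohm's law makes its ratio equal to the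
conductance, and essential edges of positive conductance give nondegenerate rectangles. -/
theorem canBeTiled_of_isPlanar {b m : ℕ} (hb : 2 ≤ b) {P : Polygon (ℝ × ℝ) (2 * b)}
    (hsimple : P.IsSimple) (horth : P.IsOrthogonal) (hccw : P.IsCounterclockwise)
    (hgeneric : P.IsGeneric) {c : Fin m → ℝ} {N : ElectricalNetwork b m} {V : N.Vertex → ℝ}
    (hN : N.IsPlanar) (hc : ∀ e, N.cond e = c e ∧ 0 < c e) (hV : N.IsVoltage P.height V)
    (hess : ∀ e, N.current V e ≠ 0) (hout : ∀ u, N.outflow V (Sum.inl u) = P.signedLength u) :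
    CanBeTiled P.region c := by
  classical
  have hn : 0 < 2 * b := by omega
  have h := Polygon.orthoLoop hsimple horth hccw hgeneric hb
  set v := P.loop hn with hv
  obtain ⟨pos, θ, K, Q, hQ⟩ := hN.exists_polyDrawing
  obtain ⟨A, B, XL, XR, hAB, hX, hXX, hflow⟩ := hQ.exists_flow hV.2
  have hX' : ∀ u, XL u - XR u = (v (2 * u + 1)).re - (v (2 * u)).re := by
    intro u
    rw [hX, hout, Polygon.signedLength_eq hsimple horth hccw hgeneric hb]
    ring
  set d : ℝ := (v 1).re - XL ⟨0, by omega⟩ with hd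
  have hXL : ∀ u : ℕ, ∀ hu : u < b, XL ⟨u, hu⟩ + d = (v (2 * u + 1)).re := by
    intro u
    induction u with
    | zero => intro hu; rw [hd]; simp
    | succ u ih =>
      intro hu
      have h1 := hXX ⟨u, by omega⟩ ⟨u + 1, hu⟩ rfl
      have h2 := ih (by omega)
      have h3 := hX' ⟨u + 1, hu⟩
      have h4 := h.vert u
      rw [show 2 * u + 2 = 2 * (u + 1) by ring] at h4
      simp only at h3
      linarith
  have hXR : ∀ u : Fin b, XR u + d = (v (2 * u)).re := by
    intro u
    have h1 := hXL u u.2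
    have h3 := hX' u
    simp only [Fin.eta] at h1
    linarith
  have hdiff : ∀ e, A e - B e = c e * (V (N.src e) - V (N.tgt e)) := by
    intro e
    rw [hAB, ElectricalNetwork.current, (hc e).1]
  have hne : ∀ e, V (N.src e) - V (N.tgt e) ≠ 0 ∧ A e - B e ≠ 0 := by
    intro e
    have h1 := hess e
    rw [← hAB] at h1
    refine ⟨fun h2 => h1 ?_, h1⟩
    rw [hdiff, h2, mul_zero]
  have hs : ∀ e, 0 < ((A e + d) - (B e + d)) * (V (N.src e) - V (N.tgt e)) := by
    intro e
    rw [add_sub_add_right_eq_sub, hdiff, mul_assoc]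
    exact mul_pos (hc e).2 (mul_self_pos.2 (hne e).1)
  set R : Fin m → Rect := fun e =>
    { left := min (A e + d) (B e + d)
      right := max (A e + d) (B e + d)
      bottom := min (V (N.src e)) (V (N.tgt e))
      top := max (V (N.src e)) (V (N.tgt e))
      left_lt_right := min_lt_max.2 fun h1 => (hne e).2 (by linarith)
      bottom_lt_top := min_lt_max.2 fun h1 => (hne e).1 (by linarith) } with hR
  set X : Finset ℝ := ((Finset.range (2 * b)).image fun i => (v i).re) ∪
    (Finset.univ.image (fun e => A e + d) ∪ Finset.univ.image (fun e => B e + d)) with hXdef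
  set Y : Finset ℝ := ((Finset.range (2 * b)).image fun i => (v i).im) ∪
    Finset.univ.image V with hYdef
  have hvX : ∀ i, (v i).re ∈ X := fun i => Finset.mem_union_left _ (Finset.mem_image.2
    ⟨i % (2 * b), Finset.mem_range.2 (Nat.mod_lt _ hn), by rw [h.mod]⟩)
  have hvY : ∀ i, (v i).im ∈ Y := fun i => Finset.mem_union_left _ (Finset.mem_image.2
    ⟨i % (2 * b), Finset.mem_range.2 (Nat.mod_lt _ hn), by rw [h.mod]⟩)
  have hAX : ∀ e, A e + d ∈ X := fun e => Finset.mem_union_right _ (Finset.mem_union_left _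
    (Finset.mem_image_of_mem _ (Finset.mem_univ e)))
  have hBX : ∀ e, B e + d ∈ X := fun e => Finset.mem_union_right _ (Finset.mem_union_right _
    (Finset.mem_image_of_mem _ (Finset.mem_univ e)))
  have hVY : ∀ w, V w ∈ Y := fun w => Finset.mem_union_right _
    (Finset.mem_image_of_mem _ (Finset.mem_univ w))
  have hmain := h.tiling_of_count R (dense_avoiding X Y)
    (fun p hp i he => hp.1 (he ▸ hvX i)) (fun p hp i he => hp.2 (he ▸ hvY i)) (fun p hp => by
      -- With these step functions the term of an edge is the indicator of its rectangle at p, and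
      -- the boundary sum is the formula for the winding number.
      have h1 := hflow (fun s => if p.1 < s + d then 1 else 0) (fun s => if p.2 < s then 1 else 0)
      rw [h.wnd_eq_sum (z := toC p) (fun i he => hp.1 ((show (v i).re = p.1 from he) ▸ hvX i))
        (fun i he => hp.2 ((show (v i).im = p.2 from he) ▸ hvY i))]
      have h2 : ∀ e, (if p ∈ (R e).toSet then (1 : ℝ) else 0) =
          ((if p.1 < A e + d then (1 : ℝ) else 0) - if p.1 < B e + d then 1 else 0) *
          ((if p.2 < V (N.src e) then 1 else 0) - if p.2 < V (N.tgt e) then 1 else 0) := by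
        intro e
        rw [indicator_mul_indicator (x := p.1) (y := p.2) (hs e) (fun he => hp.1 (he ▸ hAX e))
          (fun he => hp.1 (he ▸ hBX e)) (fun he => hp.2 (he ▸ hVY _))
          (fun he => hp.2 (he ▸ hVY _))]
        exact if_congr Iff.rfl rfl rfl
      rw [Finset.sum_congr rfl fun e _ => h2 e, h1]
      refine Finset.sum_congr rfl fun u _ => ?_
      have h3 := hXL u u.2
      simp only [Fin.eta] at h3
      rw [hV.1, Polygon.height_eq hn, hXR, h3, ite_mul, one_mul, zero_mul]
      rfl)
  refine ⟨R, fun e => ?_, ?_, hmain.2⟩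
  · simp only [Rect.ratio, hR]
    rw [max_sub_min_eq_abs, max_sub_min_eq_abs, ← abs_div,
      show B e + d - (A e + d) = c e * (V (N.tgt e) - V (N.src e)) by linarith [hdiff e],
      mul_div_assoc, div_self, mul_one, abs_of_pos (hc e).2]
    intro h1
    exact (hne e).1 (by linarith)
  · rw [hmain.1]
    ext p
    rw [mem_preimage, Polygon.mem_region_iff_loopRegion hsimple hccw hb]

/-! ### Mapping a polygon to the disc -/

/-- The double area of an inscribed triangle is 4 times the product of the sines of the halves of β
- α, γ - β and γ - α, and all these halves are in (0, π). -/
theorem cr_exp {α β γ : ℝ} (h1 : α < β) (h2 : β < γ) (h3 : γ < α + 2 * Real.pi) :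
    0 < cr (Complex.exp (α * Complex.I)) (Complex.exp (β * Complex.I))
      (Complex.exp (γ * Complex.I)) := by
  have e : cr (Complex.exp (α * Complex.I)) (Complex.exp (β * Complex.I))
      (Complex.exp (γ * Complex.I)) =
      4 * Real.sin ((β - α) / 2) * Real.sin ((γ - β) / 2) * Real.sin ((γ - α) / 2) := by
    have hα : α = (α + β) / 2 - (β - α) / 2 := by ring
    set p := (β - α) / 2 with hp
    set q := (γ - β) / 2 with hq
    have e1 : (γ - α) / 2 = p + q := by rw [hp, hq]; ring
    have e2 : β = α + 2 * p := by rw [hp]; ring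
    have e3 : γ = α + 2 * (p + q) := by rw [hp, hq]; ring
    have key : cr (Complex.exp (α * Complex.I)) (Complex.exp (β * Complex.I))
        (Complex.exp (γ * Complex.I)) =
        Real.sin (β - α) + Real.sin (γ - β) - Real.sin (γ - α) := by
      simp only [cr, Complex.exp_ofReal_mul_I_re, Complex.exp_ofReal_mul_I_im, Real.sin_sub]
      ring
    rw [key, e1, e2, e3, show α + 2 * p - α = 2 * p by ring,
      show α + 2 * (p + q) - (α + 2 * p) = 2 * q by ring,
      show α + 2 * (p + q) - α = 2 * (p + q) by ring, Real.sin_two_mul, Real.sin_two_mul,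
      Real.sin_two_mul, Real.sin_add, Real.cos_add]
    linear_combination (-2 * Real.sin p * Real.cos p) * Real.sin_sq_add_cos_sq q -
      (2 * Real.sin q * Real.cos q) * Real.sin_sq_add_cos_sq p
  rw [e]
  have s1 := Real.sin_pos_of_pos_of_lt_pi (show 0 < (β - α) / 2 by linarith) (by linarith)
  have s2 := Real.sin_pos_of_pos_of_lt_pi (show 0 < (γ - β) / 2 by linarith) (by linarith)
  have s3 := Real.sin_pos_of_pos_of_lt_pi (show 0 < (γ - α) / 2 by linarith) (by linarith)
  positivity

/-- Strict convexity of the disc. For w = `baryPt Q l` the weighted mean of the inner products of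
the points with w is ‖w‖², and each of them is at most ‖w‖. If ‖w‖ ≥ 1, equality forces every point
of nonzero weight to be w, but no such point stands alone. -/
theorem norm_baryPt_lt_one {ι : Type*} [Fintype ι] {Q : ι → ℂ} (hQ : ∀ i, ‖Q i‖ = 1)
    {l : ι → ℝ} (h0 : ∀ i, 0 ≤ l i) (h1 : ∑ i, l i = 1)
    (h : ∀ i, l i ≠ 0 → ∃ j, l j ≠ 0 ∧ Q j ≠ Q i) : ‖baryPt Q l‖ < 1 := by
  set w := baryPt Q l with hw
  have hsum : ∑ i, l i * ((Q i).re * w.re + (Q i).im * w.im) = ‖w‖ ^ 2 := by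
    rw [← Complex.normSq_eq_norm_sq, Complex.normSq_apply]
    conv_rhs => rw [hw, baryPt_re, baryPt_im, ← baryPt_re, ← baryPt_im, ← hw]
    nth_rewrite 3 [hw]
    nth_rewrite 4 [hw]
    rw [baryPt_re, baryPt_im, Finset.sum_mul, Finset.sum_mul, ← Finset.sum_add_distrib]
    refine Finset.sum_congr rfl fun i _ => by ring
  have hle : ∀ i, (Q i).re * w.re + (Q i).im * w.im ≤ ‖w‖ := by
    intro i
    have h2 := Complex.re_le_norm ((starRingEnd ℂ) (Q i) * w)
    rw [norm_mul, Complex.norm_conj, hQ, one_mul, Complex.mul_re, Complex.conj_re,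
      Complex.conj_im] at h2
    linarith
  by_contra hc
  push Not at hc
  have hle1 : ‖w‖ ≤ 1 := by
    have : ‖w‖ ^ 2 ≤ ‖w‖ := by
      rw [← hsum]
      calc ∑ i, l i * ((Q i).re * w.re + (Q i).im * w.im) ≤ ∑ i, l i * ‖w‖ :=
            Finset.sum_le_sum fun i _ => mul_le_mul_of_nonneg_left (hle i) (h0 i)
        _ = ‖w‖ := by rw [← Finset.sum_mul, h1, one_mul]
    nlinarith
  have hw1 : ‖w‖ = 1 := le_antisymm hle1 hc
  have hall : ∀ i, l i ≠ 0 → Q i = w := by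
    have h2 : ∑ i, l i * (1 - ((Q i).re * w.re + (Q i).im * w.im)) = 0 := by
      simp_rw [mul_sub, mul_one]
      rw [Finset.sum_sub_distrib, h1, hsum, hw1]
      norm_num
    rw [Finset.sum_eq_zero_iff_of_nonneg fun i _ => mul_nonneg (h0 i) (by linarith [hle i])] at h2
    intro i hi
    have h3 := (mul_eq_zero.1 (h2 i (Finset.mem_univ i))).resolve_left hi
    have n1 := Complex.normSq_eq_norm_sq (Q i)
    have n2 := Complex.normSq_eq_norm_sq w
    rw [hQ, Complex.normSq_apply] at n1
    rw [hw1, Complex.normSq_apply] at n2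
    have h4 : ((Q i).re - w.re) ^ 2 + ((Q i).im - w.im) ^ 2 = 0 := by nlinarith
    apply Complex.ext
    · nlinarith [sq_nonneg ((Q i).re - w.re), sq_nonneg ((Q i).im - w.im)]
    · nlinarith [sq_nonneg ((Q i).re - w.re), sq_nonneg ((Q i).im - w.im)]
  obtain ⟨i, -, hi⟩ := Finset.exists_ne_zero_of_sum_ne_zero (s := Finset.univ) (f := l)
    (by rw [h1]; exact one_ne_zero)
  obtain ⟨j, hj, hne⟩ := h i hi
  exact hne ((hall j hj).trans (hall i hi).symm)

/-- `Φ` is affine on `K`. -/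
def AffineOn (Φ : ℂ → ℂ) (K : Set ℂ) : Prop :=
  ∀ z ∈ K, ∀ w ∈ K, ∀ θ ∈ Icc (0 : ℝ) 1,
    Φ (AffineMap.lineMap z w θ) = AffineMap.lineMap (Φ z) (Φ w) θ

theorem isPiecewiseLinear_comp {κ : Type*} [Finite κ] {Φ : ℂ → ℂ} {𝒦 : κ → Set ℂ}
    (hconv : ∀ k, Convex ℝ (𝒦 k)) (hcl : ∀ k, IsClosed (𝒦 k)) (haff : ∀ k, AffineOn Φ (𝒦 k))
    {ρ : ℝ → ℂ} (hρ : IsPiecewiseLinear ρ) (hcov : ∀ t ∈ Icc (0 : ℝ) 1, ∃ k, ρ t ∈ 𝒦 k) :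
    IsPiecewiseLinear (Φ ∘ ρ) := by
  classical
  have := Fintype.ofFinite κ
  obtain ⟨s, hs⟩ := hρ
  obtain ⟨K, τ, hK, hτ0, hτK, hτ, hτs⟩ := exists_subdivision s
  have hmono : ∀ i j, i ≤ j → j ≤ K → τ i ≤ τ j := fun i j h1 h2 => by
    rcases h1.lt_or_eq with h | rfl
    · exact (hτ i j h h2).le
    · exact le_rfl
  have hτ01 : ∀ j ≤ K, τ j ∈ Icc (0 : ℝ) 1 := fun j hj =>
    ⟨hτ0 ▸ hmono 0 j j.zero_le hj, hτK ▸ hmono j K hj le_rfl⟩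
  have hpiece : ∀ j < K, ∀ a c, τ j ≤ a → a ≤ c → c ≤ τ (j + 1) → ∀ θ ∈ Icc (0 : ℝ) 1,
      ρ (AffineMap.lineMap a c θ) = AffineMap.lineMap (ρ a) (ρ c) θ := by
    intro j hj a c h1 h2 h3
    refine hs a c ((hτ01 j hj.le).1.trans h1) h2 (h3.trans (hτ01 (j + 1) hj).2) fun t ht hm => ?_
    exact hτs t ht j hj ⟨h1.trans_lt hm.1, hm.2.trans_le h3⟩
  set J : ℕ → κ → Set ℝ := fun j k => {t | t ∈ Icc (τ j) (τ (j + 1)) ∧ ρ t ∈ 𝒦 k} with hJ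
  have hJconv : ∀ j < K, ∀ k, ∀ t1 ∈ J j k, ∀ t2 ∈ J j k, ∀ t, t1 ≤ t → t ≤ t2 → t ∈ J j k := by
    intro j hj k t1 h1 t2 h2 t h3 h4
    refine ⟨⟨h1.1.1.trans h3, h4.trans h2.1.2⟩, ?_⟩
    have : t ∈ segment ℝ t1 t2 := by rw [segment_eq_Icc (h3.trans h4)]; exact ⟨h3, h4⟩
    rw [segment_eq_image_lineMap] at this
    obtain ⟨θ, hθ, rfl⟩ := this
    rw [hpiece j hj t1 t2 h1.1.1 (h3.trans h4) h2.1.2 θ hθ]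
    exact (hconv k).segment_subset h1.2 h2.2 (mem_segment_iff_lineMap.2 ⟨θ, hθ, rfl⟩)
  have hJcl : ∀ j < K, ∀ k, IsCompact (J j k) := by
    intro j hj k
    have hlt := hτ j (j + 1) (by omega) hj
    have hcont : ContinuousOn ρ (Icc (τ j) (τ (j + 1))) := by
      have h1 : Continuous fun t : ℝ => (AffineMap.lineMap (ρ (τ j)) (ρ (τ (j + 1)))
          ((t - τ j) / (τ (j + 1) - τ j)) : ℂ) :=
        AffineMap.lineMap_continuous.comp (by fun_prop)
      refine h1.continuousOn.congr fun t ht => ?_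
      have h2 : t = AffineMap.lineMap (τ j) (τ (j + 1)) ((t - τ j) / (τ (j + 1) - τ j)) := by
        rw [AffineMap.lineMap_apply]
        have : τ (j + 1) - τ j ≠ 0 := by linarith
        simp only [vsub_eq_sub, vadd_eq_add, smul_eq_mul]
        field_simp
        ring
      beta_reduce
      conv_lhs => rw [h2]
      refine hpiece j hj _ _ le_rfl hlt.le le_rfl _ ⟨div_nonneg (by linarith [ht.1]) (by linarith),
        (div_le_one (by linarith)).2 (by linarith [ht.2])⟩
    exact isCompact_Icc.of_isClosed_subset (hcont.preimage_isClosed_of_isClosed isClosed_Icc (hcl k))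
      fun t ht => ht.1
  -- Within a linear piece of ρ the parameters that lead to a closed convex set 𝒦 k form a compact
  -- interval `J j k`. The ends of all these intervals are added to the breakpoints; an empty
  -- interval adds only the harmless default value 0.
  refine ⟨(Finset.range (K + 1)).image τ ∪ (Finset.range K ×ˢ Finset.univ).image
    (fun x : ℕ × κ => sInf (J x.1 x.2)) ∪ (Finset.range K ×ˢ Finset.univ).image
    (fun x : ℕ × κ => sSup (J x.1 x.2)), fun a c ha hac hc hbr θ hθ => ?_⟩
  rcases hac.eq_or_lt with rfl | hlt
  · simp
  have hτbr : ∀ j ≤ K, τ j ∉ Ioo a c := fun j hj => hbr _ (by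
    simp only [Finset.mem_union, Finset.mem_image, Finset.mem_range]
    exact Or.inl (Or.inl ⟨j, by omega, rfl⟩))
  have hinf : ∀ j < K, ∀ k, sInf (J j k) ∉ Ioo a c := fun j hj k => hbr _ (by
    simp only [Finset.mem_union, Finset.mem_image, Finset.mem_product, Finset.mem_range]
    exact Or.inl (Or.inr ⟨(j, k), ⟨hj, Finset.mem_univ _⟩, rfl⟩))
  have hsup : ∀ j < K, ∀ k, sSup (J j k) ∉ Ioo a c := fun j hj k => hbr _ (by
    simp only [Finset.mem_union, Finset.mem_image, Finset.mem_product, Finset.mem_range]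
    exact Or.inr ⟨(j, k), ⟨hj, Finset.mem_univ _⟩, rfl⟩)
  obtain ⟨j, hj, hja, hjc⟩ : ∃ j < K, τ j ≤ a ∧ c ≤ τ (j + 1) := by
    set j := Nat.findGreatest (fun i => τ i ≤ a) K with hjdef
    have h1 : τ j ≤ a := Nat.findGreatest_spec (P := fun i => τ i ≤ a) (m := 0) K.zero_le
      (by rw [hτ0]; exact ha)
    have h2 : j ≤ K := Nat.findGreatest_le K
    have h3 : j < K := by
      refine lt_of_le_of_ne h2 fun h => ?_
      rw [h, hτK] at h1
      linarith
    refine ⟨j, h3, h1, ?_⟩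
    have h4 : a < τ (j + 1) := by
      by_contra hcon
      exact Nat.findGreatest_is_greatest (P := fun i => τ i ≤ a) (n := K) (Nat.lt_succ_self j) h3
        (not_lt.1 hcon)
    by_contra hcon
    exact hτbr (j + 1) h3 ⟨h4, not_le.1 hcon⟩
  -- The midpoint of [a, c] lies in some `J j k`. No end of that interval is inside (a, c), so all
  -- of [a, c] is in it and Φ is affine along this part of ρ.
  obtain ⟨k, hk⟩ := hcov ((a + c) / 2) ⟨by linarith, by linarith⟩
  have hmid : (a + c) / 2 ∈ J j k := ⟨⟨by linarith, by linarith⟩, hk⟩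
  have hcpt := hJcl j hj k
  have hne : (J j k).Nonempty := ⟨_, hmid⟩
  have h1 : sInf (J j k) ≤ a := by
    have h2 := csInf_le hcpt.bddBelow hmid
    by_contra hcon
    exact hinf j hj k ⟨not_le.1 hcon, by linarith⟩
  have h2 : c ≤ sSup (J j k) := by
    have h2 := le_csSup hcpt.bddAbove hmid
    by_contra hcon
    exact hsup j hj k ⟨by linarith, not_le.1 hcon⟩
  have hI := hcpt.sInf_mem hne
  have hS := hcpt.sSup_mem hne
  have ha' : a ∈ J j k := hJconv j hj k _ hI _ hS a h1 (hac.trans h2)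
  have hc' : c ∈ J j k := hJconv j hj k _ hI _ hS c (h1.trans hac) h2
  rw [Function.comp_apply, hpiece j hj a c hja hac hjc θ hθ, Function.comp_apply,
    Function.comp_apply]
  exact haff k _ ha'.2 _ hc'.2 θ hθ

/-- A polygon can be mapped to the disc by an injective piecewise linear map. -/
theorem PosLoop.exists_disc_map {v : ℕ → ℂ} {n : ℕ} (h : PosLoop v n) :
    ∃ (Φ : ℂ → ℂ) (κ : Type) (_ : Finite κ) (𝒦 : κ → Set ℂ), InjOn Φ (loopRegion v n) ∧
      (∀ i < n, Φ (v i) = Complex.exp ((2 * Real.pi * i / n : ℝ) * Complex.I)) ∧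
      (∀ z ∈ loopRegion v n, (∀ i < n, z ≠ v i) → ‖Φ z‖ < 1) ∧
      (∀ k, Convex ℝ (𝒦 k)) ∧ (∀ k, IsClosed (𝒦 k)) ∧ (∀ k, AffineOn Φ (𝒦 k)) ∧
      ∀ z ∈ loopRegion v n, ∃ k, z ∈ 𝒦 k := by
  classical
  have hn := h.pos
  set c : ℕ → Fin n := fun i => ⟨i % n, Nat.mod_lt _ hn⟩ with hc
  set V : Fin n → ℂ := fun i => v i with hV
  -- The vertices of the regular n-gon inscribed in the unit circle.
  set Q : Fin n → ℂ := fun i => Complex.exp ((2 * Real.pi * i / n : ℝ) * Complex.I) with hQ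
  have hVc : V ∘ c = v := funext fun i => h.mod i
  have hcn : ∀ i, c (i + n) = c i := fun i => Fin.ext (Nat.add_mod_right i n)
  have hn' : (0 : ℝ) < n := by exact_mod_cast hn
  have hpi := Real.pi_pos
  have hpos : ConvexPos Q c n := by
    intro i j k hij hjk hk
    have e : ∀ i < n, Q (c i) = Complex.exp ((2 * Real.pi * i / n : ℝ) * Complex.I) := by
      intro i hi
      simp only [hQ, hc, Nat.mod_eq_of_lt hi]
    rw [e i (by omega), e j (by omega), e k hk]
    have hij' : (i : ℝ) < j := by exact_mod_cast hij
    have hjk' : (j : ℝ) < k := by exact_mod_cast hjk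
    have hk' : (k : ℝ) < n := by exact_mod_cast hk
    refine cr_exp ?_ ?_ ?_
    · gcongr
    · gcongr
    · have h1 : 2 * Real.pi * k / n < 2 * Real.pi := by
        rw [div_lt_iff₀ hn']
        gcongr
      have h2 : 0 ≤ 2 * Real.pi * i / n := by positivity
      linarith
  obtain ⟨T, hT⟩ := PosLoop.exists_isTriangulation (V := V) (Q := Q) n (c := c)
    (by rw [hVc]; exact h) hcn hpos
  have hcov := hT.cover
  rw [hVc] at hcov
  choose! L hL using hcov
  -- Barycentric weights with respect to the polygon are reused in the regular n-gon. The uniqueness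
  -- of weights on the one side makes Φ affine on each triangle, on the other side it makes Φ
  -- injective.
  set Φ : ℂ → ℂ := fun z => baryPt Q (L z) with hΦ
  have hmem : ∀ l, IsBary T l → baryPt V l ∈ loopRegion v n := fun l hl => by
    have := hT.mem_region l hl
    rwa [hVc] at this
  have hΦl : ∀ l, IsBary T l → Φ (baryPt V l) = baryPt Q l := by
    intro l hl
    obtain ⟨h1, h2⟩ := hL _ (hmem l hl)
    rw [hΦ]
    simp only
    rw [hT.injV _ _ h1 hl h2]
  have hdirac : ∀ i : Fin n, IsBary T (Pi.single i 1) ∧ ∀ W : Fin n → ℂ,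
      baryPt W (Pi.single i 1) = W i := by
    intro i
    obtain ⟨S, hS, hi, -⟩ := hT.edge i
    have hci : c i = i := Fin.ext (Nat.mod_eq_of_lt i.2)
    rw [hci] at hi
    refine ⟨⟨fun j => ?_, by simp, S, hS, fun j hj => ?_⟩, fun W => ?_⟩
    · by_cases hji : j = i
      · subst hji; simp
      · simp [hji]
    · by_cases hji : j = i
      · subst hji; exact hi
      · simp [hji] at hj
    · rw [baryPt, Finset.sum_eq_single i]
      · simp
      · intro j _ hji; simp [hji]
      · simp
  have hQinj : Function.Injective Q := by
    intro i j hij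
    have h1 := hT.injQ _ _ (hdirac i).1 (hdirac j).1 (by rw [(hdirac i).2, (hdirac j).2, hij])
    by_contra hne
    have h2 := congrFun h1 i
    simp [hne] at h2
  set Δ : Set (Fin n) → Set (Fin n → ℝ) := fun S =>
    {l | (∀ i, 0 ≤ l i) ∧ ∑ i, l i = 1 ∧ ∀ i, l i ≠ 0 → i ∈ S} with hΔ
  have hΔT : ∀ S ∈ T, ∀ l ∈ Δ S, IsBary T l := fun S hS l hl => ⟨hl.1, hl.2.1, S, hS, hl.2.2⟩
  have hlin : ∀ (W : Fin n → ℂ) (l l' : Fin n → ℝ) (θ : ℝ),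
      baryPt W (AffineMap.lineMap l l' θ) = AffineMap.lineMap (baryPt W l) (baryPt W l') θ := by
    intro W l l' θ
    simp only [baryPt, AffineMap.lineMap_apply, Pi.vadd_apply', vsub_eq_sub, vadd_eq_add,
      Pi.smul_apply, Pi.sub_apply, smul_eq_mul, Complex.real_smul]
    rw [← Finset.sum_sub_distrib, Finset.mul_sum, ← Finset.sum_add_distrib]
    refine Finset.sum_congr rfl fun i _ => ?_
    push_cast
    ring
  have hΔline : ∀ S, ∀ l ∈ Δ S, ∀ l' ∈ Δ S, ∀ θ ∈ Icc (0 : ℝ) 1,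
      AffineMap.lineMap l l' θ ∈ Δ S := by
    intro S l hl l' hl' θ hθ
    have e : ∀ i, (AffineMap.lineMap l l' θ : Fin n → ℝ) i = (1 - θ) * l i + θ * l' i := by
      intro i
      simp only [AffineMap.lineMap_apply, vsub_eq_sub, vadd_eq_add,
        Pi.add_apply, Pi.smul_apply, Pi.sub_apply, smul_eq_mul]
      ring
    refine ⟨fun i => ?_, ?_, fun i hi => ?_⟩
    · rw [e]
      exact add_nonneg (mul_nonneg (by linarith [hθ.2]) (hl.1 i)) (mul_nonneg hθ.1 (hl'.1 i))
    · simp only [e]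
      rw [Finset.sum_add_distrib, ← Finset.mul_sum, ← Finset.mul_sum, hl.2.1, hl'.2.1]
      ring
    · by_contra hc
      apply hi
      rw [e, not_not.1 fun h => hc (hl.2.2 i h), not_not.1 fun h => hc (hl'.2.2 i h)]
      ring
  have hΔc : ∀ S, IsCompact (Δ S) := by
    intro S
    refine (isCompact_univ_pi fun _ : Fin n => isCompact_Icc (a := (0 : ℝ)) (b := 1)).of_isClosed_subset
      ?_ ?_
    · have e : Δ S = (⋂ i, {l | 0 ≤ l i}) ∩ ({l | ∑ i, l i = 1} ∩ ⋂ i : {i // i ∉ S}, {l | l i = 0}) := by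
        ext l
        simp only [hΔ, mem_ofPred_eq, mem_inter_iff, mem_iInter, Subtype.forall]
        refine and_congr_right fun _ => and_congr_right fun _ => forall_congr' fun i => ?_
        rw [← not_imp_not, not_not]
      rw [e]
      refine (isClosed_iInter fun i => isClosed_le continuous_const (continuous_apply i)).inter
        ((isClosed_eq (by fun_prop) continuous_const).inter
        (isClosed_iInter fun i => isClosed_eq (continuous_apply _) continuous_const))
    · intro l hl i _
      refine ⟨hl.1 i, ?_⟩
      rw [← hl.2.1]
      exact Finset.single_le_sum (fun j _ => hl.1 j) (Finset.mem_univ i)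
  refine ⟨Φ, {S // S ∈ T}, inferInstance, fun S => baryPt V '' Δ S, ?_, ?_, ?_, ?_, ?_, ?_, ?_⟩
  · intro z hz w hw hzw
    have h1 := hT.injQ _ _ (hL z hz).1 (hL w hw).1 hzw
    rw [← (hL z hz).2, h1, (hL w hw).2]
  · intro i hi
    have h1 := hdirac ⟨i, hi⟩
    have h2 := hΦl _ h1.1
    rw [h1.2, h1.2] at h2
    exact h2
  · intro z hz hne
    have h1 := hL z hz
    -- A point that is not a vertex has nonzero weights at two vertices at least, and these have
    -- different images on the circle.
    refine norm_baryPt_lt_one (fun i => Complex.norm_exp_ofReal_mul_I _) h1.1.1 h1.1.2.1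
      fun i hi => ?_
    by_contra hcon
    push Not at hcon
    apply hne i i.2
    have h2 : ∀ j, j ≠ i → L z j = 0 := by
      intro j hj
      by_contra hj0
      exact hj (hQinj (hcon j hj0))
    have h3 : L z = Pi.single i 1 := by
      have h4 := h1.1.2.1
      rw [Finset.sum_eq_single i (fun j _ hj => h2 j hj) (by simp)] at h4
      funext j
      by_cases hj : j = i
      · subst hj; simp [h4]
      · simp [hj, h2 j hj]
    rw [← h1.2, h3, (hdirac i).2]
  · rintro S _ ⟨l, hl, rfl⟩ _ ⟨l', hl', rfl⟩ s t hs ht hst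
    refine ⟨AffineMap.lineMap l l' t, hΔline S l hl l' hl' t ⟨ht, by linarith⟩, ?_⟩
    rw [hlin, AffineMap.lineMap_apply_module, ← hst, add_sub_cancel_right]
  · intro S
    refine ((hΔc S).image ?_).isClosed
    unfold baryPt
    fun_prop
  · rintro S _ ⟨l, hl, rfl⟩ _ ⟨l', hl', rfl⟩ θ hθ
    rw [← hlin, hΦl _ (hΔT S S.2 _ (hΔline S l hl l' hl' θ hθ)), hΦl _ (hΔT S S.2 _ hl),
      hΦl _ (hΔT S S.2 _ hl'), hlin]
  · intro z hz
    obtain ⟨⟨h1, h2, S, hS, h3⟩, h4⟩ := hL z hz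
    exact ⟨⟨S, hS⟩, _, ⟨h1, h2, h3⟩, h4⟩

/-! ### Notching the horizontal sides -/

section Notch

variable (v : ℕ → ℂ)

/-- The abscissa of the midpoint of a horizontal side. -/
noncomputable def sideMid (u : ℕ) : ℝ := ((v (2 * u)).re + (v (2 * u + 1)).re) / 2

/-- Half of the length of a horizontal side. -/
noncomputable def sideHalf (u : ℕ) : ℝ := |(v (2 * u + 1)).re - (v (2 * u)).re| / 2

open Classical in
/-- The sign of the direction of a horizontal side; the region lies above the side if it is
positive. -/
noncomputable def sideDir (u : ℕ) : ℝ := if (v (2 * u)).re < (v (2 * u + 1)).re then 1 else -1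

/-- A point inside the region near the midpoint of a horizontal side. -/
noncomputable def sideHub (η : ℝ) (u : ℕ) : ℂ :=
  ⟨sideMid v u, (v (2 * u)).im + sideDir v u * η⟩

/-- The triangle over a horizontal side with the apex `sideHub v η u`. -/
def notch (η : ℝ) (u : ℕ) : Set ℂ :=
  {z | 0 ≤ sideDir v u * (z.im - (v (2 * u)).im) ∧
    η * |z.re - sideMid v u| ≤ (η - sideDir v u * (z.im - (v (2 * u)).im)) * sideHalf v u}

/-- The curve with all the horizontal sides replaced by the other two sides of the notches. -/
noncomputable def notchLoop (η : ℝ) (i : ℕ) : ℂ :=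
  if i % 3 = 0 then v (2 * (i / 3)) else if i % 3 = 1 then sideHub v η (i / 3)
    else v (2 * (i / 3) + 1)

theorem sideDir_eq_or (u : ℕ) : sideDir v u = 1 ∨ sideDir v u = -1 := by
  unfold sideDir
  split_ifs <;> simp

theorem re_left (u : ℕ) : (v (2 * u)).re = sideMid v u - sideDir v u * sideHalf v u := by
  unfold sideMid sideDir sideHalf
  split_ifs with h
  · rw [abs_of_pos (by linarith)]; ring
  · rw [abs_of_nonpos (by linarith)]; ring

theorem re_right (u : ℕ) : (v (2 * u + 1)).re = sideMid v u + sideDir v u * sideHalf v u := by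
  unfold sideMid sideDir sideHalf
  split_ifs with h
  · rw [abs_of_pos (by linarith)]; ring
  · rw [abs_of_nonpos (by linarith)]; ring

theorem notchLoop_zero (η : ℝ) (u : ℕ) : notchLoop v η (3 * u) = v (2 * u) := by
  rw [notchLoop, if_pos (by omega), show 3 * u / 3 = u by omega]

theorem notchLoop_one (η : ℝ) (u : ℕ) : notchLoop v η (3 * u + 1) = sideHub v η u := by
  rw [notchLoop, if_neg (by omega), if_pos (by omega), show (3 * u + 1) / 3 = u by omega]

theorem notchLoop_two (η : ℝ) (u : ℕ) : notchLoop v η (3 * u + 2) = v (2 * u + 1) := by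
  rw [notchLoop, if_neg (by omega), if_neg (by omega), show (3 * u + 2) / 3 = u by omega]

theorem notchLoop_three (η : ℝ) (u : ℕ) : notchLoop v η (3 * u + 3) = v (2 * u + 2) := by
  rw [show 3 * u + 3 = 3 * (u + 1) by ring, notchLoop_zero, mul_add]

theorem isClosed_notch (η : ℝ) (u : ℕ) : IsClosed (notch v η u) := by
  have h1 := Complex.continuous_re
  have h2 := Complex.continuous_im
  have h3 : IsClosed {z : ℂ | 0 ≤ sideDir v u * (z.im - (v (2 * u)).im)} :=
    isClosed_le (by fun_prop) (by fun_prop)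
  have h4 : IsClosed {z : ℂ | η * |z.re - sideMid v u| ≤
      (η - sideDir v u * (z.im - (v (2 * u)).im)) * sideHalf v u} :=
    isClosed_le (by fun_prop) (by fun_prop)
  exact h3.inter h4

variable {v}

theorem abs_im_le_of_mem_notch {η : ℝ} {u : ℕ} {z : ℂ} (hh : 0 < sideHalf v u) (hη : 0 < η)
    (hz : z ∈ notch v η u) : |z.im - (v (2 * u)).im| ≤ η ∧ |z.re - sideMid v u| ≤ sideHalf v u ∧
      (0 < sideDir v u * (z.im - (v (2 * u)).im) → |z.re - sideMid v u| < sideHalf v u) := by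
  obtain ⟨h1, h2⟩ := hz
  have h3 : 0 ≤ η * |z.re - sideMid v u| := mul_nonneg hη.le (abs_nonneg _)
  have h4 : sideDir v u * (z.im - (v (2 * u)).im) ≤ η := by
    by_contra hc
    push Not at hc
    nlinarith
  refine ⟨?_, ?_, fun h5 => ?_⟩
  · rcases sideDir_eq_or v u with h | h <;> rw [h] at h1 h4 <;> rw [abs_le] <;>
      constructor <;> linarith
  · by_contra hc
    push Not at hc
    nlinarith
  · by_contra hc
    push Not at hc
    nlinarith

theorem lineMap_notch_zero {η s : ℝ} {u : ℕ} :
    (AffineMap.lineMap (v (2 * u)) (sideHub v η u) s : ℂ).re =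
        sideMid v u - sideDir v u * sideHalf v u * (1 - s) ∧
      (AffineMap.lineMap (v (2 * u)) (sideHub v η u) s : ℂ).im =
        (v (2 * u)).im + sideDir v u * (s * η) := by
  rw [lineMap_re, lineMap_im, re_left]
  constructor <;> simp only [sideHub] <;> ring

theorem lineMap_notch_one {η s : ℝ} {u : ℕ} (hh : (v (2 * u + 1)).im = (v (2 * u)).im) :
    (AffineMap.lineMap (sideHub v η u) (v (2 * u + 1)) s : ℂ).re =
        sideMid v u + sideDir v u * sideHalf v u * s ∧
      (AffineMap.lineMap (sideHub v η u) (v (2 * u + 1)) s : ℂ).im =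
        (v (2 * u)).im + sideDir v u * ((1 - s) * η) := by
  rw [lineMap_re, lineMap_im, re_right, hh]
  constructor <;> simp only [sideHub] <;> ring

theorem abs_sideDir_mul (u : ℕ) (x : ℝ) : |sideDir v u * x| = |x| := by
  rcases sideDir_eq_or v u with h | h <;> simp [h]

theorem sideDir_mul_self (u : ℕ) : sideDir v u * sideDir v u = 1 := by
  rcases sideDir_eq_or v u with h | h <;> simp [h]

theorem mem_notch_zero {η s : ℝ} {u : ℕ} (hh : 0 < sideHalf v u) (hη : 0 < η)
    (hs : s ∈ Icc (0 : ℝ) 1) :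
    (AffineMap.lineMap (v (2 * u)) (sideHub v η u) s : ℂ) ∈ notch v η u ∧
      sideDir v u * ((AffineMap.lineMap (v (2 * u)) (sideHub v η u) s : ℂ).im - (v (2 * u)).im) =
        s * η := by
  obtain ⟨h1, h2⟩ := lineMap_notch_zero (v := v) (η := η) (s := s) (u := u)
  have e : sideDir v u * ((AffineMap.lineMap (v (2 * u)) (sideHub v η u) s : ℂ).im -
      (v (2 * u)).im) = s * η := by
    rw [h2]
    linear_combination (s * η) * sideDir_mul_self (v := v) u
  refine ⟨⟨e ▸ mul_nonneg hs.1 hη.le, ?_⟩, e⟩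
  rw [e, h1, show sideMid v u - sideDir v u * sideHalf v u * (1 - s) - sideMid v u =
    sideDir v u * (-(sideHalf v u * (1 - s))) by ring, abs_sideDir_mul, abs_neg,
    abs_of_nonneg (mul_nonneg hh.le (by linarith [hs.2]))]
  exact le_of_eq (by ring)

theorem mem_notch_one {η s : ℝ} {u : ℕ} (hh : 0 < sideHalf v u) (hη : 0 < η)
    (hv : (v (2 * u + 1)).im = (v (2 * u)).im) (hs : s ∈ Icc (0 : ℝ) 1) :
    (AffineMap.lineMap (sideHub v η u) (v (2 * u + 1)) s : ℂ) ∈ notch v η u ∧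
      sideDir v u *
        ((AffineMap.lineMap (sideHub v η u) (v (2 * u + 1)) s : ℂ).im - (v (2 * u)).im) =
        (1 - s) * η := by
  obtain ⟨h1, h2⟩ := lineMap_notch_one (η := η) (s := s) hv
  have e : sideDir v u * ((AffineMap.lineMap (sideHub v η u) (v (2 * u + 1)) s : ℂ).im -
      (v (2 * u)).im) = (1 - s) * η := by
    rw [h2]
    linear_combination ((1 - s) * η) * sideDir_mul_self (v := v) u
  refine ⟨⟨e ▸ mul_nonneg (by linarith [hs.2]) hη.le, ?_⟩, e⟩
  rw [e, h1, show sideMid v u + sideDir v u * sideHalf v u * s - sideMid v u =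
    sideDir v u * (sideHalf v u * s) by ring, abs_sideDir_mul,
    abs_of_nonneg (mul_nonneg hh.le hs.1)]
  exact le_of_eq (by ring)

/-- The triangle cut off by a notch does not wind around the points outside it. -/
theorem ang_notch {η : ℝ} {u : ℕ} {z : ℂ} (hh : 0 < sideHalf v u) (hη : 0 < η)
    (hv : (v (2 * u + 1)).im = (v (2 * u)).im) (hz : z ∉ notch v η u) :
    ang (v (2 * u)) (sideHub v η u) z + ang (sideHub v η u) (v (2 * u + 1)) z =
      ang (v (2 * u)) (v (2 * u + 1)) z := by
  suffices ∃ c : ℂ, 0 < (c * (v (2 * u) - z)).re ∧ 0 < (c * (sideHub v η u - z)).re ∧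
      0 < (c * (v (2 * u + 1) - z)).re by
    obtain ⟨c, h1, h2, h3⟩ := this
    rw [ang_eq_sub h1 h2, ang_eq_sub h2 h3, ang_eq_sub h1 h3]
    ring
  have hp : 0 < η * sideHalf v u := mul_pos hη hh
  have hdd := sideDir_mul_self (v := v) u
  have hre : ∀ (α β : ℝ) (w : ℂ), ((⟨α, -β⟩ : ℂ) * (w - z)).re =
      α * (w.re - z.re) + β * (w.im - z.im) := by
    intro α β w
    simp [Complex.mul_re]
  have hmain : ∀ α β : ℝ, 0 < α * ((v (2 * u)).re - z.re) + β * ((v (2 * u)).im - z.im) →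
      0 < α * (sideMid v u - z.re) + β * ((v (2 * u)).im + sideDir v u * η - z.im) →
      0 < α * ((v (2 * u + 1)).re - z.re) + β * ((v (2 * u)).im - z.im) →
      ∃ c : ℂ, 0 < (c * (v (2 * u) - z)).re ∧ 0 < (c * (sideHub v η u - z)).re ∧
      0 < (c * (v (2 * u + 1) - z)).re := by
    intro α β h1 h2 h3
    refine ⟨⟨α, -β⟩, ?_, ?_, ?_⟩ <;> rw [hre]
    · exact h1
    · exact h2
    · rw [hv]; exact h3
  rw [re_left, re_right] at hmain
  -- A point outside the notch is strictly beyond the line of one of its three sides. The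
  -- coefficients α, β form the inward normal to that side, so the whole triangle is in an open
  -- half-plane as seen from z.
  by_cases h0 : 0 ≤ sideDir v u * (z.im - (v (2 * u)).im)
  · have h1 : (η - sideDir v u * (z.im - (v (2 * u)).im)) * sideHalf v u <
        η * |z.re - sideMid v u| := not_le.1 fun hc => hz ⟨h0, hc⟩
    rcases le_total 0 (z.re - sideMid v u) with h2 | h2
    · rw [abs_of_nonneg h2] at h1
      refine hmain (-η) (-(sideHalf v u * sideDir v u)) ?_ ?_ ?_ <;>
        rcases sideDir_eq_or v u with h | h <;> rw [h] at h1 ⊢ <;> nlinarith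
    · rw [abs_of_nonpos h2] at h1
      refine hmain η (-(sideHalf v u * sideDir v u)) ?_ ?_ ?_ <;>
        rcases sideDir_eq_or v u with h | h <;> rw [h] at h1 ⊢ <;> nlinarith
  · refine hmain 0 (sideDir v u) ?_ ?_ ?_ <;>
      rcases sideDir_eq_or v u with h | h <;> rw [h] at h0 ⊢ <;> nlinarith

theorem sum_range_three_mul (f : ℕ → ℝ) (b : ℕ) : ∑ i ∈ Finset.range (3 * b), f i =
    ∑ u ∈ Finset.range b, (f (3 * u) + f (3 * u + 1) + f (3 * u + 2)) := by
  induction b with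
  | zero => simp
  | succ b ih =>
    rw [show 3 * (b + 1) = 3 * b + 1 + 1 + 1 by ring, Finset.sum_range_succ, Finset.sum_range_succ,
      Finset.sum_range_succ, ih, Finset.sum_range_succ]
    ring

theorem sum_range_two_mul (f : ℕ → ℝ) (b : ℕ) : ∑ i ∈ Finset.range (2 * b), f i =
    ∑ u ∈ Finset.range b, (f (2 * u) + f (2 * u + 1)) := by
  induction b with
  | zero => simp
  | succ b ih =>
    rw [show 2 * (b + 1) = 2 * b + 1 + 1 by ring, Finset.sum_range_succ, Finset.sum_range_succ,
      ih, Finset.sum_range_succ]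
    ring

/-! ### The notched curve: simplicity, orientation and region. -/

namespace OrthoLoop

variable {b : ℕ} {η : ℝ}

/-- The width `η` is small compared to the differences of the ordinates. -/
def IsSmall (v : ℕ → ℂ) (η : ℝ) : Prop :=
  0 < η ∧ ∀ i j, (v i).im ≠ (v j).im → 2 * η < |(v i).im - (v j).im|

theorem sideHalf_pos (h : OrthoLoop v b) (u : ℕ) : 0 < sideHalf v u := by
  unfold sideHalf
  have : (v (2 * u + 1)).re - (v (2 * u)).re ≠ 0 := fun he =>
    h.ne_succ (2 * u) (Complex.ext (by linarith) (h.horiz u).symm)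
  positivity

theorem mod_ne (_ : OrthoLoop v b) (u w : ℕ) : (2 * u) % (2 * b) ≠ (2 * w + 1) % (2 * b) := by
  intro he
  have h1 := congrArg (· % 2) he
  simp only [Nat.mod_mul_right_mod] at h1
  omega

/-- A notch has height η, while an ordinate of a vertex different from that of its base differs from
it by more than 2η. So a vertical side that met the notch off its base would also cross the level of
the base, at an interior point of the horizontal side. -/
theorem notMem_vert_of_mem_notch (h : OrthoLoop v b) (hη : IsSmall v η) {u w : ℕ} {z : ℂ}
    (hz : z ∈ notch v η u) (hτ : 0 < sideDir v u * (z.im - (v (2 * u)).im)) :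
    z ∉ segment ℝ (v (2 * w + 1)) (v (2 * w + 2)) := by
  intro hm
  obtain ⟨h1, -, h2⟩ := abs_im_le_of_mem_notch (h.sideHalf_pos u) hη.1 hz
  have h3 := h2 hτ
  have hre := re_mem_uIcc hm
  rw [h.vert w, uIcc_self, mem_singleton_iff] at hre
  have him := im_mem_uIcc hm
  set y := (v (2 * u)).im with hy
  have key : ∀ i, (v i).im = y ∨ (v i).im < y - 2 * η ∨ y + 2 * η < (v i).im := by
    intro i
    by_cases he : (v i).im = y
    · exact Or.inl he
    · have := hη.2 i (2 * u) he
      rcases lt_abs.1 this with h4 | h4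
      · right; right; linarith
      · right; left; linarith
  have k1 := key (2 * w + 1)
  have k2 := key (2 * w + 2)
  have hη0 := hη.1
  rw [abs_le] at h1
  have hzy : z.im ≠ y := by
    rintro he
    rw [he, sub_self, mul_zero] at hτ
    exact lt_irrefl _ hτ
  have hmem : y ∈ uIcc (v (2 * w + 1)).im (v (2 * w + 2)).im := by
    rw [mem_uIcc] at him ⊢
    rcases lt_or_gt_of_ne hzy with h5 | h5
    · rcases him with h6 | h6
      · left
        refine ⟨by linarith, ?_⟩
        rcases k2 with h7 | h7 | h7 <;> linarith
      · right
        refine ⟨by linarith, ?_⟩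
        rcases k1 with h7 | h7 | h7 <;> linarith
    · rcases him with h6 | h6
      · left
        refine ⟨?_, by linarith⟩
        rcases k1 with h7 | h7 | h7 <;> linarith
      · right
        refine ⟨?_, by linarith⟩
        rcases k2 with h7 | h7 | h7 <;> linarith
  have hq1 : (⟨z.re, y⟩ : ℂ) ∈ openSegment ℝ (v (2 * u)) (v (2 * u + 1)) := by
    refine mem_openSegment_of_im_eq (h.horiz u) rfl ?_
    have r1 := re_left v u
    have r2 := re_right v u
    rw [abs_lt] at h3
    simp only
    rcases sideDir_eq_or v u with h | h <;> rw [h] at r1 r2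
    · left; constructor <;> linarith
    · right; constructor <;> linarith
  have hq2 : (⟨z.re, y⟩ : ℂ) ∈ segment ℝ (v (2 * w + 1)) (v (2 * w + 2)) := by
    rw [← segment_eq_uIcc, segment_eq_image_lineMap] at hmem
    obtain ⟨t, ht, hty⟩ := hmem
    refine mem_segment_iff_lineMap.2 ⟨t, ht, Complex.ext ?_ ?_⟩
    · rw [lineMap_re, h.vert w, hre]; ring
    · rw [lineMap_im, ← hty, AffineMap.lineMap_apply]
      simp; ring
  obtain ⟨s, hs, hsq⟩ := mem_openSegment_iff_lineMap.1 hq1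
  rw [← hsq] at hq2
  rcases h.mem_segment (i := 2 * u) (j := 2 * w + 1) ⟨hs.1.le, hs.2⟩ hq2 with h4 | h4
  · exact h.mod_ne u w h4
  · exact hs.1.ne' h4.2

theorem mem_side_of_mem_notch (h : OrthoLoop v b) {u : ℕ} {z : ℂ} (hη : 0 < η)
    (hz : z ∈ notch v η u)
    (hτ : sideDir v u * (z.im - (v (2 * u)).im) = 0) : z ∈ segment ℝ (v (2 * u)) (v (2 * u + 1)) := by
  obtain ⟨-, h1, -⟩ := abs_im_le_of_mem_notch (h.sideHalf_pos u) hη hz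
  have him : z.im = (v (2 * u)).im := by
    rcases sideDir_eq_or v u with h | h <;> rw [h] at hτ <;> linarith
  have hh := h.sideHalf_pos u
  have r1 := re_left v u
  have r2 := re_right v u
  rw [abs_le] at h1
  have hmem : z.re ∈ uIcc (v (2 * u)).re (v (2 * u + 1)).re := by
    rw [mem_uIcc]
    rcases sideDir_eq_or v u with h | h <;> rw [h] at r1 r2
    · left; constructor <;> linarith
    · right; constructor <;> linarith
  rw [← segment_eq_uIcc, segment_eq_image_lineMap] at hmem
  obtain ⟨t, ht, htx⟩ := hmem
  refine mem_segment_iff_lineMap.2 ⟨t, ht, Complex.ext ?_ ?_⟩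
  · rw [lineMap_re, ← htx, AffineMap.lineMap_apply]
    simp; ring
  · rw [lineMap_im, h.horiz, him]; ring

theorem notMem_notch_of_mem_vert (h : OrthoLoop v b) (hη : IsSmall v η) {u w : ℕ} {z : ℂ}
    (hz : z ∈ openSegment ℝ (v (2 * w + 1)) (v (2 * w + 2))) : z ∉ notch v η u := by
  intro hm
  rcases hm.1.lt_or_eq with hτ | hτ
  · exact h.notMem_vert_of_mem_notch hη hm hτ (openSegment_subset_segment _ _ _ hz)
  · have h1 := h.mem_side_of_mem_notch hη.1 hm hτ.symm
    obtain ⟨s, hs, rfl⟩ := mem_openSegment_iff_lineMap.1 hz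
    rcases h.mem_segment (i := 2 * w + 1) (j := 2 * u) ⟨hs.1.le, hs.2⟩ h1 with h4 | h4
    · exact h.mod_ne u w h4.symm
    · exact hs.1.ne' h4.2

theorem disjoint_notch (h : OrthoLoop v b) (hη : IsSmall v η) {u w : ℕ} (hu : u < b) (hw : w < b)
    {z : ℂ} (hz : z ∈ notch v η u) (hz' : z ∈ notch v η w) : u = w := by
  refine h.generic u hu w hw ?_
  by_contra hne
  have h1 := (abs_im_le_of_mem_notch (h.sideHalf_pos u) hη.1 hz).1
  have h2 := (abs_im_le_of_mem_notch (h.sideHalf_pos w) hη.1 hz').1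
  have h3 := hη.2 _ _ hne
  rw [abs_le] at h1 h2
  rcases lt_abs.1 h3 with h4 | h4 <;> linarith

theorem simpleLoop_notchLoop (h : OrthoLoop v b) (hη : IsSmall v η) :
    SimpleLoop (notchLoop v η) (3 * b) := by
  have hb : 2 ≤ b := by have := h.three_le; omega
  have hη0 := hη.1
  -- The names record the types of the two edges compared: 0 and 1 are the two slanted sides of a
  -- notch, 2 is a vertical side. Slanted sides lie in notches, which are pairwise disjoint, and the
  -- height over the base gives the parameter on a slanted side.
  have c00 : ∀ u < b, ∀ w < b, ∀ s ∈ Ico (0 : ℝ) 1, ∀ t ∈ Ico (0 : ℝ) 1,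
      (AffineMap.lineMap (v (2 * u)) (sideHub v η u) s : ℂ) =
        AffineMap.lineMap (v (2 * w)) (sideHub v η w) t → u = w ∧ s = t := by
    intro u hu w hw s hs t ht he
    obtain ⟨h1, h2⟩ := mem_notch_zero (h.sideHalf_pos u) hη0 ⟨hs.1, hs.2.le⟩
    obtain ⟨h3, h4⟩ := mem_notch_zero (h.sideHalf_pos w) hη0 ⟨ht.1, ht.2.le⟩
    rw [he] at h1
    obtain rfl := h.disjoint_notch hη hu hw h1 h3
    rw [he, h4] at h2
    exact ⟨rfl, (mul_right_cancel₀ hη0.ne' h2).symm⟩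
  have c11 : ∀ u < b, ∀ w < b, ∀ s ∈ Ico (0 : ℝ) 1, ∀ t ∈ Ico (0 : ℝ) 1,
      (AffineMap.lineMap (sideHub v η u) (v (2 * u + 1)) s : ℂ) =
        AffineMap.lineMap (sideHub v η w) (v (2 * w + 1)) t → u = w ∧ s = t := by
    intro u hu w hw s hs t ht he
    obtain ⟨h1, h2⟩ := mem_notch_one (h.sideHalf_pos u) hη0 (h.horiz u) ⟨hs.1, hs.2.le⟩
    obtain ⟨h3, h4⟩ := mem_notch_one (h.sideHalf_pos w) hη0 (h.horiz w) ⟨ht.1, ht.2.le⟩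
    rw [he] at h1
    obtain rfl := h.disjoint_notch hη hu hw h1 h3
    rw [he, h4] at h2
    exact ⟨rfl, by linarith [mul_right_cancel₀ hη0.ne' h2]⟩
  have c01 : ∀ u < b, ∀ w < b, ∀ s ∈ Ico (0 : ℝ) 1, ∀ t ∈ Ico (0 : ℝ) 1,
      (AffineMap.lineMap (v (2 * u)) (sideHub v η u) s : ℂ) ≠
        AffineMap.lineMap (sideHub v η w) (v (2 * w + 1)) t := by
    intro u hu w hw s hs t ht he
    obtain ⟨h1, h2⟩ := mem_notch_zero (h.sideHalf_pos u) hη0 ⟨hs.1, hs.2.le⟩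
    obtain ⟨h3, h4⟩ := mem_notch_one (h.sideHalf_pos w) hη0 (h.horiz w) ⟨ht.1, ht.2.le⟩
    rw [he] at h1
    obtain rfl := h.disjoint_notch hη hu hw h1 h3
    have h5 := (lineMap_notch_zero (v := v) (η := η) (s := s) (u := u)).1
    have h6 := (lineMap_notch_one (η := η) (s := t) (h.horiz u)).1
    rw [he, h6] at h5
    have hh := h.sideHalf_pos u
    have h7 : sideHalf v u * (1 - s + t) = 0 := by
      rcases sideDir_eq_or v u with h | h <;> rw [h] at h5 <;> linarith
    have := mul_pos hh (show 0 < 1 - s + t by linarith [hs.2, ht.1])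
    linarith
  have c02 : ∀ u < b, ∀ w < b, ∀ s ∈ Ico (0 : ℝ) 1, ∀ t ∈ Ico (0 : ℝ) 1,
      (AffineMap.lineMap (v (2 * u)) (sideHub v η u) s : ℂ) ≠
        AffineMap.lineMap (v (2 * w + 1)) (v (2 * w + 2)) t := by
    intro u hu w hw s hs t ht he
    obtain ⟨h1, h2⟩ := mem_notch_zero (h.sideHalf_pos u) hη0 ⟨hs.1, hs.2.le⟩
    rcases hs.1.eq_or_lt with h0 | h0
    · have e : (AffineMap.lineMap (v (2 * u)) (v (2 * u + 1)) (0 : ℝ) : ℂ) =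
          AffineMap.lineMap (v (2 * w + 1)) (v (2 * w + 1 + 1)) t := by
        rw [← h0] at he
        simpa using he
      exact h.mod_ne u w (h.simple' (by simp) ht e).1
    · refine h.notMem_vert_of_mem_notch (w := w) hη h1 (by rw [h2]; positivity) ?_
      exact mem_segment_iff_lineMap.2 ⟨t, ⟨ht.1, ht.2.le⟩, he.symm⟩
  have c12 : ∀ u < b, ∀ w < b, ∀ s ∈ Ico (0 : ℝ) 1, ∀ t ∈ Ico (0 : ℝ) 1,
      (AffineMap.lineMap (sideHub v η u) (v (2 * u + 1)) s : ℂ) ≠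
        AffineMap.lineMap (v (2 * w + 1)) (v (2 * w + 2)) t := by
    intro u hu w hw s hs t ht he
    obtain ⟨h1, h2⟩ := mem_notch_one (h.sideHalf_pos u) hη0 (h.horiz u) ⟨hs.1, hs.2.le⟩
    refine h.notMem_vert_of_mem_notch (w := w) hη h1
      (by rw [h2]; exact mul_pos (by linarith [hs.2]) hη0) ?_
    exact mem_segment_iff_lineMap.2 ⟨t, ⟨ht.1, ht.2.le⟩, he.symm⟩
  have c22 : ∀ u < b, ∀ w < b, ∀ s ∈ Ico (0 : ℝ) 1, ∀ t ∈ Ico (0 : ℝ) 1,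
      (AffineMap.lineMap (v (2 * u + 1)) (v (2 * u + 2)) s : ℂ) =
        AffineMap.lineMap (v (2 * w + 1)) (v (2 * w + 2)) t → u = w ∧ s = t := by
    intro u hu w hw s hs t ht he
    obtain ⟨h1, h2⟩ := h.simple (2 * u + 1) (by omega) (2 * w + 1) (by omega) s hs t ht he
    exact ⟨by omega, h2⟩
  have split : ∀ i, ∃ u, (i = 3 * u ∨ i = 3 * u + 1 ∨ i = 3 * u + 2) := fun i => ⟨i / 3, by omega⟩
  refine ⟨by omega, fun i => ?_, fun i hi j hj s hs t ht he => ?_⟩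
  · have hv : ∀ k, v (k + 2 * b) = v k := h.periodic
    obtain ⟨u, rfl | rfl | rfl⟩ := split i
    · rw [← mul_add, notchLoop_zero, notchLoop_zero, mul_add, hv]
    · rw [show 3 * u + 1 + 3 * b = 3 * (u + b) + 1 by ring, notchLoop_one, notchLoop_one]
      simp only [sideHub, sideMid, sideDir, show 2 * (u + b) = 2 * u + 2 * b by ring,
        show 2 * u + 2 * b + 1 = 2 * u + 1 + 2 * b by ring, hv]
    · rw [show 3 * u + 2 + 3 * b = 3 * (u + b) + 2 by ring, notchLoop_two, notchLoop_two,
        show 2 * (u + b) + 1 = 2 * u + 1 + 2 * b by ring, hv]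
  · obtain ⟨u, hu⟩ := split i
    obtain ⟨w, hw⟩ := split j
    have hub : u < b := by omega
    have hwb : w < b := by omega
    rcases hu with rfl | rfl | rfl <;> rcases hw with rfl | rfl | rfl <;>
      simp only [notchLoop_zero, notchLoop_one, notchLoop_two, notchLoop_three, add_assoc,
        Nat.reduceAdd] at he
    · obtain ⟨h1, h2⟩ := c00 u hub w hwb s hs t ht he
      exact ⟨by rw [h1], h2⟩
    · exact absurd he (c01 u hub w hwb s hs t ht)
    · exact absurd he (c02 u hub w hwb s hs t ht)
    · exact absurd he.symm (c01 w hwb u hub t ht s hs)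
    · obtain ⟨h1, h2⟩ := c11 u hub w hwb s hs t ht he
      exact ⟨by rw [h1], h2⟩
    · exact absurd he (c12 u hub w hwb s hs t ht)
    · exact absurd he.symm (c02 w hwb u hub t ht s hs)
    · exact absurd he.symm (c12 w hwb u hub t ht s hs)
    · obtain ⟨h1, h2⟩ := c22 u hub w hwb s hs t ht he
      exact ⟨by rw [h1], h2⟩

theorem wnd_notchLoop (h : OrthoLoop v b) (hη : IsSmall v η) {z : ℂ}
    (hz : ∀ u < b, z ∉ notch v η u) : wnd (notchLoop v η) (3 * b) z = wnd v (2 * b) z := by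
  rw [wnd_eq, wnd_eq, sum_range_three_mul, sum_range_two_mul]
  congr 1
  refine Finset.sum_congr rfl fun u hu => ?_
  simp only [add_assoc, Nat.reduceAdd, notchLoop_zero, notchLoop_one, notchLoop_two,
    notchLoop_three]
  rw [← add_assoc, ang_notch (h.sideHalf_pos u) hη.1 (h.horiz u) (hz u (Finset.mem_range.1 hu))]

theorem eventually_notMem_notch {z : ℂ} (hz : ∀ u < b, z ∉ notch v η u) :
    ∀ᶠ w in 𝓝 z, ∀ u < b, w ∉ notch v η u := by
  have h1 : ∀ᶠ w in 𝓝 z, ∀ u ∈ Finset.range b, w ∉ notch v η u := by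
    rw [Filter.eventually_all_finset]
    exact fun u hu => (isClosed_notch v η u).isOpen_compl.mem_nhds (hz u (Finset.mem_range.1 hu))
  exact h1.mono fun w hw u hu => hw u (Finset.mem_range.2 hu)

/-- The orientation is tested at a point inside a vertical side. Both curves contain the side, and
near the point there are no notches, so the two winding numbers agree. -/
theorem posLoop_notchLoop (h : OrthoLoop v b) (hη : IsSmall v η) :
    PosLoop (notchLoop v η) (3 * b) := by
  rcases (h.simpleLoop_notchLoop hη).posLoop_or with hp | hneg
  · exact hp
  exfalso
  obtain ⟨p, hp, -⟩ := exists_openSegment_mem_ball_left (v (2 * 0 + 1)) (v (2 * 0 + 2)) one_pos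
  have hfr := frequently_cr_pos (h.ne_succ (2 * 0 + 1)) hp one_ne_zero
  have h2 := hneg (3 * 0 + 2) p (by
    rw [show 3 * 0 + 2 + 1 = 3 * 0 + 3 from rfl, notchLoop_two, notchLoop_three]; exact hp)
  rw [show 3 * 0 + 2 + 1 = 3 * 0 + 3 from rfl, notchLoop_two, notchLoop_three] at h2
  obtain ⟨z, hz, h3, h4, h5⟩ := (hfr.and_eventually ((h.side (2 * 0 + 1) p hp).and (h2.and
    (eventually_notMem_notch (b := b) fun u _ =>
      h.notMem_notch_of_mem_vert (u := u) hη hp)))).exists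
  rw [one_mul] at hz
  have h6 := h3.1 hz
  rw [← h.wnd_notchLoop hη h5, h4.1 hz] at h6
  exact zero_ne_one h6

/-- A point of the region is a limit of inner points, and near a point off the notches both curves
have the same winding number. -/
theorem mem_region_notchLoop (h : OrthoLoop v b) (hη : IsSmall v η) {z : ℂ}
    (hz : z ∈ loopRegion v (2 * b)) (hn : ∀ u < b, z ∉ notch v η u) :
    z ∈ loopRegion (notchLoop v η) (3 * b) := by
  have hp := h.posLoop_notchLoop hη
  by_contra hc
  have hc' : z ∈ (loopRegion (notchLoop v η) (3 * b))ᶜ := hc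
  rw [hp.compl_region] at hc'
  have h1 := wnd_locConst hp.apply_n z hc'.1
  obtain ⟨w, hw, h3, h4⟩ := ((mem_closure_iff_frequently.1 (h.region_subset_closure hz)).and_eventually
    (h1.and (eventually_notMem_notch hn))).exists
  rw [h.wnd_notchLoop hη h4, hw.2, hc'.2] at h3
  exact one_ne_zero h3

theorem sideHub_mem_notch (h : OrthoLoop v b) (hη : 0 < η) (u : ℕ) :
    sideHub v η u ∈ notch v η u := by
  have := (mem_notch_zero (h.sideHalf_pos u) hη (s := 1) (by simp)).1
  rwa [AffineMap.lineMap_apply_one] at this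

/-- The vertices of the notched curve lie in the notches. -/
theorem exists_mem_notch (h : OrthoLoop v b) (hη : 0 < η) {i : ℕ} (hi : i < 3 * b) :
    ∃ u < b, notchLoop v η i ∈ notch v η u := by
  refine ⟨i / 3, by omega, ?_⟩
  obtain ⟨u, hu⟩ : ∃ u, i / 3 = u := ⟨_, rfl⟩
  rw [hu]
  have h1 : i = 3 * u ∨ i = 3 * u + 1 ∨ i = 3 * u + 2 := by omega
  rcases h1 with rfl | rfl | rfl
  · rw [notchLoop_zero]
    have := (mem_notch_zero (h.sideHalf_pos u) hη (s := 0) (by simp)).1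
    rwa [AffineMap.lineMap_apply_zero] at this
  · rw [notchLoop_one]
    exact h.sideHub_mem_notch hη u
  · rw [notchLoop_two]
    have := (mem_notch_one (h.sideHalf_pos u) hη (h.horiz u) (s := 1) (by simp)).1
    rwa [AffineMap.lineMap_apply_one] at this

theorem sideHub_mem_region (h : OrthoLoop v b) (hη : IsSmall v η) (u : ℕ) :
    sideHub v η u ∈ loopRegion (notchLoop v η) (3 * b) := by
  left
  rw [← notchLoop_one]
  exact (h.simpleLoop_notchLoop hη).segment_subset _ (left_mem_segment ℝ _ _)

end OrthoLoop

end Notch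

/-! ### The horizontal segments of a tiling -/

/-- The rectangles tile the region enclosed by an orthogonal curve. -/
structure IsTiling (v : ℕ → ℂ) (b : ℕ) {m : ℕ} (R : Fin m → Rect) : Prop where
  loop : OrthoLoop v b
  cover : (⋃ e, (R e).toSet) = toC ⁻¹' loopRegion v (2 * b)
  disj : ∀ e f, e ≠ f → Disjoint (interior (R e).toSet) (interior (R f).toSet)

/-- The vertical direction from the top (`true`) or the bottom (`false`) side of a rectangle to its
inside. -/
def endDir (β : Bool) : ℝ := if β then -1 else 1

theorem endDir_eq_or (β : Bool) : endDir β = 1 ∨ endDir β = -1 := by cases β <;> simp [endDir]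

section

variable {m : ℕ} (R : Fin m → Rect)

/-- The ordinate of the top (`true`) or the bottom (`false`) side of a rectangle. -/
def endY (i : Fin m × Bool) : ℝ := if i.2 then (R i.1).top else (R i.1).bottom

/-- The abscissas of the points on the horizontal sides of rectangles at the height `y`. -/
def levelSet (y : ℝ) : Set ℝ := {x | ∃ i, endY R i = y ∧ x ∈ Icc (R i.1).left (R i.1).right}

/-- The maximal segment composed of horizontal sides of rectangles through a point. -/
def levelNode (y x : ℝ) : ℝ × Set ℝ := (y, connectedComponentIn (levelSet R y) x)

/-- The maximal segment that contains a horizontal side. -/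
def endNode (i : Fin m × Bool) : ℝ × Set ℝ := levelNode R (endY R i) (R i.1).left

theorem mem_levelSet_of_end {i : Fin m × Bool} {x : ℝ}
    (hx : x ∈ Icc (R i.1).left (R i.1).right) : x ∈ levelSet R (endY R i) := ⟨i, rfl, hx⟩

theorem levelNode_eq_of_mem {y x x' : ℝ} (h : x' ∈ (levelNode R y x).2) :
    levelNode R y x' = levelNode R y x :=
  Prod.ext rfl (connectedComponentIn_eq h).symm

theorem mem_levelNode {y x : ℝ} (h : x ∈ levelSet R y) : x ∈ (levelNode R y x).2 :=
  mem_connectedComponentIn h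

theorem levelNode_subset (y x : ℝ) : (levelNode R y x).2 ⊆ levelSet R y :=
  connectedComponentIn_subset _ _

theorem levelNode_ordConnected (y x : ℝ) : (levelNode R y x).2.OrdConnected :=
  isPreconnected_connectedComponentIn.ordConnected

theorem levelNode_eq_of_Icc {y x x' a c : ℝ} (h : Icc a c ⊆ levelSet R y) (hx : x ∈ Icc a c)
    (hx' : x' ∈ Icc a c) : levelNode R y x = levelNode R y x' :=
  (levelNode_eq_of_mem R (isPreconnected_Icc.subset_connectedComponentIn hx h hx')).symm

theorem levelNode_eq_endNode {i : Fin m × Bool} {x : ℝ}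
    (hx : x ∈ Icc (R i.1).left (R i.1).right) : levelNode R (endY R i) x = endNode R i :=
  levelNode_eq_of_Icc R (fun _ hz => mem_levelSet_of_end R hz) hx
    (left_mem_Icc.2 (R i.1).left_lt_right.le)

theorem isClosed_cover (y : ℝ) (β : Bool) :
    IsClosed {x | ∃ e, endY R (e, β) = y ∧ x ∈ Icc (R e).left (R e).right} := by
  have : {x | ∃ e, endY R (e, β) = y ∧ x ∈ Icc (R e).left (R e).right} =
      ⋃ e : {e // endY R (e, β) = y}, Icc (R e).left (R e).right := by
    ext x
    constructor
    · rintro ⟨e, h1, h2⟩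
      exact mem_iUnion.2 ⟨⟨e, h1⟩, h2⟩
    · intro hx
      obtain ⟨e, he⟩ := mem_iUnion.1 hx
      exact ⟨e.1, e.2, he⟩
  rw [this]
  exact isClosed_iUnion_of_finite fun _ => isClosed_Icc

theorem isClosed_levelSet (y : ℝ) : IsClosed (levelSet R y) := by
  have : levelSet R y = {x | ∃ e, endY R (e, true) = y ∧ x ∈ Icc (R e).left (R e).right} ∪
      {x | ∃ e, endY R (e, false) = y ∧ x ∈ Icc (R e).left (R e).right} := by
    ext x
    constructor
    · rintro ⟨⟨e, β⟩, h⟩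
      cases β
      · exact Or.inr ⟨e, h⟩
      · exact Or.inl ⟨e, h⟩
    · rintro (⟨e, h⟩ | ⟨e, h⟩)
      · exact ⟨(e, true), h⟩
      · exact ⟨(e, false), h⟩
  rw [this]
  exact (isClosed_cover R y true).union (isClosed_cover R y false)

theorem bottom_lt_top_end (e : Fin m) : endY R (e, false) < endY R (e, true) :=
  (R e).bottom_lt_top

open Classical in
/-- The number of rectangles that touch a generic point of the line at the height `y` from below
or from above. -/
noncomputable def endCount (β : Bool) (x y : ℝ) : ℝ :=
  ∑ e, if x ∈ Ioo (R e).left (R e).right ∧ endY R (e, β) = y then 1 else 0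

open Classical in
/-- The jump of the winding number across the line at the height `y`. -/
noncomputable def levelJump (v : ℕ → ℂ) (b : ℕ) (x y : ℝ) : ℝ :=
  ∑ u : Fin b, if (v (2 * u)).im = y then
    (if x < (v (2 * u)).re then (1 : ℝ) else 0) - (if x < (v (2 * u + 1)).re then 1 else 0) else 0

/-- The abscissas of the vertices. -/
noncomputable def genericX (v : ℕ → ℂ) (b : ℕ) : Finset ℝ :=
  ((Finset.range (2 * b)).image fun i => (v i).re) ∪
    (Finset.univ.image (fun e => (R e).left) ∪ Finset.univ.image (fun e => (R e).right))

/-- The ordinates of the vertices. -/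
noncomputable def genericY (v : ℕ → ℂ) (b : ℕ) : Finset ℝ :=
  ((Finset.range (2 * b)).image fun i => (v i).im) ∪ Finset.univ.image (endY R)

variable {R}

theorem left_mem_genericX (v : ℕ → ℂ) (b : ℕ) (e : Fin m) : (R e).left ∈ genericX R v b :=
  Finset.mem_union_right _ (Finset.mem_union_left _ (Finset.mem_image_of_mem _ (Finset.mem_univ e)))

theorem right_mem_genericX (v : ℕ → ℂ) (b : ℕ) (e : Fin m) : (R e).right ∈ genericX R v b :=
  Finset.mem_union_right _ (Finset.mem_union_right _ (Finset.mem_image_of_mem _ (Finset.mem_univ e)))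

theorem endY_mem_genericY (v : ℕ → ℂ) (b : ℕ) (i : Fin m × Bool) : endY R i ∈ genericY R v b :=
  Finset.mem_union_right _ (Finset.mem_image_of_mem _ (Finset.mem_univ i))

end

theorem SimpleLoop.re_mem_genericX {v : ℕ → ℂ} {b m : ℕ} (h : SimpleLoop v (2 * b))
    (R : Fin m → Rect) (i : ℕ) : (v i).re ∈ genericX R v b :=
  Finset.mem_union_left _ (Finset.mem_image.2
    ⟨i % (2 * b), Finset.mem_range.2 (Nat.mod_lt _ h.pos), by rw [h.mod]⟩)

theorem SimpleLoop.im_mem_genericY {v : ℕ → ℂ} {b m : ℕ} (h : SimpleLoop v (2 * b))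
    (R : Fin m → Rect) (i : ℕ) : (v i).im ∈ genericY R v b :=
  Finset.mem_union_left _ (Finset.mem_image.2
    ⟨i % (2 * b), Finset.mem_range.2 (Nat.mod_lt _ h.pos), by rw [h.mod]⟩)

theorem exists_gap (Y : Finset ℝ) (y : ℝ) : ∃ ε > 0, ∀ c ∈ Y, c ≠ y → ε < |c - y| := by
  have h1 : ∀ᶠ ε in 𝓝[>] (0 : ℝ), ∀ c ∈ Y, c ≠ y → ε < |c - y| := by
    rw [Filter.eventually_all_finset]
    intro c _
    by_cases hc : c = y
    · exact Eventually.of_forall fun _ h => absurd hc h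
    · filter_upwards [(eventually_lt_nhds (abs_pos.2 (sub_ne_zero.2 hc))).filter_mono
        nhdsWithin_le_nhds] with ε hε _ using hε
  obtain ⟨ε, h2, h3⟩ := (h1.and (self_mem_nhdsWithin (s := Ioi (0 : ℝ)))).exists
  exact ⟨ε, h3, h2⟩

theorem exists_generic (X : Finset ℝ) {O : Set ℝ} (hO : IsOpen O) (hne : O.Nonempty) :
    ∃ x ∈ O, x ∉ X := by
  obtain ⟨x, hx, hX⟩ := (X.finite_toSet.countable.dense_compl ℝ).inter_open_nonempty O hO hne
  exact ⟨x, hx, hX⟩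

/-! ### Counting rectangles above and below a horizontal line. -/

namespace IsTiling

variable {v : ℕ → ℂ} {b m : ℕ} {R : Fin m → Rect}

theorem count (h : IsTiling v b R) {x y : ℝ} (hx : x ∉ genericX R v b) (hy : y ∉ genericY R v b) :
    ∑ e, (if x ∈ Ioo (R e).left (R e).right ∧ endY R (e, false) < y ∧ y < endY R (e, true) then
      (1 : ℝ) else 0) = wnd v (2 * b) ⟨x, y⟩ := by
  have hnot : (⟨x, y⟩ : ℂ) ∉ loopTrace v (2 * b) := h.loop.notMem_trace
    (fun i he => hx ((show (v i).re = x from he) ▸ h.loop.re_mem_genericX R i))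
    (fun i he => hy ((show (v i).im = y from he) ▸ h.loop.im_mem_genericY R i))
  have hint : ∀ e, (x ∈ Ioo (R e).left (R e).right ∧ endY R (e, false) < y ∧ y < endY R (e, true)) ↔
      (x, y) ∈ interior (R e).toSet := fun e => by rw [(R e).interior_toSet]; rfl
  have hcl : ∀ e, (x, y) ∈ (R e).toSet → (x, y) ∈ interior (R e).toSet := by
    rintro e ⟨⟨h1, h2⟩, h3, h4⟩
    rw [(R e).interior_toSet]
    refine ⟨⟨lt_of_le_of_ne h1 ?_, lt_of_le_of_ne h2 ?_⟩, lt_of_le_of_ne h3 ?_, lt_of_le_of_ne h4 ?_⟩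
    · exact fun he => hx ((show (R e).left = x from he) ▸ left_mem_genericX v b e)
    · exact fun he => hx ((show x = (R e).right from he) ▸ right_mem_genericX v b e)
    · exact fun he => hy ((show endY R (e, false) = y from he) ▸ endY_mem_genericY v b (e, false))
    · exact fun he => hy ((show y = endY R (e, true) from he) ▸ endY_mem_genericY v b (e, true))
  by_cases hex : ∃ e, (x, y) ∈ interior (R e).toSet
  · obtain ⟨e, he⟩ := hex
    rw [Finset.sum_eq_single e]
    · rw [if_pos ((hint e).2 he)]
      have h1 : (x, y) ∈ toC ⁻¹' loopRegion v (2 * b) := by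
        rw [← h.cover]
        exact mem_iUnion.2 ⟨e, interior_subset he⟩
      rcases h1 with h1 | h1
      · exact absurd h1 hnot
      · exact h1.2.symm
    · intro f _ hfe
      rw [if_neg]
      rw [hint]
      exact fun hf => Set.disjoint_left.1 (h.disj f e hfe) hf he
    · simp
  · rw [Finset.sum_eq_zero]
    · rcases h.loop.wnd_eq_or hnot with h1 | h1
      · exfalso
        have h2 : (x, y) ∈ toC ⁻¹' loopRegion v (2 * b) := Or.inr ⟨hnot, h1⟩
        rw [← h.cover] at h2
        obtain ⟨e, he⟩ := mem_iUnion.1 h2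
        exact hex ⟨e, hcl e he⟩
      · exact h1.symm
    · intro e _
      rw [if_neg]
      rw [hint]
      exact fun he => hex ⟨e, he⟩

/-- Compare `count` at the heights y - ε and y + ε, with no other ordinates in between. The
rectangles with top at y drop out and those with bottom at y come in, while the winding number
changes by the contribution of the sides at height y. -/
theorem jump (h : IsTiling v b R) {x : ℝ} (hx : x ∉ genericX R v b) (y : ℝ) :
    endCount R true x y - endCount R false x y = levelJump v b x y := by
  classical
  obtain ⟨ε, hε, hgap⟩ := exists_gap (genericY R v b) y
  have k : ∀ c ∈ genericY R v b, c = y ∨ c < y - ε ∨ y + ε < c := by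
    intro c hc
    by_cases he : c = y
    · exact Or.inl he
    · rcases lt_abs.1 (hgap c hc he) with h1 | h1
      · right; right; linarith
      · right; left; linarith
  have hg : ∀ s : ℝ, |s| = ε → y + s ∉ genericY R v b := by
    intro s hs hm
    have h2 := hgap _ hm (by
      intro h0
      have : s = 0 := by linarith
      rw [this, abs_zero] at hs
      exact hε.ne hs)
    rw [add_sub_cancel_left, hs] at h2
    exact lt_irrefl _ h2
  have hm := hg (-ε) (by rw [abs_neg, abs_of_pos hε])
  have hp := hg ε (abs_of_pos hε)
  have c1 := h.count hx hm
  have c2 := h.count hx hp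
  rw [h.loop.wnd_eq_sum (z := ⟨x, y + -ε⟩) (fun i he => hx ((show (v i).re = x from he) ▸ h.loop.re_mem_genericX R i))
    (fun i he => hm ((show (v i).im = y + -ε from he) ▸ h.loop.im_mem_genericY R i))] at c1
  rw [h.loop.wnd_eq_sum (z := ⟨x, y + ε⟩) (fun i he => hx ((show (v i).re = x from he) ▸ h.loop.re_mem_genericX R i))
    (fun i he => hp ((show (v i).im = y + ε from he) ▸ h.loop.im_mem_genericY R i))] at c2
  have hL : endCount R true x y - endCount R false x y =
      ∑ e, (if x ∈ Ioo (R e).left (R e).right ∧ endY R (e, false) < y + -ε ∧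
        y + -ε < endY R (e, true) then (1 : ℝ) else 0) -
      ∑ e, (if x ∈ Ioo (R e).left (R e).right ∧ endY R (e, false) < y + ε ∧
        y + ε < endY R (e, true) then (1 : ℝ) else 0) := by
    unfold endCount
    rw [← Finset.sum_sub_distrib, ← Finset.sum_sub_distrib]
    refine Finset.sum_congr rfl fun e _ => ?_
    by_cases hxe : x ∈ Ioo (R e).left (R e).right
    · have h1 := bottom_lt_top_end R e
      simp only [hxe, true_and]
      rcases k _ (endY_mem_genericY v b (e, false)) with h2 | h2 | h2 <;>
        rcases k _ (endY_mem_genericY v b (e, true)) with h3 | h3 | h3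
      · linarith
      · linarith
      · rw [if_neg (by linarith), if_pos h2, if_neg (by rintro ⟨h4, h5⟩; linarith),
          if_pos ⟨by linarith, h3⟩]
      · rw [if_pos h3, if_neg (by linarith), if_pos ⟨by linarith, by linarith⟩,
          if_neg (by rintro ⟨h4, h5⟩; linarith)]
      · rw [if_neg (by linarith), if_neg (by linarith), if_neg (by rintro ⟨h4, h5⟩; linarith),
          if_neg (by rintro ⟨h4, h5⟩; linarith)]
      · rw [if_neg (by linarith), if_neg (by linarith), if_pos ⟨by linarith, by linarith⟩,
          if_pos ⟨by linarith, by linarith⟩]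
        ring
      · linarith
      · linarith
      · rw [if_neg (by linarith), if_neg (by linarith), if_neg (by rintro ⟨h4, h5⟩; linarith),
          if_neg (by rintro ⟨h4, h5⟩; linarith)]
    · simp [hxe]
  have hR : levelJump v b x y = (∑ u : Fin b, if y + -ε < (v (2 * u)).im then
      (if x < (v (2 * u)).re then (1 : ℝ) else 0) - (if x < (v (2 * u + 1)).re then 1 else 0) else 0) -
      (∑ u : Fin b, if y + ε < (v (2 * u)).im then
      (if x < (v (2 * u)).re then (1 : ℝ) else 0) - (if x < (v (2 * u + 1)).re then 1 else 0) else 0) := by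
    unfold levelJump
    rw [← Finset.sum_sub_distrib]
    refine Finset.sum_congr rfl fun u _ => ?_
    rcases k _ (h.loop.im_mem_genericY R (2 * u)) with h2 | h2 | h2
    · have q1 : y + -ε < (v (2 * u)).im := by linarith
      have q2 : ¬ y + ε < (v (2 * u)).im := by linarith
      rw [if_pos h2, if_pos q1, if_neg q2, sub_zero]
    · have q0 : ¬ (v (2 * u)).im = y := by linarith
      have q1 : ¬ y + -ε < (v (2 * u)).im := by linarith
      have q2 : ¬ y + ε < (v (2 * u)).im := by linarith
      rw [if_neg q0, if_neg q1, if_neg q2, sub_zero]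
    · have q0 : ¬ (v (2 * u)).im = y := by linarith
      have q1 : y + -ε < (v (2 * u)).im := by linarith
      rw [if_neg q0, if_pos q1, if_pos h2, sub_self]
  rw [hL, hR, c1, c2]

theorem eq_of_end (h : IsTiling v b R) {e f : Fin m} {β : Bool} {x : ℝ}
    (hy : endY R (e, β) = endY R (f, β)) (he : x ∈ Ioo (R e).left (R e).right)
    (hf : x ∈ Ioo (R f).left (R f).right) : e = f := by
  by_contra hne
  -- A common inner point: its ordinate is halfway between the common level and the nearer one of
  -- the opposite sides.
  refine Set.disjoint_left.1 (h.disj e f hne) (show (x, if β then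
    (endY R (e, true) + max (endY R (e, false)) (endY R (f, false))) / 2 else
    (endY R (e, false) + min (endY R (e, true)) (endY R (f, true))) / 2) ∈ _ from ?_) ?_
  all_goals
    rw [Rect.interior_toSet]
    refine ⟨by assumption, ?_⟩
    have h1 := bottom_lt_top_end R e
    have h2 := bottom_lt_top_end R f
    cases β
    · simp only [Bool.false_eq_true, if_false]
      have h3 : endY R (e, false) < min (endY R (e, true)) (endY R (f, true)) :=
        lt_min h1 (hy ▸ h2)
      have h4 := min_le_left (endY R (e, true)) (endY R (f, true))
      have h5 := min_le_right (endY R (e, true)) (endY R (f, true))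
      constructor <;> simp only [endY, Bool.false_eq_true, if_false, if_true] at * <;> linarith
    · simp only [if_true]
      have h3 : max (endY R (e, false)) (endY R (f, false)) < endY R (e, true) :=
        max_lt h1 (hy ▸ h2)
      have h4 := le_max_left (endY R (e, false)) (endY R (f, false))
      have h5 := le_max_right (endY R (e, false)) (endY R (f, false))
      constructor <;> simp only [endY, Bool.false_eq_true, if_false, if_true] at * <;> linarith

open Classical in
theorem endCount_eq (h : IsTiling v b R) (β : Bool) (x y : ℝ) : endCount R β x y =
    if ∃ e, x ∈ Ioo (R e).left (R e).right ∧ endY R (e, β) = y then 1 else 0 := by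
  unfold endCount
  split_ifs with hex
  · obtain ⟨e, he⟩ := hex
    rw [Finset.sum_eq_single e]
    · rw [if_pos he]
    · intro f _ hfe
      rw [if_neg]
      rintro ⟨h1, h2⟩
      exact hfe (h.eq_of_end (h2.trans he.2.symm) h1 he.1)
    · simp
  · refine Finset.sum_eq_zero fun e _ => ?_
    rw [if_neg]
    exact fun he => hex ⟨e, he⟩

/-- By genericity at most one side is at height y. Its contribution is nonzero only over the side
itself, where it is determined by the direction of the side. -/
theorem levelJump_eq (h : OrthoLoop v b) {x y : ℝ} (hx : ∀ i, (v i).re ≠ x) :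
    (∃ u < b, (v (2 * u)).im = y ∧ |x - sideMid v u| < sideHalf v u ∧
      levelJump v b x y = -sideDir v u) ∨
    ((∀ u < b, (v (2 * u)).im = y → ¬ |x - sideMid v u| < sideHalf v u) ∧
      levelJump v b x y = 0) := by
  classical
  have hterm : ∀ u, (if x < (v (2 * u)).re then (1 : ℝ) else 0) -
      (if x < (v (2 * u + 1)).re then 1 else 0) =
      if |x - sideMid v u| < sideHalf v u then -sideDir v u else 0 := by
    intro u
    have r1 := re_left v u
    have r2 := re_right v u
    have hh := h.sideHalf_pos u
    have n1 := hx (2 * u)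
    have n2 := hx (2 * u + 1)
    by_cases hc : |x - sideMid v u| < sideHalf v u
    · rw [if_pos hc]
      rw [abs_lt] at hc
      rcases sideDir_eq_or v u with h | h <;> rw [h] at r1 r2 ⊢
      · rw [if_neg (by linarith), if_pos (by linarith)]; norm_num
      · rw [if_pos (by linarith), if_neg (by linarith)]; norm_num
    · rw [if_neg hc]
      push Not at hc
      rcases le_abs.1 hc with hc | hc <;>
        rcases sideDir_eq_or v u with h | h <;> rw [h] at r1 r2
      · rw [if_neg (by linarith), if_neg (by linarith)]; norm_num
      · rw [if_neg (by linarith), if_neg (by linarith)]; norm_num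
      · rw [if_pos (lt_of_le_of_ne (by linarith) n1.symm),
          if_pos (lt_of_le_of_ne (by linarith) n2.symm)]; norm_num
      · rw [if_pos (lt_of_le_of_ne (by linarith) n1.symm),
          if_pos (lt_of_le_of_ne (by linarith) n2.symm)]; norm_num
  simp only [levelJump, hterm]
  by_cases hex : ∃ u < b, (v (2 * u)).im = y ∧ |x - sideMid v u| < sideHalf v u
  · obtain ⟨u, hu, h1, h2⟩ := hex
    refine Or.inl ⟨u, hu, h1, h2, ?_⟩
    rw [Finset.sum_eq_single ⟨u, hu⟩]
    · rw [if_pos h1, if_pos h2]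
    · intro w _ hwu
      rw [if_neg]
      intro hw
      exact hwu (Fin.ext (h.generic w w.2 u hu (hw.trans h1.symm)))
    · simp
  · push Not at hex
    refine Or.inr ⟨fun u hu h1 => not_lt.2 (hex u hu h1), Finset.sum_eq_zero fun u _ => ?_⟩
    split_ifs with h1 h2
    · exact absurd h2 (not_lt.2 (hex u u.2 h1))
    · rfl
    · rfl

/-- Over a generic point of a side the numbers of tops and of bottoms at this height are 0 or 1 and
differ by 1, so exactly one kind occurs: rectangles that extend into the region. -/
theorem sideDir_of_endDir (h : IsTiling v b R) {x y : ℝ} (hx : x ∉ genericX R v b) {u : ℕ}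
    (hu : u < b) (hy : (v (2 * u)).im = y) (hxu : |x - sideMid v u| < sideHalf v u) (β : Bool) :
    (∃ e, x ∈ Ioo (R e).left (R e).right ∧ endY R (e, β) = y) ↔ endDir β = sideDir v u := by
  classical
  have hj := h.jump hx y
  rw [h.endCount_eq, h.endCount_eq] at hj
  rcases levelJump_eq h.loop (x := x) (y := y) (fun i he => hx ((show (v i).re = x from he) ▸ h.loop.re_mem_genericX R i))
    with ⟨w, hw, h1, h2, h3⟩ | ⟨h1, -⟩
  · obtain rfl := h.loop.generic u hu w hw (hy.trans h1.symm)
    rw [h3] at hj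
    rcases sideDir_eq_or v u with h4 | h4 <;> rw [h4] at hj ⊢ <;> cases β <;>
      split_ifs at hj with h5 h6 h6 <;> norm_num at hj
    all_goals first
      | exact iff_of_true (by assumption) (by norm_num [endDir])
      | exact iff_of_false (by assumption) (by norm_num [endDir])
  · exact absurd hxu (h1 u hu hy)

/-- Every point of a horizontal segment which is not on a side of the polygon is on the boundary of
rectangles from below and from above. -/
theorem exists_end (h : IsTiling v b R) {x y : ℝ} {β : Bool} (hx : x ∈ levelSet R y)
    (hβ : ∀ u < b, (v (2 * u)).im = y → |x - sideMid v u| ≤ sideHalf v u → endDir β = sideDir v u) :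
    ∃ e, endY R (e, β) = y ∧ x ∈ Icc (R e).left (R e).right := by
  classical
  by_contra hc
  obtain ⟨i, hi, hxi⟩ := hx
  have h1 : ∀ᶠ x' in 𝓝 x, ¬ ∃ e, endY R (e, β) = y ∧ x' ∈ Icc (R e).left (R e).right :=
    (isClosed_cover R y β).isOpen_compl.mem_nhds hc
  have h2 : ∀ᶠ x' in 𝓝 x, ∀ u ∈ Finset.range b, (v (2 * u)).im = y →
      |x' - sideMid v u| ≤ sideHalf v u → endDir β = sideDir v u := by
    rw [Filter.eventually_all_finset]
    intro u hu
    by_cases h3 : |x - sideMid v u| ≤ sideHalf v u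
    · exact Eventually.of_forall fun x' h4 _ => hβ u (Finset.mem_range.1 hu) h4 h3
    · have hcont : Continuous fun x' : ℝ => |x' - sideMid v u| := by fun_prop
      filter_upwards [(isOpen_lt continuous_const hcont).mem_nhds (not_le.1 h3)] with x' h4 _ h5
      exact absurd h5 (not_le.2 h4)
  obtain ⟨O, hO, hOo, hxO⟩ := mem_nhds_iff.1 (h1.and h2)
  have hcl : x ∈ closure (Ioo (R i.1).left (R i.1).right) := by
    rw [closure_Ioo (R i.1).left_lt_right.ne]; exact hxi
  -- The point is moved slightly, to a generic abscissa strictly inside a side of a rectangle at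
  -- this height, without creating an end of the missing kind.
  obtain ⟨x', ⟨h3, h4⟩, h5⟩ := exists_generic (genericX R v b) (hOo.inter isOpen_Ioo)
    (mem_closure_iff.1 hcl O hOo hxO)
  obtain ⟨h6, h7⟩ := hO h3
  have h8 : ¬ ∃ e, x' ∈ Ioo (R e).left (R e).right ∧ endY R (e, β) = y := by
    rintro ⟨e, h9, h10⟩
    exact h6 ⟨e, h10, Ioo_subset_Icc_self h9⟩
  rcases levelJump_eq h.loop (x := x') (y := y) (fun i he => h5 (he ▸ h.loop.re_mem_genericX R i))
    with ⟨u, hu, h9, h10, -⟩ | ⟨-, h9⟩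
  · exact h8 ((h.sideDir_of_endDir h5 hu h9 h10 β).2 (h7 u (Finset.mem_range.2 hu) h9 h10.le))
  -- Away from the sides of the polygon the jump is zero, so tops and bottoms occur together.
  · have hj := h.jump h5 y
    rw [h.endCount_eq, h.endCount_eq, h9] at hj
    have h10 : ∃ e, x' ∈ Ioo (R e).left (R e).right ∧ endY R (e, i.2) = y := ⟨i.1, h4, hi⟩
    generalize i.2 = γ at h10
    cases β <;> cases γ
    · exact h8 h10
    · rw [if_pos h10, if_neg h8] at hj; norm_num at hj
    · rw [if_pos h10, if_neg h8] at hj; norm_num at hj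
    · exact h8 h10

theorem mem_levelSet_of_side (h : IsTiling v b R) {u : ℕ} (hu : u < b) {x : ℝ}
    (hx : x ∈ Icc (sideMid v u - sideHalf v u) (sideMid v u + sideHalf v u)) :
    x ∈ levelSet R (v (2 * u)).im := by
  have hh := h.loop.sideHalf_pos u
  have hcl : x ∈ closure (Ioo (sideMid v u - sideHalf v u) (sideMid v u + sideHalf v u)) := by
    rw [closure_Ioo (by linarith)]; exact hx
  rw [← (isClosed_levelSet R _).closure_eq, mem_closure_iff]
  intro O hO hxO
  obtain ⟨x', ⟨h3, h4⟩, h5⟩ := exists_generic (genericX R v b) (hO.inter isOpen_Ioo)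
    (mem_closure_iff.1 hcl O hO hxO)
  have h6 : |x' - sideMid v u| < sideHalf v u := by
    rw [abs_lt]; exact ⟨by linarith [h4.1], by linarith [h4.2]⟩
  have key := fun β => (h.sideDir_of_endDir h5 hu rfl h6 β).2
  rcases sideDir_eq_or v u with h7 | h7
  · obtain ⟨e, h8, h9⟩ := key false (by rw [h7]; rfl)
    exact ⟨x', h3, (e, false), h9, Ioo_subset_Icc_self h8⟩
  · obtain ⟨e, h8, h9⟩ := key true (by rw [h7]; rfl)
    exact ⟨x', h3, (e, true), h9, Ioo_subset_Icc_self h8⟩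

/-- A point of a horizontal side is a limit of interior points of its own rectangle, and interiors
of different rectangles are disjoint. -/
theorem notMem_interior (h : IsTiling v b R) {x y : ℝ} (hx : x ∈ levelSet R y) (f : Fin m) :
    ¬ (x ∈ Ioo (R f).left (R f).right ∧ y ∈ Ioo (R f).bottom (R f).top) := by
  intro hm
  have hm' : (x, y) ∈ interior (R f).toSet := by rw [Rect.interior_toSet]; exact hm
  obtain ⟨i, hi, hxi⟩ := hx
  have hlt := (R i.1).bottom_lt_top
  have hcl : (x, y) ∈ closure (interior (R i.1).toSet) := by
    rw [← Rect.toSet_eq_closure]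
    refine ⟨hxi, ?_⟩
    rw [← hi]
    unfold endY
    split_ifs
    · exact ⟨hlt.le, le_rfl⟩
    · exact ⟨le_rfl, hlt.le⟩
  obtain ⟨p, hp1, hp2⟩ := mem_closure_iff.1 hcl _ isOpen_interior hm'
  have : i.1 = f := by
    by_contra hne
    exact Set.disjoint_left.1 (h.disj _ _ hne) hp2 hp1
  rw [← this, ← hi] at hm
  unfold endY at hm
  split_ifs at hm
  · exact lt_irrefl _ hm.2.2
  · exact lt_irrefl _ hm.2.1

/-- A rectangle on the outer side of a side of the polygon does not overlap the side. -/
theorem lt_abs_sub_mid (h : IsTiling v b R) {e : Fin m} {β : Bool} {u : ℕ} (hu : u < b)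
    (hy : endY R (e, β) = (v (2 * u)).im) (hβ : endDir β ≠ sideDir v u) {x : ℝ}
    (hx : x ∈ Ioo (R e).left (R e).right) : sideHalf v u < |x - sideMid v u| := by
  by_contra hc
  push Not at hc
  have hh := h.loop.sideHalf_pos u
  have hcl : x ∈ closure (Ioo (sideMid v u - sideHalf v u) (sideMid v u + sideHalf v u)) := by
    rw [closure_Ioo (by linarith)]
    rw [abs_le] at hc
    exact ⟨by linarith, by linarith⟩
  obtain ⟨x', ⟨h3, h4⟩, h5⟩ := exists_generic (genericX R v b) (isOpen_Ioo.inter isOpen_Ioo)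
    (mem_closure_iff.1 hcl _ isOpen_Ioo hx)
  have h6 : |x' - sideMid v u| < sideHalf v u := by
    rw [abs_lt]; exact ⟨by linarith [h4.1], by linarith [h4.2]⟩
  exact hβ ((h.sideDir_of_endDir h5 hu rfl h6 β).1 ⟨e, h3, hy⟩)

/-- The segment that contains a side of the polygon. -/
noncomputable def _root_.sideNode (v : ℕ → ℂ) (R : Fin m → Rect) (u : ℕ) : ℝ × Set ℝ :=
  levelNode R (v (2 * u)).im (sideMid v u)

theorem levelNode_eq_sideNode (h : IsTiling v b R) {u : ℕ} (hu : u < b) {x : ℝ}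
    (hx : |x - sideMid v u| ≤ sideHalf v u) : levelNode R (v (2 * u)).im x = sideNode v R u := by
  have hh := h.loop.sideHalf_pos u
  rw [abs_le] at hx
  exact levelNode_eq_of_Icc R (fun _ hz => h.mem_levelSet_of_side hu hz)
    ⟨by linarith, by linarith⟩ ⟨by linarith, by linarith⟩

theorem mem_sideNode (h : IsTiling v b R) {u : ℕ} (hu : u < b) {x : ℝ}
    (hx : |x - sideMid v u| ≤ sideHalf v u) : x ∈ (sideNode v R u).2 := by
  have hh := h.loop.sideHalf_pos u
  rw [← h.levelNode_eq_sideNode hu hx]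
  rw [abs_le] at hx
  exact mem_levelNode R (h.mem_levelSet_of_side hu ⟨by linarith, by linarith⟩)

open Classical in
/-- The difference of the total widths of the rectangles below and above a segment. -/
theorem flux_eq_integral (h : IsTiling v b R) {y x₀ : ℝ} {g : ℝ → ℝ}
    (hg : ∀ x ∉ genericX R v b, g x = if x ∈ (levelNode R y x₀).2 then levelJump v b x y else 0) :
    ∑ e, ((if endNode R (e, true) = levelNode R y x₀ then (R e).right - (R e).left else 0) -
      (if endNode R (e, false) = levelNode R y x₀ then (R e).right - (R e).left else 0)) =
      ∫ x, g x := by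
  set κ := levelNode R y x₀ with hκ
  set a : Fin m → ℝ := fun e => (if endNode R (e, true) = κ then 1 else 0) -
    (if endNode R (e, false) = κ then 1 else 0) with ha
  -- S x is the signed number of rectangles with an end on the segment that lie over x. Integrating
  -- it gives the signed sum of widths, and for generic x it is the jump of the winding number, cut
  -- off outside the segment.
  set S : ℝ → ℝ := fun x => ∑ e, a e * (Ioo (R e).left (R e).right).indicator (fun _ => 1) x with hS
  have hSg : S =ᵐ[MeasureTheory.volume] g := by
    have h0 : ∀ᵐ x, x ∉ (genericX R v b : Set ℝ) :=
      (MeasureTheory.measure_eq_zero_iff_ae_notMem).1 ((genericX R v b).finite_toSet.measure_zero _)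
    filter_upwards [h0] with x hx
    have hx' : x ∉ genericX R v b := hx
    rw [hg x hx']
    by_cases hxκ : x ∈ κ.2
    · rw [if_pos hxκ, ← h.jump hx' y]
      have hnode := levelNode_eq_of_mem R hxκ
      unfold endCount
      rw [hS, ← Finset.sum_sub_distrib]
      refine Finset.sum_congr rfl fun e _ => ?_
      by_cases hxe : x ∈ Ioo (R e).left (R e).right
      · rw [indicator_of_mem hxe, mul_one]
        have hiff : ∀ β, endNode R (e, β) = κ ↔ endY R (e, β) = y := by
          intro β
          constructor
          · intro he
            exact congrArg Prod.fst he
          · intro he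
            rw [← levelNode_eq_endNode R (i := (e, β)) (Ioo_subset_Icc_self hxe), he, hnode]
        simp only [ha, hiff, hxe, true_and]
      · simp [hxe]
    · rw [if_neg hxκ]
      refine Finset.sum_eq_zero fun e _ => ?_
      by_cases hxe : x ∈ Ioo (R e).left (R e).right
      · have hne : ∀ β, endNode R (e, β) ≠ κ := by
          intro β he
          apply hxκ
          rw [← he, ← levelNode_eq_endNode R (i := (e, β)) (Ioo_subset_Icc_self hxe)]
          exact mem_levelNode R (mem_levelSet_of_end R (i := (e, β)) (Ioo_subset_Icc_self hxe))
        simp [ha, hne]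
      · rw [indicator_of_notMem hxe, mul_zero]
  rw [← MeasureTheory.integral_congr_ae hSg, hS, MeasureTheory.integral_finsetSum]
  · refine Finset.sum_congr rfl fun e _ => ?_
    have hlt := (R e).left_lt_right
    rw [MeasureTheory.integral_const_mul, MeasureTheory.integral_indicator measurableSet_Ioo]
    simp only [MeasureTheory.integral_const, MeasurableSet.univ, MeasureTheory.measureReal_restrict_apply,
      univ_inter, Real.volume_real_Ioo_of_le hlt.le, smul_eq_mul, mul_one]
    simp only [ha]
    split_ifs <;> ring
  · intro e _
    refine MeasureTheory.Integrable.const_mul ?_ _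
    rw [MeasureTheory.integrable_indicator_iff measurableSet_Ioo]
    exact MeasureTheory.integrableOn_const (by simp)

-- Kirchhoff's law at an inner vertex. A nonzero jump at a point of the segment comes from a side
-- through that point, which would make the segment the one containing that side.
open Classical in
theorem flux_inner (h : IsTiling v b R) {y x₀ : ℝ}
    (hne : ∀ u < b, sideNode v R u ≠ levelNode R y x₀) :
    ∑ e, ((if endNode R (e, true) = levelNode R y x₀ then (R e).right - (R e).left else 0) -
      (if endNode R (e, false) = levelNode R y x₀ then (R e).right - (R e).left else 0)) = 0 := by
  rw [h.flux_eq_integral (g := fun _ => 0), MeasureTheory.integral_zero]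
  intro x hx
  split_ifs with hxκ
  · rcases levelJump_eq h.loop (x := x) (y := y) (fun i he => hx ((show (v i).re = x from he) ▸ h.loop.re_mem_genericX R i))
      with ⟨u, hu, h1, h2, -⟩ | ⟨-, h1⟩
    · exfalso
      apply hne u hu
      rw [← h.levelNode_eq_sideNode hu h2.le, h1]
      exact levelNode_eq_of_mem R hxκ
    · exact h1.symm
  · rfl

-- The only jump along the segment is that of the side u, and the whole side is contained in the
-- segment; the integral is the signed length of u.
open Classical in
theorem flux_side (h : IsTiling v b R) {u : ℕ} (hu : u < b) :
    ∑ e, ((if endNode R (e, true) = sideNode v R u then (R e).right - (R e).left else 0) -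
      (if endNode R (e, false) = sideNode v R u then (R e).right - (R e).left else 0)) =
      (v (2 * u)).re - (v (2 * u + 1)).re := by
  have hh := h.loop.sideHalf_pos u
  unfold sideNode
  rw [h.flux_eq_integral (g := fun x => -sideDir v u *
    (Ioo (sideMid v u - sideHalf v u) (sideMid v u + sideHalf v u)).indicator (fun _ => 1) x)]
  · rw [MeasureTheory.integral_const_mul, MeasureTheory.integral_indicator measurableSet_Ioo]
    simp only [MeasureTheory.integral_const, MeasurableSet.univ, MeasureTheory.measureReal_restrict_apply,
      univ_inter, smul_eq_mul, mul_one]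
    rw [Real.volume_real_Ioo_of_le (by linarith), re_left, re_right]
    ring
  · intro x hx
    have hiff : x ∈ Ioo (sideMid v u - sideHalf v u) (sideMid v u + sideHalf v u) ↔
        |x - sideMid v u| < sideHalf v u := by
      rw [abs_lt]
      constructor <;> rintro ⟨h1, h2⟩ <;> constructor <;> linarith
    rcases levelJump_eq h.loop (x := x) (y := (v (2 * u)).im)
      (fun i he => hx ((show (v i).re = x from he) ▸ h.loop.re_mem_genericX R i)) with ⟨w, hw, h1, h2, h3⟩ | ⟨h1, h3⟩
    · obtain rfl := h.loop.generic w hw u hu h1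
      rw [indicator_of_mem (hiff.2 h2), if_pos, h3, mul_one]
      exact h.mem_sideNode hu h2.le
    · rw [indicator_of_notMem fun hm => h1 u hu rfl (hiff.1 hm), h3, mul_zero, ite_self]

end IsTiling

/-! ### The circuit of a tiling and its drawing -/

/-- The vertices of the circuit of a tiling, which are the maximal horizontal segments, with a point
`hubX` on each segment and small sizes `η` and `δ` for the drawing. -/
structure TilingFrame (v : ℕ → ℂ) (b : ℕ) {m : ℕ} (R : Fin m → Rect) where
  inner : ℕ
  node : Fin b ⊕ Fin inner → ℝ × Set ℝ
  vert : Fin m × Bool → Fin b ⊕ Fin inner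
  hubX : Fin b ⊕ Fin inner → ℝ
  η : ℝ
  δ : ℝ
  tiling : IsTiling v b R
  node_injective : Function.Injective node
  node_inl : ∀ u : Fin b, node (Sum.inl u) = sideNode v R u
  node_vert : ∀ i, node (vert i) = endNode R i
  node_eq : ∀ w, node w = levelNode R (node w).1 (hubX w)
  hubX_mem : ∀ w, hubX w ∈ levelSet R (node w).1
  hubX_inl : ∀ u : Fin b, hubX (Sum.inl u) = sideMid v u
  height_mem : ∀ w, (node w).1 ∈ genericY R v b
  η_pos : 0 < η
  -- Neighbourhoods of width 2η about different levels are disjoint, and between the two bends of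
  -- any edge there is room for a vertical piece.
  gap : ∀ c ∈ genericY R v b, ∀ c' ∈ genericY R v b, c ≠ c' → 10 * η < |c - c'|
  δ_pos : 0 < δ
  δ_le : δ ≤ 2 * η
  -- A rectangle on the outer side of a polygon side may still end on the segment containing that
  -- side. The inequality says that the line from the hub, at height η inside, to the bend, at depth
  -- δ outside, runs outside the notch.
  bend : ∀ (e : Fin m) (β : Bool) (u : Fin b), endY R (e, β) = (v (2 * u)).im →
    endDir β ≠ sideDir v u →
      (η + δ) * sideHalf v u < η * |((R e).left + (R e).right) / 2 - sideMid v u|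

namespace TilingFrame

variable {v : ℕ → ℂ} {b m : ℕ} {R : Fin m → Rect} (F : TilingFrame v b R)

theorem hubX_mem_node (w : Fin b ⊕ Fin F.inner) : F.hubX w ∈ (F.node w).2 := by
  rw [F.node_eq]
  exact mem_levelNode R (F.hubX_mem w)

theorem node_subset (w : Fin b ⊕ Fin F.inner) : (F.node w).2 ⊆ levelSet R (F.node w).1 := by
  conv_lhs => rw [F.node_eq]
  exact levelNode_subset R _ _

theorem node_ordConnected (w : Fin b ⊕ Fin F.inner) : (F.node w).2.OrdConnected := by
  rw [F.node_eq]
  exact levelNode_ordConnected R _ _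

theorem levelNode_eq_node {w : Fin b ⊕ Fin F.inner} {x : ℝ} (hx : x ∈ (F.node w).2) :
    levelNode R (F.node w).1 x = F.node w := by
  conv_rhs => rw [F.node_eq]
  rw [F.node_eq] at hx
  exact levelNode_eq_of_mem R hx

theorem eq_of_mem {w w' : Fin b ⊕ Fin F.inner} (hy : (F.node w).1 = (F.node w').1) {x : ℝ}
    (hx : x ∈ (F.node w).2) (hx' : x ∈ (F.node w').2) : w = w' :=
  F.node_injective (by rw [← F.levelNode_eq_node hx, hy, F.levelNode_eq_node hx'])

theorem height_vert (i : Fin m × Bool) : (F.node (F.vert i)).1 = endY R i := by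
  rw [F.node_vert]; rfl

theorem height_inl (u : Fin b) : (F.node (Sum.inl u)).1 = (v (2 * u)).im := by
  rw [F.node_inl]; rfl

theorem mem_node_vert {i : Fin m × Bool} {x : ℝ} (hx : x ∈ Icc (R i.1).left (R i.1).right) :
    x ∈ (F.node (F.vert i)).2 := by
  rw [F.node_vert, ← levelNode_eq_endNode R hx]
  exact mem_levelNode R (mem_levelSet_of_end R hx)

theorem vert_eq {i : Fin m × Bool} {w : Fin b ⊕ Fin F.inner} {x : ℝ} (hy : endY R i = (F.node w).1)
    (hw : x ∈ (F.node w).2) (hx : x ∈ Icc (R i.1).left (R i.1).right) : F.vert i = w :=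
  F.eq_of_mem (by rw [F.height_vert, hy]) (F.mem_node_vert hx) hw

theorem mem_node_inl (u : Fin b) {x : ℝ} (hx : |x - sideMid v u| ≤ sideHalf v u) :
    x ∈ (F.node (Sum.inl u)).2 := by
  rw [F.node_inl]
  exact F.tiling.mem_sideNode u.2 hx

theorem inl_eq {w : Fin b ⊕ Fin F.inner} {x : ℝ} (hw : x ∈ (F.node w).2) {u : Fin b}
    (hy : (v (2 * u)).im = (F.node w).1) (hx : |x - sideMid v u| ≤ sideHalf v u) :
    Sum.inl u = w :=
  F.eq_of_mem (by rw [F.height_inl, hy]) (F.mem_node_inl u hx) hw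

theorem bottom_lt_top (e : Fin m) :
    (F.node (F.vert (e, false))).1 < (F.node (F.vert (e, true))).1 := by
  rw [F.height_vert, F.height_vert]
  exact bottom_lt_top_end R e

theorem exists_vert_bottom (κ : Fin F.inner) : ∃ e, F.vert (e, false) = Sum.inr κ := by
  have hx := F.hubX_mem (Sum.inr κ)
  obtain ⟨e, he, hxe⟩ := F.tiling.exists_end (β := false) hx fun u hu hy hxu => by
    have h1 := F.inl_eq (F.hubX_mem_node (Sum.inr κ)) (u := ⟨u, hu⟩) hy hxu
    exact absurd h1 (by simp)
  exact ⟨e, F.vert_eq he (F.hubX_mem_node _) hxe⟩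

/-- The network of a tiling. -/
@[reducible] noncomputable def network : ElectricalNetwork b m where
  inner := F.inner
  src e := F.vert (e, true)
  tgt e := F.vert (e, false)
  cond e := (R e).ratio
  src_ne_tgt e h := (F.bottom_lt_top e).ne (by rw [h])
  cond_nonneg e := (div_pos (sub_pos.2 (R e).left_lt_right) (sub_pos.2 (R e).bottom_lt_top)).le
  component_boundary := by
    -- A component without boundary vertices would have a highest vertex. Some rectangle stands on
    -- this inner segment, and its top is a higher vertex of the same component.
    by_contra! hc
    obtain ⟨w₀, hw₀⟩ := hc
    obtain ⟨w, hw, hmax⟩ := Set.exists_max_image _ (fun w => (F.node w).1)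
      (Set.toFinite {w | ∀ u : Fin b, ¬ Relation.EqvGen
        (fun v w => ∃ e, F.vert (e, true) = v ∧ F.vert (e, false) = w) w (Sum.inl u)}) ⟨w₀, hw₀⟩
    rcases w with u | κ
    · exact hw u (Relation.EqvGen.refl _)
    · obtain ⟨e, he⟩ := F.exists_vert_bottom κ
      have h1 := hmax (F.vert (e, true)) fun u hu =>
        hw u ((Relation.EqvGen.rel _ _ ⟨e, rfl, he⟩).symm.trans _ _ _ hu)
      have h2 := F.bottom_lt_top e
      rw [he] at h2
      exact not_le.2 h2 h1

/-- The voltage at a segment is its ordinate. -/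
noncomputable def voltage (w : F.network.Vertex) : ℝ := (F.node w).1

theorem current_eq (e : Fin m) : F.network.current F.voltage e = (R e).right - (R e).left := by
  have h1 : F.voltage (F.network.src e) = (R e).top := F.height_vert (e, true)
  have h2 : F.voltage (F.network.tgt e) = (R e).bottom := F.height_vert (e, false)
  have h3 := sub_pos.2 (R e).bottom_lt_top
  rw [ElectricalNetwork.current, h1, h2]
  exact div_mul_cancel₀ _ h3.ne'

open Classical in
theorem outflow_eq (w : F.network.Vertex) : F.network.outflow F.voltage w =
    ∑ e, ((if endNode R (e, true) = F.node w then (R e).right - (R e).left else 0) -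
      (if endNode R (e, false) = F.node w then (R e).right - (R e).left else 0)) := by
  have h : ∀ i, F.vert i = w ↔ endNode R i = F.node w := fun i => by
    rw [← F.node_vert, F.node_injective.eq_iff]
  unfold ElectricalNetwork.outflow
  refine Finset.sum_congr rfl fun e _ => ?_
  rw [F.current_eq]
  exact congrArg₂ (· - ·) (if_congr (h (e, true)) rfl rfl) (if_congr (h (e, false)) rfl rfl)

theorem outflow_inr (κ : Fin F.inner) : F.network.outflow F.voltage (Sum.inr κ) = 0 := by
  refine (F.outflow_eq (Sum.inr κ)).trans ?_
  rw [F.node_eq]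
  refine F.tiling.flux_inner fun u hu h => ?_
  rw [← F.node_eq, ← F.node_inl ⟨u, hu⟩] at h
  exact absurd (F.node_injective h) (by simp)

theorem outflow_inl (u : Fin b) : F.network.outflow F.voltage (Sum.inl u) =
    (v (2 * u)).re - (v (2 * u + 1)).re := by
  refine (F.outflow_eq (Sum.inl u)).trans ?_
  rw [F.node_inl]
  exact F.tiling.flux_side u.2

/-! ### The drawing -/

/-- The vertical direction from a side of the polygon to the inside, and zero for the other
segments. -/
noncomputable def sign : Fin b ⊕ Fin F.inner → ℝ := Sum.elim (fun u => sideDir v u) fun _ => 0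

/-- The point that represents a vertex. -/
noncomputable def hub (w : Fin b ⊕ Fin F.inner) : ℂ :=
  ⟨F.hubX w, (F.node w).1 + F.sign w * F.η⟩

open Classical in
/-- The distance from a segment to the bends of the edges. -/
noncomputable def lev (w : Fin b ⊕ Fin F.inner) (β : Bool) : ℝ :=
  if endDir β = F.sign w then 2 * F.η else F.δ

/-- The height of the first piece of an edge. -/
noncomputable def depth (w : Fin b ⊕ Fin F.inner) (β : Bool) : ℝ :=
  F.lev w β - endDir β * F.sign w * F.η

/-- The abscissa of the centre of a rectangle. -/
noncomputable def _root_.Rect.midX (r : Rect) : ℝ := (r.left + r.right) / 2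

/-- The bend of an edge. -/
noncomputable def bendPoint (i : Fin m × Bool) : ℂ :=
  ⟨(R i.1).midX, endY R i + endDir i.2 * F.lev (F.vert i) i.2⟩

/-- The segment between a vertex and a bend. -/
noncomputable def fan (i : Fin m × Bool) (s : ℝ) : ℂ :=
  F.hub (F.vert i) + s * (F.bendPoint i - F.hub (F.vert i))

/-- The edge. -/
noncomputable def edge (e : Fin m) (t : ℝ) : ℂ :=
  if t ≤ 1 / 3 then F.fan (e, true) (3 * t) else
    if t < 2 / 3 then
      F.bendPoint (e, true) + (3 * t - 1 : ℝ) * (F.bendPoint (e, false) - F.bendPoint (e, true))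
    else F.fan (e, false) (3 - 3 * t)

/-- The neighbourhood of a segment that contains the pieces of edges ending there. -/
def star (w : Fin b ⊕ Fin F.inner) : Set ℂ :=
  {z | z.re ∈ (F.node w).2 ∧ ∀ β, endDir β * (z.im - (F.node w).1) < F.lev w β}

theorem _root_.Rect.midX_mem (r : Rect) : r.midX ∈ Ioo r.left r.right := by
  have := r.left_lt_right
  unfold Rect.midX
  constructor <;> linarith

theorem lev_pos (w : Fin b ⊕ Fin F.inner) (β : Bool) : 0 < F.lev w β := by
  have := F.η_pos
  have := F.δ_pos
  unfold lev
  split_ifs <;> linarith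

theorem lev_le (w : Fin b ⊕ Fin F.inner) (β : Bool) : F.lev w β ≤ 2 * F.η := by
  have := F.δ_le
  unfold lev
  split_ifs <;> linarith

theorem endDir_mul_self (β : Bool) : endDir β * endDir β = 1 := by
  rcases endDir_eq_or β with h | h <;> rw [h] <;> norm_num

theorem endDir_eq_neg {β γ : Bool} (h : γ ≠ β) : endDir γ = -endDir β := by
  cases β <;> cases γ <;> simp_all [endDir]

theorem sign_eq_or (w : Fin b ⊕ Fin F.inner) : F.sign w = 1 ∨ F.sign w = -1 ∨ F.sign w = 0 := by
  rcases w with u | κ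
  · rcases sideDir_eq_or v u with h | h
    · exact Or.inl h
    · exact Or.inr (Or.inl h)
  · exact Or.inr (Or.inr rfl)

theorem endDir_mul_sign (w : Fin b ⊕ Fin F.inner) (β : Bool) :
    (endDir β = F.sign w ∧ endDir β * F.sign w = 1) ∨
    (endDir β ≠ F.sign w ∧ (endDir β * F.sign w = -1 ∨ endDir β * F.sign w = 0)) := by
  rcases endDir_eq_or β with h | h <;> rcases F.sign_eq_or w with h' | h' | h' <;> rw [h, h'] <;>
    norm_num

/-- From the hub every piece moves strictly towards its own rectangle: by η on the inner side of a
polygon side (from η to 2η), by η + δ on the outer side, and by δ at an inner vertex. -/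
theorem depth_pos (w : Fin b ⊕ Fin F.inner) (β : Bool) : 0 < F.depth w β := by
  have := F.η_pos
  have := F.δ_pos
  unfold depth lev
  rcases F.endDir_mul_sign w β with ⟨h1, h2⟩ | ⟨h1, h2 | h2⟩
  · rw [if_pos h1, h2]; linarith
  · rw [if_neg h1, h2]; linarith
  · rw [if_neg h1, h2]; linarith

theorem fan_re (i : Fin m × Bool) (s : ℝ) : (F.fan i s).re =
    F.hubX (F.vert i) + s * ((R i.1).midX - F.hubX (F.vert i)) := by
  simp [fan, hub, bendPoint]

theorem fan_im (i : Fin m × Bool) (s : ℝ) : (F.fan i s).im = (F.node (F.vert i)).1 +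
    F.sign (F.vert i) * F.η + s * (endDir i.2 * F.depth (F.vert i) i.2) := by
  have h := endDir_mul_self i.2
  have h2 := F.height_vert i
  simp only [fan, hub, bendPoint, depth, Complex.add_im, Complex.mul_im, Complex.ofReal_re,
    Complex.ofReal_im, Complex.sub_im, zero_mul, add_zero]
  linear_combination -s * h2 + s * F.sign (F.vert i) * F.η * h

theorem hub_mem_star (w : Fin b ⊕ Fin F.inner) : F.hub w ∈ F.star w := by
  refine ⟨F.hubX_mem_node w, fun β => ?_⟩
  have := F.depth_pos w β
  unfold depth at this
  simp only [hub]
  linarith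

theorem fan_mem_node (i : Fin m × Bool) {s : ℝ} (hs : s ∈ Icc (0 : ℝ) 1) :
    (F.fan i s).re ∈ (F.node (F.vert i)).2 := by
  rw [fan_re]
  have h1 := (F.node_ordConnected (F.vert i)).convex (F.hubX_mem_node _)
    (F.mem_node_vert (Ioo_subset_Icc_self (R i.1).midX_mem)) (a := 1 - s) (b := s)
    (by linarith [hs.2]) hs.1 (by ring)
  convert h1 using 1
  simp only [smul_eq_mul]
  ring

theorem fan_mem_star (i : Fin m × Bool) {s : ℝ} (hs : s ∈ Ico (0 : ℝ) 1) :
    F.fan i s ∈ F.star (F.vert i) := by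
  refine ⟨F.fan_mem_node i ⟨hs.1, hs.2.le⟩, fun γ => ?_⟩
  rw [fan_im]
  set w := F.vert i
  have h1 := F.depth_pos w γ
  have hl := F.lev_pos w γ
  have hl' := F.lev_pos w i.2
  have h4 := sub_pos.2 hs.2
  by_cases h2 : γ = i.2
  · have h3 := endDir_mul_self i.2
    rw [h2] at h1 ⊢
    unfold depth at h1 ⊢
    have := mul_pos h4 h1
    have h5 : endDir i.2 * ((F.node w).1 + F.sign w * F.η + s * (endDir i.2 *
      (F.lev w i.2 - endDir i.2 * F.sign w * F.η)) - (F.node w).1) =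
      endDir i.2 * F.sign w * F.η + s * (F.lev w i.2 - endDir i.2 * F.sign w * F.η) := by
      linear_combination s * (F.lev w i.2 - endDir i.2 * F.sign w * F.η) * h3
    rw [h5]
    linarith
  · have h3 := endDir_mul_self i.2
    have h6 := mul_nonneg hs.1 hl'.le
    have h7 := mul_nonneg hs.1 hl.le
    have h8 := mul_pos h4 h1
    unfold depth at h1 h8 ⊢
    rw [endDir_eq_neg h2] at h1 h8 ⊢
    have h5 : -endDir i.2 * ((F.node w).1 + F.sign w * F.η + s * (endDir i.2 *
      (F.lev w i.2 - endDir i.2 * F.sign w * F.η)) - (F.node w).1) =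
      -endDir i.2 * F.sign w * F.η - s * (F.lev w i.2 - endDir i.2 * F.sign w * F.η) := by
      linear_combination -s * (F.lev w i.2 - endDir i.2 * F.sign w * F.η) * h3
    rw [h5]
    linarith

theorem abs_lt_of_mem_star {z : ℂ} {w : Fin b ⊕ Fin F.inner} (hz : z ∈ F.star w) :
    |z.im - (F.node w).1| < 2 * F.η := by
  have h1 := hz.2 true
  have h2 := hz.2 false
  have h3 := F.lev_le w true
  have h4 := F.lev_le w false
  simp only [endDir, if_true, Bool.false_eq_true, if_false] at h1 h2
  rw [abs_lt]
  constructor <;> linarith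

/-- Stars at different heights are separated by the gap; at the same height a common abscissa
identifies the segments. -/
theorem eq_of_mem_star {z : ℂ} {w w' : Fin b ⊕ Fin F.inner} (hz : z ∈ F.star w)
    (hz' : z ∈ F.star w') : w = w' := by
  refine F.eq_of_mem ?_ hz.1 hz'.1
  by_contra hne
  have h1 := F.gap _ (F.height_mem w) _ (F.height_mem w') hne
  have h2 := F.abs_lt_of_mem_star hz
  have h3 := F.abs_lt_of_mem_star hz'
  have h4 := F.η_pos
  rw [abs_lt] at h2 h3
  rcases lt_abs.1 h1 with h | h <;> linarith

theorem hub_injective : Function.Injective F.hub := fun w w' h =>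
  F.eq_of_mem_star (F.hub_mem_star w) (h ▸ F.hub_mem_star w')

/-- The vertical piece of an edge. -/
def trunk (e : Fin m) : Set ℂ :=
  {z | z.re = (R e).midX ∧ z.im ∈ Icc (F.bendPoint (e, false)).im (F.bendPoint (e, true)).im}

theorem bendPoint_bottom (e : Fin m) : (F.bendPoint (e, false)).im =
    endY R (e, false) + F.lev (F.vert (e, false)) false := by
  simp [bendPoint, endDir]

theorem bendPoint_top (e : Fin m) : (F.bendPoint (e, true)).im =
    endY R (e, true) - F.lev (F.vert (e, true)) true := by
  simp [bendPoint, endDir]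
  ring

theorem height_gap (e : Fin m) : 10 * F.η < endY R (e, true) - endY R (e, false) := by
  have h := bottom_lt_top_end R e
  have h1 := F.gap _ (endY_mem_genericY v b (e, true)) _ (endY_mem_genericY v b (e, false)) h.ne'
  rwa [abs_of_pos (sub_pos.2 h)] at h1

theorem bend_lt_bend (e : Fin m) : (F.bendPoint (e, false)).im < (F.bendPoint (e, true)).im := by
  rw [bendPoint_bottom, bendPoint_top]
  have h1 := F.height_gap e
  have h2 := F.lev_le (F.vert (e, false)) false
  have h3 := F.lev_le (F.vert (e, true)) true
  have := F.η_pos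
  linarith

theorem mem_interior_of_trunk {e : Fin m} {z : ℂ} (hz : z ∈ F.trunk e) :
    z.re ∈ Ioo (R e).left (R e).right ∧ z.im ∈ Ioo (endY R (e, false)) (endY R (e, true)) := by
  obtain ⟨h1, h2, h3⟩ := hz
  rw [bendPoint_bottom] at h2
  rw [bendPoint_top] at h3
  have h4 := F.lev_pos (F.vert (e, false)) false
  have h5 := F.lev_pos (F.vert (e, true)) true
  exact ⟨h1 ▸ (R e).midX_mem, by linarith, by linarith⟩

/-- A star at the level of an end of the rectangle stops before the bend there. A star at another
level close enough to the vertical piece would belong to a segment running through the interior of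
the rectangle. -/
theorem notMem_star_of_trunk {e : Fin m} {z : ℂ} (hz : z ∈ F.trunk e) (w : Fin b ⊕ Fin F.inner) :
    z ∉ F.star w := by
  intro hw
  obtain ⟨hx, hz1, hz2⟩ := F.mem_interior_of_trunk hz
  have h1 := F.tiling.notMem_interior (F.node_subset w hw.1) e
  have h2 := F.abs_lt_of_mem_star hw
  have h3 := F.η_pos
  rw [abs_lt] at h2
  by_cases hb : (F.node w).1 = endY R (e, false)
  · have h4 := F.vert_eq hb.symm hw.1 (Ioo_subset_Icc_self hx)
    have h5 := hw.2 false
    have h6 := hz.2.1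
    rw [bendPoint_bottom, h4] at h6
    simp only [endDir, Bool.false_eq_true, if_false, hb] at h5
    linarith
  by_cases ht : (F.node w).1 = endY R (e, true)
  · have h4 := F.vert_eq ht.symm hw.1 (Ioo_subset_Icc_self hx)
    have h5 := hw.2 true
    have h6 := hz.2.2
    rw [bendPoint_top, h4] at h6
    simp only [endDir, if_true, ht] at h5
    linarith
  have g1 := F.gap _ (F.height_mem w) _ (endY_mem_genericY v b (e, false)) hb
  have g2 := F.gap _ (F.height_mem w) _ (endY_mem_genericY v b (e, true)) ht
  apply h1
  refine ⟨hx, ?_, ?_⟩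
  · change endY R (e, false) < _
    rcases lt_abs.1 g1 with g | g <;> linarith
  · change _ < endY R (e, true)
    rcases lt_abs.1 g2 with g | g <;> linarith

theorem eq_of_mem_trunk {e f : Fin m} {z : ℂ} (he : z ∈ F.trunk e) (hf : z ∈ F.trunk f) :
    e = f := by
  by_contra hne
  refine Set.disjoint_left.1 (F.tiling.disj e f hne) (show (z.re, z.im) ∈ _ from ?_) ?_ <;>
    rw [Rect.interior_toSet]
  · exact F.mem_interior_of_trunk he
  · exact F.mem_interior_of_trunk hf

/-- The height relative to the common hub changes linearly with nonzero slope. Its sign tells a top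
from a bottom and its size gives the parameter; then the abscissa gives the middle of the rectangle,
and no two rectangles with the same kind of end at one level overlap horizontally. -/
theorem fan_eq_fan {i j : Fin m × Bool} {s t : ℝ} (hw : F.vert i = F.vert j) (hs : 0 < s)
    (ht : 0 ≤ t) (h : F.fan i s = F.fan j t) : i = j ∧ s = t := by
  have him := congrArg Complex.im h
  have hre := congrArg Complex.re h
  have hy : endY R i = endY R j := by rw [← F.height_vert, ← F.height_vert, hw]
  rw [fan_im, fan_im, hw, add_right_inj] at him
  rw [fan_re, fan_re, hw, add_right_inj] at hre
  have d1 := F.depth_pos (F.vert j) i.2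
  have d2 := F.depth_pos (F.vert j) j.2
  have hβ : i.2 = j.2 := by
    by_contra hne
    rw [endDir_eq_neg hne] at him
    have h1 := mul_pos hs d1
    have h2 := mul_nonneg ht d2.le
    rcases endDir_eq_or j.2 with h3 | h3 <;> rw [h3] at him <;> linarith
  rw [hβ] at him
  have hst : s = t := by
    refine mul_right_cancel₀ (b := endDir j.2 * F.depth (F.vert j) j.2) ?_ him
    refine mul_ne_zero ?_ d2.ne'
    rcases endDir_eq_or j.2 with h3 | h3 <;> rw [h3] <;> norm_num
  refine ⟨?_, hst⟩
  rw [← hst] at hre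
  have hm : (R i.1).midX = (R j.1).midX := by
    have := mul_left_cancel₀ hs.ne' hre
    linarith
  obtain ⟨e, β⟩ := i
  obtain ⟨f, γ⟩ := j
  obtain rfl : β = γ := hβ
  rw [F.tiling.eq_of_end hy (R e).midX_mem (hm ▸ (R f).midX_mem)]

theorem fan_zero (i : Fin m × Bool) : F.fan i 0 = F.hub (F.vert i) := by simp [fan]

theorem edge_cases (e : Fin m) {t : ℝ} (ht : t ∈ Icc (0 : ℝ) 1) :
    (∃ s ∈ Ico (0 : ℝ) 1, t = s / 3 ∧ F.edge e t = F.fan (e, true) s) ∨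
    (F.edge e t ∈ F.trunk e ∧ (F.edge e t).im = (F.bendPoint (e, true)).im +
      (3 * t - 1) * ((F.bendPoint (e, false)).im - (F.bendPoint (e, true)).im)) ∨
    ∃ s ∈ Ico (0 : ℝ) 1, t = 1 - s / 3 ∧ F.edge e t = F.fan (e, false) s := by
  have hlt := F.bend_lt_bend e
  rcases lt_trichotomy t (1 / 3) with h | h | h
  · refine Or.inl ⟨3 * t, ⟨by linarith [ht.1], by linarith⟩, by ring, ?_⟩
    rw [edge, if_pos h.le]
  · refine Or.inr (Or.inl ?_)
    have h1 : F.edge e t = F.bendPoint (e, true) := by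
      rw [edge, if_pos h.le, h]
      norm_num [fan]
    rw [h1, h]
    exact ⟨⟨rfl, hlt.le, le_rfl⟩, by ring⟩
  · rcases lt_trichotomy t (2 / 3) with h' | h' | h'
    · refine Or.inr (Or.inl ?_)
      have h1 : F.edge e t = F.bendPoint (e, true) +
          (3 * t - 1 : ℝ) * (F.bendPoint (e, false) - F.bendPoint (e, true)) := by
        rw [edge, if_neg (not_le.2 h), if_pos h']
      have h2 : (F.edge e t).im = (F.bendPoint (e, true)).im +
          (3 * t - 1) * ((F.bendPoint (e, false)).im - (F.bendPoint (e, true)).im) := by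
        rw [h1, Complex.add_im, Complex.im_ofReal_mul, Complex.sub_im]
      refine ⟨⟨?_, ?_⟩, h2⟩
      · rw [h1, Complex.add_re, Complex.re_ofReal_mul, Complex.sub_re]
        simp [bendPoint]
      · rw [h2]
        have h3 := sub_pos.2 hlt
        constructor <;> nlinarith
    · refine Or.inr (Or.inl ?_)
      have h1 : F.edge e t = F.bendPoint (e, false) := by
        rw [edge, if_neg (not_le.2 h), if_neg h'.ge.not_gt, h']
        norm_num [fan]
      rw [h1, h']
      exact ⟨⟨rfl, le_rfl, hlt.le⟩, by ring⟩
    · refine Or.inr (Or.inr ⟨3 - 3 * t, ⟨by linarith [ht.2], by linarith⟩, by ring, ?_⟩)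
      rw [edge, if_neg (not_le.2 h), if_neg (not_lt.2 h'.le)]

theorem edge_zero (e : Fin m) : F.edge e 0 = F.hub (F.vert (e, true)) := by
  rw [edge, if_pos (by norm_num), mul_zero, fan_zero]

theorem edge_one (e : Fin m) : F.edge e 1 = F.hub (F.vert (e, false)) := by
  rw [edge, if_neg (by norm_num), if_neg (by norm_num), ← fan_zero]
  norm_num

theorem edge_eq_edge {e f : Fin m} {s t : ℝ} (hs : s ∈ Ioo (0 : ℝ) 1) (ht : t ∈ Icc (0 : ℝ) 1)
    (h : F.edge e s = F.edge f t) : e = f ∧ s = t := by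
  have key : ∀ i j : Fin m × Bool, ∀ p ∈ Ioo (0 : ℝ) 1, ∀ q ∈ Ico (0 : ℝ) 1,
      F.fan i p = F.fan j q → i = j ∧ p = q := fun i j p hp q hq hpq =>
    F.fan_eq_fan (F.eq_of_mem_star (F.fan_mem_star i ⟨hp.1.le, hp.2⟩)
      (hpq ▸ F.fan_mem_star j hq)) hp.1 hq.1 hpq
  rcases F.edge_cases e (Ioo_subset_Icc_self hs) with ⟨p, hp, hps, h1⟩ | ⟨h1, h1'⟩ |
    ⟨p, hp, hps, h1⟩ <;>
  rcases F.edge_cases f ht with ⟨q, hq, hqt, h2⟩ | ⟨h2, h2'⟩ | ⟨q, hq, hqt, h2⟩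
  · obtain ⟨h3, h4⟩ := key _ _ p ⟨by linarith [hs.1], hp.2⟩ q hq (by rw [← h1, ← h2, h])
    exact ⟨congrArg Prod.fst h3, by rw [hps, hqt, h4]⟩
  · exact absurd (h1 ▸ F.fan_mem_star _ hp) (F.notMem_star_of_trunk (h ▸ h2) _)
  · obtain ⟨h3, h4⟩ := key _ _ p ⟨by linarith [hs.1], hp.2⟩ q hq (by rw [← h1, ← h2, h])
    exact absurd (congrArg Prod.snd h3) (by simp)
  · exact absurd (h2 ▸ F.fan_mem_star _ hq) (F.notMem_star_of_trunk (h ▸ h1) _)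
  · obtain rfl := F.eq_of_mem_trunk h1 (h ▸ h2)
    refine ⟨rfl, ?_⟩
    have h3 := congrArg Complex.im h
    rw [h1', h2', add_right_inj] at h3
    have h4 := mul_right_cancel₀ (sub_neg.2 (F.bend_lt_bend e)).ne h3
    linarith
  · exact absurd (h2 ▸ F.fan_mem_star _ hq) (F.notMem_star_of_trunk (h ▸ h1) _)
  · obtain ⟨h3, h4⟩ := key _ _ p ⟨by linarith [hs.2], hp.2⟩ q hq (by rw [← h1, ← h2, h])
    exact absurd (congrArg Prod.snd h3) (by simp)
  · exact absurd (h1 ▸ F.fan_mem_star _ hp) (F.notMem_star_of_trunk (h ▸ h2) _)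
  · obtain ⟨h3, h4⟩ := key _ _ p ⟨by linarith [hs.2], hp.2⟩ q hq (by rw [← h1, ← h2, h])
    exact ⟨congrArg Prod.fst h3, by rw [hps, hqt, h4]⟩

theorem edge_ne_hub {e : Fin m} {t : ℝ} (ht : t ∈ Ioo (0 : ℝ) 1) (w : Fin b ⊕ Fin F.inner) :
    F.edge e t ≠ F.hub w := by
  intro h
  have key : ∀ i : Fin m × Bool, ∀ p ∈ Ioo (0 : ℝ) 1, F.fan i p ≠ F.hub w := by
    intro i p hp hi
    obtain rfl := F.eq_of_mem_star (F.fan_mem_star i ⟨hp.1.le, hp.2⟩) (hi ▸ F.hub_mem_star w)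
    rw [← fan_zero] at hi
    exact hp.1.ne' (F.fan_eq_fan rfl hp.1 le_rfl hi).2
  rcases F.edge_cases e (Ioo_subset_Icc_self ht) with ⟨p, hp, hpt, h1⟩ | ⟨h1, -⟩ | ⟨p, hp, hpt, h1⟩
  · exact key _ p ⟨by linarith [ht.1], hp.2⟩ (h1 ▸ h)
  · exact F.notMem_star_of_trunk h1 w (h ▸ F.hub_mem_star w)
  · exact key _ p ⟨by linarith [ht.2], hp.2⟩ (h1 ▸ h)

theorem injOn_edge (e : Fin m) : InjOn (F.edge e) (Icc 0 1) := by
  intro s hs t ht h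
  by_cases h1 : s ∈ Ioo (0 : ℝ) 1
  · exact (F.edge_eq_edge h1 ht h).2
  by_cases h2 : t ∈ Ioo (0 : ℝ) 1
  · exact (F.edge_eq_edge h2 hs h.symm).2.symm
  have hend : ∀ r ∈ Icc (0 : ℝ) 1, r ∉ Ioo (0 : ℝ) 1 → r = 0 ∨ r = 1 := by
    intro r hr hr'
    by_contra! hc
    exact hr' ⟨lt_of_le_of_ne hr.1 hc.1.symm, lt_of_le_of_ne hr.2 hc.2⟩
  have hne : F.hub (F.vert (e, false)) ≠ F.hub (F.vert (e, true)) := fun h3 =>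
    (F.bottom_lt_top e).ne (by rw [F.hub_injective h3])
  rcases hend s hs h1 with rfl | rfl <;> rcases hend t ht h2 with rfl | rfl
  · rfl
  · rw [edge_zero, edge_one] at h; exact absurd h.symm hne
  · rw [edge_zero, edge_one] at h; exact absurd h hne
  · rfl

end TilingFrame

theorem lineMap_of_affineOn {f : ℝ → ℂ} {A B : ℂ} {p q a c θ : ℝ}
    (hf : ∀ t ∈ Icc p q, f t = A + t * B) (ha : p ≤ a) (hac : a ≤ c) (hc : c ≤ q)
    (hθ : θ ∈ Icc (0 : ℝ) 1) :
    f (AffineMap.lineMap a c θ) = AffineMap.lineMap (f a) (f c) θ := by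
  have h1 : AffineMap.lineMap a c θ = a + θ * (c - a) := by
    rw [AffineMap.lineMap_apply, vsub_eq_sub, vadd_eq_add, smul_eq_mul, add_comm]
  have h2 := mul_nonneg hθ.1 (sub_nonneg.2 hac)
  have h3 := mul_nonneg (sub_nonneg.2 hθ.2) (sub_nonneg.2 hac)
  rw [h1, hf _ ⟨by linarith, by linarith⟩, hf a ⟨ha, hac.trans hc⟩, hf c ⟨ha.trans hac, hc⟩,
    AffineMap.lineMap_apply, vsub_eq_sub, vadd_eq_add, Complex.real_smul]
  push_cast
  ring

theorem IsTiling.mem_region_of_mem_rect {v : ℕ → ℂ} {b m : ℕ} {R : Fin m → Rect}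
    (h : IsTiling v b R) {e : Fin m} {z : ℂ}
    (hx : z.re ∈ Icc (R e).left (R e).right)
    (hy : z.im ∈ Icc (endY R (e, false)) (endY R (e, true))) : z ∈ loopRegion v (2 * b) := by
  have hz : (z.re, z.im) ∈ toC ⁻¹' loopRegion v (2 * b) := by
    rw [← h.cover]
    exact mem_iUnion.2 ⟨e, hx, hy⟩
  exact hz

/-! ### The drawing stays in the notched polygon. -/

namespace TilingFrame

variable {v : ℕ → ℂ} {b m : ℕ} {R : Fin m → Rect} (F : TilingFrame v b R)

theorem isPiecewiseLinear_edge (e : Fin m) : IsPiecewiseLinear (F.edge e) := by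
  have h1 : ∀ t ∈ Icc (0 : ℝ) (1 / 3), F.edge e t = F.hub (F.vert (e, true)) +
      t * (3 * (F.bendPoint (e, true) - F.hub (F.vert (e, true)))) := by
    intro t ht
    rw [edge, if_pos ht.2, fan]
    push_cast
    ring
  have h3 : ∀ t ∈ Icc (2 / 3 : ℝ) 1, F.edge e t = F.hub (F.vert (e, false)) +
      3 * (F.bendPoint (e, false) - F.hub (F.vert (e, false))) +
      t * (-3 * (F.bendPoint (e, false) - F.hub (F.vert (e, false)))) := by
    intro t ht
    rw [edge, if_neg (by linarith [ht.1]), if_neg (not_lt.2 ht.1), fan]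
    push_cast
    ring
  have h2 : ∀ t ∈ Icc (1 / 3 : ℝ) (2 / 3), F.edge e t = F.bendPoint (e, true) -
      (F.bendPoint (e, false) - F.bendPoint (e, true)) +
      t * (3 * (F.bendPoint (e, false) - F.bendPoint (e, true))) := by
    intro t ht
    rcases ht.1.eq_or_lt with rfl | h4
    · rw [h1 _ ⟨by norm_num, le_rfl⟩]
      push_cast
      ring
    rcases ht.2.eq_or_lt with rfl | h5
    · rw [h3 _ ⟨le_rfl, by norm_num⟩]
      push_cast
      ring
    rw [edge, if_neg (not_le.2 h4), if_pos h5]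
    push_cast
    ring
  refine ⟨{1 / 3, 2 / 3}, fun a c ha hac hc hs θ hθ => ?_⟩
  have h4 := hs (1 / 3) (by simp)
  have h5 := hs (2 / 3) (by simp)
  rcases le_or_gt c (1 / 3) with h6 | h6
  · exact lineMap_of_affineOn h1 ha hac h6 hθ
  have h7 : 1 / 3 ≤ a := by
    by_contra! h; exact h4 ⟨h, h6⟩
  rcases le_or_gt c (2 / 3) with h8 | h8
  · exact lineMap_of_affineOn h2 h7 hac h8 hθ
  have h9 : 2 / 3 ≤ a := by
    by_contra! h; exact h5 ⟨h, h8⟩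
  exact lineMap_of_affineOn h3 h9 hac hc hθ

/-- A point slightly above or below a segment is in a rectangle that touches the segment from that
direction. Such a rectangle may be missing only on the outer side of a polygon side, which is
excluded by `hside`. -/
theorem mem_region_of_mem_node {w : Fin b ⊕ Fin F.inner} {z : ℂ} (hx : z.re ∈ (F.node w).2)
    (hd : |z.im - (F.node w).1| ≤ 2 * F.η)
    (hside : ∀ u, w = Sum.inl u → |z.re - sideMid v u| ≤ sideHalf v u →
      0 ≤ sideDir v u * (z.im - (F.node w).1)) : z ∈ loopRegion v (2 * b) := by
  have key : ∀ β, 0 < endDir β * (z.im - (F.node w).1) →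
      ∃ e, endY R (e, β) = (F.node w).1 ∧ z.re ∈ Icc (R e).left (R e).right := by
    intro β hβ
    refine F.tiling.exists_end (F.node_subset w hx) fun u hu hy hxu => ?_
    have h1 := hside ⟨u, hu⟩ (F.inl_eq hx (u := ⟨u, hu⟩) hy hxu).symm hxu
    change 0 ≤ sideDir v u * _ at h1
    rcases endDir_eq_or β with h2 | h2 <;> rcases sideDir_eq_or v u with h3 | h3 <;>
      rw [h2] at hβ ⊢ <;> rw [h3] at h1 ⊢ <;> linarith
  have hη := F.η_pos
  rw [abs_le] at hd
  rcases lt_trichotomy z.im (F.node w).1 with h | h | h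
  · obtain ⟨e, he, hxe⟩ := key true (by simp only [endDir, if_true]; linarith)
    have h1 := F.height_gap e
    exact F.tiling.mem_region_of_mem_rect hxe ⟨by linarith, by linarith⟩
  · obtain ⟨⟨e, β⟩, he, hxe⟩ := F.node_subset w hx
    refine F.tiling.mem_region_of_mem_rect hxe ?_
    rw [h, ← he]
    cases β
    · exact ⟨le_rfl, (bottom_lt_top_end R e).le⟩
    · exact ⟨(bottom_lt_top_end R e).le, le_rfl⟩
  · obtain ⟨e, he, hxe⟩ := key false (by simp only [endDir, Bool.false_eq_true, if_false]; linarith)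
    have h1 := F.height_gap e
    exact F.tiling.mem_region_of_mem_rect hxe ⟨by linarith, by linarith⟩

/-- In the coordinates of a side of the polygon, a piece of an edge that ends there either goes
inside or avoids the triangle cut off at the side. -/
theorem fan_inl {i : Fin m × Bool} {u : Fin b} (hi : F.vert i = Sum.inl u) {s : ℝ}
    (hs : 0 < s) :
    F.η < sideDir v u * ((F.fan i s).im - (v (2 * u)).im) ∨
    (F.η - sideDir v u * ((F.fan i s).im - (v (2 * u)).im)) * sideHalf v u <
      F.η * |(F.fan i s).re - sideMid v u| := by
  have hη := F.η_pos
  have hsq := sideDir_mul_self (v := v) u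
  have hsign : F.sign (Sum.inl u) = sideDir v u := rfl
  have hd := F.depth_pos (Sum.inl u) i.2
  rw [fan_im, fan_re, hi, F.height_inl, F.hubX_inl, hsign, add_sub_cancel_left]
  have h0 : sideDir v u * ((v (2 * u)).im + sideDir v u * F.η +
      s * (endDir i.2 * F.depth (Sum.inl u) i.2) - (v (2 * u)).im) =
      F.η + sideDir v u * endDir i.2 * (s * F.depth (Sum.inl u) i.2) := by
    linear_combination F.η * hsq
  rw [h0]
  by_cases hβ : endDir i.2 = sideDir v u
  · left
    rw [hβ, hsq]
    have := mul_pos hs hd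
    linarith
  · right
    have hy : endY R i = (v (2 * u)).im := by rw [← F.height_vert, hi, F.height_inl]
    have h1 := F.bend i.1 i.2 u hy hβ
    have h2 : sideDir v u * endDir i.2 = -1 := by
      rcases endDir_eq_or i.2 with h3 | h3 <;> rcases sideDir_eq_or v u with h4 | h4 <;>
        rw [h3, h4] at hβ ⊢ <;> first | exact absurd rfl hβ | norm_num
    have h3 : F.depth (Sum.inl u) i.2 = F.η + F.δ := by
      unfold depth lev
      rw [hsign, if_neg hβ, mul_comm (endDir i.2), h2]
      ring
    rw [h2, h3, abs_mul, abs_of_pos hs]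
    have h4 := mul_lt_mul_of_pos_left h1 hs
    change s * ((F.η + F.δ) * sideHalf v u) < s * (F.η * |(R i.1).midX - sideMid v u|) at h4
    linarith

theorem abs_fan_im_sub_le (i : Fin m × Bool) {s : ℝ} (hs : s ∈ Ico (0 : ℝ) 1) :
    |(F.fan i s).im - (F.node (F.vert i)).1| ≤ 2 * F.η :=
  (F.abs_lt_of_mem_star (F.fan_mem_star i hs)).le

theorem fan_mem_region (i : Fin m × Bool) {s : ℝ} (hs : s ∈ Ico (0 : ℝ) 1) :
    F.fan i s ∈ loopRegion v (2 * b) := by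
  refine F.mem_region_of_mem_node (F.fan_mem_node i ⟨hs.1, hs.2.le⟩) (F.abs_fan_im_sub_le i hs) ?_
  intro u hu hx
  have hη := F.η_pos
  rw [hu, F.height_inl]
  rcases hs.1.eq_or_lt with h0 | h0
  · rw [← h0, fan_im, hu, F.height_inl]
    have : F.sign (Sum.inl u) = sideDir v u := rfl
    rw [this]
    have hsq := sideDir_mul_self (v := v) u
    have h1 : sideDir v u * ((v (2 * u)).im + sideDir v u * F.η +
      0 * (endDir i.2 * F.depth (Sum.inl u) i.2) - (v (2 * u)).im) = F.η := by
      linear_combination F.η * hsq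
    rw [h1]
    exact hη.le
  · rcases F.fan_inl hu h0 with h | h
    · linarith
    · by_contra! hc
      have h1 := mul_le_mul_of_nonneg_left hx hη.le
      have h2 := F.tiling.loop.sideHalf_pos u
      nlinarith

theorem edge_mem_region (e : Fin m) {t : ℝ} (ht : t ∈ Icc (0 : ℝ) 1) :
    F.edge e t ∈ loopRegion v (2 * b) := by
  rcases F.edge_cases e ht with ⟨s, hs, -, h⟩ | ⟨h, -⟩ | ⟨s, hs, -, h⟩
  · rw [h]; exact F.fan_mem_region _ hs
  · obtain ⟨h1, h2⟩ := F.mem_interior_of_trunk h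
    exact F.tiling.mem_region_of_mem_rect (Ioo_subset_Icc_self h1) (Ioo_subset_Icc_self h2)
  · rw [h]; exact F.fan_mem_region _ hs

theorem isSmall : OrthoLoop.IsSmall v F.η := by
  refine ⟨F.η_pos, fun i j hij => ?_⟩
  have h1 := F.gap _ (F.tiling.loop.im_mem_genericY R i) _ (F.tiling.loop.im_mem_genericY R j) hij
  have := F.η_pos
  linarith

theorem mem_star_of_mem_notch {u : Fin b} {z : ℂ} (hz : z ∈ notch v F.η u) :
    z ∈ F.star (Sum.inl u) := by
  have hη := F.η_pos
  have h1 := abs_im_le_of_mem_notch (F.tiling.loop.sideHalf_pos u) hη hz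
  have h2 : 0 ≤ sideDir v u * (z.im - (v (2 * u)).im) := hz.1
  refine ⟨F.mem_node_inl u h1.2.1, fun β => ?_⟩
  have hl := F.lev_pos (Sum.inl u) β
  rw [F.height_inl]
  by_cases hβ : endDir β = sideDir v u
  · have hl' : F.lev (Sum.inl u) β = 2 * F.η := if_pos hβ
    have h3 := (abs_le.1 h1.1).1
    have h4 := (abs_le.1 h1.1).2
    rw [hl']
    rcases endDir_eq_or β with h5 | h5 <;> rw [h5] <;> linarith
  · rcases endDir_eq_or β with h5 | h5 <;> rcases sideDir_eq_or v u with h6 | h6 <;>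
      rw [h5, h6] at hβ <;> rw [h6] at h2 <;> rw [h5] <;> first | linarith | exact absurd rfl hβ

theorem notMem_notch_of_fan {i : Fin m × Bool} {s : ℝ} (hs : s ∈ Ioo (0 : ℝ) 1) (u : Fin b) :
    F.fan i s ∉ notch v F.η u := by
  intro h
  have hi := F.eq_of_mem_star (F.fan_mem_star i ⟨hs.1.le, hs.2⟩) (F.mem_star_of_mem_notch h)
  have hη := F.η_pos
  have hh := F.tiling.loop.sideHalf_pos u
  have h1 : F.η * |(F.fan i s).re - sideMid v u| ≤
    (F.η - sideDir v u * ((F.fan i s).im - (v (2 * u)).im)) * sideHalf v u := h.2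
  rcases F.fan_inl hi hs.1 with h2 | h2
  · have h3 := mul_nonneg hη.le (abs_nonneg ((F.fan i s).re - sideMid v u))
    nlinarith
  · linarith

theorem edge_notMem_notch (e : Fin m) {t : ℝ} (ht : t ∈ Ioo (0 : ℝ) 1) (u : Fin b) :
    F.edge e t ∉ notch v F.η u := by
  rcases F.edge_cases e (Ioo_subset_Icc_self ht) with ⟨s, hs, hst, h⟩ | ⟨h, -⟩ | ⟨s, hs, hst, h⟩
  · rw [h]; exact F.notMem_notch_of_fan ⟨by linarith [ht.1], hs.2⟩ u
  · exact fun h1 => F.notMem_star_of_trunk h _ (F.mem_star_of_mem_notch h1)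
  · rw [h]; exact F.notMem_notch_of_fan ⟨by linarith [ht.2], hs.2⟩ u

theorem hub_inr_notMem_notch (κ : Fin F.inner) (u : Fin b) :
    F.hub (Sum.inr κ) ∉ notch v F.η u := fun h =>
  absurd (F.eq_of_mem_star (F.hub_mem_star _) (F.mem_star_of_mem_notch h)) (by simp)

theorem hub_inl (u : Fin b) : F.hub (Sum.inl u) = sideHub v F.η u := by
  have : F.sign (Sum.inl u) = sideDir v u := rfl
  rw [hub, F.hubX_inl, F.height_inl, this]
  rfl

theorem hub_mem_region_notchLoop (w : Fin b ⊕ Fin F.inner) :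
    F.hub w ∈ loopRegion (notchLoop v F.η) (3 * b) := by
  rcases w with u | κ
  · rw [hub_inl]
    exact F.tiling.loop.sideHub_mem_region F.isSmall u
  · refine F.tiling.loop.mem_region_notchLoop F.isSmall ?_
      fun u hu => F.hub_inr_notMem_notch κ ⟨u, hu⟩
    refine F.mem_region_of_mem_node (F.hubX_mem_node (Sum.inr κ))
      (F.abs_lt_of_mem_star (F.hub_mem_star _)).le ?_
    intro u hu
    exact absurd hu (by simp)

theorem edge_mem_region_notchLoop (e : Fin m) {t : ℝ} (ht : t ∈ Icc (0 : ℝ) 1) :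
    F.edge e t ∈ loopRegion (notchLoop v F.η) (3 * b) := by
  by_cases h : t ∈ Ioo (0 : ℝ) 1
  · exact F.tiling.loop.mem_region_notchLoop F.isSmall (F.edge_mem_region e ht)
      fun u hu => F.edge_notMem_notch e h ⟨u, hu⟩
  · rcases ht.1.eq_or_lt with h0 | h0
    · rw [← h0, edge_zero]
      exact F.hub_mem_region_notchLoop _
    rcases ht.2.eq_or_lt with h1 | h1
    · rw [h1, edge_one]
      exact F.hub_mem_region_notchLoop _
    · exact absurd ⟨h0, h1⟩ h

/-- The drawing in the notched polygon is transported to the disc by an injective piecewise linear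
map, which preserves disjointness and polygonal arcs. -/
theorem isPlanar_network : F.network.IsPlanar := by
  have hloop := F.tiling.loop.posLoop_notchLoop F.isSmall
  obtain ⟨Φ, κ, hκ, 𝒦, hinj, hvert, hlt, hconv, hcl, haff, hcov⟩ := hloop.exists_disc_map
  have hb : (0 : ℝ) < b := by
    have := hloop.pos
    exact_mod_cast (by omega : 0 < b)
  -- All the vertices of the notched polygon are in notches, so points off the notches go to the
  -- open disc.
  have hnorm : ∀ z ∈ loopRegion (notchLoop v F.η) (3 * b), (∀ u : Fin b, z ∉ notch v F.η u) →
      ‖Φ z‖ < 1 := by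
    intro z hz hn
    refine hlt z hz fun i hi he => ?_
    obtain ⟨u, hu, h1⟩ := F.tiling.loop.exists_mem_notch F.η_pos hi
    exact hn ⟨u, hu⟩ (he ▸ h1)
  have hπ := Real.pi_pos
  refine ⟨fun w => Φ (F.hub w), fun e t => Φ (F.edge e t), ?_, ?_, ?_, ?_, ?_, ?_⟩
  · exact fun w w' h => F.hub_injective
      (hinj (F.hub_mem_region_notchLoop w) (F.hub_mem_region_notchLoop w') h)
  -- The hub of the side u is the vertex 3u + 1 of the notched polygon with 3b vertices, which
  -- determines its angle.
  · refine ⟨fun u => 2 * Real.pi * ((3 * u + 1 : ℕ) : ℝ) / ((3 * b : ℕ) : ℝ), ?_, ?_, ?_⟩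
    · intro u w huw
      have h1 : (u : ℕ) < w := huw
      have h2 : ((3 * u + 1 : ℕ) : ℝ) < ((3 * w + 1 : ℕ) : ℝ) := by exact_mod_cast by omega
      have h3 : (0 : ℝ) < ((3 * b : ℕ) : ℝ) := by push_cast; linarith
      change 2 * Real.pi * ((3 * u + 1 : ℕ) : ℝ) / ((3 * b : ℕ) : ℝ) <
        2 * Real.pi * ((3 * w + 1 : ℕ) : ℝ) / ((3 * b : ℕ) : ℝ)
      gcongr
    · intro u w
      have h1 := w.2
      have h2 : ((3 * w + 1 : ℕ) : ℝ) < ((3 * u + 1 : ℕ) : ℝ) + ((3 * b : ℕ) : ℝ) := by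
        exact_mod_cast by omega
      have h3 : (0 : ℝ) < ((3 * b : ℕ) : ℝ) := by push_cast; linarith
      change 2 * Real.pi * ((3 * w + 1 : ℕ) : ℝ) / ((3 * b : ℕ) : ℝ) <
        2 * Real.pi * ((3 * u + 1 : ℕ) : ℝ) / ((3 * b : ℕ) : ℝ) + 2 * Real.pi
      rw [div_lt_iff₀ h3, add_mul, div_mul_cancel₀ _ h3.ne']
      nlinarith
    · intro u
      have h1 := u.2
      change Φ (F.hub (Sum.inl u)) = _
      rw [hub_inl, ← notchLoop_one, hvert _ (by omega)]
  · exact fun k => hnorm _ (F.hub_mem_region_notchLoop _) fun u => F.hub_inr_notMem_notch k u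
  · intro e
    refine ⟨isPiecewiseLinear_comp hconv hcl haff (F.isPiecewiseLinear_edge e)
      fun t ht => hcov _ (F.edge_mem_region_notchLoop e ht), ?_, ?_, ?_⟩
    · exact fun s hs t ht h => F.injOn_edge e hs ht
        (hinj (F.edge_mem_region_notchLoop e hs) (F.edge_mem_region_notchLoop e ht) h)
    · exact congrArg Φ (F.edge_zero e)
    · exact congrArg Φ (F.edge_one e)
  · intro e t ht
    refine ⟨hnorm _ (F.edge_mem_region_notchLoop e (Ioo_subset_Icc_self ht))
      fun u => F.edge_notMem_notch e ht u, fun w h => F.edge_ne_hub (e := e) ht w ?_⟩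
    exact hinj (F.edge_mem_region_notchLoop e (Ioo_subset_Icc_self ht))
      (F.hub_mem_region_notchLoop w) h
  · intro e f hef s hs t ht h
    exact hef (F.edge_eq_edge hs (Ioo_subset_Icc_self ht)
      (hinj (F.edge_mem_region_notchLoop e (Ioo_subset_Icc_self hs))
        (F.edge_mem_region_notchLoop f (Ioo_subset_Icc_self ht)) h)).1

end TilingFrame

/-! ### Existence of the frame -/

namespace IsTiling

variable {v : ℕ → ℂ} {b m : ℕ} {R : Fin m → Rect}

theorem exists_sizes (h : IsTiling v b R) : ∃ η δ : ℝ, 0 < η ∧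
    (∀ c ∈ genericY R v b, ∀ c' ∈ genericY R v b, c ≠ c' → 10 * η < |c - c'|) ∧
    0 < δ ∧ δ ≤ 2 * η ∧
    ∀ (e : Fin m) (β : Bool) (u : Fin b), endY R (e, β) = (v (2 * u)).im →
      endDir β ≠ sideDir v u →
        (η + δ) * sideHalf v u < η * |((R e).left + (R e).right) / 2 - sideMid v u| := by
  have h1 : ∀ᶠ η in 𝓝[>] (0 : ℝ), ∀ c ∈ genericY R v b, ∀ c' ∈ genericY R v b, c ≠ c' →
      10 * η < |c - c'| := by
    rw [Filter.eventually_all_finset]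
    intro c _
    rw [Filter.eventually_all_finset]
    intro c' _
    by_cases hc : c = c'
    · exact Eventually.of_forall fun _ hne => absurd hc hne
    · have hpos : 0 < |c - c'| / 10 := div_pos (abs_pos.2 (sub_ne_zero.2 hc)) (by norm_num)
      filter_upwards [(eventually_lt_nhds hpos).filter_mono nhdsWithin_le_nhds] with η hη _
      linarith
  obtain ⟨η, h2, h3⟩ := (h1.and (self_mem_nhdsWithin (s := Ioi (0 : ℝ)))).exists
  have h3' : 0 < η := h3
  have h4 : ∀ᶠ δ in 𝓝[>] (0 : ℝ), ∀ (e : Fin m) (β : Bool) (u : Fin b),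
      endY R (e, β) = (v (2 * u)).im → endDir β ≠ sideDir v u →
        (η + δ) * sideHalf v u < η * |((R e).left + (R e).right) / 2 - sideMid v u| := by
    simp only [Filter.eventually_all]
    intro e β u hy hβ
    have h5 := h.lt_abs_sub_mid u.2 hy hβ (R e).midX_mem
    have h6 : Continuous fun δ : ℝ => (η + δ) * sideHalf v u := by fun_prop
    -- η is already fixed. The inequality is strict at δ = 0, because a rectangle on the outer side
    -- has its middle strictly beyond the side, so it persists for small δ.
    have h7 : (η + 0) * sideHalf v u < η * |((R e).left + (R e).right) / 2 - sideMid v u| := by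
      rw [add_zero]
      exact mul_lt_mul_of_pos_left h5 h3'
    exact (h6.continuousAt.eventually (gt_mem_nhds h7)).filter_mono nhdsWithin_le_nhds
  have h5 : ∀ᶠ δ in 𝓝[>] (0 : ℝ), δ < 2 * η :=
    (eventually_lt_nhds (by linarith)).filter_mono nhdsWithin_le_nhds
  obtain ⟨δ, h6, h7, h8⟩ := (h4.and (h5.and (self_mem_nhdsWithin (s := Ioi (0 : ℝ))))).exists
  exact ⟨η, δ, h3', h2, h8, h7.le, h6⟩

theorem exists_frame (h : IsTiling v b R) : Nonempty (TilingFrame v b R) := by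
  classical
  obtain ⟨η, δ, hη, hgap, hδ, hδη, hbend⟩ := h.exists_sizes
  -- The inner vertices are the finitely many segments that carry an end of a rectangle but no side
  -- of the polygon.
  set S : Finset (ℝ × Set ℝ) := (Finset.univ.image (endNode R)).filter
    fun κ => ∀ u : Fin b, sideNode v R u ≠ κ with hS
  set node : Fin b ⊕ Fin S.card → ℝ × Set ℝ :=
    Sum.elim (fun u => sideNode v R u) fun k => (S.equivFin.symm k).1 with hnode
  have hin : ∀ k, ∃ i, endNode R i = (S.equivFin.symm k).1 := fun k => by
    have := (Finset.mem_filter.1 (S.equivFin.symm k).2).1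
    obtain ⟨i, -, hi⟩ := Finset.mem_image.1 this
    exact ⟨i, hi⟩
  choose idx hidx using hin
  have hinj : Function.Injective node := by
    refine Function.Injective.sumElim ?_ ?_ ?_
    · intro u w huw
      exact Fin.ext (h.loop.generic u u.2 w w.2 (congrArg Prod.fst huw))
    · exact fun k l hkl => S.equivFin.symm.injective (Subtype.ext hkl)
    · exact fun u k => (Finset.mem_filter.1 (S.equivFin.symm k).2).2 u
  have hsurj : ∀ i, ∃ w, node w = endNode R i := by
    intro i
    by_cases hc : ∃ u : Fin b, sideNode v R u = endNode R i
    · obtain ⟨u, hu⟩ := hc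
      exact ⟨Sum.inl u, hu⟩
    · push Not at hc
      have hmem : endNode R i ∈ S :=
        Finset.mem_filter.2 ⟨Finset.mem_image_of_mem _ (Finset.mem_univ i), hc⟩
      exact ⟨Sum.inr (S.equivFin ⟨_, hmem⟩), by simp [hnode]⟩
  choose vert hvert using hsurj
  have hx : ∀ w, node w = levelNode R (node w).1
      (Sum.elim (fun u : Fin b => sideMid v u) (fun k => (R (idx k).1).left) w) ∧
      Sum.elim (fun u : Fin b => sideMid v u) (fun k => (R (idx k).1).left) w ∈
        levelSet R (node w).1 ∧ (node w).1 ∈ genericY R v b := by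
    rintro (u | k)
    · refine ⟨rfl, h.mem_levelSet_of_side u.2 ?_, h.loop.im_mem_genericY R (2 * u)⟩
      have := h.loop.sideHalf_pos u
      exact ⟨by simp only [Sum.elim_inl]; linarith, by simp only [Sum.elim_inl]; linarith⟩
    · have h1 : node (Sum.inr k) = endNode R (idx k) := (hidx k).symm
      rw [h1]
      exact ⟨rfl, mem_levelSet_of_end R (left_mem_Icc.2 (R (idx k).1).left_lt_right.le),
        endY_mem_genericY v b (idx k)⟩
  exact ⟨{
    inner := S.card
    node := node
    vert := vert
    hubX := Sum.elim (fun u : Fin b => sideMid v u) (fun k => (R (idx k).1).left)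
    η := η
    δ := δ
    tiling := h
    node_injective := hinj
    node_inl := fun u => rfl
    node_vert := hvert
    node_eq := fun w => (hx w).1
    hubX_mem := fun w => (hx w).2.1
    hubX_inl := fun u => rfl
    height_mem := fun w => (hx w).2.2
    η_pos := hη
    gap := hgap
    δ_pos := hδ
    δ_le := hδη
    bend := hbend }⟩

end IsTiling

/-! ### Assembly of the two directions, and the case without sides. -/

theorem exists_circuit_of_canBeTiled {b m : ℕ} (hb : 2 ≤ b) {P : Polygon (ℝ × ℝ) (2 * b)}
    (hsimple : P.IsSimple) (horth : P.IsOrthogonal) (hccw : P.IsCounterclockwise)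
    (hgeneric : P.IsGeneric) {c : Fin m → ℝ} (h : CanBeTiled P.region c) :
    ∃ (N : ElectricalNetwork b m) (V : N.Vertex → ℝ),
      N.IsPlanar ∧
      (∀ e, N.cond e = c e ∧ 0 < c e) ∧
      N.IsVoltage P.height V ∧
      (∀ e, N.current V e ≠ 0) ∧
      (∀ u, N.outflow V (Sum.inl u) = P.signedLength u) := by
  have hn : 0 < 2 * b := by omega
  obtain ⟨R, hratio, hcover, hdisj⟩ := h
  have ht : IsTiling (P.loop hn) b R :=
    { loop := Polygon.orthoLoop hsimple horth hccw hgeneric hb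
      cover := hcover.trans (Set.ext fun p => Polygon.mem_region_iff_loopRegion hsimple hccw hb p)
      disj := hdisj }
  obtain ⟨F⟩ := ht.exists_frame
  refine ⟨F.network, F.voltage, F.isPlanar_network, fun e => ⟨hratio e, ?_⟩, ⟨fun u => ?_,
    F.outflow_inr⟩, fun e => ?_, fun u => ?_⟩
  · rw [← hratio e]
    exact div_pos (sub_pos.2 (R e).left_lt_right) (sub_pos.2 (R e).bottom_lt_top)
  · rw [Polygon.height_eq hn]
    exact F.height_inl u
  · rw [F.current_eq]
    exact (sub_pos.2 (R e).left_lt_right).ne'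
  · rw [Polygon.signedLength_eq hsimple horth hccw hgeneric hb]
    exact F.outflow_inl u

/-- Without vertices the boundary is empty, and its complement is the whole plane, which is
connected and unbounded. -/
theorem Polygon.region_eq_empty (P : Polygon (ℝ × ℝ) (2 * 0)) : P.region = ∅ := by
  have h : P.boundary ℝ = ∅ := by
    rw [Polygon.boundary]
    exact iUnion_of_empty (ι := Fin 0) _
  refine eq_empty_of_forall_notMem fun p hp => ?_
  rw [Polygon.region, h] at hp
  rcases hp with hp | ⟨-, hp⟩
  · exact hp
  · rw [compl_empty, connectedComponentIn_univ, PreconnectedSpace.connectedComponent_eq_univ] at hp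
    exact NormedSpace.unbounded_univ ℝ (ℝ × ℝ) hp

theorem canBeTiled_empty_iff {m : ℕ} (c : Fin m → ℝ) : CanBeTiled ∅ c ↔ m = 0 := by
  constructor
  · rintro ⟨R, -, h, -⟩
    by_contra hm
    have e : Fin m := ⟨0, Nat.pos_of_ne_zero hm⟩
    have h1 : ((R e).left, (R e).bottom) ∈ ⋃ e, (R e).toSet :=
      mem_iUnion.2 ⟨e, ⟨le_rfl, (R e).left_lt_right.le⟩, le_rfl, (R e).bottom_lt_top.le⟩
    rw [h] at h1
    exact h1
  · rintro rfl
    exact ⟨fun e => e.elim0, fun e => e.elim0, iUnion_of_empty _, fun e => e.elim0⟩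

/-- The network without vertices. -/
def ElectricalNetwork.empty : ElectricalNetwork 0 0 where
  inner := 0
  src e := e.elim0
  tgt e := e.elim0
  cond e := e.elim0
  src_ne_tgt e := e.elim0
  cond_nonneg e := e.elim0
  component_boundary v := by rcases v with v | v <;> exact v.elim0

theorem ElectricalNetwork.empty_isPlanar : ElectricalNetwork.empty.IsPlanar :=
  ⟨Sum.elim (fun u => u.elim0) fun k => Fin.elim0 k, fun e => e.elim0,
    fun v => by rcases v with v | v <;> exact Fin.elim0 v,
    ⟨fun u => u.elim0, fun u => u.elim0, fun u => u.elim0, fun u => u.elim0⟩,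
    fun k => Fin.elim0 k, fun e => e.elim0, fun e => e.elim0, fun e => e.elim0⟩

theorem ElectricalNetwork.edges_eq_zero {m : ℕ} (N : ElectricalNetwork 0 m) : m = 0 := by
  by_contra hm
  obtain ⟨u, -⟩ := N.component_boundary (N.src ⟨0, Nat.pos_of_ne_zero hm⟩)
  exact u.elim0

theorem lemma5 {b m : ℕ} (P : Polygon (ℝ × ℝ) (2 * b))
    (hsimple : P.IsSimple) (horth : P.IsOrthogonal) (hccw : P.IsCounterclockwise)
    (hgeneric : P.IsGeneric) (c : Fin m → ℝ) :
    CanBeTiled P.region c ↔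
      ∃ (N : ElectricalNetwork b m) (V : N.Vertex → ℝ),
        N.IsPlanar ∧
        (∀ e, N.cond e = c e ∧ 0 < c e) ∧
        N.IsVoltage P.height V ∧
        (∀ e, N.current V e ≠ 0) ∧
        (∀ u, N.outflow V (Sum.inl u) = P.signedLength u) := by
  -- For b = 0 both conditions say m = 0: the empty region contains no rectangle, and a network
  -- without boundary vertices has no vertices at all, hence no edges.
  rcases Nat.eq_zero_or_pos b with rfl | hb
  · rw [Polygon.region_eq_empty, canBeTiled_empty_iff]
    constructor
    · rintro rfl
      exact ⟨.empty, Sum.elim (fun u => u.elim0) fun k => Fin.elim0 k,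
        ElectricalNetwork.empty_isPlanar, fun e => e.elim0,
        ⟨fun u => u.elim0, fun k => Fin.elim0 k⟩, fun e => e.elim0, fun u => u.elim0⟩
    · rintro ⟨N, -⟩
      exact N.edges_eq_zero
  · have hb2 := Polygon.two_le_of_isSimple hsimple hb.ne'
    constructor
    · exact exists_circuit_of_canBeTiled hb2 hsimple horth hccw hgeneric
    · rintro ⟨N, V, hN, hc, hV, hess, hout⟩
      exact canBeTiled_of_isPlanar hb2 hsimple horth hccw hgeneric hN hc hV hess hout
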